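/- **Setting.** Fix integers $d_z,J,L$, a ratio $\gamma>0$ and constants $C,K$. For $m\ge 1$ let $n=\gamma m$ (an integer) and let $\mathcal Z$ be a set with $d_z$ elements. *Data.* Let $\zeta_1,\dots,\zeta_m$ be independent $\mathcal Z$-valued latent variables (not necessarily identically distributed; deterministic ones are allowed). Given them, the samples $x_i\sim N(\hat x(\zeta_i),R(\zeta_i))$ are independent Gaussian vectors in $\mathbb R^n$. The labels are $y_i=y(\zeta_i)$, with $y(\cdot)$ a fixed map into a finite set, and $X$ is the $n\times m$ matrix with columns $x_i$. *Training dynamics.* Let $\mathcal B$ be the space of $\xi=(\{q(l)\}_{l},\{p(l)\}_{l})$, $0\le l<L$, with $q(l)\in\mathbb R^{n\times J}$, $p(l)\in\mathbb R^{m\times J}$ and norm $\max_l\max\{\|q(l)\|,\|p(l)\|/\sqrt m\}$, where $\|\cdot\|$ is the Euclidean (Frobenius) norm. Differentiable maps give $\theta(l)=\theta_l(\{q(k),p(k)\}_{k<l};y)\in\mathbb R^{n\times J}$ and $\omega(l)=\omega_l(\{p(k)\}_{k\le l},\{q(k)\}_{k<l};y)\in\mathbb R^{m\times J}$. Let $\xi_\phi$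 be the unique $\xi$ with $q(l)=\frac1mX\omega(l)$ and $p(l)=X^T\theta(l)$ for all $l$. Write $\Theta,\Omega$ for the matrices with block columns $\theta(l),\omega(l)$, and a subscript $\zeta$ for the restriction to the rows $i$ with $\zeta_i=\zeta$. *DMF dynamics.* Let $G_\zeta$ ($n\times LJ$) and $H_\zeta$ (as many rows as $\Omega_\zeta$, $LJ$ columns) have independent standard Gaussian entries and be independent of the $\zeta_i$. Denote their block columns by $\mathbf g_\zeta(\mu),\mathbf h_\zeta(\mu)$. For deterministic $LJ\times LJ$ block matrices $\bar A_\theta(\zeta),\bar A_\omega(\zeta),\bar B_\theta(\zeta),\bar B_\omega(\zeta)$ with $J\times J$ blocks $\bar a_\theta(\mu,l;\zeta)$ etc., and deterministic $\bar e(l)\in\mathbb R^{n\times J}$, $\bar\beta(l,\zeta)\in\mathbb R^{1\times J}$, put $\tilde g(l)=\sum_\zeta\sum_\mu R^{1/2}(\zeta)\mathbf g_\zeta(\mu)\bar a_\omega(\mu,l;\zeta)$ and $\tilde h_\zeta(l)=\sum_\mu\mathbf h_\zeta(\mu)\bar a_\theta(\mu,l;\zeta)$. Let $\bar\xi=(\{\bar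 q(l)\},\{\bar p(l)\})$ be the unique solution of $$\bar q(l)=\bar e(l)+\tfrac1{\sqrt m}\tilde g(l)+\sum_\zeta\sum_{\mu\le l}R(\zeta)\bar\theta(\mu)\bar b_\theta(\mu,l;\zeta),\qquad \bar p_\zeta(l)=\mathbf 1\bar\beta(l,\zeta)+\tilde h_\zeta(l)+\sum_{\mu<l}\bar\omega_\zeta(\mu)\bar b_\omega(\mu,l;\zeta),$$ where $\bar\theta(l),\bar\omega(l),\bar\Theta,\bar\Omega$ are obtained by applying $\theta_l,\omega_l$ to $\bar\xi$. The parameters solve the *DMF equations* if, for all $l,\zeta$: 1. $\bar\beta(l,\zeta)=\mathbb E[\hat x(\zeta)^T\bar\theta(l)]$ and $\bar e(l)=\sum_\zeta\hat x(\zeta)\,\mathbb E[\mathbf 1^T\bar\omega_\zeta(l)/m]$. 2. $\bar A_\theta(\zeta),\bar A_\omega(\zeta)$ are block upper triangular, with $\bar A_\theta^T\bar A_\theta=\mathbb E[\bar\Theta^TR(\zeta)\bar\Theta]$ and $\bar A_\omega^T\bar A_\omega=\frac1m\mathbb E[\bar\Omega_\zeta^T\bar\Omega_\zeta]$. 3.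 Either all $\bar A_\theta(\zeta),\bar A_\omega(\zeta)$ are invertible, $\bar B_\theta(\zeta)=\bar A_\theta^{-1}(\zeta)\,\mathbb E\big(\tfrac{H_\zeta^T\bar\Omega_\zeta}{m}\big)_{\rm u}$ and $\bar B_\omega(\zeta)=\bar A_\omega^{-1}(\zeta)\,\mathbb E\big(\tfrac{G_\zeta^TR^{1/2}(\zeta)\bar\Theta}{\sqrt m}\big)_{\rm U}$, where $(\cdot)_{\rm u}$ and $(\cdot)_{\rm U}$ are the block upper triangular parts with and without the diagonal blocks; or, alternatively, $\bar b_\theta(\mu,l;\zeta)_{j',j}=\frac1m\mathbb E\,\mathrm{Tr}\frac{\partial\bar\omega_{j,\zeta}(l)}{\partial\tilde h_{j'}(\mu)}$ and $\bar b_\omega(\mu,l;\zeta)_{j',j}=\frac1{\sqrt m}\mathbb E\,\mathrm{Tr}\big[R(\zeta)\frac{\partial\bar\theta_j(l)}{\partial\tilde g_{j'}(\mu)}\big]$. **Theorem 2.** Let $c_m\to0$ and $\delta_m\to0$. There is a sequence $C_m\to0$, depending only on $d_z,J,L,\gamma,C,K,(c_m),(\delta_m)$, such that the following holds for all $m\ge1$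 and every problem of size $m$ as above. Assume that * the maps $\theta_l$ and $\omega_l$ are $C$-Lipschitz, where the input is measured in the norm of $\mathcal B$, $\theta(l)$ by $\|\cdot\|$ and $\omega(l)$ by $\|\cdot\|/\sqrt m$; * the values of $\theta_l$ and $\omega_l$ at zero input are bounded by $K$ in the same norms (so that bounded inputs give bounded outputs); * $\|\hat x(\zeta)\|\le K$ and $\|R(\zeta)\|_{\rm op}\le K$ for all $\zeta$; * the parameters of $\bar\xi$ solve the DMF equations, and each entry of $\bar\Theta^TR(\zeta)\bar\Theta$, $\frac1m\bar\Omega_\zeta^T\bar\Omega_\zeta$, $\frac1{\sqrt m}G_\zeta^TR^{1/2}(\zeta)\bar\Theta$, $\frac1mH_\zeta^T\bar\Omega_\zeta$, $\hat x(\zeta)^T\bar\theta(l)$ and $\frac1m\mathbf 1^T\bar\omega_\zeta(l)$ deviates by more than $c_m$ from its mean with probability at most $\delta_m$. Then, for every $1$-Lipschitz $h:\mathcal B\to[0,1]$, $$\big|\mathbb E\,h(\xi_\phi)-\mathbb E\,h(\bar\xi)\big|<C_m .$$ -/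

import Mathlib

open MeasureTheory ProbabilityTheory Filter Topology
open scoped MatrixOrder

noncomputable section

namespace DMF

/-- The space of pairs `ξ = (Q, P)`: the block `q(l)` is `n × J` and the block `p(l)` is `m × J`,
for `l = 0, …, L - 1`. -/
abbrev Blocks (J L n m : ℕ) : Type :=
  (Fin L → Fin n → Fin J → ℝ) × (Fin L → Fin m → Fin J → ℝ)

/-- The Euclidean (Frobenius) norm of an array with `a` rows and `b` columns. -/
def l2norm {a b : ℕ} (x : Fin a → Fin b → ℝ) : ℝ :=
  Real.sqrt (∑ i, ∑ j, x i j ^ 2)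

/-- The norm of the block space: the maximum over `l` of `‖q(l)‖` and `‖p(l)‖ / √m`. -/
def blockNorm {J L n m : ℕ} (ξ : Blocks J L n m) : ℝ :=
  max (⨆ l, l2norm (ξ.1 l)) (⨆ l, l2norm (ξ.2 l) / Real.sqrt m)

/-- A Gaussian mixture with independent latent variables, together with a sequential training
algorithm. -/
structure Model (dz J L n m : ℕ) where
  /-- the number of class labels -/
  d : ℕ
  /-- the deterministic map from latent values to labels -/
  label : Fin dz → Fin d
  /-- the law of the latent variable of each sample -/
  latent : Fin m → Measure (Fin dz)
  latent_prob : ∀ k, IsProbabilityMeasure (latent k)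
  /-- the conditional mean of a sample -/
  mean : Fin dz → EuclideanSpace ℝ (Fin n)
  /-- the conditional covariance of a sample -/
  cov : Fin dz → Matrix (Fin n) (Fin n) ℝ
  cov_posSemidef : ∀ ζ, (cov ζ).PosSemidef
  /-- the update maps `θ_l`, given the vector of labels -/
  theta : (Fin m → Fin d) → Fin L → Blocks J L n m → Fin n → Fin J → ℝ
  /-- the update maps `ω_l`, given the vector of labels -/
  omega : (Fin m → Fin d) → Fin L → Blocks J L n m → Fin m → Fin J → ℝ
  /-- `θ_l` only uses `q(k), p(k)` for `k < l` -/
  theta_causal : ∀ y l ξ ξ', (∀ k < l, ξ.1 k = ξ'.1 k) → (∀ k < l, ξ.2 k = ξ'.2 k) →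
    theta y l ξ = theta y l ξ'
  /-- `ω_l` only uses `q(k)` for `k < l` and `p(k)` for `k ≤ l` -/
  omega_causal : ∀ y l ξ ξ', (∀ k < l, ξ.1 k = ξ'.1 k) → (∀ k ≤ l, ξ.2 k = ξ'.2 k) →
    omega y l ξ = omega y l ξ'
  theta_differentiable : ∀ y l, Differentiable ℝ (theta y l)
  omega_differentiable : ∀ y l, Differentiable ℝ (omega y l)

/-- A self-map of the block space that can be run in the order
`p(0) → q(0) → p(1) → q(1) → ⋯`. -/
def Sequential {J L n m : ℕ} (F : Blocks J L n m → Blocks J L n m) : Prop :=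
  (∀ l ξ ξ', (∀ k < l, ξ.1 k = ξ'.1 k) → (∀ k < l, ξ.2 k = ξ'.2 k) → (F ξ).2 l = (F ξ').2 l) ∧
  (∀ l ξ ξ', (∀ k < l, ξ.1 k = ξ'.1 k) → (∀ k ≤ l, ξ.2 k = ξ'.2 k) → (F ξ).1 l = (F ξ').1 l)

/-- The solution of `ξ = F ξ` for a sequential map `F`: every second iteration settles one more
time step. -/
def solve {J L n m : ℕ} (F : Blocks J L n m → Blocks J L n m) : Blocks J L n m :=
  F^[2 * L] 0

theorem Sequential.iterate_agree {J L n m : ℕ} {F : Blocks J L n m → Blocks J L n m}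
    (hF : Sequential F) (ξ ξ' : Blocks J L n m) (t : ℕ) :
    (∀ k : Fin L, 2 * (k : ℕ) + 1 ≤ t → (F^[t] ξ).2 k = (F^[t] ξ').2 k) ∧
    (∀ k : Fin L, 2 * (k : ℕ) + 2 ≤ t → (F^[t] ξ).1 k = (F^[t] ξ').1 k) := by
  induction t with
  | zero => exact ⟨fun k hk => by omega, fun k hk => by omega⟩
  | succ t ih =>
    simp only [Function.iterate_succ_apply']
    refine ⟨fun k hk => hF.1 k _ _ (fun i hi => ih.2 i ?_) (fun i hi => ih.1 i ?_),
      fun k hk => hF.2 k _ _ (fun i hi => ih.2 i ?_) (fun i hi => ih.1 i ?_)⟩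
    · have : (i : ℕ) < k := hi
      omega
    · have : (i : ℕ) < k := hi
      omega
    · have : (i : ℕ) < k := hi
      omega
    · have : (i : ℕ) ≤ k := hi
      omega

/-- `solve F` is the unique solution of `F ξ = ξ`. -/
theorem Sequential.eq_iff {J L n m : ℕ} {F : Blocks J L n m → Blocks J L n m}
    (hF : Sequential F) (ξ : Blocks J L n m) : F ξ = ξ ↔ ξ = solve F := by
  have key : ∀ ξ ξ' : Blocks J L n m, F^[2 * L] ξ = F^[2 * L] ξ' := fun ξ ξ' => by
    have h := hF.iterate_agree ξ ξ' (2 * L)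
    refine Prod.ext (funext fun k => h.2 k ?_) (funext fun k => h.1 k ?_)
    · have := k.2
      omega
    · have := k.2
      omega
  constructor
  · intro h
    rw [solve, key 0 ξ, Function.iterate_fixed h]
  · rintro rfl
    have h : F (F^[2 * L] 0) = F^[2 * L] (F 0) := by
      rw [← Function.iterate_succ_apply' F, Function.iterate_succ_apply]
    exact h.trans (key _ _)

section

variable {dz J L n m : ℕ}

/-- The vector of labels. -/
def Model.labels (M : Model dz J L n m) (z : Fin m → Fin dz) : Fin m → Fin M.d :=
  fun k => M.label (z k)

/-- The right-hand side of `q(l) = X ω(l) / m`, `p(l) = Xᵀ θ(l)`, where the samples `x k` are the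
columns of `X`. -/
def Model.trainMap (M : Model dz J L n m) (z : Fin m → Fin dz)
    (x : Fin m → EuclideanSpace ℝ (Fin n)) (ξ : Blocks J L n m) : Blocks J L n m :=
  (fun l i j => (m : ℝ)⁻¹ * ∑ k, x k i * M.omega (M.labels z) l ξ k j,
   fun l k j => ∑ i, x k i * M.theta (M.labels z) l ξ i j)

theorem Model.trainMap_sequential (M : Model dz J L n m) (z : Fin m → Fin dz)
    (x : Fin m → EuclideanSpace ℝ (Fin n)) : Sequential (M.trainMap z x) := by
  refine ⟨fun l ξ ξ' hq hp => ?_, fun l ξ ξ' hq hp => ?_⟩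
  · simp only [trainMap, M.theta_causal _ l ξ ξ' hq hp]
  · simp only [trainMap, M.omega_causal _ l ξ ξ' hq hp]

/-- The response `ξ_φ` of the training dynamics to a data set. -/
def Model.response (M : Model dz J L n m) (z : Fin m → Fin dz)
    (x : Fin m → EuclideanSpace ℝ (Fin n)) : Blocks J L n m :=
  solve (M.trainMap z x)

/-- The law of the samples given the latent variables. -/
def Model.sampleLaw (M : Model dz J L n m) (z : Fin m → Fin dz) :
    Measure (Fin m → EuclideanSpace ℝ (Fin n)) :=
  Measure.pi fun k => multivariateGaussian (M.mean (z k)) (M.cov (z k))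

/-- The law of the latent variables. -/
def Model.latentLaw (M : Model dz J L n m) : Measure (Fin m → Fin dz) :=
  Measure.pi M.latent

/-- The expectation `E h(ξ_φ)`. -/
def Model.trainExpectation (M : Model dz J L n m) (h : Blocks J L n m → ℝ) : ℝ :=
  ∫ z, ∫ x, h (M.response z x) ∂(M.sampleLaw z) ∂M.latentLaw

/-- Square matrices made of `L × L` blocks of size `J × J`. -/
abbrev Kernel (J L : ℕ) : Type := Matrix (Fin L × Fin J) (Fin L × Fin J) ℝ

/-- The block upper-triangular part, including the diagonal blocks. -/
def upper (A : Kernel J L) : Kernel J L := fun a b => if a.1 ≤ b.1 then A a b else 0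

/-- The strictly block upper-triangular part. -/
def strictUpper (A : Kernel J L) : Kernel J L := fun a b => if a.1 < b.1 then A a b else 0

/-- The deterministic parameters of the mean-field dynamics. -/
structure Params (dz J L n : ℕ) where
  Atheta : Fin dz → Kernel J L
  Aomega : Fin dz → Kernel J L
  Btheta : Fin dz → Kernel J L
  Bomega : Fin dz → Kernel J L
  e : Fin L → Fin n → Fin J → ℝ
  beta : Fin L → Fin dz → Fin J → ℝ

/-- The randomness of the mean-field dynamics: the latent variables, the matrices `G_ζ`
(`n × LJ`), and the matrices `H_ζ`. Since every row index `k` belongs to exactly one `H_ζ`, namely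
the one with `ζ = ζ_k`, these are stored as one `m × LJ` matrix. -/
abbrev Noise (dz J L n m : ℕ) : Type :=
  (Fin m → Fin dz) × (Fin dz → Fin n → Fin L × Fin J → ℝ) × (Fin m → Fin L × Fin J → ℝ)

/-- The latent variables and independent standard Gaussian entries. -/
def Model.noiseLaw (M : Model dz J L n m) : Measure (Noise dz J L n m) :=
  M.latentLaw.prod
    ((Measure.pi fun _ => Measure.pi fun _ => Measure.pi fun _ => gaussianReal 0 1).prod
      (Measure.pi fun _ => Measure.pi fun _ => gaussianReal 0 1))

/-- The symmetric square root of the covariance. -/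
def Model.covSqrt (M : Model dz J L n m) (ζ : Fin dz) : Matrix (Fin n) (Fin n) ℝ :=
  CFC.sqrt (M.cov ζ)

/-- The Gaussian input `g̃(l) = ∑_ζ R(ζ)^{1/2} ∑_μ g_ζ(μ) a_ω(μ, l; ζ)`. -/
def Model.gTilde (M : Model dz J L n m) (P : Params dz J L n) (s : Noise dz J L n m) :
    Fin L → Fin n → Fin J → ℝ :=
  fun l i j => ∑ ζ, ∑ i', M.covSqrt ζ i i' * ∑ a, s.2.1 ζ i' a * P.Aomega ζ a (l, j)

/-- The Gaussian input `h̃_ζ(l) = ∑_μ h_ζ(μ) a_θ(μ, l; ζ)`, with all rows collected. -/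
def hTilde (P : Params dz J L n) (s : Noise dz J L n m) : Fin L → Fin m → Fin J → ℝ :=
  fun l k j => ∑ a, s.2.2 k a * P.Atheta (s.1 k) a (l, j)

/-- The right-hand side of the mean-field dynamics, driven by the inputs `gt`, `ht`. -/
def Model.dmfMap (M : Model dz J L n m) (P : Params dz J L n) (z : Fin m → Fin dz)
    (gt : Fin L → Fin n → Fin J → ℝ) (ht : Fin L → Fin m → Fin J → ℝ)
    (ξ : Blocks J L n m) : Blocks J L n m :=
  (fun l i j => P.e l i j + gt l i j / Real.sqrt m +
      ∑ ζ, ∑ μ with μ ≤ l, ∑ i', M.cov ζ i i' *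
        ∑ j', M.theta (M.labels z) μ ξ i' j' * P.Btheta ζ (μ, j') (l, j),
   fun l k j => P.beta l (z k) j + ht l k j +
      ∑ μ with μ < l, ∑ j', M.omega (M.labels z) μ ξ k j' * P.Bomega (z k) (μ, j') (l, j))

theorem Model.dmfMap_sequential (M : Model dz J L n m) (P : Params dz J L n)
    (z : Fin m → Fin dz) (gt : Fin L → Fin n → Fin J → ℝ) (ht : Fin L → Fin m → Fin J → ℝ) :
    Sequential (M.dmfMap P z gt ht) := by
  refine ⟨fun l ξ ξ' hq hp => ?_, fun l ξ ξ' hq hp => ?_⟩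
  · funext k j
    simp only [dmfMap]
    congr 1
    refine Finset.sum_congr rfl fun μ hμ => ?_
    have hμ' : μ < l := (Finset.mem_filter.1 hμ).2
    rw [M.omega_causal _ μ ξ ξ' (fun i hi => hq i (hi.trans hμ'))
      (fun i hi => hp i (lt_of_le_of_lt hi hμ'))]
  · funext i j
    simp only [dmfMap]
    congr 1
    refine Finset.sum_congr rfl fun ζ _ => Finset.sum_congr rfl fun μ hμ => ?_
    have hμ' : μ ≤ l := (Finset.mem_filter.1 hμ).2
    rw [M.theta_causal _ μ ξ ξ' (fun i hi => hq i (lt_of_lt_of_le hi hμ'))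
      (fun i hi => hp i (hi.le.trans hμ'))]

/-- The solution of the mean-field dynamics as a function of its inputs. -/
def Model.dmfSolution (M : Model dz J L n m) (P : Params dz J L n) (z : Fin m → Fin dz)
    (gt : Fin L → Fin n → Fin J → ℝ) (ht : Fin L → Fin m → Fin J → ℝ) : Blocks J L n m :=
  solve (M.dmfMap P z gt ht)

/-- The mean-field limit `ξ̄`. -/
def Model.xiBar (M : Model dz J L n m) (P : Params dz J L n) (s : Noise dz J L n m) :
    Blocks J L n m :=
  M.dmfSolution P s.1 (M.gTilde P s) (hTilde P s)

/-- The mean-field model estimates `θ̄(l)`. -/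
def Model.thetaBar (M : Model dz J L n m) (P : Params dz J L n) (s : Noise dz J L n m)
    (l : Fin L) : Fin n → Fin J → ℝ :=
  M.theta (M.labels s.1) l (M.xiBar P s)

/-- The mean-field dual variables `ω̄(l)`. -/
def Model.omegaBar (M : Model dz J L n m) (P : Params dz J L n) (s : Noise dz J L n m)
    (l : Fin L) : Fin m → Fin J → ℝ :=
  M.omega (M.labels s.1) l (M.xiBar P s)

/-- The entries of `Θ̄ᵀ R(ζ) Θ̄`. -/
def Model.overlapTheta (M : Model dz J L n m) (P : Params dz J L n) (ζ : Fin dz)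
    (a b : Fin L × Fin J) (s : Noise dz J L n m) : ℝ :=
  ∑ i, ∑ i', M.thetaBar P s a.1 i a.2 * M.cov ζ i i' * M.thetaBar P s b.1 i' b.2

/-- The entries of `Ω̄_ζᵀ Ω̄_ζ / m`. -/
def Model.overlapOmega (M : Model dz J L n m) (P : Params dz J L n) (ζ : Fin dz)
    (a b : Fin L × Fin J) (s : Noise dz J L n m) : ℝ :=
  (m : ℝ)⁻¹ * ∑ k with s.1 k = ζ, M.omegaBar P s a.1 k a.2 * M.omegaBar P s b.1 k b.2

/-- The entries of `G_ζᵀ R(ζ)^{1/2} Θ̄ / √m`. -/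
def Model.crossTheta (M : Model dz J L n m) (P : Params dz J L n) (ζ : Fin dz)
    (a b : Fin L × Fin J) (s : Noise dz J L n m) : ℝ :=
  (∑ i, ∑ i', s.2.1 ζ i a * M.covSqrt ζ i i' * M.thetaBar P s b.1 i' b.2) / Real.sqrt m

/-- The entries of `H_ζᵀ Ω̄_ζ / m`. -/
def Model.crossOmega (M : Model dz J L n m) (P : Params dz J L n) (ζ : Fin dz)
    (a b : Fin L × Fin J) (s : Noise dz J L n m) : ℝ :=
  (m : ℝ)⁻¹ * ∑ k with s.1 k = ζ, s.2.2 k a * M.omegaBar P s b.1 k b.2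

/-- The entries of `x̂(ζ)ᵀ θ̄(l)`. -/
def Model.meanTheta (M : Model dz J L n m) (P : Params dz J L n) (ζ : Fin dz)
    (l : Fin L) (j : Fin J) (s : Noise dz J L n m) : ℝ :=
  ∑ i, M.mean ζ i * M.thetaBar P s l i j

/-- The entries of `1ᵀ ω̄_ζ(l) / m`. -/
def Model.meanOmega (M : Model dz J L n m) (P : Params dz J L n) (ζ : Fin dz)
    (l : Fin L) (j : Fin J) (s : Noise dz J L n m) : ℝ :=
  (m : ℝ)⁻¹ * ∑ k with s.1 k = ζ, M.omegaBar P s l k j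

/-- `A` is the block upper-triangular factor in a block Cholesky-type decomposition of `V`. -/
def IsBlockCholesky (A V : Kernel J L) : Prop :=
  (∀ a b, b.1 < a.1 → A a b = 0) ∧ A.transpose * A = V

/-- `B_θ = A_θ⁻¹ E(H_ζᵀ Ω̄_ζ / m)_u` and `B_ω = A_ω⁻¹ E(G_ζᵀ R(ζ)^{1/2} Θ̄ / √m)_U`, the matrices
`A_θ`, `A_ω` being invertible. -/
def Model.MeanRelation (M : Model dz J L n m) (P : Params dz J L n) : Prop :=
  ∀ ζ, IsUnit (P.Atheta ζ).det ∧ IsUnit (P.Aomega ζ).det ∧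
    P.Btheta ζ = (P.Atheta ζ)⁻¹ *
      upper (Matrix.of fun a b => ∫ s, M.crossOmega P ζ a b s ∂M.noiseLaw) ∧
    P.Bomega ζ = (P.Aomega ζ)⁻¹ *
      strictUpper (Matrix.of fun a b => ∫ s, M.crossTheta P ζ a b s ∂M.noiseLaw)

/-- The unit array with entry `1` at `(μ, i, j)`. -/
def unitArray {r : ℕ} (μ : Fin L) (i : Fin r) (j : Fin J) : Fin L → Fin r → Fin J → ℝ :=
  Pi.single μ (Pi.single i (Pi.single j 1))

/-- The partial derivative `∂ω̄_{k,j}(l) / ∂h̃_{k',j'}(μ)`. -/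
def Model.dOmega (M : Model dz J L n m) (P : Params dz J L n) (s : Noise dz J L n m)
    (l : Fin L) (k : Fin m) (j : Fin J) (μ : Fin L) (k' : Fin m) (j' : Fin J) : ℝ :=
  fderiv ℝ (fun ht => M.omega (M.labels s.1) l (M.dmfSolution P s.1 (M.gTilde P s) ht) k j)
    (hTilde P s) (unitArray μ k' j')

/-- The partial derivative `∂θ̄_{i,j}(l) / ∂g̃_{i',j'}(μ)`. -/
def Model.dTheta (M : Model dz J L n m) (P : Params dz J L n) (s : Noise dz J L n m)
    (l : Fin L) (i : Fin n) (j : Fin J) (μ : Fin L) (i' : Fin n) (j' : Fin J) : ℝ :=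
  fderiv ℝ (fun gt => M.theta (M.labels s.1) l (M.dmfSolution P s.1 gt (hTilde P s)) i j)
    (M.gTilde P s) (unitArray μ i' j')

/-- The self-consistent form of the relations for `B_θ` and `B_ω`:
`b_θ(μ, l; ζ)_{j',j} = E Tr[∂ω̄_{j,ζ}(l) / ∂h̃_{j'}(μ)] / m` and
`b_ω(μ, l; ζ)_{j',j} = E Tr[R(ζ) ∂θ̄_j(l) / ∂g̃_{j'}(μ)] / √m`. -/
def Model.DerivRelation (M : Model dz J L n m) (P : Params dz J L n) : Prop :=
  ∀ ζ μ j' l j,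
    P.Btheta ζ (μ, j') (l, j) =
      (m : ℝ)⁻¹ * ∫ s, ∑ k with s.1 k = ζ, M.dOmega P s l k j μ k j' ∂M.noiseLaw ∧
    P.Bomega ζ (μ, j') (l, j) =
      (∫ s, ∑ i, ∑ i', M.cov ζ i i' * M.dTheta P s l i' j μ i j' ∂M.noiseLaw) / Real.sqrt m

/-- The parameters solve the dynamic mean-field equations. -/
structure Model.IsDMF (M : Model dz J L n m) (P : Params dz J L n) : Prop where
  beta_eq : ∀ l ζ j, P.beta l ζ j = ∫ s, M.meanTheta P ζ l j s ∂M.noiseLaw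
  e_eq : ∀ l i j, P.e l i j = ∑ ζ, M.mean ζ i * ∫ s, M.meanOmega P ζ l j s ∂M.noiseLaw
  B_eq : M.MeanRelation P ∨ M.DerivRelation P
  Atheta_cholesky : ∀ ζ, IsBlockCholesky (P.Atheta ζ)
    (Matrix.of fun a b => ∫ s, M.overlapTheta P ζ a b s ∂M.noiseLaw)
  Aomega_cholesky : ∀ ζ, IsBlockCholesky (P.Aomega ζ)
    (Matrix.of fun a b => ∫ s, M.overlapOmega P ζ a b s ∂M.noiseLaw)

/-- `X` deviates by more than `c` from its mean with probability at most `δ`. -/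
def Model.ConcentratesVar (M : Model dz J L n m) (c δ : ℝ) (X : Noise dz J L n m → ℝ) : Prop :=
  M.noiseLaw.real {s | c < |X s - ∫ s', X s' ∂M.noiseLaw|} ≤ δ

/-- Concentration of the mean-field parameters: every entry of the six families of random variables
deviates by more than `c` from its mean with probability at most `δ`. -/
structure Model.Concentrates (M : Model dz J L n m) (P : Params dz J L n) (c δ : ℝ) : Prop where
  overlapTheta : ∀ ζ a b, M.ConcentratesVar c δ (M.overlapTheta P ζ a b)
  overlapOmega : ∀ ζ a b, M.ConcentratesVar c δ (M.overlapOmega P ζ a b)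
  crossTheta : ∀ ζ a b, M.ConcentratesVar c δ (M.crossTheta P ζ a b)
  crossOmega : ∀ ζ a b, M.ConcentratesVar c δ (M.crossOmega P ζ a b)
  meanTheta : ∀ ζ l j, M.ConcentratesVar c δ (M.meanTheta P ζ l j)
  meanOmega : ∀ ζ l j, M.ConcentratesVar c δ (M.meanOmega P ζ l j)

/-- The update maps are `C`-Lipschitz, the dual variables `ω(l)` being measured, like `p(l)`, by
`‖·‖ / √m`. -/
structure Model.LipschitzUpdates (M : Model dz J L n m) (C : ℝ) : Prop where
  theta : ∀ y l ξ ξ', l2norm (M.theta y l ξ - M.theta y l ξ') ≤ C * blockNorm (ξ - ξ')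
  omega : ∀ y l ξ ξ',
    l2norm (M.omega y l ξ - M.omega y l ξ') / Real.sqrt m ≤ C * blockNorm (ξ - ξ')

/-- The means and covariances of the mixture, and the updates at zero input, are bounded by `K`
(for Lipschitz updates the latter says that bounded inputs give bounded outputs). -/
structure Model.BoundedBy (M : Model dz J L n m) (K : ℝ) : Prop where
  mean : ∀ ζ, ‖M.mean ζ‖ ≤ K
  cov : ∀ ζ, ‖Matrix.toEuclideanCLM (𝕜 := ℝ) (M.cov ζ)‖ ≤ K
  theta : ∀ y l, l2norm (M.theta y l 0) ≤ K
  omega : ∀ y l, l2norm (M.omega y l 0) / Real.sqrt m ≤ K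

end

end DMF

end

/-! The training dynamics meets the Gaussian matrices only through their products with the few
vectors that it has produced so far; apart from these products the matrices are still fresh. The
proof makes this a coupling: instead of conditioning the matrices on the training, it builds them
from a run of the mean-field dynamics.

Run the mean-field dynamics on Gaussian vectors, one for each `ζ`, time and component, and call the
columns of `R(ζ)^{1/2} Θ̄` and of `Ω̄_ζ / √m` its features. Orthonormalize the features to
directions `q`. Take independent Gaussian matrices `W`, one for each `ζ`, and overwrite `Wᵀ q` (for
a `θ`-feature) or `W q` (for an `ω`-feature) by the Gaussian vector of that direction. A direction
depends only on noise of earlier times, so the resulting matrices are again Gaussian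
(`AdaptiveStep.lintegral_run`, `measurePreserving_adaptive`), and they produce samples of the
correct law (`measurePreserving_data`).

For these matrices the products are explicit (`blockMul_runSteps`): a direction is mapped to its
Gaussian vector plus a combination of earlier directions of the opposite kind, whose coefficients
are correlations of noise with directions. Gaussian integration by parts identifies the means of
these correlations (`integral_crossOmega`, `integral_crossTheta`). It also shows that both
alternatives in the DMF equations say the same thing, namely that `B` is the averaged response of
the dynamics to its Gaussian inputs (`Model.IsDMF.B_eq_resp`). With the concentration hypothesis,
the combination of directions becomes the memory term of the mean-field equation. Thus the
mean-field trajectory solves the training equations up to a small residual (`Outcome.residual_eq`,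
`GrowingProblems.vanishing_residual`). Since the operator norms of the matrices are of order `√m`, a
discrete Gronwall argument shows that the training response to the constructed samples is close to
the mean-field limit (`blockNorm_response_sub_le`, `GrowingProblems.vanishing_response_sub`).

Orthonormalizing the features is unstable when `A_θ` or `A_ω` is nearly singular. Therefore `AᵀA` is
replaced by `AᵀA + D² = RᵀR` with `R` invertible (`nonempty_regularization`), each feature receives
an extra coordinate of size `D`, and the dynamics is rerun with inputs `y R = x A + x' D`, where
`x'` is independent noise and `y` is again standard (`measurePreserving_rotate`). The size of `D` at
time `t` is `η^(2L - t)`. A feature sees only inputs of strictly earlier times, so rerunning changes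
it by `O(η D)`, and dividing by `D` in the normalization still leaves an error `O(η)`
(`norm_feature_regularized_sub_le`, `GrowingProblems.vanishing_norFeat_sub`).

All constants must be uniform in the problem. Bounds on `B`, then on the remaining parameters and on
the second moments, follow by induction along the time order `p(0), q(0), p(1), …`
(`Problem.exists_memoryBound`, `Problem.exists_l2Bound`). The errors are handled with a filter of
likely events in which first the problem grows at fixed `η` and then `η → 0`. The sequence `C_m` is
the supremum of the errors over all problems of size `m`, plus `1/(m+1)` to make the inequality
strict. -/

noncomputable section

namespace DMF

/-! ### Standard Gaussian vectors: invariance, tail bounds, integration by parts. -/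

section Gaussian

variable {ι κ α β : Type*} [Fintype ι] [Fintype κ] [Fintype α] [Fintype β]

/-- The law of a family of independent standard Gaussian variables. -/
abbrev gaussPi (κ : Type*) [Fintype κ] : Measure (κ → ℝ) :=
  Measure.pi fun _ : κ => gaussianReal 0 1

/-- The adjoint of a coisometry preserves norms, and the characteristic function of a standard
Gaussian depends only on the norm. Rectangular `T` are allowed on purpose: coordinate projections,
unit linear forms and the overwriting maps `[a, 1 - a aᵀ]` are all instances. -/
theorem measurePreserving_mulVec [DecidableEq ι] (T : Matrix ι κ ℝ) (hT : T * T.transpose = 1) :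
    MeasurePreserving (fun x => T.mulVec x) (gaussPi κ) (gaussPi ι) := by
  have hmeas : Measurable (fun x : κ → ℝ => T.mulVec x) := by
    unfold Matrix.mulVec dotProduct; fun_prop
  refine ⟨hmeas, ?_⟩
  have h : ((gaussPi κ).map (fun x => T.mulVec x)).map (WithLp.toLp 2) =
      (gaussPi ι).map (WithLp.toLp 2) := by
    rw [map_pi_eq_stdGaussian, Measure.map_map (by fun_prop) hmeas]
    apply Measure.ext_of_charFun (E := EuclideanSpace ℝ ι)
    ext t
    have h1 := charFun_stdGaussian (E := EuclideanSpace ℝ κ)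
      (WithLp.toLp 2 (T.transpose.mulVec t.ofLp))
    have h2 : ‖(WithLp.toLp 2 (T.transpose.mulVec t.ofLp) : EuclideanSpace ℝ κ)‖ ^ 2 = ‖t‖ ^ 2 := by
      rw [EuclideanSpace.real_norm_sq_eq, EuclideanSpace.real_norm_sq_eq]
      have : ∀ (τ : Type _) [Fintype τ] (x : τ → ℝ), ∑ i, x i ^ 2 = dotProduct x x := by
        intro τ _ x; simp [dotProduct, sq]
      simp only
      rw [this, Matrix.mulVec_transpose, ← Matrix.dotProduct_mulVec, Matrix.mulVec_vecMul]
      rw [hT, Matrix.one_mulVec]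
      simp [dotProduct, sq]
    rw [charFun_stdGaussian, ← Complex.ofReal_pow, ← h2, Complex.ofReal_pow, ← h1, ← map_pi_eq_stdGaussian, charFun_apply, charFun_apply,
      integral_map (by fun_prop) (by fun_prop), integral_map (by fun_prop) (by fun_prop)]
    refine integral_congr_ae (ae_of_all _ fun x => ?_)
    simp only [Function.comp]
    congr 3
    simp only [PiLp.inner_apply, RCLike.inner_apply, conj_trivial]
    have := Matrix.dotProduct_mulVec t.ofLp T x
    simp only [dotProduct] at this
    rw [this, Matrix.mulVec_transpose]
  have h3 := congrArg (Measure.map (WithLp.ofLp (p := 2) (V := ι → ℝ))) h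
  rw [Measure.map_map (by fun_prop) (by fun_prop), Measure.map_map (by fun_prop) (by fun_prop),
    show (WithLp.ofLp (p := 2) (V := ι → ℝ)) ∘ WithLp.toLp 2 = id from rfl, Function.id_comp, Measure.map_map (by fun_prop) (by fun_prop),
    show (WithLp.ofLp (p := 2) (V := ι → ℝ)) ∘ WithLp.toLp 2 = id from rfl, Measure.map_id] at h3
  exact h3

/-- The 0–1 matrix of an injection is a coisometry. -/
theorem measurePreserving_comp_injective {e : ι → κ} (he : Function.Injective e) :
    MeasurePreserving (fun x i => x (e i)) (gaussPi κ) (gaussPi ι) := by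
  classical
  have h := measurePreserving_mulVec (Matrix.of fun i k => if k = e i then (1 : ℝ) else 0) (by
    ext i j
    simp [Matrix.mul_apply, Matrix.one_apply, he.eq_iff, eq_comm])
  convert h using 2 with x
  ext i
  simp [Matrix.mulVec, dotProduct]

theorem measurePreserving_sumElim :
    MeasurePreserving (fun p : (α → ℝ) × (β → ℝ) => Sum.elim p.1 p.2)
      ((gaussPi α).prod (gaussPi β)) (gaussPi (α ⊕ β)) := by
  have h := measurePreserving_sumPiEquivProdPi_symm
    (fun _ : α ⊕ β => gaussianReal 0 1)
  convert h using 2 with p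
  ext (i | i) <;> rfl

theorem measurePreserving_sum_split :
    MeasurePreserving (fun x : α ⊕ β → ℝ => ((fun a => x (.inl a)), (fun b => x (.inr b))))
      (gaussPi (α ⊕ β)) ((gaussPi α).prod (gaussPi β)) :=
  measurePreserving_sumPiEquivProdPi (fun _ : α ⊕ β => gaussianReal 0 1)

theorem measurePreserving_curry :
    MeasurePreserving (Function.curry : (α × β → ℝ) → α → β → ℝ)
      (gaussPi (α × β)) (Measure.pi fun _ : α => gaussPi β) := by
  refine ⟨measurable_curry, ?_⟩
  have h := Measure.infinitePi_map_curry (X := ℝ) (fun (_ : α) (_ : β) => gaussianReal 0 1)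
  simpa only [Measure.infinitePi_eq_pi, MeasurableEquiv.coe_curry] using h

/-- Resampling some coordinates does not change the law. This is how fresh noise is integrated out
below while all other entries are frozen. The result selects distinct coordinates of `κ ⊕ ι`, even
if `f` is not injective. -/
theorem measurePreserving_extend (f : ι → κ) :
    MeasurePreserving (fun p : (κ → ℝ) × (ι → ℝ) => Function.extend f p.2 p.1)
      ((gaussPi κ).prod (gaussPi ι)) (gaussPi κ) := by
  classical
  let σ : κ → κ ⊕ ι := fun k => if h : ∃ i, f i = k then .inr h.choose else .inl k
  have hσ : Function.Injective σ := by
    intro k k' h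
    simp only [σ] at h
    split_ifs at h with h1 h2 h2
    · rw [← h1.choose_spec, ← h2.choose_spec, Sum.inr.inj h]
    · exact Sum.inl.inj h
  convert (measurePreserving_comp_injective hσ).comp measurePreserving_sumElim using 2 with p
  ext k
  simp only [Function.comp, σ, Function.extend]
  split_ifs <;> rfl

theorem measurePreserving_dotProduct (c : κ → ℝ) (hc : ∑ k, c k ^ 2 = 1) :
    MeasurePreserving (fun x => ∑ k, c k * x k) (gaussPi κ) (gaussianReal 0 1) := by
  have h := measurePreserving_mulVec (ι := Unit) (Matrix.of fun _ k => c k) (by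
    ext; simp [Matrix.mul_apply, ← sq, hc])
  have h2 := (measurePreserving_eval (fun _ : Unit => gaussianReal 0 1) ()).comp h
  convert h2 using 1
  ext x
  simp [Matrix.mulVec, dotProduct]

theorem integral_sq_gaussianReal : ∫ x, x ^ 2 ∂(gaussianReal 0 1) = 1 := by
  have h := variance_id_gaussianReal (μ := 0) (v := 1)
  rw [variance_eq_integral (by fun_prop)] at h
  simpa using h

theorem lintegral_sq_dotProduct (c : κ → ℝ) :
    ∫⁻ x, ENNReal.ofReal ((∑ k, c k * x k) ^ 2) ∂(gaussPi κ) = ENNReal.ofReal (∑ k, c k ^ 2) := by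
  have hint : Integrable (fun x : ℝ => x ^ 2) (gaussianReal 0 1) :=
    (memLp_id_gaussianReal (μ := 0) (v := 1) 2).integrable_sq
  rcases eq_or_lt_of_le (Finset.sum_nonneg fun k (_ : k ∈ Finset.univ) => sq_nonneg (c k)) with h | h
  · have hz : ∀ k, c k = 0 := fun k => by
      have := (Finset.sum_eq_zero_iff_of_nonneg fun k _ => sq_nonneg (c k)).1 h.symm k
        (Finset.mem_univ k)
      exact pow_eq_zero_iff two_ne_zero |>.1 this
    simp [hz]
  · set s := ∑ k, c k ^ 2 with hs
    have hsq : Real.sqrt s ^ 2 = s := Real.sq_sqrt h.le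
    have hs0 : Real.sqrt s ≠ 0 := (Real.sqrt_pos.2 h).ne'
    have hmp := measurePreserving_dotProduct (fun k => c k / Real.sqrt s) (by
      simp_rw [div_pow, ← Finset.sum_div, hsq, ← hs, div_self h.ne'])
    have : ∀ x : κ → ℝ, ENNReal.ofReal ((∑ k, c k * x k) ^ 2) =
        ENNReal.ofReal (s * (∑ k, c k / Real.sqrt s * x k) ^ 2) := fun x => by
      congr 1
      have : ∑ k, c k / Real.sqrt s * x k = (∑ k, c k * x k) / Real.sqrt s := by
        rw [Finset.sum_div]; exact Finset.sum_congr rfl fun k _ => by ring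
      rw [this, div_pow, hsq]; field_simp
    simp_rw [this]
    rw [hmp.lintegral_comp (f := fun y => ENNReal.ofReal (s * y ^ 2)) (by fun_prop),
      ← ofReal_integral_eq_lintegral_ofReal (hint.const_mul s)
        (ae_of_all _ fun x => by positivity), integral_const_mul, integral_sq_gaussianReal, mul_one]

/-- Chernoff bound with the optimal parameter `t`. -/
theorem gaussianReal_tail (t : ℝ) (ht : 0 ≤ t) :
    gaussianReal 0 1 {x | t < x} ≤ ENNReal.ofReal (Real.exp (-t ^ 2 / 2)) := by
  have hexp : Integrable (fun x : ℝ => Real.exp (t * x)) (gaussianReal 0 1) :=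
    integrable_exp_mul_gaussianReal t
  have h := measure_ge_le_exp_mul_mgf (μ := gaussianReal 0 1) (X := id) t ht hexp
  rw [mgf_id_gaussianReal] at h
  simp only [NNReal.coe_one, zero_mul, one_mul, zero_add] at h
  rw [← Real.exp_add] at h
  have hsub : {x : ℝ | t < x} ⊆ {x | t ≤ id x} := by
    intro x hx
    simp only [Set.mem_ofPred_eq, id] at hx ⊢
    exact hx.le
  refine (measure_mono hsub).trans ?_
  rw [← ENNReal.ofReal_toReal (measure_ne_top (gaussianReal 0 1) {x | t ≤ id x})]
  refine ENNReal.ofReal_le_ofReal (h.trans (le_of_eq ?_))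
  congr 1; ring

theorem gaussPi_dotProduct_tail (c : κ → ℝ) {s t : ℝ} (ht : 0 ≤ t)
    (hc : ∑ k, c k ^ 2 ≤ s ^ 2) :
    gaussPi κ {x | t < ∑ k, c k * x k} ≤ ENNReal.ofReal (Real.exp (-t ^ 2 / (2 * s ^ 2))) := by
  rcases eq_or_lt_of_le (Finset.sum_nonneg fun k (_ : k ∈ Finset.univ) => sq_nonneg (c k)) with h | h
  · have hz : ∀ k, c k = 0 := fun k => by
      have := (Finset.sum_eq_zero_iff_of_nonneg fun k _ => sq_nonneg (c k)).1 h.symm k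
        (Finset.mem_univ k)
      exact pow_eq_zero_iff two_ne_zero |>.1 this
    simp [hz, ht.not_gt]
  · set r := ∑ k, c k ^ 2 with hr
    have hsq : Real.sqrt r ^ 2 = r := Real.sq_sqrt h.le
    have hr0 : 0 < Real.sqrt r := Real.sqrt_pos.2 h
    have hmp := measurePreserving_dotProduct (fun k => c k / Real.sqrt r) (by
      simp_rw [div_pow, ← Finset.sum_div, hsq, ← hr, div_self h.ne'])
    have hset : {x : κ → ℝ | t < ∑ k, c k * x k} =
        (fun x => ∑ k, c k / Real.sqrt r * x k) ⁻¹' {y | t / Real.sqrt r < y} := by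
      ext x
      have : ∑ k, c k / Real.sqrt r * x k = (∑ k, c k * x k) / Real.sqrt r := by
        rw [Finset.sum_div]; exact Finset.sum_congr rfl fun k _ => by ring
      simp only [Set.mem_ofPred_eq, Set.mem_preimage, this]
      rw [div_lt_div_iff_of_pos_right hr0]
    have hms : MeasurableSet {y : ℝ | t / Real.sqrt r < y} :=
      measurableSet_lt measurable_const measurable_id
    rw [hset, hmp.measure_preimage hms.nullMeasurableSet]
    refine (gaussianReal_tail _ (by positivity)).trans (ENNReal.ofReal_le_ofReal ?_)
    apply Real.exp_le_exp.2
    rw [div_pow, hsq, neg_div, neg_div, neg_le_neg_iff, div_div]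
    exact div_le_div_of_nonneg_left (by positivity) (by positivity) (by linarith)

/-- A 1-separated subset of the ball of radius 2 with the largest possible number of points is a
net. Its cardinality is bounded by the packing estimate from the Besicovitch covering theorem.
Radius 2 with mesh 1 loses only a factor one half in the two lemmas that use the net. -/
theorem exists_net (E : Type*) [NormedAddCommGroup E] [NormedSpace ℝ E] [FiniteDimensional ℝ E] :
    ∃ s : Finset E, s.card ≤ 5 ^ Module.finrank ℝ E ∧ (∀ c ∈ s, ‖c‖ ≤ 2) ∧
      ∀ v : E, ‖v‖ ≤ 2 → ∃ c ∈ s, ‖v - c‖ < 1 := by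
  classical
  let S : Set ℕ := {N | ∃ s : Finset E, s.card = N ∧ (∀ c ∈ s, ‖c‖ ≤ 2) ∧
    ∀ c ∈ s, ∀ d ∈ s, c ≠ d → 1 ≤ ‖c - d‖}
  have hb : BddAbove S := ⟨5 ^ Module.finrank ℝ E, by
    rintro _ ⟨s, rfl, h1, h2⟩
    exact Besicovitch.card_le_of_separated s h1 h2⟩
  have hne : S.Nonempty := ⟨0, ∅, by simp⟩
  obtain ⟨s, hs, h1, h2⟩ := Nat.sSup_mem hne hb
  refine ⟨s, Besicovitch.card_le_of_separated s h1 h2, h1, fun v hv => ?_⟩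
  by_contra! hcon
  have hvs : v ∉ s := fun h => by simpa using (hcon v h).trans_lt (by simp : ‖v - v‖ < 1)
  have hmem : (insert v s).card ∈ S := by
    refine ⟨_, rfl, ?_, ?_⟩
    · intro c hc
      rcases Finset.mem_insert.1 hc with rfl | hc
      exacts [hv, h1 c hc]
    · intro c hc d hd hcd
      rcases Finset.mem_insert.1 hc with hc' | hc <;> rcases Finset.mem_insert.1 hd with hd' | hd
      · exact absurd (hc'.trans hd'.symm) hcd
      · rw [hc']; exact hcon d hd
      · rw [hd', norm_sub_rev]; exact hcon c hc
      · exact h2 c hc d hd hcd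
  have := le_csSup hb hmem
  rw [Finset.card_insert_of_notMem hvs, ← hs] at this
  omega

/-- The vector `v = (2 / ‖w‖) w` has `⟪v, w⟫ = 2 ‖w‖`, and replacing it by a net point costs at most
`‖w‖`. -/
theorem norm_le_of_net {E : Type*} [NormedAddCommGroup E] [InnerProductSpace ℝ E] {s : Finset E}
    (hs : ∀ v : E, ‖v‖ ≤ 2 → ∃ c ∈ s, ‖v - c‖ < 1) {w : E} {t : ℝ} (ht : 0 ≤ t)
    (h : ∀ c ∈ s, inner ℝ c w ≤ t) : ‖w‖ ≤ t := by
  rcases eq_or_ne w 0 with rfl | hw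
  · simpa using ht
  have hw' : 0 < ‖w‖ := norm_pos_iff.2 hw
  obtain ⟨c, hc, hvc⟩ := hs ((2 / ‖w‖) • w) (by
    rw [norm_smul, Real.norm_of_nonneg (by positivity)]; field_simp; exact le_rfl)
  have h1 : inner ℝ ((2 / ‖w‖) • w) w = 2 * ‖w‖ := by
    rw [real_inner_smul_left, real_inner_self_eq_norm_sq]; field_simp
  have h2 : inner ℝ ((2 / ‖w‖) • w - c) w ≤ ‖w‖ :=
    (real_inner_le_norm _ _).trans (by nlinarith)
  rw [inner_sub_left, h1] at h2
  linarith [h c hc]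

/-- On vectors of norm 2, approximation by the net gives `2 ‖W‖ ≤ t + ‖W‖`, and the term on the
right is absorbed. -/
theorem opNorm_le_of_net {E F : Type*} [NormedAddCommGroup E] [NormedSpace ℝ E]
    [NormedAddCommGroup F] [NormedSpace ℝ F] {s : Finset E}
    (hs : ∀ v : E, ‖v‖ ≤ 2 → ∃ c ∈ s, ‖v - c‖ < 1) {W : E →L[ℝ] F} {t : ℝ} (ht : 0 ≤ t)
    (h : ∀ c ∈ s, ‖W c‖ ≤ t) : ‖W‖ ≤ t := by
  have : ‖W‖ ≤ (t + ‖W‖) / 2 := by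
    refine W.opNorm_le_bound (by positivity) fun v => ?_
    rcases eq_or_ne v 0 with rfl | hv
    · simp
    have hv' : 0 < ‖v‖ := norm_pos_iff.2 hv
    obtain ⟨c, hc, hvc⟩ := hs ((2 / ‖v‖) • v) (by
      rw [norm_smul, Real.norm_of_nonneg (by positivity)]; field_simp; exact le_rfl)
    have h1 : ‖W ((2 / ‖v‖) • v)‖ ≤ t + ‖W‖ := by
      calc ‖W ((2 / ‖v‖) • v)‖ = ‖W c + W ((2 / ‖v‖) • v - c)‖ := by rw [← map_add]; congr 2; abel
        _ ≤ ‖W c‖ + ‖W‖ * ‖(2 / ‖v‖) • v - c‖ :=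
          (norm_add_le _ _).trans (add_le_add le_rfl (W.le_opNorm _))
        _ ≤ t + ‖W‖ * 1 := by gcongr; exact h c hc
        _ = _ := by ring
    rw [map_smul, norm_smul, Real.norm_of_nonneg (by positivity)] at h1
    calc ‖W v‖ = (2 / ‖v‖ * ‖W v‖) * (‖v‖ / 2) := by field_simp
      _ ≤ (t + ‖W‖) * (‖v‖ / 2) := by gcongr
      _ = _ := by ring
  linarith

/-- Union bound over the net. A net point has norm at most 2, so its linear form has variance at
most 4, which gives the 8 in the exponent. -/
theorem gaussPi_norm_tail {t : ℝ} (ht : 0 ≤ t) :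
    gaussPi κ {x | t < ‖(WithLp.toLp 2 x : EuclideanSpace ℝ κ)‖} ≤
      ENNReal.ofReal (5 ^ Fintype.card κ * Real.exp (-t ^ 2 / 8)) := by
  obtain ⟨s, hcard, h2, hs⟩ := exists_net (EuclideanSpace ℝ κ)
  have hsub : {x | t < ‖(WithLp.toLp 2 x : EuclideanSpace ℝ κ)‖} ⊆
      ⋃ c ∈ s, {x : κ → ℝ | t < ∑ k, c k * x k} := by
    intro x hx
    by_contra hcon
    refine absurd (norm_le_of_net hs ht fun c hc => ?_) (not_le.2 hx)
    simp only [Set.mem_iUnion, not_exists] at hcon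
    have h1 := hcon c hc
    rw [Set.mem_ofPred_eq, not_lt] at h1
    refine le_trans (le_of_eq ?_) h1
    simp [PiLp.inner_apply, mul_comm]
  refine (measure_mono hsub).trans ((measure_biUnion_finset_le _ _).trans ?_)
  calc ∑ c ∈ s, gaussPi κ {x : κ → ℝ | t < ∑ k, c k * x k}
      ≤ ∑ c ∈ s, ENNReal.ofReal (Real.exp (-t ^ 2 / 8)) := by
        refine Finset.sum_le_sum fun c hc => ?_
        refine (gaussPi_dotProduct_tail c.ofLp (s := 2) ht ?_).trans
          (ENNReal.ofReal_le_ofReal (le_of_eq (by norm_num)))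
        rw [← EuclideanSpace.real_norm_sq_eq]
        exact pow_le_pow_left₀ (norm_nonneg _) (h2 c hc) 2
    _ = ENNReal.ofReal (s.card * Real.exp (-t ^ 2 / 8)) := by
        rw [Finset.sum_const, nsmul_eq_mul, ENNReal.ofReal_mul (by positivity),
          ENNReal.ofReal_natCast]
    _ ≤ _ := by
        refine ENNReal.ofReal_le_ofReal ?_
        gcongr
        rw [finrank_euclideanSpace] at hcard
        exact_mod_cast hcard

/-- Two nets: one for the argument, here, and one inside the bound on the norm of the image. Hence
`25 = 5 · 5`, and `32 = 8 · 2²` because arguments have norm up to 2. -/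
theorem gaussPi_opNorm_tail [DecidableEq ι] {t : ℝ} (ht : 0 ≤ t) :
    gaussPi (ι × ι) {x : ι × ι → ℝ | t < ‖Matrix.toEuclideanCLM (n := ι) (𝕜 := ℝ) (Matrix.of (Function.curry x))‖} ≤
      ENNReal.ofReal (25 ^ Fintype.card ι * Real.exp (-t ^ 2 / 32)) := by
  obtain ⟨s, hcard, h2, hs⟩ := exists_net (EuclideanSpace ℝ ι)
  have hsub : {x : ι × ι → ℝ | t < ‖Matrix.toEuclideanCLM (n := ι) (𝕜 := ℝ) (Matrix.of (Function.curry x))‖} ⊆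
      ⋃ c ∈ s, {x : ι × ι → ℝ |
        t < ‖(WithLp.toLp 2 fun i => ∑ j, x (i, j) * c j : EuclideanSpace ℝ ι)‖} := by
    intro x hx
    by_contra hcon
    refine absurd (opNorm_le_of_net hs ht fun c hc => ?_) (not_le.2 hx)
    simp only [Set.mem_iUnion, not_exists] at hcon
    have h1 := hcon c hc
    rw [Set.mem_ofPred_eq, not_lt] at h1
    exact h1
  refine (measure_mono hsub).trans ((measure_biUnion_finset_le _ _).trans ?_)
  calc ∑ c ∈ s, gaussPi (ι × ι) {x : ι × ι → ℝ |
        t < ‖(WithLp.toLp 2 fun i => ∑ j, x (i, j) * c j : EuclideanSpace ℝ ι)‖}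
      ≤ ∑ c ∈ s, ENNReal.ofReal (5 ^ Fintype.card ι * Real.exp (-t ^ 2 / 32)) := by
        refine Finset.sum_le_sum fun c hc => ?_
        rcases eq_or_ne c 0 with rfl | hc0
        · have : (WithLp.toLp 2 fun i : ι => (0 : ℝ) : EuclideanSpace ℝ ι) = 0 := rfl
          simp [ht.not_gt, this]
        have hcn : 0 < ‖c‖ := norm_pos_iff.2 hc0
        have hsum : ∑ j, c j ^ 2 = ‖c‖ ^ 2 := (EuclideanSpace.real_norm_sq_eq c).symm
        -- For a fixed `c ≠ 0`, the image of `c / ‖c‖` under a Gaussian matrix is a standard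
        -- Gaussian vector.
        have hmp := measurePreserving_mulVec (ι := ι) (κ := ι × ι)
          (Matrix.of fun i p => if p.1 = i then c p.2 / ‖c‖ else 0) (by
            ext i i'
            simp only [Matrix.mul_apply, Matrix.of_apply, Matrix.transpose_apply,
              Fintype.sum_prod_type, Matrix.one_apply]
            by_cases h : i = i'
            · subst h
              rw [Finset.sum_eq_single i (by intros; simp_all) (by simp)]
              simp only [if_true, ← sq, div_pow]
              rw [← Finset.sum_div, hsum]
              exact div_self (pow_pos hcn 2).ne'
            · rw [if_neg h]
              refine Finset.sum_eq_zero fun a _ => Finset.sum_eq_zero fun b _ => ?_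
              split_ifs <;> simp_all)
        have hset : {x : ι × ι → ℝ |
            t < ‖(WithLp.toLp 2 fun i => ∑ j, x (i, j) * c j : EuclideanSpace ℝ ι)‖} =
            (fun x => (Matrix.of fun i (p : ι × ι) =>
              if p.1 = i then c p.2 / ‖c‖ else 0).mulVec x) ⁻¹'
              {y | t / ‖c‖ < ‖(WithLp.toLp 2 y : EuclideanSpace ℝ ι)‖} := by
          ext x
          have : (WithLp.toLp 2 ((Matrix.of fun i (p : ι × ι) =>
              if p.1 = i then c p.2 / ‖c‖ else 0).mulVec x) : EuclideanSpace ℝ ι) =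
              (1 / ‖c‖) • (WithLp.toLp 2 fun i => ∑ j, x (i, j) * c j) := by
            ext i
            simp only [Matrix.mulVec, dotProduct, Matrix.of_apply, Fintype.sum_prod_type,
              PiLp.smul_apply, smul_eq_mul, Finset.mul_sum]
            rw [Finset.sum_eq_single i (by intros; simp_all) (by simp)]
            refine Finset.sum_congr rfl fun j _ => ?_
            simp only [if_true]; ring
          rw [Set.mem_preimage, Set.mem_ofPred_eq, Set.mem_ofPred_eq, this, norm_smul,
            Real.norm_of_nonneg (by positivity), one_div, inv_mul_eq_div,
            div_lt_div_iff_of_pos_right hcn]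
        have hms : MeasurableSet {y : ι → ℝ | t / ‖c‖ < ‖(WithLp.toLp 2 y : EuclideanSpace ℝ ι)‖} :=
          measurableSet_lt measurable_const (by fun_prop)
        rw [hset, hmp.measure_preimage hms.nullMeasurableSet]
        refine (gaussPi_norm_tail (by positivity)).trans (ENNReal.ofReal_le_ofReal ?_)
        refine mul_le_mul_of_nonneg_left (Real.exp_le_exp.2 ?_) (by positivity)
        have h4 : ‖c‖ ^ 2 ≤ 4 := by nlinarith [h2 c hc]
        rw [div_pow, neg_div, neg_div, neg_le_neg_iff, div_div]
        exact div_le_div_of_nonneg_left (by positivity) (by positivity) (by linarith)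
    _ = ENNReal.ofReal (s.card * (5 ^ Fintype.card ι * Real.exp (-t ^ 2 / 32))) := by
        rw [Finset.sum_const, nsmul_eq_mul, ENNReal.ofReal_mul (p := (s.card : ℝ)) (by positivity),
          ENNReal.ofReal_natCast]
    _ ≤ _ := by
        refine ENNReal.ofReal_le_ofReal ?_
        rw [finrank_euclideanSpace] at hcard
        have : (s.card : ℝ) ≤ 5 ^ Fintype.card ι := by exact_mod_cast hcard
        rw [show (25 : ℝ) = 5 * 5 by norm_num, mul_pow, mul_assoc]
        gcongr

theorem integrable_gaussianReal_of_bound {f : ℝ → ℝ} (hf : Measurable f) {a b : ℝ}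
    (h : ∀ x, |f x| ≤ a + b * x ^ 2) : Integrable f (gaussianReal 0 1) := by
  have hsq : Integrable (fun x : ℝ => x ^ 2) (gaussianReal 0 1) :=
    (memLp_id_gaussianReal (μ := 0) (v := 1) 2).integrable_sq
  refine Integrable.mono' ((integrable_const a).add (hsq.const_mul b)) hf.aestronglyMeasurable
    (ae_of_all _ fun x => ?_)
  simpa using h x

theorem abs_le_of_deriv_bound {f : ℝ → ℝ} (hf : Differentiable ℝ f) {c : ℝ}
    (hc : ∀ x, |deriv f x| ≤ c) (x : ℝ) : |f x| ≤ |f 0| + c * |x| := by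
  have := Convex.norm_image_sub_le_of_norm_deriv_le (f := f) (s := Set.univ) (x := 0) (y := x)
    (fun x _ => hf x) (fun x _ => hc x) convex_univ trivial trivial
  simp only [Real.norm_eq_abs, sub_zero] at this
  have h2 := abs_sub_abs_le_abs_sub (f x) (f 0)
  linarith

/-- Integration by parts, since `x φ(x)` is the derivative of `-φ` for the Gaussian density `φ`. A
bounded derivative forces linear growth of `f`, which makes all products integrable. -/
theorem integral_mul_gaussianReal_eq_integral_deriv {f : ℝ → ℝ} (hf : Differentiable ℝ f) {c : ℝ}
    (hc : ∀ x, |deriv f x| ≤ c) :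
    ∫ x, x * f x ∂(gaussianReal 0 1) = ∫ x, deriv f x ∂(gaussianReal 0 1) := by
  have hb := abs_le_of_deriv_bound hf hc
  have hc0 : 0 ≤ c := (abs_nonneg _).trans (hc 0)
  have hfm : Measurable f := hf.continuous.measurable
  have hI : ∀ g : ℝ → ℝ, Integrable g (gaussianReal 0 1) →
      Integrable (fun x => gaussianPDFReal 0 1 x * g x) := fun g hg => by
    rw [gaussianReal_of_var_ne_zero 0 one_ne_zero] at hg
    have := (integrable_withDensity_iff_integrable_smul' (measurable_gaussianPDF 0 1)
      (ae_of_all _ fun x => gaussianPDF_lt_top)).1 hg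
    simpa [toReal_gaussianPDF] using this
  have h1 := hI (fun x => x * f x) (integrable_gaussianReal_of_bound (by fun_prop)
    (a := |f 0|) (b := |f 0| + c) fun x => by
      rw [abs_mul]
      have := hb x
      nlinarith [abs_nonneg x, abs_nonneg (f 0), sq_abs x, sq_nonneg (|x| - 1),
        mul_le_mul_of_nonneg_left this (abs_nonneg x)])
  have h2 := hI (deriv f) (integrable_gaussianReal_of_bound (measurable_deriv f)
    (a := c) (b := 0) fun x => by simpa using hc x)
  have h3 := hI f (integrable_gaussianReal_of_bound hfm (a := |f 0| + c) (b := c) fun x => by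
      have := hb x
      nlinarith [abs_nonneg x, sq_abs x, sq_nonneg (|x| - 1)])
  have hpdf : ∀ x : ℝ, HasDerivAt (fun x => -gaussianPDFReal 0 1 x) (x * gaussianPDFReal 0 1 x) x := by
    intro x
    unfold gaussianPDFReal
    have : HasDerivAt (fun x : ℝ => -(x - 0) ^ 2 / (2 * (1 : NNReal))) (-x) x := by
      have := (((hasDerivAt_id' x).sub_const 0).fun_pow 2).fun_neg.div_const (2 * ((1 : NNReal) : ℝ))
      refine this.congr_deriv ?_
      norm_num
      ring
    refine (this.exp.const_mul ((Real.sqrt (2 * Real.pi * (1 : NNReal)))⁻¹)).fun_neg.congr_deriv ?_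
    ring
  have key := integral_mul_deriv_eq_deriv_mul_of_integrable (u := f) (u' := deriv f)
    (v := fun x => -gaussianPDFReal 0 1 x) (v' := fun x => x * gaussianPDFReal 0 1 x)
    (fun x _ => (hf x).hasDerivAt) (fun x _ => hpdf x)
    (h1.congr (ae_of_all _ fun x => by simp; ring))
    (h2.neg.congr (ae_of_all _ fun x => by simp; ring))
    (h3.neg.congr (ae_of_all _ fun x => by simp; ring))
  rw [integral_gaussianReal_eq_integral_smul one_ne_zero,
    integral_gaussianReal_eq_integral_smul one_ne_zero]
  simp only [smul_eq_mul]
  calc ∫ x, gaussianPDFReal 0 1 x * (x * f x) = ∫ x, f x * (x * gaussianPDFReal 0 1 x) := by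
        congr 1; ext x; ring
    _ = _ := by
        rw [key, ← integral_neg]; congr 1; ext x; ring

/-- Gaussian integration by parts in the direction of one coordinate. -/
theorem integral_eval_mul_gaussPi_eq_integral_lineDeriv {F F' : (κ → ℝ) → ℝ} (k : κ) [DecidableEq κ]
    (hF : ∀ x, HasDerivAt (fun t => F (Function.update x k t)) (F' x) (x k)) {c : ℝ}
    (hc : ∀ x, |F' x| ≤ c) (hF' : Measurable F') (hint : Integrable (fun x => x k * F x) (gaussPi κ)) :
    ∫ x, x k * F x ∂(gaussPi κ) = ∫ x, F' x ∂(gaussPi κ) := by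
  have hmp := measurePreserving_extend (fun _ : Unit => k)
  have hev := measurePreserving_eval (fun _ : Unit => gaussianReal 0 1) ()
  have hext : ∀ (x : κ → ℝ) (y : Unit → ℝ),
      Function.extend (fun _ : Unit => k) y x = Function.update x k (y ()) := by
    intro x y
    ext i
    by_cases h : i = k
    · subst h
      rw [Function.update_self]
      exact Function.Injective.extend_apply (fun _ _ _ => rfl) y x ()
    · rw [Function.update_of_ne h, Function.extend_apply' _ _ _ (by rintro ⟨_, rfl⟩; exact h rfl)]
  have hint2 : Integrable F' (gaussPi κ) :=
    Integrable.mono' (integrable_const c) hF'.aestronglyMeasurable (ae_of_all _ hc)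
  have hderiv : ∀ x : κ → ℝ, ∀ t, HasDerivAt (fun t => F (Function.update x k t))
      (F' (Function.update x k t)) t := fun x t => by
    have := hF (Function.update x k t)
    simpa using this
  rw [← hmp.map_eq, integral_map hmp.measurable.aemeasurable
      (by rw [hmp.map_eq]; exact hint.aestronglyMeasurable),
    integral_map hmp.measurable.aemeasurable hF'.aestronglyMeasurable,
    integral_prod (fun p : (κ → ℝ) × (Unit → ℝ) => Function.extend (fun _ => k) p.2 p.1 k *
      F (Function.extend (fun _ => k) p.2 p.1)) (hmp.integrable_comp_of_integrable hint),
    integral_prod (fun p : (κ → ℝ) × (Unit → ℝ) => F' (Function.extend (fun _ => k) p.2 p.1))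
      (hmp.integrable_comp_of_integrable hint2)]
  refine integral_congr_ae (ae_of_all _ fun x => ?_)
  simp only [hext, Function.update_self]
  have h1 := hev.integral_comp' (f := MeasurableEquiv.funUnique Unit ℝ)
    (g := fun y => y * F (Function.update x k y))
  have h2 := hev.integral_comp' (f := MeasurableEquiv.funUnique Unit ℝ)
    (g := fun y => F' (Function.update x k y))
  refine h1.trans (Eq.trans ?_ h2.symm)
  have hd : deriv (fun t => F (Function.update x k t)) = fun t => F' (Function.update x k t) :=
    funext fun t => (hderiv x t).deriv
  rw [integral_mul_gaussianReal_eq_integral_deriv (fun t => (hderiv x t).differentiableAt)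
    (c := c) (fun t => by rw [hd]; exact hc _), hd]

end Gaussian

end DMF

end

noncomputable section

namespace DMF

/-! ### The Frobenius norm and the columns of an array. -/

section L2norm

variable {a b : ℕ}

theorem l2norm_eq_norm (x : Fin a → Fin b → ℝ) :
    l2norm x = ‖(WithLp.toLp 2 fun p : Fin a × Fin b => x p.1 p.2 :
      EuclideanSpace ℝ (Fin a × Fin b))‖ := by
  rw [EuclideanSpace.norm_eq, l2norm, Fintype.sum_prod_type]
  simp

theorem l2norm_nonneg (x : Fin a → Fin b → ℝ) : 0 ≤ l2norm x := Real.sqrt_nonneg _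

@[simp] theorem l2norm_zero : l2norm (0 : Fin a → Fin b → ℝ) = 0 := by
  simp [l2norm]

theorem l2norm_add_le (x y : Fin a → Fin b → ℝ) : l2norm (x + y) ≤ l2norm x + l2norm y := by
  simp only [l2norm_eq_norm]
  exact norm_add_le (WithLp.toLp 2 fun p : Fin a × Fin b => x p.1 p.2 :
      EuclideanSpace ℝ (Fin a × Fin b)) (WithLp.toLp 2 fun p : Fin a × Fin b => y p.1 p.2)

theorem l2norm_smul (c : ℝ) (x : Fin a → Fin b → ℝ) : l2norm (c • x) = |c| * l2norm x := by
  simp only [l2norm_eq_norm]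
  exact norm_smul c (WithLp.toLp 2 fun p : Fin a × Fin b => x p.1 p.2 :
      EuclideanSpace ℝ (Fin a × Fin b))

theorem l2norm_sum_le {ι : Type*} (s : Finset ι) (x : ι → Fin a → Fin b → ℝ) :
    l2norm (∑ i ∈ s, x i) ≤ ∑ i ∈ s, l2norm (x i) :=
  Finset.le_sum_of_subadditive l2norm l2norm_zero.le l2norm_add_le s x

theorem l2norm_le_sub_add (x y : Fin a → Fin b → ℝ) : l2norm x ≤ l2norm (x - y) + l2norm y := by
  simpa using l2norm_add_le (x - y) y

theorem abs_le_l2norm (x : Fin a → Fin b → ℝ) (i : Fin a) (j : Fin b) : |x i j| ≤ l2norm x := by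
  rw [l2norm_eq_norm]
  exact PiLp.norm_apply_le (WithLp.toLp 2 fun p : Fin a × Fin b => x p.1 p.2 :
      EuclideanSpace ℝ (Fin a × Fin b)) (i, j)

@[fun_prop]
theorem continuous_l2norm : Continuous (l2norm : (Fin a → Fin b → ℝ) → ℝ) := by
  unfold l2norm; fun_prop

/-- A column of an array, as a vector of the Euclidean space. -/
def col (x : Fin a → Fin b → ℝ) (j : Fin b) : EuclideanSpace ℝ (Fin a) :=
  WithLp.toLp 2 fun i => x i j

@[simp] theorem col_apply (x : Fin a → Fin b → ℝ) (j : Fin b) (i : Fin a) : col x j i = x i j := rfl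

theorem col_sub (x y : Fin a → Fin b → ℝ) (j : Fin b) : col (x - y) j = col x j - col y j := rfl

theorem l2norm_sq (x : Fin a → Fin b → ℝ) : l2norm x ^ 2 = ∑ j, ‖col x j‖ ^ 2 := by
  rw [l2norm, Real.sq_sqrt (by positivity), Finset.sum_comm]
  simp [EuclideanSpace.real_norm_sq_eq]

theorem norm_col_le (x : Fin a → Fin b → ℝ) (j : Fin b) : ‖col x j‖ ≤ l2norm x := by
  refine le_of_sq_le_sq ?_ (l2norm_nonneg x)
  rw [l2norm_sq]
  exact Finset.single_le_sum (f := fun j => ‖col x j‖ ^ 2) (fun _ _ => by positivity)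
    (Finset.mem_univ j)

theorem l2norm_le_sum_col (x : Fin a → Fin b → ℝ) : l2norm x ≤ ∑ j, ‖col x j‖ := by
  refine le_of_sq_le_sq ?_ (Finset.sum_nonneg fun _ _ => norm_nonneg _)
  rw [l2norm_sq]
  exact Finset.sum_sq_le_sq_sum_of_nonneg fun _ _ => norm_nonneg _

/-- The coefficient matrix may vary with the row because row `k` of `p(l)` uses the coefficients
that belong to the latent value of sample `k`. -/
theorem l2norm_rowwise_le {c : ℕ} {β : ℝ} (hβ : 0 ≤ β) (w : Fin a → Fin c → ℝ)
    (B : Fin a → Fin c → Fin b → ℝ) (hB : ∀ k i j, |B k i j| ≤ β) :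
    l2norm (fun k j => ∑ i, w k i * B k i j) ≤ b * (c * β) * l2norm w := by
  refine (l2norm_le_sum_col _).trans ?_
  have hcol : ∀ j, ‖col (fun k j => ∑ i, w k i * B k i j) j‖ ≤ c * β * l2norm w := fun j => by
    have h1 : col (fun k j => ∑ i, w k i * B k i j) j =
        ∑ i, (WithLp.toLp 2 fun k => w k i * B k i j : EuclideanSpace ℝ (Fin a)) := by
      ext k; simp
    rw [h1]
    refine (norm_sum_le _ _).trans ?_
    have h2 : ∀ i, ‖(WithLp.toLp 2 fun k => w k i * B k i j : EuclideanSpace ℝ (Fin a))‖ ≤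
        β * l2norm w := fun i => by
      refine le_trans ?_ (mul_le_mul_of_nonneg_left (norm_col_le w i) hβ)
      refine le_of_sq_le_sq ?_ (by positivity)
      rw [mul_pow, EuclideanSpace.real_norm_sq_eq, EuclideanSpace.real_norm_sq_eq, Finset.mul_sum]
      refine Finset.sum_le_sum fun k _ => ?_
      simp only [col_apply, mul_pow]
      rw [mul_comm]
      refine mul_le_mul_of_nonneg_right (sq_le_sq.2 ?_) (sq_nonneg _)
      rw [abs_of_nonneg hβ]; exact hB k i j
    calc _ ≤ ∑ _i : Fin c, β * l2norm w := Finset.sum_le_sum fun i _ => h2 i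
      _ = _ := by simp; ring
  calc _ ≤ ∑ _j : Fin b, c * β * l2norm w := Finset.sum_le_sum fun j _ => hcol j
    _ = _ := by simp; ring

theorem col_matrix_mul (R : Matrix (Fin a) (Fin a) ℝ) (w : Fin a → Fin b → ℝ) (j : Fin b) :
    col (fun i j => ∑ i', R i i' * w i' j) j = Matrix.toEuclideanCLM (𝕜 := ℝ) R (col w j) := by
  ext i
  rfl

theorem l2norm_matrix_mul_le (R : Matrix (Fin a) (Fin a) ℝ) (w : Fin a → Fin b → ℝ) :
    l2norm (fun i j => ∑ i', R i i' * w i' j) ≤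
      ‖Matrix.toEuclideanCLM (𝕜 := ℝ) R‖ * l2norm w := by
  refine le_of_sq_le_sq ?_ (mul_nonneg (norm_nonneg _) (l2norm_nonneg w))
  rw [mul_pow, l2norm_sq, l2norm_sq, Finset.mul_sum]
  refine Finset.sum_le_sum fun j _ => ?_
  rw [col_matrix_mul, ← mul_pow]
  exact pow_le_pow_left₀ (norm_nonneg _) (ContinuousLinearMap.le_opNorm _ _) 2

end L2norm

/-- The partial sums of `x` obey the same bound as the terms, and the induction carries both. -/
theorem discrete_gronwall {x s : ℕ → ℝ} {κ : ℝ} (hκ : 0 ≤ κ) {T : ℕ} (hs : ∀ t, 0 ≤ s t)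
    (h : ∀ t ≤ T, x t ≤ s t + κ * ∑ r ∈ Finset.range t, x r) :
    ∀ t ≤ T, x t ≤ (1 + κ) ^ t * ∑ r ∈ Finset.range (t + 1), s r := by
  have key : ∀ t ≤ T, ∑ r ∈ Finset.range (t + 1), x r ≤
      (1 + κ) ^ t * ∑ r ∈ Finset.range (t + 1), s r ∧
      x t ≤ (1 + κ) ^ t * ∑ r ∈ Finset.range (t + 1), s r := by
    intro t
    induction t with
    | zero =>
      intro h0
      have := h 0 h0
      simp at this ⊢
      exact this
    | succ t ih =>
      intro ht
      have h1 := (ih (by omega)).1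
      have h2 := h (t + 1) ht
      have h3 : 1 ≤ (1 + κ) ^ (t + 1) := one_le_pow₀ (by linarith)
      have h4 := hs (t + 1)
      have h5 : 0 ≤ ∑ r ∈ Finset.range (t + 1), s r := Finset.sum_nonneg fun _ _ => hs _
      have h6 : 0 ≤ (1 + κ) ^ t := by positivity
      rw [Finset.sum_range_succ x (t + 1), Finset.sum_range_succ s (t + 1)]
      have h7 : κ * ∑ r ∈ Finset.range (t + 1), x r ≤
          κ * ((1 + κ) ^ t * ∑ r ∈ Finset.range (t + 1), s r) := mul_le_mul_of_nonneg_left h1 hκ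
      have h8 : s (t + 1) ≤ (1 + κ) ^ (t + 1) * s (t + 1) := le_mul_of_one_le_left h4 h3
      have h9 : 0 ≤ (1 + κ) ^ t * ∑ r ∈ Finset.range (t + 1), s r := by positivity
      rw [pow_succ] at h8 ⊢
      constructor <;> nlinarith
  exact fun t ht => (key t ht).2

/-! ### The time order of the dynamics, and Lipschitz dependence on the inputs. -/

section Blocks

variable {dz J L n m : ℕ}

/-- The norms of the components of a block array, in the order `p(0), q(0), p(1), q(1), …`. -/
def stepNorm (ξ : Blocks J L n m) (t : ℕ) : ℝ :=
  if h : t / 2 < L then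
    (if t % 2 = 0 then l2norm (ξ.2 ⟨t / 2, h⟩) / Real.sqrt m else l2norm (ξ.1 ⟨t / 2, h⟩))
  else 0

theorem stepNorm_nonneg (ξ : Blocks J L n m) (t : ℕ) : 0 ≤ stepNorm ξ t := by
  unfold stepNorm
  split_ifs
  · exact div_nonneg (l2norm_nonneg _) (Real.sqrt_nonneg _)
  · exact l2norm_nonneg _
  · exact le_rfl

theorem stepNorm_even (ξ : Blocks J L n m) (l : Fin L) :
    stepNorm ξ (2 * l) = l2norm (ξ.2 l) / Real.sqrt m := by
  have h : 2 * (l : ℕ) / 2 = l := by omega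
  simp [stepNorm, h]

theorem stepNorm_odd (ξ : Blocks J L n m) (l : Fin L) :
    stepNorm ξ (2 * l + 1) = l2norm (ξ.1 l) := by
  have h : (2 * (l : ℕ) + 1) / 2 = l := by omega
  have h2 : (2 * (l : ℕ) + 1) % 2 = 1 := by omega
  simp [stepNorm, h, h2]

/-- Time is interleaved: even times are the `p(l)`, odd times the `q(l)`. Times from `2L` on carry
no component and have norm zero by convention. -/
theorem stepNorm_cases {p : ℕ → Prop} (T : ℕ) (h0 : ∀ l : Fin L, 2 * (l : ℕ) ≤ T → p (2 * l))
    (h1 : ∀ l : Fin L, 2 * (l : ℕ) + 1 ≤ T → p (2 * l + 1))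
    (h2 : ∀ t, L ≤ t / 2 → p t) : ∀ t ≤ T, p t := by
  intro t ht
  by_cases h : t / 2 < L
  · rcases Nat.mod_two_eq_zero_or_one t with h' | h'
    · have : t = 2 * (⟨t / 2, h⟩ : Fin L) := by simp; omega
      rw [this]; exact h0 _ (by omega)
    · have : t = 2 * (⟨t / 2, h⟩ : Fin L) + 1 := by simp; omega
      rw [this]; exact h1 _ (by omega)
  · exact h2 t (by omega)

theorem stepNorm_of_le (ξ : Blocks J L n m) {t : ℕ} (h : L ≤ t / 2) : stepNorm ξ t = 0 := by
  simp [stepNorm, not_lt.2 h]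

theorem stepNorm_add_le (ξ ξ' : Blocks J L n m) (t : ℕ) :
    stepNorm (ξ + ξ') t ≤ stepNorm ξ t + stepNorm ξ' t := by
  refine stepNorm_cases (L := L) (p := fun t => stepNorm (ξ + ξ') t ≤ stepNorm ξ t + stepNorm ξ' t)
    t (fun l _ => ?_) (fun l _ => ?_) (fun t h => ?_) t le_rfl
  · simp only [stepNorm_even, ← add_div]
    exact div_le_div_of_nonneg_right (l2norm_add_le _ _) (Real.sqrt_nonneg _)
  · simp only [stepNorm_odd]
    exact l2norm_add_le _ _
  · simp [stepNorm_of_le _ h]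

theorem stepNorm_smul (c : ℝ) (ξ : Blocks J L n m) (t : ℕ) :
    stepNorm (c • ξ) t = |c| * stepNorm ξ t := by
  refine stepNorm_cases (L := L) (p := fun t => stepNorm (c • ξ) t = |c| * stepNorm ξ t)
    t (fun l _ => ?_) (fun l _ => ?_) (fun t h => ?_) t le_rfl
  · simp only [stepNorm_even, Prod.smul_snd, Pi.smul_apply, l2norm_smul, mul_div_assoc]
  · simp only [stepNorm_odd, Prod.smul_fst, Pi.smul_apply, l2norm_smul]
  · simp [stepNorm_of_le _ h]

theorem stepNorm_le_blockNorm (ξ : Blocks J L n m) (t : ℕ) : stepNorm ξ t ≤ blockNorm ξ := by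
  refine stepNorm_cases (L := L) (p := fun t => stepNorm ξ t ≤ blockNorm ξ)
    t (fun l _ => ?_) (fun l _ => ?_) (fun t h => ?_) t le_rfl
  · rw [stepNorm_even]
    exact (le_ciSup (f := fun l => l2norm (ξ.2 l) / Real.sqrt m) (Set.finite_range _).bddAbove l).trans
      (le_max_right _ _)
  · rw [stepNorm_odd]
    exact (le_ciSup (f := fun l => l2norm (ξ.1 l)) (Set.finite_range _).bddAbove l).trans
      (le_max_left _ _)
  · rw [stepNorm_of_le _ h]
    exact (Real.iSup_nonneg fun l => l2norm_nonneg (ξ.1 l)).trans (le_max_left _ _)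

theorem blockNorm_nonneg (ξ : Blocks J L n m) : 0 ≤ blockNorm ξ :=
  (stepNorm_nonneg ξ 0).trans (stepNorm_le_blockNorm ξ 0)

theorem blockNorm_le_of_stepNorm_le (ξ : Blocks J L n m) {c : ℝ} (hc : 0 ≤ c)
    (h : ∀ t < 2 * L, stepNorm ξ t ≤ c) : blockNorm ξ ≤ c := by
  refine max_le (Real.iSup_le (fun l => ?_) hc) (Real.iSup_le (fun l => ?_) hc)
  · rw [← stepNorm_odd]; exact h _ (by omega)
  · rw [← stepNorm_even]; exact h _ (by omega)

theorem blockNorm_le_sum_stepNorm (ξ : Blocks J L n m) :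
    blockNorm ξ ≤ ∑ t ∈ Finset.range (2 * L), stepNorm ξ t :=
  blockNorm_le_of_stepNorm_le ξ (Finset.sum_nonneg fun _ _ => stepNorm_nonneg _ _) fun _ ht =>
    Finset.single_le_sum (f := stepNorm ξ) (fun _ _ => stepNorm_nonneg ξ _) (Finset.mem_range.2 ht)

/-- The components that are settled before time `T` in the order `p(0), q(0), p(1), q(1), …`. -/
def truncate (T : ℕ) (ξ : Blocks J L n m) : Blocks J L n m :=
  (fun k => if 2 * (k : ℕ) + 1 < T then ξ.1 k else 0, fun k => if 2 * (k : ℕ) < T then ξ.2 k else 0)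

theorem truncate_sub (T : ℕ) (ξ ξ' : Blocks J L n m) :
    truncate T ξ - truncate T ξ' = truncate T (ξ - ξ') := by
  refine Prod.ext (funext fun k => ?_) (funext fun k => ?_) <;> simp only [truncate, Prod.fst_sub,
    Prod.snd_sub, Pi.sub_apply] <;> split_ifs <;> simp

theorem blockNorm_truncate_le (T : ℕ) (ξ : Blocks J L n m) :
    blockNorm (truncate T ξ) ≤ ∑ t ∈ Finset.range T, stepNorm ξ t := by
  have h0 : 0 ≤ ∑ t ∈ Finset.range T, stepNorm ξ t :=
    Finset.sum_nonneg fun _ _ => stepNorm_nonneg _ _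
  have h1 : ∀ t < T, stepNorm ξ t ≤ ∑ t ∈ Finset.range T, stepNorm ξ t := fun t ht =>
    Finset.single_le_sum (f := stepNorm ξ) (fun _ _ => stepNorm_nonneg ξ _) (Finset.mem_range.2 ht)
  refine blockNorm_le_of_stepNorm_le _ h0 ?_
  intro t _
  refine stepNorm_cases (L := L) (p := fun t => stepNorm (truncate T ξ) t ≤ ∑ t ∈ Finset.range T, stepNorm ξ t)
    t (fun l _ => ?_) (fun l _ => ?_) (fun t h => ?_) t le_rfl
  · rw [stepNorm_even]
    simp only [truncate]
    split_ifs with h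
    · rw [← stepNorm_even]; exact h1 _ h
    · simpa using h0
  · rw [stepNorm_odd]
    simp only [truncate]
    split_ifs with h
    · rw [← stepNorm_odd]; exact h1 _ h
    · simpa using h0
  · rw [stepNorm_of_le _ h]; exact h0

theorem continuous_stepNorm (t : ℕ) : Continuous fun ξ : Blocks J L n m => stepNorm ξ t := by
  unfold stepNorm
  split_ifs <;> fun_prop

variable {M : Model dz J L n m} {C K : ℝ}

/-- Causality sharpens the Lipschitz hypothesis: components that `θ_l` does not see may be set to
zero before the norm is taken, so only the times before `2l` contribute. -/
theorem Model.LipschitzUpdates.theta_le (hM : M.LipschitzUpdates C) (hC : 0 ≤ C) (y) (l : Fin L)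
    (ξ ξ' : Blocks J L n m) :
    l2norm (M.theta y l ξ - M.theta y l ξ') ≤
      C * ∑ t ∈ Finset.range (2 * l), stepNorm (ξ - ξ') t := by
  have h : ∀ ξ, M.theta y l ξ = M.theta y l (truncate (2 * l) ξ) := fun ξ =>
    M.theta_causal y l _ _ (fun k hk => by
      have : (k : ℕ) < l := hk
      rw [truncate]; simp only; rw [if_pos (by omega)]) (fun k hk => by
      have : (k : ℕ) < l := hk
      rw [truncate]; simp only; rw [if_pos (by omega)])
  rw [h ξ, h ξ']
  refine (hM.theta y l _ _).trans (mul_le_mul_of_nonneg_left ?_ hC)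
  rw [truncate_sub]
  exact blockNorm_truncate_le _ _

/-- As for `θ_l`, with one more time step, because `ω_l` also sees `p(l)`. -/
theorem Model.LipschitzUpdates.omega_le (hM : M.LipschitzUpdates C) (hC : 0 ≤ C) (y) (l : Fin L)
    (ξ ξ' : Blocks J L n m) :
    l2norm (M.omega y l ξ - M.omega y l ξ') / Real.sqrt m ≤
      C * ∑ t ∈ Finset.range (2 * l + 1), stepNorm (ξ - ξ') t := by
  have h : ∀ ξ, M.omega y l ξ = M.omega y l (truncate (2 * l + 1) ξ) := fun ξ =>
    M.omega_causal y l _ _ (fun k hk => by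
      have : (k : ℕ) < l := hk
      rw [truncate]; simp only; rw [if_pos (by omega)]) (fun k hk => by
      have : (k : ℕ) ≤ l := hk
      rw [truncate]; simp only; rw [if_pos (by omega)])
  rw [h ξ, h ξ']
  refine (hM.omega y l _ _).trans (mul_le_mul_of_nonneg_left ?_ hC)
  rw [truncate_sub]
  exact blockNorm_truncate_le _ _

theorem Model.theta_growth (hM : M.LipschitzUpdates C) (hC : 0 ≤ C) (hK : M.BoundedBy K) (y)
    (l : Fin L) (ξ : Blocks J L n m) :
    l2norm (M.theta y l ξ) ≤ K + C * ∑ t ∈ Finset.range (2 * l), stepNorm ξ t := by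
  have h1 := hM.theta_le hC y l ξ 0
  have h2 := l2norm_le_sub_add (M.theta y l ξ) (M.theta y l 0)
  rw [sub_zero] at h1
  linarith [hK.theta y l]

theorem Model.omega_growth (hM : M.LipschitzUpdates C) (hC : 0 ≤ C) (hK : M.BoundedBy K) (y)
    (l : Fin L) (ξ : Blocks J L n m) :
    l2norm (M.omega y l ξ) / Real.sqrt m ≤
      K + C * ∑ t ∈ Finset.range (2 * l + 1), stepNorm ξ t := by
  have h1 := hM.omega_le hC y l ξ 0
  have h2 := div_le_div_of_nonneg_right (l2norm_le_sub_add (M.omega y l ξ) (M.omega y l 0))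
    (Real.sqrt_nonneg m)
  rw [sub_zero] at h1
  rw [add_div] at h2
  linarith [hK.omega y l]

/-- The memory terms in the mean-field equation of `q(l)`. -/
def Model.feedbackQ (M : Model dz J L n m) (P : Params dz J L n) (w : Fin L → Fin n → Fin J → ℝ)
    (l : Fin L) : Fin n → Fin J → ℝ := fun i j =>
  ∑ ζ, ∑ μ with μ ≤ l, ∑ i', M.cov ζ i i' * ∑ j', w μ i' j' * P.Btheta ζ (μ, j') (l, j)

/-- The memory terms in the mean-field equation of `p(l)`. -/
def feedbackP (P : Params dz J L n) (z : Fin m → Fin dz) (w : Fin L → Fin m → Fin J → ℝ)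
    (l : Fin L) : Fin m → Fin J → ℝ := fun k j =>
  ∑ μ with μ < l, ∑ j', w μ k j' * P.Bomega (z k) (μ, j') (l, j)

theorem Model.feedbackQ_sub (P : Params dz J L n) (w w' : Fin L → Fin n → Fin J → ℝ) (l : Fin L) :
    M.feedbackQ P w l - M.feedbackQ P w' l = M.feedbackQ P (w - w') l := by
  ext i j
  simp only [Pi.sub_apply, feedbackQ, ← Finset.sum_sub_distrib, ← mul_sub, ← sub_mul]

theorem feedbackP_sub (P : Params dz J L n) (z : Fin m → Fin dz)
    (w w' : Fin L → Fin m → Fin J → ℝ) (l : Fin L) :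
    feedbackP P z w l - feedbackP P z w' l = feedbackP P z (w - w') l := by
  ext i j
  simp only [Pi.sub_apply, feedbackP, ← Finset.sum_sub_distrib, ← sub_mul]

theorem Model.feedbackQ_le (hK : M.BoundedBy K) (hK0 : 0 ≤ K) {P : Params dz J L n} {b : ℝ}
    (hb : 0 ≤ b) (w : Fin L → Fin n → Fin J → ℝ) (l : Fin L)
    (hB : ∀ ζ a j, |P.Btheta ζ a (l, j)| ≤ b) :
    l2norm (M.feedbackQ P w l) ≤
      dz * K * (J * (J * b)) * ∑ μ with μ ≤ l, l2norm (w μ) := by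
  have h : M.feedbackQ P w l = ∑ ζ, ∑ μ with μ ≤ l,
      fun i j => ∑ i', M.cov ζ i i' * ∑ j', w μ i' j' * P.Btheta ζ (μ, j') (l, j) := by
    ext i j
    simp [feedbackQ, Finset.sum_apply]
  rw [h]
  refine (l2norm_sum_le _ _).trans ?_
  have h2 : ∀ ζ : Fin dz, l2norm (∑ μ with μ ≤ l,
      fun i j => ∑ i', M.cov ζ i i' * ∑ j', w μ i' j' * P.Btheta ζ (μ, j') (l, j)) ≤
      K * (J * (J * b)) * ∑ μ with μ ≤ l, l2norm (w μ) := fun ζ => by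
    refine (l2norm_sum_le _ _).trans ?_
    rw [Finset.mul_sum]
    refine Finset.sum_le_sum fun μ _ => ?_
    refine (l2norm_matrix_mul_le (M.cov ζ)
      (fun i' j => ∑ j', w μ i' j' * P.Btheta ζ (μ, j') (l, j))).trans ?_
    rw [mul_assoc]
    exact mul_le_mul (hK.cov ζ) (l2norm_rowwise_le hb _ (fun _ j' j => P.Btheta ζ (μ, j') (l, j))
      (fun _ _ _ => hB _ _ _)) (l2norm_nonneg _) hK0
  calc _ ≤ ∑ _ζ : Fin dz, K * (J * (J * b)) * ∑ μ with μ ≤ l, l2norm (w μ) :=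
        Finset.sum_le_sum fun ζ _ => h2 ζ
    _ = _ := by simp; ring

theorem feedbackP_le {P : Params dz J L n} {z : Fin m → Fin dz} {b : ℝ}
    (hb : 0 ≤ b) (w : Fin L → Fin m → Fin J → ℝ) (l : Fin L)
    (hB : ∀ ζ a j, |P.Bomega ζ a (l, j)| ≤ b) :
    l2norm (feedbackP P z w l) ≤ J * (J * b) * ∑ μ with μ < l, l2norm (w μ) := by
  have h : feedbackP P z w l = ∑ μ with μ < l,
      fun k j => ∑ j', w μ k j' * P.Bomega (z k) (μ, j') (l, j) := by
    ext i j
    simp [feedbackP, Finset.sum_apply]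
  rw [h, Finset.mul_sum]
  refine (l2norm_sum_le _ _).trans (Finset.sum_le_sum fun μ _ => ?_)
  exact l2norm_rowwise_le hb _ (fun k j' j => P.Bomega (z k) (μ, j') (l, j)) fun _ _ _ => hB _ _ _

/-- The inputs of the mean-field dynamics, scaled as they enter it. -/
def inputBlocks (gt : Fin L → Fin n → Fin J → ℝ) (ht : Fin L → Fin m → Fin J → ℝ) :
    Blocks J L n m :=
  (fun l i j => gt l i j / Real.sqrt m, ht)

theorem inputBlocks_sub (gt gt' : Fin L → Fin n → Fin J → ℝ) (ht ht' : Fin L → Fin m → Fin J → ℝ) :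
    inputBlocks gt ht - inputBlocks gt' ht' = inputBlocks (gt - gt') (ht - ht') := by
  refine Prod.ext ?_ rfl
  ext l i j
  simp [inputBlocks, sub_div]

theorem Model.dmfSolution_eq (P : Params dz J L n) (z : Fin m → Fin dz)
    (gt : Fin L → Fin n → Fin J → ℝ) (ht : Fin L → Fin m → Fin J → ℝ) :
    M.dmfMap P z gt ht (M.dmfSolution P z gt ht) = M.dmfSolution P z gt ht :=
  ((M.dmfMap_sequential P z gt ht).eq_iff _).2 rfl

/-- The Lipschitz constant of the memory terms of the mean-field dynamics. -/
def memoryConst (dz J L : ℕ) (C K b : ℝ) : ℝ :=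
  (dz * K + 1) * (J * (J * b)) * (L * C)

theorem memoryConst_nonneg {dz J L : ℕ} {C K b : ℝ} (hC : 0 ≤ C) (hK : 0 ≤ K) (hb : 0 ≤ b) :
    0 ≤ memoryConst dz J L C K b := by
  unfold memoryConst; positivity

/-- The coefficients of the memory terms that act up to time `T` are bounded by `b`. -/
def Params.MemoryBound (P : Params dz J L n) (b : ℝ) (T : ℕ) : Prop :=
  (∀ ζ a (l : Fin L) j, 2 * (l : ℕ) ≤ T → |P.Bomega ζ a (l, j)| ≤ b) ∧
  (∀ ζ a (l : Fin L) j, 2 * (l : ℕ) + 1 ≤ T → |P.Btheta ζ a (l, j)| ≤ b)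

theorem sum_filter_le_card_mul {L : ℕ} (p : Fin L → Prop) [DecidablePred p] (f : Fin L → ℝ) {c : ℝ}
    (hc : 0 ≤ c) (h : ∀ μ, p μ → f μ ≤ c) : ∑ μ with p μ, f μ ≤ L * c := by
  calc ∑ μ with p μ, f μ ≤ ∑ μ with p μ, c :=
        Finset.sum_le_sum fun μ hμ => h μ (Finset.mem_filter.1 hμ).2
    _ ≤ ∑ _μ : Fin L, c := Finset.sum_le_sum_of_subset_of_nonneg (Finset.filter_subset _ _)
        fun _ _ _ => hc
    _ = _ := by simp

/-- The mean-field dynamics depends on its inputs in a causal and Lipschitz way. -/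
theorem Model.dmfSolution_lipschitz (hM : M.LipschitzUpdates C) (hC : 0 ≤ C) (hK : M.BoundedBy K)
    (hK0 : 0 ≤ K) {P : Params dz J L n} {b : ℝ} (hb : 0 ≤ b) {T : ℕ} (hB : P.MemoryBound b T)
    (z : Fin m → Fin dz) (gt gt' : Fin L → Fin n → Fin J → ℝ) (ht ht' : Fin L → Fin m → Fin J → ℝ) :
    ∀ t ≤ T, stepNorm (M.dmfSolution P z gt ht - M.dmfSolution P z gt' ht') t ≤
      (1 + memoryConst dz J L C K b) ^ t *
        ∑ r ∈ Finset.range (t + 1), stepNorm (inputBlocks (gt - gt') (ht - ht')) r := by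
  set ξ := M.dmfSolution P z gt ht with hξ
  set ξ' := M.dmfSolution P z gt' ht' with hξ'
  have e := M.dmfSolution_eq P z gt ht
  have e' := M.dmfSolution_eq P z gt' ht'
  rw [← hξ] at e
  rw [← hξ'] at e'
  have hmono : ∀ {r t : ℕ}, r ≤ t → ∑ r ∈ Finset.range r, stepNorm (ξ - ξ') r ≤
      ∑ r ∈ Finset.range t, stepNorm (ξ - ξ') r := fun h =>
    Finset.sum_le_sum_of_subset_of_nonneg (by simpa using h) fun _ _ _ => stepNorm_nonneg _ _
  have hpos : ∀ t, 0 ≤ ∑ r ∈ Finset.range t, stepNorm (ξ - ξ') r := fun t =>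
    Finset.sum_nonneg fun _ _ => stepNorm_nonneg _ _
  -- At each time the difference of the solutions is the difference of the inputs plus memory terms
  -- that involve only earlier times, so Gronwall applies.
  refine discrete_gronwall (memoryConst_nonneg hC hK0 hb) (fun t => stepNorm_nonneg _ _) ?_
  refine stepNorm_cases (L := L) T (fun l hl => ?_) (fun l hl => ?_) (fun t h => ?_)
  · have h1 : (ξ - ξ').2 l = (ht - ht') l +
        feedbackP P z ((fun μ => M.omega (M.labels z) μ ξ) - fun μ => M.omega (M.labels z) μ ξ') l := by
      rw [← feedbackP_sub]
      conv_lhs => rw [← e, ← e']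
      ext k j
      simp only [dmfMap, feedbackP, Prod.snd_sub, Pi.sub_apply, Pi.add_apply]
      ring
    rw [stepNorm_even, stepNorm_even, h1]
    refine (div_le_div_of_nonneg_right (l2norm_add_le _ _) (Real.sqrt_nonneg _)).trans ?_
    rw [add_div]
    refine add_le_add le_rfl ?_
    refine (div_le_div_of_nonneg_right (feedbackP_le hb _ _ fun ζ a j => hB.1 ζ a l j hl)
      (Real.sqrt_nonneg _)).trans ?_
    rw [mul_div_assoc, Finset.sum_div]
    have h2 := sum_filter_le_card_mul (fun μ => μ < l)
      (fun μ => l2norm (M.omega (M.labels z) μ ξ - M.omega (M.labels z) μ ξ') / Real.sqrt m)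
      (c := C * ∑ r ∈ Finset.range (2 * l), stepNorm (ξ - ξ') r) (mul_nonneg hC (hpos _))
      fun μ hμ => (hM.omega_le hC _ μ ξ ξ').trans (mul_le_mul_of_nonneg_left (hmono (by
        have : (μ : ℕ) < l := hμ
        omega)) hC)
    calc _ ≤ J * (J * b) * (L * (C * ∑ r ∈ Finset.range (2 * l), stepNorm (ξ - ξ') r)) :=
          mul_le_mul_of_nonneg_left h2 (by positivity)
      _ = J * (J * b) * (L * C) * ∑ r ∈ Finset.range (2 * l), stepNorm (ξ - ξ') r := by ring
      _ ≤ _ := by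
        refine mul_le_mul_of_nonneg_right ?_ (hpos _)
        unfold memoryConst
        have : 0 ≤ J * (J * b) * (L * C) := by positivity
        nlinarith [mul_nonneg (mul_nonneg (Nat.cast_nonneg dz : (0 : ℝ) ≤ dz) hK0) this]
  · have h1 : (ξ - ξ').1 l = (inputBlocks (gt - gt') (ht - ht')).1 l +
        M.feedbackQ P ((fun μ => M.theta (M.labels z) μ ξ) - fun μ => M.theta (M.labels z) μ ξ') l := by
      rw [← feedbackQ_sub, ← inputBlocks_sub]
      conv_lhs => rw [← e, ← e']
      ext k j
      simp only [dmfMap, feedbackQ, Prod.fst_sub, Pi.sub_apply, Pi.add_apply, inputBlocks]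
      ring
    rw [stepNorm_odd, stepNorm_odd, h1]
    refine (l2norm_add_le _ _).trans ?_
    refine add_le_add le_rfl ?_
    refine (Model.feedbackQ_le hK hK0 hb _ _ fun ζ a j => hB.2 ζ a l j hl).trans ?_
    have h2 := sum_filter_le_card_mul (fun μ => μ ≤ l)
      (fun μ => l2norm (M.theta (M.labels z) μ ξ - M.theta (M.labels z) μ ξ'))
      (c := C * ∑ r ∈ Finset.range (2 * l + 1), stepNorm (ξ - ξ') r) (mul_nonneg hC (hpos _))
      fun μ hμ => (hM.theta_le hC _ μ ξ ξ').trans (mul_le_mul_of_nonneg_left (hmono (by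
        have : (μ : ℕ) ≤ l := hμ
        omega)) hC)
    calc _ ≤ dz * K * (J * (J * b)) *
          (L * (C * ∑ r ∈ Finset.range (2 * l + 1), stepNorm (ξ - ξ') r)) :=
          mul_le_mul_of_nonneg_left h2 (by positivity)
      _ = dz * K * (J * (J * b)) * (L * C) *
          ∑ r ∈ Finset.range (2 * l + 1), stepNorm (ξ - ξ') r := by ring
      _ ≤ _ := by
        refine mul_le_mul_of_nonneg_right ?_ (hpos _)
        unfold memoryConst
        have : 0 ≤ J * (J * b) * (L * C) := by positivity
        nlinarith
  · rw [stepNorm_of_le _ h, stepNorm_of_le _ h, zero_add]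
    exact mul_nonneg (memoryConst_nonneg hC hK0 hb) (hpos _)

/-- The solution is a fixed finite iterate of a map that is differentiable jointly in the inputs and
the state. -/
theorem Model.differentiable_dmfSolution (M : Model dz J L n m) (P : Params dz J L n)
    (z : Fin m → Fin dz) :
    Differentiable ℝ fun p : (Fin L → Fin n → Fin J → ℝ) × (Fin L → Fin m → Fin J → ℝ) =>
      M.dmfSolution P z p.1 p.2 := by
  unfold dmfSolution solve
  generalize 2 * L = t
  induction t with
  | zero => exact differentiable_const _
  | succ t ih =>
    simp only [Function.iterate_succ_apply']
    have h1 : ∀ μ, Differentiable ℝ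
        fun p : (Fin L → Fin n → Fin J → ℝ) × (Fin L → Fin m → Fin J → ℝ) =>
        M.theta (M.labels z) μ ((M.dmfMap P z p.1 p.2)^[t] 0) := fun μ =>
      (M.theta_differentiable _ μ).comp ih
    have h2 : ∀ μ, Differentiable ℝ
        fun p : (Fin L → Fin n → Fin J → ℝ) × (Fin L → Fin m → Fin J → ℝ) =>
        M.omega (M.labels z) μ ((M.dmfMap P z p.1 p.2)^[t] 0) := fun μ =>
      (M.omega_differentiable _ μ).comp ih
    simp only [differentiable_pi] at h1 h2
    refine Differentiable.prodMk ?_ ?_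
    · simp only [differentiable_pi]
      intro l i j
      refine Differentiable.add (by fun_prop) ?_
      refine Differentiable.fun_sum fun ζ _ => Differentiable.fun_sum fun μ _ =>
        Differentiable.fun_sum fun i' _ => Differentiable.const_mul ?_ _
      exact Differentiable.fun_sum fun j' _ => (h1 μ i' j').mul_const _
    · simp only [differentiable_pi]
      intro l i j
      refine Differentiable.add (by fun_prop) ?_
      exact Differentiable.fun_sum fun μ _ =>
        Differentiable.fun_sum fun j' _ => (h2 μ i j').mul_const _

end Blocks

end DMF

end

noncomputable section

namespace DMF

/-! ### Calculus of second-moment bounds. -/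

section L2Bound

variable {Ω : Type*} [MeasurableSpace Ω] {μ : Measure Ω}

/-- The real random variable `X` has `L²` norm at most `c`. -/
structure L2Bound (μ : Measure Ω) (X : Ω → ℝ) (c : ℝ) : Prop where
  nonneg : 0 ≤ c
  aesm : AEStronglyMeasurable X μ
  le : eLpNorm X 2 μ ≤ ENNReal.ofReal c

namespace L2Bound

variable {X Y : Ω → ℝ} {c d : ℝ}

theorem memLp (h : L2Bound μ X c) : MemLp X 2 μ :=
  ⟨h.aesm, h.le.trans_lt ENNReal.ofReal_lt_top⟩

theorem mono_const (h : L2Bound μ X c) (hcd : c ≤ d) : L2Bound μ X d :=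
  ⟨h.nonneg.trans hcd, h.aesm, h.le.trans (ENNReal.ofReal_le_ofReal hcd)⟩

theorem mono (h : L2Bound μ X c) (hY : AEStronglyMeasurable Y μ) (hle : ∀ s, |Y s| ≤ X s) :
    L2Bound μ Y c :=
  ⟨h.nonneg, hY, (eLpNorm_mono_real hle).trans h.le⟩

theorem add (h : L2Bound μ X c) (h' : L2Bound μ Y d) : L2Bound μ (fun s => X s + Y s) (c + d) :=
  ⟨add_nonneg h.nonneg h'.nonneg, h.aesm.add h'.aesm,
    (eLpNorm_add_le h.aesm h'.aesm one_le_two).trans (by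
      rw [ENNReal.ofReal_add h.nonneg h'.nonneg]; exact add_le_add h.le h'.le)⟩

theorem const [IsProbabilityMeasure μ] (hc : 0 ≤ c) : L2Bound μ (fun _ => c) c :=
  ⟨hc, aestronglyMeasurable_const, by
    rw [eLpNorm_const _ two_ne_zero (IsProbabilityMeasure.ne_zero μ)]
    simp [Real.enorm_eq_ofReal hc]⟩

theorem zero : L2Bound μ (fun _ => (0 : ℝ)) 0 :=
  ⟨le_rfl, aestronglyMeasurable_const, by simp⟩

theorem const_mul (h : L2Bound μ X c) {a : ℝ} (ha : 0 ≤ a) : L2Bound μ (fun s => a * X s) (a * c) :=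
  ⟨mul_nonneg ha h.nonneg, h.aesm.const_mul a, (eLpNorm_const_smul_le (c := a) (f := X)).trans (by
    rw [ENNReal.ofReal_mul ha, Real.enorm_eq_ofReal ha]; exact mul_le_mul_right h.le _)⟩

theorem sum {ι : Type*} (s : Finset ι) {X : ι → Ω → ℝ} {c : ι → ℝ}
    (h : ∀ i ∈ s, L2Bound μ (X i) (c i)) : L2Bound μ (fun w => ∑ i ∈ s, X i w) (∑ i ∈ s, c i) := by
  classical
  induction s using Finset.induction_on with
  | empty => simpa using zero
  | insert i s hi ih =>
    simp only [Finset.sum_insert hi]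
    exact (h i (by simp)).add (ih fun j hj => h j (by simp [hj]))

theorem lintegral_sq_le (h : L2Bound μ X c) :
    ∫⁻ s, ENNReal.ofReal (X s ^ 2) ∂μ ≤ ENNReal.ofReal (c ^ 2) := by
  have h1 := eLpNorm_nnreal_pow_eq_lintegral (μ := μ) (f := X) (p := 2) two_ne_zero
  have h2 : ∀ s, ENNReal.ofReal (X s ^ 2) = ‖X s‖ₑ ^ ((2 : NNReal) : ℝ) := fun s => by
    rw [← sq_abs, ENNReal.ofReal_pow (abs_nonneg _), ← Real.norm_eq_abs, ofReal_norm]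
    simp
  simp_rw [h2, ← h1, ENNReal.ofReal_pow h.nonneg]
  have h3 : eLpNorm X 2 μ ^ 2 ≤ ENNReal.ofReal c ^ 2 := by gcongr; exact h.le
  simpa using h3

theorem of_lintegral_sq (hc : 0 ≤ c) (hX : AEStronglyMeasurable X μ)
    (h : ∫⁻ s, ENNReal.ofReal (X s ^ 2) ∂μ ≤ ENNReal.ofReal (c ^ 2)) : L2Bound μ X c := by
  refine ⟨hc, hX, ?_⟩
  have h1 := eLpNorm_nnreal_pow_eq_lintegral (μ := μ) (f := X) (p := 2) two_ne_zero
  have h2 : ∀ s, ENNReal.ofReal (X s ^ 2) = ‖X s‖ₑ ^ ((2 : NNReal) : ℝ) := fun s => by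
    rw [← sq_abs, ENNReal.ofReal_pow (abs_nonneg _), ← Real.norm_eq_abs, ofReal_norm]
    simp
  simp_rw [h2, ← h1, ENNReal.ofReal_pow hc] at h
  exact (ENNReal.pow_le_pow_left_iff two_ne_zero).1 (by simpa using h)

theorem integral_sq_le (h : L2Bound μ X c) : ∫ s, X s ^ 2 ∂μ ≤ c ^ 2 := by
  have h1 := h.lintegral_sq_le
  rw [← ofReal_integral_eq_lintegral_ofReal h.memLp.integrable_sq
    (ae_of_all _ fun _ => sq_nonneg _)] at h1
  exact (ENNReal.ofReal_le_ofReal_iff (sq_nonneg c)).1 h1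

theorem integral_abs_le [IsProbabilityMeasure μ] (h : L2Bound μ X c) : ∫ s, |X s| ∂μ ≤ c := by
  have h1 := (eLpNorm_le_eLpNorm_of_exponent_le (μ := μ) one_le_two h.aesm).trans h.le
  rw [eLpNorm_one_eq_lintegral_enorm, ← ofReal_integral_norm_eq_lintegral_enorm
    (h.memLp.integrable one_le_two)] at h1
  exact (ENNReal.ofReal_le_ofReal_iff h.nonneg).1 h1

end L2Bound

end L2Bound

/-! ### Measurability and second moments of the mean-field noise. -/

section NoiseLaw

variable {dz J L n m : ℕ} (M : Model dz J L n m)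

instance (k : Fin m) : IsProbabilityMeasure (M.latent k) := M.latent_prob k

instance : IsProbabilityMeasure M.latentLaw := by unfold Model.latentLaw; infer_instance

instance : IsProbabilityMeasure M.noiseLaw := by unfold Model.noiseLaw; infer_instance

/-- The index set of the Gaussian entries of the noise. -/
abbrev NoiseIndex (dz J L n m : ℕ) : Type :=
  (Fin dz × Fin n × (Fin L × Fin J)) ⊕ (Fin m × (Fin L × Fin J))

/-- The noise with given latent variables and Gaussian entries. -/
def mkNoise (p : (Fin m → Fin dz) × (NoiseIndex dz J L n m → ℝ)) : Noise dz J L n m :=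
  (p.1, fun ζ i a => p.2 (.inl (ζ, i, a)), fun k a => p.2 (.inr (k, a)))

theorem measurePreserving_mkNoise :
    MeasurePreserving mkNoise (M.latentLaw.prod (gaussPi (NoiseIndex dz J L n m))) M.noiseLaw := by
  refine (MeasurePreserving.id M.latentLaw).prod
    (g := fun x : NoiseIndex dz J L n m → ℝ =>
      ((fun ζ i a => x (.inl (ζ, i, a))), (fun k a => x (.inr (k, a))))) ?_
  have h1 := measurePreserving_curry (α := Fin dz) (β := Fin n × (Fin L × Fin J))
  have h2 := (measurePreserving_pi (fun _ : Fin dz => gaussPi (Fin n × (Fin L × Fin J)))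
    (fun _ => Measure.pi fun _ : Fin n => gaussPi (Fin L × Fin J))
    (fun _ => measurePreserving_curry)).comp h1
  have h3 := measurePreserving_curry (α := Fin m) (β := Fin L × Fin J)
  exact (h2.prod h3).comp measurePreserving_sum_split

variable {M}

/-- The latent variables take finitely many values, so continuity in the Gaussian entries suffices.
-/
theorem measurable_noise {f : Noise dz J L n m → ℝ}
    (h : ∀ z, Continuous fun x => f (z, x)) : Measurable f :=
  measurable_from_prod_countable_right fun z => (h z).measurable

theorem continuous_xiBar (P : Params dz J L n) (z : Fin m → Fin dz) :
    Continuous fun x => M.xiBar P (z, x) := by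
  have h1 : Continuous fun x => M.gTilde P (m := m) (z, x) := by unfold Model.gTilde; fun_prop
  have h2 : Continuous fun x => hTilde P (m := m) (z, x) := by unfold hTilde; fun_prop
  exact (M.differentiable_dmfSolution P z).continuous.comp (h1.prodMk h2)

theorem continuous_thetaBar (P : Params dz J L n) (z : Fin m → Fin dz) (l : Fin L) :
    Continuous fun x => M.thetaBar P (z, x) l :=
  (M.theta_differentiable (M.labels z) l).continuous.comp (continuous_xiBar P z)

theorem continuous_omegaBar (P : Params dz J L n) (z : Fin m → Fin dz) (l : Fin L) :
    Continuous fun x => M.omegaBar P (z, x) l :=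
  (M.omega_differentiable (M.labels z) l).continuous.comp (continuous_xiBar P z)

/-- The norm of a column of `G_ζ`. -/
def normG (s : Noise dz J L n m) (ζ : Fin dz) (a : Fin L × Fin J) : ℝ :=
  ‖(WithLp.toLp 2 fun i => s.2.1 ζ i a : EuclideanSpace ℝ (Fin n))‖

/-- The norm of a column of the matrix collecting the rows of the `H_ζ`. -/
def normH (s : Noise dz J L n m) (a : Fin L × Fin J) : ℝ :=
  ‖(WithLp.toLp 2 fun k => s.2.2 k a : EuclideanSpace ℝ (Fin m))‖

theorem lintegral_sq_noiseIndex (c : NoiseIndex dz J L n m) :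
    ∫⁻ p : (Fin m → Fin dz) × (NoiseIndex dz J L n m → ℝ), ENNReal.ofReal (p.2 c ^ 2)
      ∂(M.latentLaw.prod (gaussPi (NoiseIndex dz J L n m))) = 1 := by
  classical
  have h := lintegral_sq_dotProduct (κ := NoiseIndex dz J L n m) (Pi.single c 1)
  simp only [Pi.single_apply, ite_mul, one_mul, zero_mul, Finset.sum_ite_eq', Finset.mem_univ,
    if_true, ite_pow, one_pow, ne_eq, OfNat.ofNat_ne_zero, not_false_eq_true, zero_pow,
    ENNReal.ofReal_one] at h
  rw [lintegral_prod _ (by fun_prop)]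
  simp [h]

theorem l2Bound_normG (ζ : Fin dz) (a : Fin L × Fin J) :
    L2Bound M.noiseLaw (fun s => normG s ζ a) (Real.sqrt n) := by
  have hc : Measurable fun s : Noise dz J L n m => normG s ζ a :=
    measurable_noise fun z => by unfold normG; fun_prop
  refine .of_lintegral_sq (Real.sqrt_nonneg _) hc.aestronglyMeasurable ?_
  rw [← (measurePreserving_mkNoise M).lintegral_comp (by fun_prop)]
  simp only [normG, mkNoise, EuclideanSpace.real_norm_sq_eq]
  simp_rw [ENNReal.ofReal_sum_of_nonneg fun (i : Fin n) _ => sq_nonneg _]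
  rw [lintegral_finsetSum _ (by fun_prop)]
  simp_rw [lintegral_sq_noiseIndex]
  simp

theorem l2Bound_normH (a : Fin L × Fin J) :
    L2Bound M.noiseLaw (fun s => normH s a) (Real.sqrt m) := by
  have hc : Measurable fun s : Noise dz J L n m => normH s a :=
    measurable_noise fun z => by unfold normH; fun_prop
  refine .of_lintegral_sq (Real.sqrt_nonneg _) hc.aestronglyMeasurable ?_
  rw [← (measurePreserving_mkNoise M).lintegral_comp (by fun_prop)]
  simp only [normH, mkNoise, EuclideanSpace.real_norm_sq_eq]
  simp_rw [ENNReal.ofReal_sum_of_nonneg fun (i : Fin m) _ => sq_nonneg _]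
  rw [lintegral_finsetSum _ (by fun_prop)]
  simp_rw [lintegral_sq_noiseIndex]
  simp

theorem covSqrt_mul_self (ζ : Fin dz) : M.covSqrt ζ * M.covSqrt ζ = M.cov ζ :=
  CFC.sqrt_mul_sqrt_self _ (M.cov_posSemidef ζ).nonneg

theorem covSqrt_transpose (ζ : Fin dz) : (M.covSqrt ζ).transpose = M.covSqrt ζ := by
  have h : IsSelfAdjoint (M.covSqrt ζ) := (CFC.sqrt_nonneg (M.cov ζ)).isSelfAdjoint
  have h2 : (M.covSqrt ζ).conjTranspose = M.covSqrt ζ := h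
  simpa [Matrix.conjTranspose_eq_transpose_of_trivial] using h2

/-- The C*-identity for the self-adjoint square root. -/
theorem norm_covSqrt_sq (ζ : Fin dz) :
    ‖Matrix.toEuclideanCLM (𝕜 := ℝ) (M.covSqrt ζ)‖ ^ 2 =
      ‖Matrix.toEuclideanCLM (𝕜 := ℝ) (M.cov ζ)‖ := by
  have h : IsSelfAdjoint (Matrix.toEuclideanCLM (𝕜 := ℝ) (M.covSqrt ζ)) :=
    (CFC.sqrt_nonneg (M.cov ζ)).isSelfAdjoint.map _
  rw [← covSqrt_mul_self, map_mul]
  have := CStarRing.norm_star_mul_self (x := Matrix.toEuclideanCLM (𝕜 := ℝ) (M.covSqrt ζ))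
  rw [h.star_eq] at this
  rw [this, sq]

theorem norm_covSqrt_le {K : ℝ} (hK : M.BoundedBy K) (ζ : Fin dz) :
    ‖Matrix.toEuclideanCLM (𝕜 := ℝ) (M.covSqrt ζ)‖ ≤ Real.sqrt K := by
  apply Real.le_sqrt_of_sq_le
  rw [norm_covSqrt_sq]
  exact hK.cov ζ

theorem l2norm_gTilde_le {K : ℝ} (hK : M.BoundedBy K) (P : Params dz J L n) (s : Noise dz J L n m)
    (l : Fin L) :
    l2norm (M.gTilde P s l) ≤
      ∑ j, ∑ ζ, ∑ a, Real.sqrt K * |P.Aomega ζ a (l, j)| * normG s ζ a := by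
  refine (l2norm_le_sum_col _).trans (Finset.sum_le_sum fun j _ => ?_)
  have h : col (M.gTilde P s l) j = ∑ ζ, ∑ a, P.Aomega ζ a (l, j) •
      Matrix.toEuclideanCLM (𝕜 := ℝ) (M.covSqrt ζ) (WithLp.toLp 2 fun i => s.2.1 ζ i a) := by
    simp_rw [← map_smul, ← map_sum]
    ext i
    simp only [Model.gTilde, col_apply, WithLp.ofLp_sum, Finset.sum_apply]
    refine Finset.sum_congr rfl fun ζ _ => ?_
    simp only [Matrix.ofLp_toEuclideanCLM, Matrix.mulVec, dotProduct, WithLp.ofLp_sum,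
      Finset.sum_apply, WithLp.ofLp_smul, Pi.smul_apply, smul_eq_mul, mul_comm]
  rw [h]
  refine (norm_sum_le _ _).trans (Finset.sum_le_sum fun ζ _ => (norm_sum_le _ _).trans
    (Finset.sum_le_sum fun a _ => ?_))
  rw [norm_smul, Real.norm_eq_abs, mul_comm (Real.sqrt K), mul_assoc]
  refine mul_le_mul_of_nonneg_left ?_ (abs_nonneg _)
  exact (ContinuousLinearMap.le_opNorm _ _).trans
    (mul_le_mul_of_nonneg_right (norm_covSqrt_le hK ζ) (norm_nonneg _))

/-- Each row carries the coefficient of its own latent value, which is dominated by the sum over all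
values. -/
theorem l2norm_hTilde_le (P : Params dz J L n) (s : Noise dz J L n m) (l : Fin L) :
    l2norm (hTilde P s l) ≤ ∑ j, ∑ a, (∑ ζ, |P.Atheta ζ a (l, j)|) * normH s a := by
  refine (l2norm_le_sum_col _).trans (Finset.sum_le_sum fun j _ => ?_)
  have h : col (hTilde P s l) j = ∑ a,
      (WithLp.toLp 2 fun k => s.2.2 k a * P.Atheta (s.1 k) a (l, j) :
        EuclideanSpace ℝ (Fin m)) := by
    ext k
    simp [hTilde]
  rw [h]
  refine (norm_sum_le _ _).trans (Finset.sum_le_sum fun a _ => ?_)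
  refine le_of_sq_le_sq ?_ (mul_nonneg (Finset.sum_nonneg fun _ _ => abs_nonneg _) (norm_nonneg _))
  rw [mul_pow, EuclideanSpace.real_norm_sq_eq, normH, EuclideanSpace.real_norm_sq_eq,
    Finset.mul_sum]
  refine Finset.sum_le_sum fun k _ => ?_
  simp only [mul_pow]
  rw [mul_comm]
  refine mul_le_mul_of_nonneg_right ?_ (sq_nonneg _)
  rw [← sq_abs (P.Atheta (s.1 k) a (l, j))]
  exact pow_le_pow_left₀ (abs_nonneg _) (Finset.single_le_sum
    (f := fun ζ => |P.Atheta ζ a (l, j)|) (fun _ _ => abs_nonneg _) (Finset.mem_univ _)) 2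

end NoiseLaw

end DMF

end

noncomputable section

namespace DMF

/-! ### Second moments of the mean-field trajectory. -/

section Moments

variable {dz J L n m : ℕ} {M : Model dz J L n m} {C K : ℝ}

theorem Model.xiBar_eq (P : Params dz J L n) (s : Noise dz J L n m) :
    M.dmfMap P s.1 (M.gTilde P s) (hTilde P s) (M.xiBar P s) = M.xiBar P s :=
  M.dmfSolution_eq P s.1 _ _

/-- The contribution of the updates at zero input to the memory terms. -/
def memorySource (dz J L : ℕ) (K b : ℝ) : ℝ := (dz * K + 1) * (J * (J * b)) * (L * K)

theorem sum_stepNorm_mono (ξ : Blocks J L n m) {r t : ℕ} (h : r ≤ t) :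
    ∑ r ∈ Finset.range r, stepNorm ξ r ≤ ∑ r ∈ Finset.range t, stepNorm ξ r :=
  Finset.sum_le_sum_of_subset_of_nonneg (by simpa using h) fun _ _ _ => stepNorm_nonneg _ _

theorem sum_stepNorm_nonneg (ξ : Blocks J L n m) (t : ℕ) :
    0 ≤ ∑ r ∈ Finset.range t, stepNorm ξ r := Finset.sum_nonneg fun _ _ => stepNorm_nonneg _ _

/-- The parameters enter only through their values at the target time `l`. This lets later
inductions bound parameters and trajectory alternately along the time order. -/
theorem Model.xiBar_even_le (hM : M.LipschitzUpdates C) (hC : 0 ≤ C) (hK : M.BoundedBy K)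
    (hK0 : 0 ≤ K) {P : Params dz J L n} {b : ℝ} (hb : 0 ≤ b) (l : Fin L)
    (hB : ∀ ζ a j, |P.Bomega ζ a (l, j)| ≤ b) (s : Noise dz J L n m) :
    stepNorm (M.xiBar P s) (2 * l) ≤ (∑ j, ∑ ζ, |P.beta l ζ j|) +
      l2norm (hTilde P s l) / Real.sqrt m + memorySource dz J L K b +
      memoryConst dz J L C K b * ∑ r ∈ Finset.range (2 * l), stepNorm (M.xiBar P s) r := by
  set ξ := M.xiBar P s with hξ
  have e := M.xiBar_eq P s
  rw [← hξ] at e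
  have h1 : ξ.2 l = (fun k j => P.beta l (s.1 k) j) + hTilde P s l +
      feedbackP P s.1 (fun μ => M.omega (M.labels s.1) μ ξ) l := by
    conv_lhs => rw [← e]
    ext k j
    simp only [dmfMap, feedbackP, Pi.add_apply]
  have hβ : l2norm (fun k j => P.beta l (s.1 k) j) / Real.sqrt m ≤ ∑ j, ∑ ζ, |P.beta l ζ j| := by
    rcases Nat.eq_zero_or_pos m with rfl | hm
    · simpa using Finset.sum_nonneg fun j _ => Finset.sum_nonneg fun ζ _ => abs_nonneg _
    rw [div_le_iff₀ (Real.sqrt_pos.2 (by exact_mod_cast hm))]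
    refine (l2norm_le_sum_col _).trans ?_
    rw [Finset.sum_mul]
    refine Finset.sum_le_sum fun j _ => ?_
    refine le_of_sq_le_sq ?_ (by positivity)
    rw [mul_pow, Real.sq_sqrt (by positivity), EuclideanSpace.real_norm_sq_eq]
    calc ∑ k, (col (fun k j => P.beta l (s.1 k) j) j) k ^ 2
        ≤ ∑ _k : Fin m, (∑ ζ, |P.beta l ζ j|) ^ 2 := by
          refine Finset.sum_le_sum fun k _ => ?_
          rw [← sq_abs]
          exact pow_le_pow_left₀ (abs_nonneg _) (Finset.single_le_sum
            (f := fun ζ => |P.beta l ζ j|) (fun _ _ => abs_nonneg _) (Finset.mem_univ (s.1 k))) 2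
      _ = _ := by simp; ring
  rw [stepNorm_even, h1]
  refine (div_le_div_of_nonneg_right ((l2norm_add_le _ _).trans
    (add_le_add (l2norm_add_le _ _) le_rfl)) (Real.sqrt_nonneg _)).trans ?_
  rw [add_div, add_div, add_assoc (_ + _) (memorySource _ _ _ _ _)]
  refine add_le_add (add_le_add hβ le_rfl) ?_
  refine (div_le_div_of_nonneg_right (feedbackP_le hb _ _ hB) (Real.sqrt_nonneg _)).trans ?_
  rw [mul_div_assoc, Finset.sum_div]
  have hS := sum_stepNorm_nonneg ξ (2 * l)
  have h2 := sum_filter_le_card_mul (fun μ => μ < l)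
    (fun μ => l2norm (M.omega (M.labels s.1) μ ξ) / Real.sqrt m)
    (c := K + C * ∑ r ∈ Finset.range (2 * l), stepNorm ξ r) (by positivity)
    fun μ hμ => (M.omega_growth hM hC hK _ μ ξ).trans (by
      have : (μ : ℕ) < l := hμ
      have := sum_stepNorm_mono ξ (show 2 * (μ : ℕ) + 1 ≤ 2 * l by omega)
      gcongr)
  calc _ ≤ J * (J * b) * (L * (K + C * ∑ r ∈ Finset.range (2 * l), stepNorm ξ r)) :=
        mul_le_mul_of_nonneg_left h2 (by positivity)
    _ ≤ (dz * K + 1) *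
        (J * (J * b) * (L * (K + C * ∑ r ∈ Finset.range (2 * l), stepNorm ξ r))) :=
        le_mul_of_one_le_left (by positivity) (by nlinarith [Nat.cast_nonneg (α := ℝ) dz])
    _ = _ := by unfold memorySource memoryConst; ring

theorem Model.xiBar_odd_le (hM : M.LipschitzUpdates C) (hC : 0 ≤ C) (hK : M.BoundedBy K)
    (hK0 : 0 ≤ K) {P : Params dz J L n} {b : ℝ} (hb : 0 ≤ b) (l : Fin L)
    (hB : ∀ ζ a j, |P.Btheta ζ a (l, j)| ≤ b) (s : Noise dz J L n m) :
    stepNorm (M.xiBar P s) (2 * l + 1) ≤ l2norm (P.e l) +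
      l2norm (M.gTilde P s l) / Real.sqrt m + memorySource dz J L K b +
      memoryConst dz J L C K b * ∑ r ∈ Finset.range (2 * l + 1), stepNorm (M.xiBar P s) r := by
  set ξ := M.xiBar P s with hξ
  have e := M.xiBar_eq P s
  rw [← hξ] at e
  have h1 : ξ.1 l = P.e l + (Real.sqrt m)⁻¹ • M.gTilde P s l +
      M.feedbackQ P (fun μ => M.theta (M.labels s.1) μ ξ) l := by
    conv_lhs => rw [← e]
    ext k j
    simp only [dmfMap, feedbackQ, Pi.add_apply, Pi.smul_apply, smul_eq_mul, div_eq_inv_mul]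
  rw [stepNorm_odd, h1]
  refine ((l2norm_add_le _ _).trans (add_le_add (l2norm_add_le _ _) le_rfl)).trans ?_
  rw [l2norm_smul, abs_of_nonneg (by positivity), ← div_eq_inv_mul,
    add_assoc (_ + _) (memorySource _ _ _ _ _)]
  refine add_le_add le_rfl ?_
  refine (Model.feedbackQ_le hK hK0 hb _ _ hB).trans ?_
  have hS := sum_stepNorm_nonneg ξ (2 * l + 1)
  have h2 := sum_filter_le_card_mul (fun μ => μ ≤ l)
    (fun μ => l2norm (M.theta (M.labels s.1) μ ξ))
    (c := K + C * ∑ r ∈ Finset.range (2 * l + 1), stepNorm ξ r) (by positivity)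
    fun μ hμ => (M.theta_growth hM hC hK _ μ ξ).trans (by
      have : (μ : ℕ) ≤ l := hμ
      have := sum_stepNorm_mono ξ (show 2 * (μ : ℕ) ≤ 2 * l + 1 by omega)
      gcongr)
  calc _ ≤ dz * K * (J * (J * b)) * (L * (K + C * ∑ r ∈ Finset.range (2 * l + 1), stepNorm ξ r)) :=
        mul_le_mul_of_nonneg_left h2 (by positivity)
    _ ≤ (dz * K + 1) *
        (J * (J * b)) * (L * (K + C * ∑ r ∈ Finset.range (2 * l + 1), stepNorm ξ r)) := by
        gcongr; linarith
    _ = _ := by unfold memorySource memoryConst; ring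

theorem aesm_stepNorm_xiBar (P : Params dz J L n) (t : ℕ) :
    AEStronglyMeasurable (fun s => stepNorm (M.xiBar P s) t) M.noiseLaw :=
  (measurable_noise fun z => (continuous_stepNorm t).comp
    (continuous_xiBar P z)).aestronglyMeasurable

theorem l2Bound_xiBar_even (hm : 0 < m) (hM : M.LipschitzUpdates C) (hC : 0 ≤ C)
    (hK : M.BoundedBy K) (hK0 : 0 ≤ K) {P : Params dz J L n} {b : ℝ} (hb : 0 ≤ b) (l : Fin L)
    (hB : ∀ ζ a j, |P.Bomega ζ a (l, j)| ≤ b) {β₀ α₀ c : ℝ}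
    (hβ : ∀ ζ j, |P.beta l ζ j| ≤ β₀) (hα0 : 0 ≤ α₀) (hβ0 : 0 ≤ β₀)
    (hα : ∀ ζ a j, |P.Atheta ζ a (l, j)| ≤ α₀)
    (hc : ∀ r < 2 * (l : ℕ), L2Bound M.noiseLaw (fun s => stepNorm (M.xiBar P s) r) c) :
    L2Bound M.noiseLaw (fun s => stepNorm (M.xiBar P s) (2 * l))
      (J * (dz * β₀) + J * (L * J * (dz * α₀)) + memorySource dz J L K b +
        memoryConst dz J L C K b * ((2 * l : ℕ) * c)) := by
  have hm' : (0 : ℝ) < Real.sqrt m := Real.sqrt_pos.2 (by exact_mod_cast hm)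
  have hs : 0 ≤ memorySource dz J L K b := by unfold memorySource; positivity
  have h1 : L2Bound M.noiseLaw
      (fun s => (Real.sqrt m)⁻¹ * ∑ _j : Fin J, ∑ a : Fin L × Fin J, (dz * α₀) * normH s a)
      ((Real.sqrt m)⁻¹ * ∑ _j : Fin J, ∑ _a : Fin L × Fin J, (dz * α₀) * Real.sqrt m) :=
    (L2Bound.sum _ fun j _ => L2Bound.sum _ fun a _ =>
      (l2Bound_normH a).const_mul (by positivity)).const_mul (by positivity)
  have h2 := ((((L2Bound.const (μ := M.noiseLaw) (c := J * (dz * β₀)) (by positivity)).add h1).add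
    (.const hs)).add ((L2Bound.sum (Finset.range (2 * l)) fun r hr =>
      hc r (Finset.mem_range.1 hr)).const_mul (memoryConst_nonneg (dz := dz) (J := J) (L := L)
        hC hK0 hb)))
  refine (h2.mono (aesm_stepNorm_xiBar P _) fun s => ?_).mono_const (le_of_eq ?_)
  · rw [abs_of_nonneg (stepNorm_nonneg _ _)]
    refine (M.xiBar_even_le hM hC hK hK0 hb l hB s).trans ?_
    gcongr
    · calc ∑ j, ∑ ζ, |P.beta l ζ j| ≤ ∑ _j : Fin J, ∑ _ζ : Fin dz, β₀ :=
          Finset.sum_le_sum fun j _ => Finset.sum_le_sum fun ζ _ => hβ ζ j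
        _ = _ := by simp
    · rw [div_eq_inv_mul]
      gcongr
      refine (l2norm_hTilde_le P s l).trans ?_
      refine Finset.sum_le_sum fun j _ => Finset.sum_le_sum fun a _ => ?_
      refine mul_le_mul_of_nonneg_right ?_ (norm_nonneg _)
      calc ∑ ζ, |P.Atheta ζ a (l, j)| ≤ ∑ _ζ : Fin dz, α₀ := Finset.sum_le_sum fun ζ _ => hα ζ a j
        _ = _ := by simp
  · simp only [Finset.sum_const, Finset.card_univ, Fintype.card_prod, Fintype.card_fin,
      nsmul_eq_mul, Finset.card_range]
    congr 2
    push_cast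
    field_simp

theorem l2Bound_xiBar_odd (hm : 0 < m) {γ : ℝ} (hn : (n : ℝ) = γ * m)
    (hM : M.LipschitzUpdates C) (hC : 0 ≤ C)
    (hK : M.BoundedBy K) (hK0 : 0 ≤ K) {P : Params dz J L n} {b : ℝ} (hb : 0 ≤ b) (l : Fin L)
    (hB : ∀ ζ a j, |P.Btheta ζ a (l, j)| ≤ b) {e₀ α₀ c : ℝ}
    (he : l2norm (P.e l) ≤ e₀) (hα0 : 0 ≤ α₀)
    (hα : ∀ ζ a j, |P.Aomega ζ a (l, j)| ≤ α₀)
    (hc : ∀ r < 2 * (l : ℕ) + 1, L2Bound M.noiseLaw (fun s => stepNorm (M.xiBar P s) r) c) :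
    L2Bound M.noiseLaw (fun s => stepNorm (M.xiBar P s) (2 * l + 1))
      (e₀ + J * (dz * (L * J * (Real.sqrt K * α₀))) * Real.sqrt γ + memorySource dz J L K b +
        memoryConst dz J L C K b * ((2 * l + 1 : ℕ) * c)) := by
  have hm' : (0 : ℝ) < Real.sqrt m := Real.sqrt_pos.2 (by exact_mod_cast hm)
  have hs : 0 ≤ memorySource dz J L K b := by unfold memorySource; positivity
  have h1 : L2Bound M.noiseLaw
      (fun s => (Real.sqrt m)⁻¹ * ∑ _j : Fin J, ∑ ζ : Fin dz, ∑ a : Fin L × Fin J,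
        (Real.sqrt K * α₀) * normG s ζ a)
      ((Real.sqrt m)⁻¹ * ∑ _j : Fin J, ∑ _ζ : Fin dz, ∑ _a : Fin L × Fin J,
        (Real.sqrt K * α₀) * Real.sqrt n) :=
    (L2Bound.sum _ fun j _ => L2Bound.sum _ fun ζ _ => L2Bound.sum _ fun a _ =>
      (l2Bound_normG ζ a).const_mul (by positivity)).const_mul (by positivity)
  have h2 := ((((L2Bound.const (μ := M.noiseLaw) (c := e₀) ((l2norm_nonneg _).trans he)).add h1).add
    (.const hs)).add ((L2Bound.sum (Finset.range (2 * l + 1)) fun r hr =>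
      hc r (Finset.mem_range.1 hr)).const_mul (memoryConst_nonneg (dz := dz) (J := J) (L := L)
        hC hK0 hb)))
  refine (h2.mono (aesm_stepNorm_xiBar P _) fun s => ?_).mono_const (le_of_eq ?_)
  · rw [abs_of_nonneg (stepNorm_nonneg _ _)]
    refine (M.xiBar_odd_le hM hC hK hK0 hb l hB s).trans ?_
    gcongr
    rw [div_eq_inv_mul]
    gcongr
    refine (l2norm_gTilde_le hK P s l).trans ?_
    refine Finset.sum_le_sum fun j _ => Finset.sum_le_sum fun ζ _ => Finset.sum_le_sum fun a _ => ?_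
    refine mul_le_mul_of_nonneg_right ?_ (norm_nonneg _)
    exact mul_le_mul_of_nonneg_left (hα ζ a j) (Real.sqrt_nonneg _)
  · have hγ : Real.sqrt n = Real.sqrt γ * Real.sqrt m := by
      rw [hn, Real.sqrt_mul' _ (by positivity)]
    simp only [Finset.sum_const, Finset.card_univ, Fintype.card_prod, Fintype.card_fin,
      nsmul_eq_mul, Finset.card_range, hγ]
    congr 2
    push_cast
    field_simp

theorem l2Bound_thetaBar (hM : M.LipschitzUpdates C) (hC : 0 ≤ C) (hK : M.BoundedBy K)
    (hK0 : 0 ≤ K) {P : Params dz J L n} (l : Fin L) {c : ℝ}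
    (hc : ∀ r < 2 * (l : ℕ), L2Bound M.noiseLaw (fun s => stepNorm (M.xiBar P s) r) c) :
    L2Bound M.noiseLaw (fun s => l2norm (M.thetaBar P s l)) (K + C * ((2 * l : ℕ) * c)) := by
  have h2 := (L2Bound.const (μ := M.noiseLaw) hK0).add
    ((L2Bound.sum (Finset.range (2 * l)) fun r hr => hc r (Finset.mem_range.1 hr)).const_mul hC)
  refine (h2.mono (measurable_noise fun z => continuous_l2norm.comp
    (continuous_thetaBar P z l)).aestronglyMeasurable fun s => ?_).mono_const (le_of_eq (by simp))
  rw [abs_of_nonneg (l2norm_nonneg _)]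
  exact M.theta_growth hM hC hK _ l _

theorem l2Bound_omegaBar (hM : M.LipschitzUpdates C) (hC : 0 ≤ C) (hK : M.BoundedBy K)
    (hK0 : 0 ≤ K) {P : Params dz J L n} (l : Fin L) {c : ℝ}
    (hc : ∀ r < 2 * (l : ℕ) + 1, L2Bound M.noiseLaw (fun s => stepNorm (M.xiBar P s) r) c) :
    L2Bound M.noiseLaw (fun s => l2norm (M.omegaBar P s l) / Real.sqrt m)
      (K + C * ((2 * l + 1 : ℕ) * c)) := by
  have h2 := (L2Bound.const (μ := M.noiseLaw) hK0).add
    ((L2Bound.sum (Finset.range (2 * l + 1)) fun r hr => hc r (Finset.mem_range.1 hr)).const_mul hC)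
  refine (h2.mono (measurable_noise fun z => (continuous_l2norm.comp
    (continuous_omegaBar P z l)).div_const _).aestronglyMeasurable fun s => ?_).mono_const
      (le_of_eq (by simp))
  rw [abs_of_nonneg (div_nonneg (l2norm_nonneg _) (Real.sqrt_nonneg _))]
  exact M.omega_growth hM hC hK _ l _

theorem exists_abs_le {ι : Type*} [Finite ι] (f : ι → ℝ) : ∃ c, 0 ≤ c ∧ ∀ i, |f i| ≤ c := by
  obtain ⟨c, hc⟩ := (Set.finite_range fun i => |f i|).bddAbove
  exact ⟨max c 0, le_max_right _ _, fun i => (hc ⟨i, rfl⟩).trans (le_max_left _ _)⟩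

theorem exists_memoryBound (P : Params dz J L n) : ∃ b, 0 ≤ b ∧ ∀ T, P.MemoryBound b T := by
  obtain ⟨b, hb, h⟩ := exists_abs_le fun p : Fin dz × (Fin L × Fin J) × (Fin L × Fin J) =>
    P.Btheta p.1 p.2.1 p.2.2
  obtain ⟨b', hb', h'⟩ := exists_abs_le fun p : Fin dz × (Fin L × Fin J) × (Fin L × Fin J) =>
    P.Bomega p.1 p.2.1 p.2.2
  exact ⟨b + b', by positivity, fun T =>
    ⟨fun ζ a l j _ => (h' (ζ, a, l, j)).trans (by linarith),
      fun ζ a l j _ => (h (ζ, a, l, j)).trans (by linarith)⟩⟩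

/-- The constant may depend on the problem: it is only used for integrability in the integration by
parts. A uniform constant is available only after `B` has been identified and bounded with the help
of that identity. -/
theorem exists_l2Bound_xiBar (hm : 0 < m) (hM : M.LipschitzUpdates C) (hC : 0 ≤ C)
    (hK : M.BoundedBy K) (hK0 : 0 ≤ K) (P : Params dz J L n) (T : ℕ) :
    ∃ c, 0 ≤ c ∧ ∀ t < T, L2Bound M.noiseLaw (fun s => stepNorm (M.xiBar P s) t) c := by
  obtain ⟨b, hb, hB⟩ := exists_memoryBound P
  induction T with
  | zero => exact ⟨0, le_rfl, fun t ht => absurd ht (Nat.not_lt_zero t)⟩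
  | succ T ih =>
    obtain ⟨c, hc0, hc⟩ := ih
    have h : ∃ c', L2Bound M.noiseLaw (fun s => stepNorm (M.xiBar P s) T) c' := by
      -- No uniform ratio is needed here, so `n / m` takes the place of `γ`.
      have hn : (n : ℝ) = n / m * m := by
        have : (m : ℝ) ≠ 0 := by exact_mod_cast hm.ne'
        field_simp
      have main : ∀ t ≤ T, t = T →
          ∃ c', L2Bound M.noiseLaw (fun s => stepNorm (M.xiBar P s) t) c' := by
        refine stepNorm_cases (L := L) (p := fun t => t = T →
          ∃ c', L2Bound M.noiseLaw (fun s => stepNorm (M.xiBar P s) t) c') T ?_ ?_ ?_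
        · rintro l hl rfl
          obtain ⟨β₀, hβ0, hβ⟩ := exists_abs_le fun p : Fin dz × Fin J => P.beta l p.1 p.2
          obtain ⟨α₀, hα0, hα⟩ := exists_abs_le fun p : Fin dz × (Fin L × Fin J) × Fin J =>
            P.Atheta p.1 p.2.1 (l, p.2.2)
          exact ⟨_, l2Bound_xiBar_even hm hM hC hK hK0 hb l
            (fun ζ a j => (hB _).1 ζ a l j le_rfl) (fun ζ j => hβ (ζ, j)) hα0 hβ0
            (fun ζ a j => hα (ζ, a, j)) hc⟩
        · rintro l hl rfl
          obtain ⟨α₀, hα0, hα⟩ := exists_abs_le fun p : Fin dz × (Fin L × Fin J) × Fin J =>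
            P.Aomega p.1 p.2.1 (l, p.2.2)
          exact ⟨_, l2Bound_xiBar_odd hm hn hM hC hK hK0 hb l
            (fun ζ a j => (hB _).2 ζ a l j le_rfl) le_rfl hα0 (fun ζ a j => hα (ζ, a, j)) hc⟩
        · rintro t ht -
          simp_rw [stepNorm_of_le _ ht]
          exact ⟨0, .zero⟩
      exact main T le_rfl rfl
    obtain ⟨c', hc'⟩ := h
    refine ⟨max c c', le_max_of_le_left hc0, fun t ht => ?_⟩
    rcases Nat.lt_succ_iff_lt_or_eq.1 ht with h | rfl
    · exact (hc t h).mono_const (le_max_left _ _)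
    · exact hc'.mono_const (le_max_right _ _)

end Moments

end DMF

end

noncomputable section

namespace DMF

/-! ### Integration by parts with a parameter. -/

section SteinParam

variable {Z κ : Type*} [MeasurableSpace Z] [Fintype κ] [DecidableEq κ]

theorem integral_eval_mul_prod_eq_integral_lineDeriv (μ : Measure Z) [IsProbabilityMeasure μ]
    {F F' : Z × (κ → ℝ) → ℝ} (k : κ)
    (hF : ∀ z x, HasDerivAt (fun t => F (z, Function.update x k t)) (F' (z, x)) (x k)) {c : ℝ}
    (hc : ∀ p, |F' p| ≤ c) (hF' : Measurable F')
    (hint : Integrable (fun p => p.2 k * F p) (μ.prod (gaussPi κ))) :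
    ∫ p, p.2 k * F p ∂(μ.prod (gaussPi κ)) = ∫ p, F' p ∂(μ.prod (gaussPi κ)) := by
  have hint2 : Integrable F' (μ.prod (gaussPi κ)) :=
    Integrable.mono' (integrable_const c) hF'.aestronglyMeasurable (ae_of_all _ hc)
  rw [integral_prod _ hint, integral_prod _ hint2]
  refine integral_congr_ae ?_
  filter_upwards [hint.prod_right_ae] with z hz
  exact integral_eval_mul_gaussPi_eq_integral_lineDeriv (F := fun x => F (z, x))
    (F' := fun x => F' (z, x)) k (hF z) (fun x => hc _) (hF'.comp measurable_prodMk_left) hz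

theorem abs_le_of_hasDerivAt_zero {f : ℝ → ℝ} {f' c : ℝ} (h : HasDerivAt f f' 0) (hc : 0 ≤ c)
    (hlip : ∀ τ, |f τ - f 0| ≤ c * |τ|) : |f'| ≤ c :=
  h.le_of_lip' hc (Eventually.of_forall fun τ => by simpa using hlip τ)

end SteinParam

/-! ### Derivatives of the mean-field trajectory with respect to its Gaussian inputs. -/

section Response

variable {dz J L n m : ℕ} {M : Model dz J L n m} {C K : ℝ}

theorem l2norm_unitArray {r : ℕ} (μ l : Fin L) (i : Fin r) (j : Fin J) (τ : ℝ) :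
    l2norm ((τ • unitArray μ i j : Fin L → Fin r → Fin J → ℝ) l) = if l = μ then |τ| else 0 := by
  rw [Pi.smul_apply, l2norm_smul]
  split_ifs with h
  · subst h
    have : l2norm ((unitArray l i j : Fin L → Fin r → Fin J → ℝ) l) = 1 := by
      rw [l2norm, unitArray, Pi.single_eq_same, Finset.sum_eq_single i, Finset.sum_eq_single j]
      · simp
      · intro j' _ hj; simp [hj]
      · simp
      · intro i' _ hi; simp [hi]
      · simp
    rw [this, mul_one]
  · rw [unitArray, Pi.single_eq_of_ne h]; simp

theorem sum_stepNorm_input_ht (μ : Fin L) (k : Fin m) (j : Fin J) (τ : ℝ) (T : ℕ) :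
    ∑ r ∈ Finset.range T, stepNorm (inputBlocks (n := n) 0 (τ • unitArray μ k j)) r =
      if 2 * (μ : ℕ) < T then |τ| / Real.sqrt m else 0 := by
  have h : ∀ r, stepNorm (inputBlocks (n := n) 0 (τ • unitArray μ k j)) r =
      if r = 2 * (μ : ℕ) then |τ| / Real.sqrt m else 0 := fun r =>
    stepNorm_cases (L := L) (p := fun r => stepNorm (inputBlocks (n := n) 0 (τ • unitArray μ k j)) r =
      if r = 2 * (μ : ℕ) then |τ| / Real.sqrt m else 0) r (fun l _ => by
        rw [stepNorm_even, inputBlocks, l2norm_unitArray]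
        have : (2 * (l : ℕ) = 2 * (μ : ℕ)) ↔ l = μ := by rw [Fin.ext_iff]; omega
        simp only [this]; split_ifs <;> simp) (fun l _ => by
        rw [stepNorm_odd, inputBlocks, if_neg (by omega)]
        simpa [Pi.zero_def] using l2norm_zero (a := n) (b := J)) (fun t ht => by
        rw [stepNorm_of_le _ ht, if_neg (by have := μ.2; omega)]) r le_rfl
  simp only [h, Finset.sum_ite_eq', Finset.mem_range]

theorem sum_stepNorm_input_gt (μ : Fin L) (i : Fin n) (j : Fin J) (τ : ℝ) (T : ℕ) :
    ∑ r ∈ Finset.range T, stepNorm (inputBlocks (m := m) (τ • unitArray μ i j) 0) r =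
      if 2 * (μ : ℕ) + 1 < T then |τ| / Real.sqrt m else 0 := by
  have h : ∀ r, stepNorm (inputBlocks (m := m) (τ • unitArray μ i j) 0) r =
      if r = 2 * (μ : ℕ) + 1 then |τ| / Real.sqrt m else 0 := fun r =>
    stepNorm_cases (L := L) (p := fun r => stepNorm (inputBlocks (m := m) (τ • unitArray μ i j) 0) r =
      if r = 2 * (μ : ℕ) + 1 then |τ| / Real.sqrt m else 0) r (fun l _ => by
        rw [stepNorm_even, inputBlocks, if_neg (by omega)]
        simp) (fun l _ => by
        have h1 : (inputBlocks (m := m) (τ • unitArray μ i j) 0).1 l =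
            (Real.sqrt m)⁻¹ • (τ • unitArray μ i j : Fin L → Fin n → Fin J → ℝ) l := by
          ext; simp [inputBlocks, div_eq_inv_mul]
        rw [stepNorm_odd, h1, l2norm_smul, l2norm_unitArray, abs_of_nonneg (by positivity)]
        have : (2 * (l : ℕ) + 1 = 2 * (μ : ℕ) + 1) ↔ l = μ := by rw [Fin.ext_iff]; omega
        simp only [this, div_eq_inv_mul]; split_ifs <;> simp) (fun t ht => by
        rw [stepNorm_of_le _ ht, if_neg (by have := μ.2; omega)]) r le_rfl
  simp only [h, Finset.sum_ite_eq', Finset.mem_range]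

/-- The Lipschitz constant of the first `T` steps of the mean-field dynamics. -/
def responseConst (dz J L : ℕ) (C K b : ℝ) (T : ℕ) : ℝ :=
  C * ∑ t ∈ Finset.range T, (1 + memoryConst dz J L C K b) ^ t

theorem responseConst_nonneg (hC : 0 ≤ C) (hK : 0 ≤ K) {b : ℝ} (hb : 0 ≤ b) (T : ℕ) :
    0 ≤ responseConst dz J L C K b T := by
  have := memoryConst_nonneg (dz := dz) (J := J) (L := L) hC hK hb
  unfold responseConst; positivity

theorem Model.sum_stepNorm_dmfSolution_le (hM : M.LipschitzUpdates C) (hC : 0 ≤ C)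
    (hK : M.BoundedBy K) (hK0 : 0 ≤ K) {P : Params dz J L n} {b : ℝ} (hb : 0 ≤ b) {T : ℕ}
    (hB : ∀ t < T, P.MemoryBound b t) (z : Fin m → Fin dz)
    (gt gt' : Fin L → Fin n → Fin J → ℝ) (ht ht' : Fin L → Fin m → Fin J → ℝ) :
    C * ∑ t ∈ Finset.range T, stepNorm (M.dmfSolution P z gt ht - M.dmfSolution P z gt' ht') t ≤
      responseConst dz J L C K b T *
        ∑ r ∈ Finset.range T, stepNorm (inputBlocks (gt - gt') (ht - ht')) r := by
  rw [responseConst, mul_assoc, Finset.sum_mul]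
  refine mul_le_mul_of_nonneg_left (Finset.sum_le_sum fun t ht => ?_) hC
  have ht := Finset.mem_range.1 ht
  have h0 := memoryConst_nonneg (dz := dz) (J := J) (L := L) hC hK0 hb
  refine (M.dmfSolution_lipschitz hM hC hK hK0 hb (hB t ht) z gt gt' _ ht' t le_rfl).trans ?_
  exact mul_le_mul_of_nonneg_left (sum_stepNorm_mono _ (by omega)) (by positivity)

theorem differentiable_omega_ht (P : Params dz J L n) (z : Fin m → Fin dz)
    (gt : Fin L → Fin n → Fin J → ℝ) (l : Fin L) (k : Fin m) (j : Fin J) :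
    Differentiable ℝ fun ht => M.omega (M.labels z) l (M.dmfSolution P z gt ht) k j := by
  have h1 : Differentiable ℝ fun ht => M.dmfSolution P z gt ht :=
    (M.differentiable_dmfSolution P z).comp (f := fun ht => (gt, ht)) (by fun_prop)
  have h : Differentiable ℝ fun ht => M.omega (M.labels z) l (M.dmfSolution P z gt ht) :=
    (M.omega_differentiable (M.labels z) l).comp h1
  have h2 := differentiable_pi.1 h k
  exact differentiable_pi.1 h2 j

theorem differentiable_theta_gt (P : Params dz J L n) (z : Fin m → Fin dz)
    (ht : Fin L → Fin m → Fin J → ℝ) (l : Fin L) (i : Fin n) (j : Fin J) :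
    Differentiable ℝ fun gt => M.theta (M.labels z) l (M.dmfSolution P z gt ht) i j := by
  have h1 : Differentiable ℝ fun gt => M.dmfSolution P z gt ht :=
    (M.differentiable_dmfSolution P z).comp (f := fun gt => (gt, ht)) (by fun_prop)
  have h : Differentiable ℝ fun gt => M.theta (M.labels z) l (M.dmfSolution P z gt ht) :=
    (M.theta_differentiable (M.labels z) l).comp h1
  have h2 := differentiable_pi.1 h i
  exact differentiable_pi.1 h2 j

/-- For fixed latent values the map is jointly continuous in the two inputs, which makes its partial
derivative in one of them measurable in both. -/
theorem measurable_dOmega (P : Params dz J L n) (l : Fin L) (k : Fin m) (j : Fin J) (μ : Fin L)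
    (k' : Fin m) (j' : Fin J) : Measurable fun s => M.dOmega P s l k j μ k' j' := by
  refine measurable_from_prod_countable_right fun z => ?_
  have h1 : Continuous fun x => M.gTilde P (m := m) (z, x) := by unfold Model.gTilde; fun_prop
  have h2 : Continuous fun x => hTilde P (m := m) (z, x) := by unfold hTilde; fun_prop
  have h3 : Continuous (fun p : (Fin L → Fin n → Fin J → ℝ) × (Fin L → Fin m → Fin J → ℝ) =>
      M.omega (M.labels z) l (M.dmfSolution P z p.1 p.2) k j) := by
    have := (M.omega_differentiable (M.labels z) l).continuous.comp
      (M.differentiable_dmfSolution P z).continuous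
    exact (continuous_apply_apply k j).comp this
  have h4 := (measurable_fderiv_apply_const_with_param ℝ (f := fun gt ht =>
    M.omega (M.labels z) l (M.dmfSolution P z gt ht) k j) h3 (unitArray μ k' j'))
  have h5 := h4.comp (h1.prodMk h2).measurable
  simpa only [Function.comp_def, Model.dOmega] using h5

theorem measurable_dTheta (P : Params dz J L n) (l : Fin L) (i : Fin n) (j : Fin J) (μ : Fin L)
    (i' : Fin n) (j' : Fin J) : Measurable fun s => M.dTheta P s l i j μ i' j' := by
  refine measurable_from_prod_countable_right fun z => ?_
  have h1 : Continuous fun x => M.gTilde P (m := m) (z, x) := by unfold Model.gTilde; fun_prop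
  have h2 : Continuous fun x => hTilde P (m := m) (z, x) := by unfold hTilde; fun_prop
  have h3 : Continuous (fun p : (Fin L → Fin m → Fin J → ℝ) × (Fin L → Fin n → Fin J → ℝ) =>
      M.theta (M.labels z) l (M.dmfSolution P z p.2 p.1) i j) := by
    have := (M.theta_differentiable (M.labels z) l).continuous.comp
      ((M.differentiable_dmfSolution P z).continuous.comp continuous_swap)
    exact (continuous_apply_apply i j).comp this
  have h4 := (measurable_fderiv_apply_const_with_param ℝ (f := fun ht gt =>
    M.theta (M.labels z) l (M.dmfSolution P z gt ht) i j) h3 (unitArray μ i' j'))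
  have h5 := h4.comp (h2.prodMk h1).measurable
  simpa only [Function.comp_def, Model.dTheta] using h5

/-- The input `h̃` and the output `ω` are both measured with a factor `1 / √m`, which cancels: the
bound does not depend on `m`. Responses to inputs later than `l` vanish by causality. -/
theorem abs_dOmega_le (hm : 0 < m) (hM : M.LipschitzUpdates C) (hC : 0 ≤ C) (hK : M.BoundedBy K)
    (hK0 : 0 ≤ K) {P : Params dz J L n} {b : ℝ} (hb : 0 ≤ b) (s : Noise dz J L n m) (l : Fin L)
    (hB : ∀ t < 2 * (l : ℕ) + 1, P.MemoryBound b t) (k : Fin m) (j : Fin J) (μ : Fin L)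
    (k' : Fin m) (j' : Fin J) :
    |M.dOmega P s l k j μ k' j'| ≤
      if μ ≤ l then responseConst dz J L C K b (2 * l + 1) else 0 := by
  have hm' : (0 : ℝ) < Real.sqrt m := Real.sqrt_pos.2 (by exact_mod_cast hm)
  have h0 := responseConst_nonneg (dz := dz) (J := J) (L := L) hC hK0 hb (2 * l + 1)
  refine abs_le_of_hasDerivAt_zero (((differentiable_omega_ht P s.1 (M.gTilde P s) l k j)
    (hTilde P s)).hasFDerivAt.hasLineDerivAt (unitArray μ k' j')) (by split_ifs <;> simp [h0])
    fun τ => ?_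
  have h1 := hM.omega_le hC (M.labels s.1) l
    (M.dmfSolution P s.1 (M.gTilde P s) (hTilde P s + τ • unitArray μ k' j'))
    (M.dmfSolution P s.1 (M.gTilde P s) (hTilde P s + (0 : ℝ) • unitArray μ k' j'))
  have h2 := M.sum_stepNorm_dmfSolution_le hM hC hK hK0 hb hB s.1 (M.gTilde P s) (M.gTilde P s)
    (hTilde P s + τ • unitArray μ k' j') (hTilde P s + (0 : ℝ) • unitArray μ k' j')
  rw [sub_self, show hTilde P s + τ • unitArray μ k' j' - (hTilde P s + (0 : ℝ) • unitArray μ k' j')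
    = τ • unitArray μ k' j' by simp, sum_stepNorm_input_ht] at h2
  have h3 := (abs_le_l2norm _ k j).trans ((div_le_iff₀ hm').1 (h1.trans h2))
  refine h3.trans (le_of_eq ?_)
  have : 2 * (μ : ℕ) < 2 * l + 1 ↔ μ ≤ l := by rw [Fin.le_def]; omega
  simp only [this]
  split_ifs
  · field_simp
  · simp

theorem abs_dTheta_le (hM : M.LipschitzUpdates C) (hC : 0 ≤ C) (hK : M.BoundedBy K)
    (hK0 : 0 ≤ K) {P : Params dz J L n} {b : ℝ} (hb : 0 ≤ b) (s : Noise dz J L n m) (l : Fin L)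
    (hB : ∀ t < 2 * (l : ℕ), P.MemoryBound b t) (i : Fin n) (j : Fin J) (μ : Fin L)
    (i' : Fin n) (j' : Fin J) :
    |M.dTheta P s l i j μ i' j'| ≤
      if μ < l then responseConst dz J L C K b (2 * l) / Real.sqrt m else 0 := by
  have h0 := responseConst_nonneg (dz := dz) (J := J) (L := L) hC hK0 hb (2 * l)
  refine abs_le_of_hasDerivAt_zero (((differentiable_theta_gt P s.1 (hTilde P s) l i j)
    (M.gTilde P s)).hasFDerivAt.hasLineDerivAt (unitArray μ i' j'))
    (by split_ifs; positivity; exact le_rfl) fun τ => ?_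
  have h1 := hM.theta_le hC (M.labels s.1) l
    (M.dmfSolution P s.1 (M.gTilde P s + τ • unitArray μ i' j') (hTilde P s))
    (M.dmfSolution P s.1 (M.gTilde P s + (0 : ℝ) • unitArray μ i' j') (hTilde P s))
  have h2 := M.sum_stepNorm_dmfSolution_le hM hC hK hK0 hb hB s.1
    (M.gTilde P s + τ • unitArray μ i' j') (M.gTilde P s + (0 : ℝ) • unitArray μ i' j')
    (hTilde P s) (hTilde P s)
  rw [sub_self, show M.gTilde P s + τ • unitArray μ i' j' -
    (M.gTilde P s + (0 : ℝ) • unitArray μ i' j')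
    = τ • unitArray μ i' j' by simp, sum_stepNorm_input_gt] at h2
  have h3 := (abs_le_l2norm _ i j).trans (h1.trans h2)
  refine h3.trans (le_of_eq ?_)
  have : 2 * (μ : ℕ) + 1 < 2 * l ↔ μ < l := by rw [Fin.lt_def]; omega
  simp only [this]
  split_ifs
  · ring
  · simp

/-- Applying `R(ζ)` to the whole perturbed column costs only its operator norm. Bounding the `n`
summands one by one would lose a factor that the trace in the definition of `b_ω` cannot afford. -/
theorem abs_sum_cov_dTheta_le (hM : M.LipschitzUpdates C) (hC : 0 ≤ C)
    (hK : M.BoundedBy K) (hK0 : 0 ≤ K) {P : Params dz J L n} {b : ℝ} (hb : 0 ≤ b)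
    (s : Noise dz J L n m) (l : Fin L) (hB : ∀ t < 2 * (l : ℕ), P.MemoryBound b t)
    (ζ : Fin dz) (i : Fin n) (j : Fin J) (μ : Fin L) (i' : Fin n) (j' : Fin J) :
    |∑ p, M.cov ζ i p * M.dTheta P s l p j μ i' j'| ≤
      if μ < l then K * responseConst dz J L C K b (2 * l) / Real.sqrt m else 0 := by
  have h0 := responseConst_nonneg (dz := dz) (J := J) (L := L) hC hK0 hb (2 * l)
  have hd : HasDerivAt (fun τ : ℝ => ∑ p, M.cov ζ i p * M.theta (M.labels s.1) l
      (M.dmfSolution P s.1 (M.gTilde P s + τ • unitArray μ i' j') (hTilde P s)) p j)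
      (∑ p, M.cov ζ i p * M.dTheta P s l p j μ i' j') 0 :=
    HasDerivAt.fun_sum fun p _ => HasDerivAt.const_mul (M.cov ζ i p)
      (((differentiable_theta_gt P s.1 (hTilde P s) l p j)
        (M.gTilde P s)).hasFDerivAt.hasLineDerivAt (unitArray μ i' j'))
  refine abs_le_of_hasDerivAt_zero hd (by split_ifs; positivity; exact le_rfl) fun τ => ?_
  have h1 := hM.theta_le hC (M.labels s.1) l
    (M.dmfSolution P s.1 (M.gTilde P s + τ • unitArray μ i' j') (hTilde P s))
    (M.dmfSolution P s.1 (M.gTilde P s + (0 : ℝ) • unitArray μ i' j') (hTilde P s))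
  have h2 := M.sum_stepNorm_dmfSolution_le hM hC hK hK0 hb hB s.1
    (M.gTilde P s + τ • unitArray μ i' j') (M.gTilde P s + (0 : ℝ) • unitArray μ i' j')
    (hTilde P s) (hTilde P s)
  rw [sub_self, show M.gTilde P s + τ • unitArray μ i' j' -
    (M.gTilde P s + (0 : ℝ) • unitArray μ i' j')
    = τ • unitArray μ i' j' by simp, sum_stepNorm_input_gt] at h2
  rw [← Finset.sum_sub_distrib]
  simp_rw [← mul_sub]
  refine (abs_le_l2norm (fun i j => ∑ p, M.cov ζ i p * (M.theta (M.labels s.1) l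
    (M.dmfSolution P s.1 (M.gTilde P s + τ • unitArray μ i' j') (hTilde P s)) -
    M.theta (M.labels s.1) l (M.dmfSolution P s.1
      (M.gTilde P s + (0 : ℝ) • unitArray μ i' j') (hTilde P s))) p j) i j).trans ?_
  refine ((l2norm_matrix_mul_le (M.cov ζ) _).trans (mul_le_mul (hK.cov ζ) (h1.trans h2)
    (l2norm_nonneg _) hK0)).trans (le_of_eq ?_)
  have : 2 * (μ : ℕ) + 1 < 2 * l ↔ μ < l := by rw [Fin.lt_def]; omega
  simp only [this]
  split_ifs
  · ring
  · simp

end Response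

/-! ### Integration by parts for the features. -/

section Stein

variable {dz J L n m : ℕ} {M : Model dz J L n m} {C K : ℝ}

/-- Moving one entry of row `k` moves only row `k` of `h̃`, with the coefficients of the latent
value of that row. -/
theorem hTilde_mkNoise_add (P : Params dz J L n) (z : Fin m → Fin dz)
    (x : NoiseIndex dz J L n m → ℝ) (k : Fin m) (a : Fin L × Fin J) (τ : ℝ) :
    hTilde P (mkNoise (z, x + τ • Pi.single (.inr (k, a)) 1)) = hTilde P (mkNoise (z, x)) +
      τ • ∑ c : Fin L × Fin J, P.Atheta (z k) a c • unitArray c.1 k c.2 := by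
  ext l k' j
  simp only [hTilde, mkNoise, Pi.add_apply, Pi.smul_apply, smul_eq_mul, add_mul,
    Finset.sum_add_distrib, Finset.sum_apply, unitArray]
  congr 1
  rw [Finset.sum_eq_single a, Finset.sum_eq_single (l, j)]
  · by_cases h : k' = k
    · subst h; simp
    · simp [h]
  · rintro ⟨l', j'⟩ _ h
    by_cases h1 : l = l'
    · subst h1
      by_cases h2 : k' = k
      · subst h2
        have : j ≠ j' := fun e => h (by rw [e])
        simp [this]
      · simp [h2]
    · simp [h1]
  · simp
  · intro a' _ h
    simp [h]
  · simp

theorem gTilde_mkNoise_add_inr (P : Params dz J L n) (z : Fin m → Fin dz)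
    (x : NoiseIndex dz J L n m → ℝ) (k : Fin m) (a : Fin L × Fin J) (τ : ℝ) :
    M.gTilde P (mkNoise (z, x + τ • Pi.single (.inr (k, a)) 1)) = M.gTilde P (mkNoise (z, x)) := by
  ext l i j
  simp [Model.gTilde, mkNoise]

theorem hTilde_mkNoise_add_inl (P : Params dz J L n) (z : Fin m → Fin dz)
    (x : NoiseIndex dz J L n m → ℝ) (c : Fin dz × Fin n × (Fin L × Fin J)) (τ : ℝ) :
    hTilde P (mkNoise (z, x + τ • Pi.single (.inl c) 1)) = hTilde P (mkNoise (z, x)) := by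
  ext l i j
  simp [hTilde, mkNoise]

theorem gTilde_mkNoise_add (P : Params dz J L n) (z : Fin m → Fin dz)
    (x : NoiseIndex dz J L n m → ℝ) (ζ : Fin dz) (i : Fin n) (a : Fin L × Fin J) (τ : ℝ) :
    M.gTilde P (mkNoise (z, x + τ • Pi.single (.inl (ζ, i, a)) 1)) = M.gTilde P (mkNoise (z, x)) +
      τ • ∑ c : Fin L × Fin J, P.Aomega ζ a c • ∑ p, M.covSqrt ζ p i • unitArray c.1 p c.2 := by
  ext l i' j
  simp only [Model.gTilde, mkNoise, Pi.add_apply, Pi.smul_apply, smul_eq_mul, add_mul,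
    Finset.sum_add_distrib, Finset.sum_apply, unitArray, mul_add]
  congr 1
  rw [Finset.sum_eq_single ζ, Finset.sum_eq_single i, Finset.sum_eq_single a,
    Finset.sum_eq_single (l, j), Finset.sum_eq_single i']
  · simp; ring
  · intro p _ hp
    simp [hp.symm]
  · simp
  · rintro ⟨l', j'⟩ _ h
    by_cases h1 : l = l'
    · subst h1
      have : j ≠ j' := fun e => h (by rw [e])
      refine mul_eq_zero_of_right _ (Finset.sum_eq_zero fun p _ => ?_)
      by_cases hp : i' = p
      · subst hp; simp [this]
      · simp [hp]
    · simp [h1]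
  · simp
  · intro a' _ h
    simp [h]
  · simp
  · intro p _ h
    simp [h]
  · simp
  · intro ζ' _ h
    simp [h]
  · simp

theorem update_eq_add_smul_single {κ : Type*} [DecidableEq κ] (x : κ → ℝ) (k : κ) (t : ℝ) :
    Function.update x k t = x + (t - x k) • Pi.single k 1 := by
  ext i
  by_cases h : i = k
  · subst h; simp
  · simp [h]

theorem memLp_two_omegaBar (hm : 0 < m) (hM : M.LipschitzUpdates C) (hC : 0 ≤ C)
    (hK : M.BoundedBy K) (hK0 : 0 ≤ K) (P : Params dz J L n) (l : Fin L) (k : Fin m) (j : Fin J) :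
    MemLp (fun s => M.omegaBar P s l k j) 2 M.noiseLaw := by
  obtain ⟨c, hc0, hc⟩ := exists_l2Bound_xiBar hm hM hC hK hK0 P (2 * l + 1)
  have h := (l2Bound_omegaBar hM hC hK hK0 l hc).const_mul (Real.sqrt_nonneg m)
  refine (h.mono (measurable_noise fun z => (continuous_apply_apply k j).comp
    (continuous_omegaBar P z l)).aestronglyMeasurable fun s => ?_).memLp
  have hm' : Real.sqrt m ≠ 0 := (Real.sqrt_pos.2 (by exact_mod_cast hm)).ne'
  rw [mul_div_cancel₀ _ hm']
  exact abs_le_l2norm _ k j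

theorem memLp_two_thetaBar (hm : 0 < m) (hM : M.LipschitzUpdates C) (hC : 0 ≤ C)
    (hK : M.BoundedBy K) (hK0 : 0 ≤ K) (P : Params dz J L n) (l : Fin L) (i : Fin n) (j : Fin J) :
    MemLp (fun s => M.thetaBar P s l i j) 2 M.noiseLaw := by
  obtain ⟨c, hc0, hc⟩ := exists_l2Bound_xiBar hm hM hC hK hK0 P (2 * l)
  refine ((l2Bound_thetaBar hM hC hK hK0 l hc).mono (measurable_noise fun z =>
    (continuous_apply_apply i j).comp (continuous_thetaBar P z l)).aestronglyMeasurable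
    fun s => ?_).memLp
  exact abs_le_l2norm _ i j

theorem memLp_two_noiseH (k : Fin m) (a : Fin L × Fin J) :
    MemLp (fun s : Noise dz J L n m => s.2.2 k a) 2 M.noiseLaw :=
  ((l2Bound_normH a).mono (by fun_prop) fun s => PiLp.norm_apply_le
    (WithLp.toLp 2 fun k => s.2.2 k a : EuclideanSpace ℝ (Fin m)) k).memLp

theorem memLp_two_noiseG (ζ : Fin dz) (i : Fin n) (a : Fin L × Fin J) :
    MemLp (fun s : Noise dz J L n m => s.2.1 ζ i a) 2 M.noiseLaw :=
  ((l2Bound_normG ζ a).mono (by fun_prop) fun s => PiLp.norm_apply_le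
    (WithLp.toLp 2 fun i => s.2.1 ζ i a : EuclideanSpace ℝ (Fin n)) i).memLp

theorem exists_abs_dOmega_le (hm : 0 < m) (hM : M.LipschitzUpdates C) (hC : 0 ≤ C)
    (hK : M.BoundedBy K) (hK0 : 0 ≤ K) (P : Params dz J L n) :
    ∃ c, 0 ≤ c ∧ ∀ s l k j μ k' j', |M.dOmega P s l k j μ k' j'| ≤ c := by
  obtain ⟨b, hb, hB⟩ := exists_memoryBound P
  obtain ⟨c, hc, h⟩ := exists_abs_le fun l : Fin L => responseConst dz J L C K b (2 * l + 1)
  refine ⟨c, hc, fun s l k j μ k' j' =>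
    (abs_dOmega_le hm hM hC hK hK0 hb s l (fun t _ => hB t) k j μ k' j').trans ?_⟩
  split_ifs
  · exact (le_abs_self _).trans (h l)
  · exact hc

/-- Gaussian integration by parts in one entry, transported from the flat index set to the noise of
the model. Derivatives along the coordinate are expressed at `τ = 0`, so that they match directional
derivatives. -/
theorem integral_noise_mul (c : NoiseIndex dz J L n m) {X F F' : Noise dz J L n m → ℝ}
    (hX : ∀ p, X (mkNoise p) = p.2 c)
    (hF : ∀ z x, HasDerivAt (fun τ : ℝ => F (mkNoise (z, x + τ • Pi.single c 1)))
      (F' (mkNoise (z, x))) 0) {c₀ : ℝ} (hc : ∀ s, |F' s| ≤ c₀) (hF' : Measurable F')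
    (hint : Integrable (fun s => X s * F s) M.noiseLaw) :
    ∫ s, X s * F s ∂M.noiseLaw = ∫ s, F' s ∂M.noiseLaw := by
  classical
  have hmp := measurePreserving_mkNoise M
  have h1 : Integrable (fun p : (Fin m → Fin dz) × (NoiseIndex dz J L n m → ℝ) =>
      p.2 c * F (mkNoise p)) (M.latentLaw.prod (gaussPi (NoiseIndex dz J L n m))) := by
    have := hmp.integrable_comp_of_integrable hint
    simpa only [Function.comp_def, hX] using this
  have key := integral_eval_mul_prod_eq_integral_lineDeriv M.latentLaw
    (F := fun p => F (mkNoise p)) (F' := fun p => F' (mkNoise p)) c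
    (fun z x => by
      simp_rw [update_eq_add_smul_single]
      refine HasDerivAt.comp_sub_const (f := fun τ => F (mkNoise (z, x + τ •
        (Pi.single c 1 : NoiseIndex dz J L n m → ℝ)))) _ _ ?_
      rw [sub_self]
      exact hF z x)
    (fun p => hc _) (hF'.comp hmp.measurable) h1
  rw [← hmp.map_eq, integral_map hmp.measurable.aemeasurable
    (by rw [hmp.map_eq]; exact hint.aestronglyMeasurable),
    integral_map hmp.measurable.aemeasurable hF'.aestronglyMeasurable]
  simpa only [hX] using key

/-- Integration by parts in one entry of `H`, followed by the chain rule: `h̃` is linear in that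
entry with coefficients `A_θ`, and this is where the factor `A_θ` comes from. -/
theorem integral_noiseH_mul_omegaBar (hm : 0 < m) (hM : M.LipschitzUpdates C) (hC : 0 ≤ C)
    (hK : M.BoundedBy K) (hK0 : 0 ≤ K) (P : Params dz J L n) (ζ : Fin dz) (a : Fin L × Fin J)
    (l : Fin L) (k : Fin m) (j : Fin J) :
    ∫ s, s.2.2 k a * (if s.1 k = ζ then M.omegaBar P s l k j else 0) ∂M.noiseLaw =
      ∑ c, P.Atheta ζ a c *
        ∫ s, (if s.1 k = ζ then M.dOmega P s l k j c.1 k c.2 else 0) ∂M.noiseLaw := by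
  classical
  obtain ⟨c₀, hc0, hc⟩ := exists_abs_dOmega_le hm hM hC hK hK0 P
  have hset : MeasurableSet {s : Noise dz J L n m | s.1 k = ζ} :=
    measurableSet_eq_fun (by fun_prop) measurable_const
  have hd : ∀ c : Fin L × Fin J, Measurable fun s : Noise dz J L n m =>
      if s.1 k = ζ then M.dOmega P s l k j c.1 k c.2 else 0 := fun c =>
    Measurable.ite hset (measurable_dOmega P l k j c.1 k c.2) measurable_const
  have hb : ∀ (c : Fin L × Fin J) s,
      |if s.1 k = ζ then M.dOmega P s l k j c.1 k c.2 else 0| ≤ c₀ := fun c s => by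
    split_ifs
    · exact hc _ _ _ _ _ _ _
    · simpa using hc0
  have hint : Integrable (fun s => s.2.2 k a * (if s.1 k = ζ then M.omegaBar P s l k j else 0))
      M.noiseLaw := by
    have h1 := (memLp_two_noiseH (M := M) k a).integrable_mul
      (memLp_two_omegaBar hm hM hC hK hK0 P l k j)
    refine h1.mono (h1.aestronglyMeasurable.indicator hset |>.congr (ae_of_all _ fun s => ?_))
      (ae_of_all _ fun s => ?_)
    · simp [Set.indicator_apply]
    · split_ifs <;> simp [abs_nonneg, mul_nonneg]
  rw [integral_noise_mul (.inr (k, a)) (X := fun s => s.2.2 k a) (F' := fun s =>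
    ∑ c, P.Atheta ζ a c * (if s.1 k = ζ then M.dOmega P s l k j c.1 k c.2 else 0))
    (fun p => rfl) (fun z x => ?_) (c₀ := ∑ c, |P.Atheta ζ a c| * c₀) (fun s => ?_)
    (Finset.measurable_sum _ fun c _ => (hd c).const_mul _) hint, integral_finsetSum]
  · simp_rw [integral_const_mul]
  · intro c _
    exact Integrable.const_mul (Integrable.mono' (integrable_const c₀)
      (hd c).aestronglyMeasurable (ae_of_all _ (hb c))) _
  -- The latent variables are frozen in the integration by parts, so the indicator is constant and
  -- both sides vanish when the row has another latent value.
  · by_cases hz : z k = ζ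
    · have hz' : ∀ x : NoiseIndex dz J L n m → ℝ, (mkNoise (z, x)).1 k = ζ := fun _ => hz
      simp only [hz', if_true]
      have h := ((differentiable_omega_ht (M := M) P z (M.gTilde P (mkNoise (z, x))) l k j)
        (hTilde P (mkNoise (z, x)))).hasFDerivAt.hasLineDerivAt
          (∑ c : Fin L × Fin J, P.Atheta (z k) a c • unitArray c.1 k c.2)
      rw [map_sum] at h
      simp only [map_smul, smul_eq_mul] at h
      unfold HasLineDerivAt at h
      simp_rw [← hTilde_mkNoise_add] at h
      rw [hz] at h
      refine h.congr_of_eventuallyEq (Eventually.of_forall fun τ => ?_)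
      simp only [Model.omegaBar, Model.xiBar, gTilde_mkNoise_add_inr]
      rfl
    · have hz' : ∀ x : NoiseIndex dz J L n m → ℝ, ¬ (mkNoise (z, x)).1 k = ζ := fun _ => hz
      simp only [hz', if_false, mul_zero, Finset.sum_const_zero]
      exact hasDerivAt_const _ _
  · refine (Finset.abs_sum_le_sum_abs _ _).trans (Finset.sum_le_sum fun c _ => ?_)
    rw [abs_mul]
    exact mul_le_mul_of_nonneg_left (hb c s) (abs_nonneg _)

theorem exists_abs_dTheta_le (hM : M.LipschitzUpdates C) (hC : 0 ≤ C)
    (hK : M.BoundedBy K) (hK0 : 0 ≤ K) (P : Params dz J L n) :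
    ∃ c, 0 ≤ c ∧ ∀ s l i j μ i' j', |M.dTheta P s l i j μ i' j'| ≤ c := by
  obtain ⟨b, hb, hB⟩ := exists_memoryBound P
  obtain ⟨c, hc, h⟩ := exists_abs_le fun l : Fin L =>
    responseConst dz J L C K b (2 * l) / Real.sqrt m
  refine ⟨c, hc, fun s l i j μ i' j' =>
    (abs_dTheta_le hM hC hK hK0 hb s l (fun t _ => hB t) i j μ i' j').trans ?_⟩
  split_ifs
  · exact (le_abs_self _).trans (h l)
  · exact hc

/-- The same argument for `G`. One entry of `G_ζ` moves a whole column of `g̃` through `R(ζ)^{1/2}`,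
hence the additional sum. -/
theorem integral_noiseG_mul_thetaBar (hm : 0 < m) (hM : M.LipschitzUpdates C) (hC : 0 ≤ C)
    (hK : M.BoundedBy K) (hK0 : 0 ≤ K) (P : Params dz J L n) (ζ : Fin dz) (a : Fin L × Fin J)
    (l : Fin L) (i i' : Fin n) (j : Fin J) :
    ∫ s, s.2.1 ζ i a * M.thetaBar P s l i' j ∂M.noiseLaw =
      ∑ c, P.Aomega ζ a c * ∑ p, M.covSqrt ζ p i *
        ∫ s, M.dTheta P s l i' j c.1 p c.2 ∂M.noiseLaw := by
  obtain ⟨c₀, hc0, hc⟩ := exists_abs_dTheta_le hM hC hK hK0 P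
  have hi : ∀ (c : Fin L × Fin J) p, Integrable (fun s => M.dTheta P s l i' j c.1 p c.2)
      M.noiseLaw := fun c p => Integrable.mono' (integrable_const c₀)
      (measurable_dTheta P _ _ _ _ _ _).aestronglyMeasurable (ae_of_all _ fun s => hc _ _ _ _ _ _ _)
  have hint : Integrable (fun s => s.2.1 ζ i a * M.thetaBar P s l i' j) M.noiseLaw :=
    (memLp_two_noiseG (M := M) ζ i a).integrable_mul (memLp_two_thetaBar hm hM hC hK hK0 P l i' j)
  rw [integral_noise_mul (.inl (ζ, i, a)) (X := fun s => s.2.1 ζ i a) (F' := fun s =>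
    ∑ c, P.Aomega ζ a c * ∑ p, M.covSqrt ζ p i * M.dTheta P s l i' j c.1 p c.2)
    (fun p => rfl) (fun z x => ?_)
    (c₀ := ∑ c, |P.Aomega ζ a c| * ∑ p, |M.covSqrt ζ p i| * c₀) (fun s => ?_)
    (Finset.measurable_sum _ fun c _ => (Finset.measurable_sum _ fun p _ =>
      (measurable_dTheta P _ _ _ _ _ _).const_mul _).const_mul _) hint, integral_finsetSum]
  · refine Finset.sum_congr rfl fun c _ => ?_
    rw [integral_const_mul, integral_finsetSum _ fun p _ => (hi c p).const_mul _]
    simp_rw [integral_const_mul]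
  · exact fun c _ => (integrable_finsetSum _ fun p _ => (hi c p).const_mul _).const_mul _
  · have h := ((differentiable_theta_gt (M := M) P z (hTilde P (mkNoise (z, x))) l i' j)
      (M.gTilde P (mkNoise (z, x)))).hasFDerivAt.hasLineDerivAt
        (∑ c : Fin L × Fin J, P.Aomega ζ a c • ∑ p, M.covSqrt ζ p i • unitArray c.1 p c.2)
    rw [map_sum] at h
    simp only [map_smul, map_sum, smul_eq_mul] at h
    unfold HasLineDerivAt at h
    simp_rw [← gTilde_mkNoise_add] at h
    refine h.congr_of_eventuallyEq (Eventually.of_forall fun τ => ?_)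
    simp only [Model.thetaBar, Model.xiBar, hTilde_mkNoise_add_inl]
    rfl
  · refine (Finset.abs_sum_le_sum_abs _ _).trans (Finset.sum_le_sum fun c _ => ?_)
    rw [abs_mul]
    refine mul_le_mul_of_nonneg_left ?_ (abs_nonneg _)
    refine (Finset.abs_sum_le_sum_abs _ _).trans (Finset.sum_le_sum fun p _ => ?_)
    rw [abs_mul]
    exact mul_le_mul_of_nonneg_left (hc _ _ _ _ _ _ _) (abs_nonneg _)

end Stein

end DMF

end

noncomputable section

namespace DMF

/-! ### Identification of `B` with the averaged responses. -/

section Relations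

variable {dz J L n m : ℕ} {M : Model dz J L n m} {C K : ℝ}

/-- The averaged response of `ω̄` to the inputs `h̃`. -/
def Model.respTheta (M : Model dz J L n m) (P : Params dz J L n) (ζ : Fin dz) : Kernel J L :=
  fun a b => (m : ℝ)⁻¹ *
    ∫ s, ∑ k with s.1 k = ζ, M.dOmega P s b.1 k b.2 a.1 k a.2 ∂M.noiseLaw

/-- The averaged response of `θ̄` to the inputs `g̃`. -/
def Model.respOmega (M : Model dz J L n m) (P : Params dz J L n) (ζ : Fin dz) : Kernel J L :=
  fun a b => (∫ s, ∑ i, ∑ i', M.cov ζ i i' * M.dTheta P s b.1 i' b.2 a.1 i a.2 ∂M.noiseLaw) /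
    Real.sqrt m

theorem abs_integral_le_of_forall {Ω : Type*} [MeasurableSpace Ω] {μ : Measure Ω}
    [IsProbabilityMeasure μ] {f : Ω → ℝ} {c : ℝ} (h : ∀ s, |f s| ≤ c) : |∫ s, f s ∂μ| ≤ c := by
  simpa using norm_integral_le_of_norm_le_const (μ := μ) (f := f) (ae_of_all _ h)

theorem abs_respTheta_le (hm : 0 < m) (hM : M.LipschitzUpdates C) (hC : 0 ≤ C) (hK : M.BoundedBy K)
    (hK0 : 0 ≤ K) {P : Params dz J L n} {b : ℝ} (hb : 0 ≤ b) (l : Fin L)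
    (hB : ∀ t < 2 * (l : ℕ) + 1, P.MemoryBound b t) (ζ : Fin dz) (a : Fin L × Fin J) (j : Fin J) :
    |M.respTheta P ζ a (l, j)| ≤ if a.1 ≤ l then responseConst dz J L C K b (2 * l + 1) else 0 := by
  have hm' : (0 : ℝ) < m := by exact_mod_cast hm
  have h0 := responseConst_nonneg (dz := dz) (J := J) (L := L) hC hK0 hb (2 * l + 1)
  set r : ℝ := if a.1 ≤ l then responseConst dz J L C K b (2 * l + 1) else 0 with hr
  have hr0 : 0 ≤ r := by rw [hr]; split_ifs <;> simp [h0]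
  have h : |∫ s, ∑ k with s.1 k = ζ, M.dOmega P s l k j a.1 k a.2 ∂M.noiseLaw| ≤ m * r := by
    refine abs_integral_le_of_forall fun s => (Finset.abs_sum_le_sum_abs _ _).trans ?_
    refine (Finset.sum_le_sum_of_subset_of_nonneg (Finset.filter_subset _ _)
      fun _ _ _ => abs_nonneg _).trans ?_
    refine (Finset.sum_le_sum fun k _ =>
      abs_dOmega_le hm hM hC hK hK0 hb s l hB k j a.1 k a.2).trans (le_of_eq ?_)
    simp [hr]
  rw [Model.respTheta, abs_mul, abs_of_pos (inv_pos.2 hm'), inv_mul_le_iff₀ hm']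
  exact h

/-- The trace has `n` terms of order `1 / √m` and is divided by `√m`, so the bound is of order `n /
m`. -/
theorem abs_respOmega_le (hm : 0 < m) (hM : M.LipschitzUpdates C) (hC : 0 ≤ C) (hK : M.BoundedBy K)
    (hK0 : 0 ≤ K) {P : Params dz J L n} {b : ℝ} (hb : 0 ≤ b) (l : Fin L)
    (hB : ∀ t < 2 * (l : ℕ), P.MemoryBound b t) (ζ : Fin dz) (a : Fin L × Fin J) (j : Fin J) :
    |M.respOmega P ζ a (l, j)| ≤
      if a.1 < l then n / m * (K * responseConst dz J L C K b (2 * l)) else 0 := by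
  have hm' : (0 : ℝ) < Real.sqrt m := Real.sqrt_pos.2 (by exact_mod_cast hm)
  have hmm : Real.sqrt m * Real.sqrt m = m := Real.mul_self_sqrt (by positivity)
  have h : |∫ s, ∑ i, ∑ i', M.cov ζ i i' * M.dTheta P s l i' j a.1 i a.2 ∂M.noiseLaw| ≤
      n * (if a.1 < l then K * responseConst dz J L C K b (2 * l) / Real.sqrt m else 0) := by
    refine abs_integral_le_of_forall fun s => (Finset.abs_sum_le_sum_abs _ _).trans ?_
    refine (Finset.sum_le_sum fun i _ =>
      abs_sum_cov_dTheta_le hM hC hK hK0 hb s l hB ζ i j a.1 i a.2).trans (le_of_eq ?_)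
    simp
  rw [Model.respOmega, abs_div, abs_of_pos hm', div_le_iff₀ hm']
  refine h.trans (le_of_eq ?_)
  split_ifs
  · have : (m : ℝ) ≠ 0 := by exact_mod_cast hm.ne'
    rw [mul_div_assoc', div_mul_eq_mul_div, div_mul_eq_mul_div, div_eq_div_iff hm'.ne' this]
    linear_combination (-(n * (K * responseConst dz J L C K b (2 * l)))) * hmm
  · simp

theorem respTheta_eq_zero (hm : 0 < m) (hM : M.LipschitzUpdates C) (hC : 0 ≤ C)
    (hK : M.BoundedBy K) (hK0 : 0 ≤ K) (P : Params dz J L n) (ζ : Fin dz) (a b : Fin L × Fin J)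
    (h : b.1 < a.1) : M.respTheta P ζ a b = 0 := by
  obtain ⟨c, hc, hB⟩ := exists_memoryBound P
  have := abs_respTheta_le hm hM hC hK hK0 hc b.1 (fun t _ => hB t) ζ a b.2
  rw [if_neg (not_le.2 h)] at this
  exact abs_nonpos_iff.1 this

theorem respOmega_eq_zero (hm : 0 < m) (hM : M.LipschitzUpdates C) (hC : 0 ≤ C)
    (hK : M.BoundedBy K) (hK0 : 0 ≤ K) (P : Params dz J L n) (ζ : Fin dz) (a b : Fin L × Fin J)
    (h : b.1 ≤ a.1) : M.respOmega P ζ a b = 0 := by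
  obtain ⟨c, hc, hB⟩ := exists_memoryBound P
  have := abs_respOmega_le hm hM hC hK hK0 hc b.1 (fun t _ => hB t) ζ a b.2
  rw [if_neg (not_lt.2 h)] at this
  exact abs_nonpos_iff.1 this

/-- Integration by parts summed over the rows. It turns the correlation of the noise with the
features, which concentrates, into `A_θ` times the response. -/
theorem integral_crossOmega (hm : 0 < m) (hM : M.LipschitzUpdates C) (hC : 0 ≤ C)
    (hK : M.BoundedBy K) (hK0 : 0 ≤ K) (P : Params dz J L n) (ζ : Fin dz) :
    (Matrix.of fun a b => ∫ s, M.crossOmega P ζ a b s ∂M.noiseLaw) =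
      P.Atheta ζ * M.respTheta P ζ := by
  classical
  obtain ⟨c₀, hc0, hc⟩ := exists_abs_dOmega_le hm hM hC hK hK0 P
  have hset : ∀ k, MeasurableSet {s : Noise dz J L n m | s.1 k = ζ} := fun k =>
    measurableSet_eq_fun (by fun_prop) measurable_const
  ext a b
  have h1 : ∀ k ∈ Finset.univ, Integrable (fun s : Noise dz J L n m =>
      s.2.2 k a * (if s.1 k = ζ then M.omegaBar P s b.1 k b.2 else 0)) M.noiseLaw := fun k _ => by
    have h1 := (memLp_two_noiseH (M := M) k a).integrable_mul
      (memLp_two_omegaBar hm hM hC hK hK0 P b.1 k b.2)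
    refine h1.mono (h1.aestronglyMeasurable.indicator (hset k) |>.congr (ae_of_all _ fun s => ?_))
      (ae_of_all _ fun s => ?_)
    · simp [Set.indicator_apply]
    · split_ifs <;> simp [abs_nonneg, mul_nonneg]
  have h2 : ∀ (c : Fin L × Fin J), ∀ k ∈ Finset.univ, Integrable (fun s : Noise dz J L n m =>
      if s.1 k = ζ then M.dOmega P s b.1 k b.2 c.1 k c.2 else 0) M.noiseLaw := fun c k _ => by
    refine Integrable.mono' (integrable_const c₀) (Measurable.ite (hset k)
      (measurable_dOmega P b.1 k b.2 c.1 k c.2) measurable_const).aestronglyMeasurable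
      (ae_of_all _ fun s => ?_)
    rw [Real.norm_eq_abs]
    split_ifs
    · exact hc _ _ _ _ _ _ _
    · simpa using hc0
  have e1 : ∀ s : Noise dz J L n m, M.crossOmega P ζ a b s = (m : ℝ)⁻¹ *
      ∑ k, s.2.2 k a * (if s.1 k = ζ then M.omegaBar P s b.1 k b.2 else 0) := fun s => by
    rw [Model.crossOmega, Finset.sum_filter]
    simp only [mul_ite, mul_zero]
  rw [Matrix.of_apply, Matrix.mul_apply]
  simp_rw [e1, integral_const_mul]
  rw [integral_finsetSum _ h1]
  simp_rw [integral_noiseH_mul_omegaBar hm hM hC hK hK0 P ζ a b.1 _ b.2]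
  rw [Finset.sum_comm, Finset.mul_sum]
  refine Finset.sum_congr rfl fun c _ => ?_
  simp_rw [Model.respTheta, Finset.sum_filter]
  rw [integral_finsetSum _ (h2 c), ← Finset.mul_sum]
  ring

theorem sum_mul_sum_rearrange {ι κ : Type*} [Fintype ι] [Fintype κ] (S : ι → ι → ℝ) (A : κ → ℝ)
    (D : κ → ι → ι → ℝ) :
    ∑ i, ∑ i', S i i' * ∑ c, A c * ∑ p, S p i * D c p i' =
      ∑ c, A c * ∑ p, ∑ i', (∑ i, S p i * S i i') * D c p i' := by
  simp_rw [Finset.sum_mul, Finset.mul_sum]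
  calc _ = ∑ i, ∑ c, ∑ i', ∑ p, S i i' * (A c * (S p i * D c p i')) :=
        Finset.sum_congr rfl fun i _ => Finset.sum_comm
    _ = ∑ c, ∑ i, ∑ i', ∑ p, S i i' * (A c * (S p i * D c p i')) := Finset.sum_comm
    _ = ∑ c, ∑ i, ∑ p, ∑ i', S i i' * (A c * (S p i * D c p i')) :=
        Finset.sum_congr rfl fun c _ => Finset.sum_congr rfl fun i _ => Finset.sum_comm
    _ = ∑ c, ∑ p, ∑ i, ∑ i', S i i' * (A c * (S p i * D c p i')) :=
        Finset.sum_congr rfl fun c _ => Finset.sum_comm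
    _ = ∑ c, ∑ p, ∑ i', ∑ i, S i i' * (A c * (S p i * D c p i')) :=
        Finset.sum_congr rfl fun c _ => Finset.sum_congr rfl fun p _ => Finset.sum_comm
    _ = _ := Finset.sum_congr rfl fun c _ => Finset.sum_congr rfl fun p _ =>
        Finset.sum_congr rfl fun i' _ => Finset.sum_congr rfl fun i _ => by ring

/-- One factor `R^{1/2}` comes from the observable and one from the chain rule. Together they give
the `R` in the response. -/
theorem integral_crossTheta (hm : 0 < m) (hM : M.LipschitzUpdates C) (hC : 0 ≤ C)
    (hK : M.BoundedBy K) (hK0 : 0 ≤ K) (P : Params dz J L n) (ζ : Fin dz) :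
    (Matrix.of fun a b => ∫ s, M.crossTheta P ζ a b s ∂M.noiseLaw) =
      P.Aomega ζ * M.respOmega P ζ := by
  obtain ⟨c₀, hc0, hc⟩ := exists_abs_dTheta_le hM hC hK hK0 P
  ext a b
  have hi : ∀ (c : Fin L × Fin J) p i', Integrable (fun s => M.dTheta P s b.1 i' b.2 c.1 p c.2)
      M.noiseLaw := fun c p i' => Integrable.mono' (integrable_const c₀)
      (measurable_dTheta P _ _ _ _ _ _).aestronglyMeasurable (ae_of_all _ fun s => hc _ _ _ _ _ _ _)
  have h1 : ∀ i i', Integrable (fun s : Noise dz J L n m =>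
      M.covSqrt ζ i i' * (s.2.1 ζ i a * M.thetaBar P s b.1 i' b.2)) M.noiseLaw := fun i i' =>
    ((memLp_two_noiseG (M := M) ζ i a).integrable_mul
      (memLp_two_thetaBar hm hM hC hK hK0 P b.1 i' b.2)).const_mul _
  have e1 : ∀ s : Noise dz J L n m, M.crossTheta P ζ a b s =
      (∑ i, ∑ i', M.covSqrt ζ i i' * (s.2.1 ζ i a * M.thetaBar P s b.1 i' b.2)) / Real.sqrt m :=
    fun s => by
      rw [Model.crossTheta]
      congr 1
      exact Finset.sum_congr rfl fun i _ => Finset.sum_congr rfl fun i' _ => by ring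
  rw [Matrix.of_apply, Matrix.mul_apply]
  simp_rw [e1, integral_div]
  rw [integral_finsetSum _ fun i _ => integrable_finsetSum _ fun i' _ => h1 i i']
  simp_rw [integral_finsetSum _ fun i' _ => h1 _ i', integral_const_mul,
    integral_noiseG_mul_thetaBar hm hM hC hK hK0 P ζ a b.1 _ _ b.2, Model.respOmega]
  simp_rw [integral_finsetSum Finset.univ fun i _ => integrable_finsetSum Finset.univ fun i' _ =>
    (hi _ i i').const_mul (M.cov ζ i i'), integral_finsetSum Finset.univ fun i' _ =>
    (hi _ _ i').const_mul (M.cov ζ _ i'), integral_const_mul]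
  simp_rw [mul_div_assoc', ← Finset.sum_div]
  congr 1
  have e2 : ∀ p i', M.cov ζ p i' = ∑ i, M.covSqrt ζ p i * M.covSqrt ζ i i' := fun p i' => by
    rw [← covSqrt_mul_self, Matrix.mul_apply]
  simp_rw [e2]
  exact sum_mul_sum_rearrange (M.covSqrt ζ) (P.Aomega ζ a)
    fun c p i' => ∫ s, M.dTheta P s b.1 i' b.2 c.1 p c.2 ∂M.noiseLaw

/-- Products of block upper-triangular matrices are of the same type. Hence the truncation in the
first form of the relation for `B` removes nothing. -/
theorem upper_mul {A B : Kernel J L} (hA : ∀ a b, b.1 < a.1 → A a b = 0)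
    (hB : ∀ a b, b.1 < a.1 → B a b = 0) : upper (A * B) = A * B := by
  ext a b
  rw [upper]
  split_ifs with h
  · rfl
  · rw [Matrix.mul_apply, Finset.sum_eq_zero]
    intro c _
    rcases lt_or_ge c.1 a.1 with h1 | h1
    · rw [hA _ _ h1, zero_mul]
    · rw [hB _ _ ((not_le.1 h).trans_le h1), mul_zero]

theorem strictUpper_mul {A B : Kernel J L} (hA : ∀ a b, b.1 < a.1 → A a b = 0)
    (hB : ∀ a b, b.1 ≤ a.1 → B a b = 0) : strictUpper (A * B) = A * B := by
  ext a b
  rw [strictUpper]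
  split_ifs with h
  · rfl
  · rw [Matrix.mul_apply, Finset.sum_eq_zero]
    intro c _
    rcases lt_or_ge c.1 a.1 with h1 | h1
    · rw [hA _ _ h1, zero_mul]
    · rw [hB _ _ ((not_lt.1 h).trans h1), mul_zero]

/-- By integration by parts the expectation in the first alternative is `A` times the response, and
causality makes the truncation harmless, so `A⁻¹` cancels. The second alternative is the response by
definition. From here on the two cases need not be distinguished. -/
theorem Model.IsDMF.B_eq_resp (hm : 0 < m) (hM : M.LipschitzUpdates C) (hC : 0 ≤ C)
    (hK : M.BoundedBy K) (hK0 : 0 ≤ K) {P : Params dz J L n} (hP : M.IsDMF P) (ζ : Fin dz) :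
    P.Btheta ζ = M.respTheta P ζ ∧ P.Bomega ζ = M.respOmega P ζ := by
  rcases hP.B_eq with h | h
  · obtain ⟨h1, h2, h3, h4⟩ := h ζ
    rw [integral_crossOmega hm hM hC hK hK0, upper_mul (hP.Atheta_cholesky ζ).1
      (respTheta_eq_zero hm hM hC hK hK0 P ζ), Matrix.nonsing_inv_mul_cancel_left _ _ h1] at h3
    rw [integral_crossTheta hm hM hC hK hK0, strictUpper_mul (hP.Aomega_cholesky ζ).1
      (respOmega_eq_zero hm hM hC hK hK0 P ζ), Matrix.nonsing_inv_mul_cancel_left _ _ h2] at h4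
    exact ⟨h3, h4⟩
  · constructor
    · ext a b
      exact (h ζ a.1 a.2 b.1 b.2).1
    · ext a b
      exact (h ζ a.1 a.2 b.1 b.2).2

end Relations

/-- The hypotheses of the problem that do not involve the concentration of the parameters. -/
structure Problem (dz J L : ℕ) (γ C K : ℝ) where
  m : ℕ
  n : ℕ
  m_pos : 0 < m
  n_eq : (n : ℝ) = γ * m
  M : Model dz J L n m
  lip : M.LipschitzUpdates C
  bdd : M.BoundedBy K
  P : Params dz J L n
  isDMF : M.IsDMF P

/-! ### Uniform bounds on the memory coefficients. -/

namespace Problem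

variable {dz J L : ℕ} {γ C K : ℝ}

theorem sqrt_m_pos (p : Problem dz J L γ C K) : 0 < Real.sqrt p.m :=
  Real.sqrt_pos.2 (by exact_mod_cast p.m_pos)

theorem n_div_m (p : Problem dz J L γ C K) : (p.n : ℝ) / p.m = γ := by
  have : (p.m : ℝ) ≠ 0 := by exact_mod_cast p.m_pos.ne'
  rw [p.n_eq]; field_simp

/-- Induction over time. The coefficients that act at time `t` are averaged responses, and these are
bounded in terms of coefficients that act strictly before `t`. No moment bound is needed. -/
theorem exists_memoryBound (dz J L : ℕ) (γ : ℝ) (hγ : 0 < γ) {C K : ℝ} (hC : 0 ≤ C) (hK : 0 ≤ K)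
    (T : ℕ) :
    ∃ b, 0 ≤ b ∧ ∀ p : Problem dz J L γ C K, ∀ t < T, p.P.MemoryBound b t := by
  induction T with
  | zero => exact ⟨0, le_rfl, fun p t ht => absurd ht (Nat.not_lt_zero t)⟩
  | succ T ih =>
    obtain ⟨b, hb, h⟩ := ih
    have hr : ∀ T, 0 ≤ responseConst dz J L C K b T := fun T => responseConst_nonneg hC hK hb T
    have hmono : ∀ t ≤ T, responseConst dz J L C K b t ≤ responseConst dz J L C K b T :=
      fun t ht => by
        have := memoryConst_nonneg (dz := dz) (J := J) (L := L) hC hK hb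
        unfold responseConst
        refine mul_le_mul_of_nonneg_left (Finset.sum_le_sum_of_subset_of_nonneg (by simpa using ht)
          fun _ _ _ => by positivity) hC
    set r := responseConst dz J L C K b T with hrr
    have hr0 := hr T
    -- The response of `ω̄` is bounded by `r`, and that of `θ̄` by `(n / m) K r = γ K r`.
    refine ⟨max r (γ * (K * r)), le_max_of_le_left hr0, fun p t ht => ⟨fun ζ a l j hl => ?_,
      fun ζ a l j hl => ?_⟩⟩
    · rw [(p.isDMF.B_eq_resp p.m_pos p.lip hC p.bdd hK ζ).2]
      refine (abs_respOmega_le p.m_pos p.lip hC p.bdd hK hb l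
        (fun t' ht' => h p t' (by omega)) ζ a j).trans ((?_ : _ ≤ _).trans (le_max_right _ _))
      rw [p.n_div_m]
      split_ifs
      · exact mul_le_mul_of_nonneg_left (mul_le_mul_of_nonneg_left (hmono _ (by omega)) hK) hγ.le
      · positivity
    · rw [(p.isDMF.B_eq_resp p.m_pos p.lip hC p.bdd hK ζ).1]
      refine (abs_respTheta_le p.m_pos p.lip hC p.bdd hK hb l
        (fun t' ht' => h p t' (by omega)) ζ a j).trans ((?_ : _ ≤ _).trans (le_max_left _ _))
      split_ifs
      · exact hmono _ (by omega)
      · exact hr0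

end Problem

end DMF

end

noncomputable section

namespace DMF

/-! ### The observables as inner products; bounds on `A`, `β` and `e`. -/

section Vectors

variable {dz J L n m : ℕ} {M : Model dz J L n m} {C K : ℝ}

/-- The column `R(ζ)^{1/2} θ̄_a`. -/
def Model.vecTheta (M : Model dz J L n m) (P : Params dz J L n) (ζ : Fin dz) (a : Fin L × Fin J)
    (s : Noise dz J L n m) : EuclideanSpace ℝ (Fin n) :=
  Matrix.toEuclideanCLM (𝕜 := ℝ) (M.covSqrt ζ) (col (M.thetaBar P s a.1) a.2)

/-- The column `ω̄_a / √m`, restricted to the rows with latent value `ζ`. -/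
def Model.vecOmega (M : Model dz J L n m) (P : Params dz J L n) (ζ : Fin dz) (a : Fin L × Fin J)
    (s : Noise dz J L n m) : EuclideanSpace ℝ (Fin m) :=
  WithLp.toLp 2 fun k => if s.1 k = ζ then M.omegaBar P s a.1 k a.2 / Real.sqrt m else 0

/-- A column of `G_ζ`. -/
def vecG (ζ : Fin dz) (a : Fin L × Fin J) (s : Noise dz J L n m) : EuclideanSpace ℝ (Fin n) :=
  WithLp.toLp 2 fun i => s.2.1 ζ i a

/-- A column of the matrix collecting the rows of the `H_ζ`. -/
def vecH (a : Fin L × Fin J) (s : Noise dz J L n m) : EuclideanSpace ℝ (Fin m) :=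
  WithLp.toLp 2 fun k => s.2.2 k a

theorem vecTheta_apply (P : Params dz J L n) (ζ : Fin dz) (a : Fin L × Fin J)
    (s : Noise dz J L n m) (i : Fin n) :
    M.vecTheta P ζ a s i = ∑ i', M.covSqrt ζ i i' * M.thetaBar P s a.1 i' a.2 := rfl

theorem overlapTheta_eq_inner (P : Params dz J L n) (ζ : Fin dz) (a b : Fin L × Fin J)
    (s : Noise dz J L n m) :
    M.overlapTheta P ζ a b s = inner ℝ (M.vecTheta P ζ a s) (M.vecTheta P ζ b s) := by
  have hS : IsSelfAdjoint (Matrix.toEuclideanCLM (𝕜 := ℝ) (M.covSqrt ζ)) :=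
    (CFC.sqrt_nonneg (M.cov ζ)).isSelfAdjoint.map _
  have h1 : inner ℝ (M.vecTheta P ζ a s) (M.vecTheta P ζ b s) =
      inner ℝ (col (M.thetaBar P s a.1) a.2)
        (Matrix.toEuclideanCLM (𝕜 := ℝ) (M.cov ζ) (col (M.thetaBar P s b.1) b.2)) := by
    rw [← covSqrt_mul_self, map_mul]
    exact hS.isSymmetric _ _
  rw [h1, Model.overlapTheta, EuclideanSpace.inner_eq_star_dotProduct]
  simp only [dotProduct, Pi.star_apply, star_trivial, col_apply]
  refine Finset.sum_congr rfl fun i _ => ?_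
  have : (Matrix.toEuclideanCLM (𝕜 := ℝ) (M.cov ζ) (col (M.thetaBar P s b.1) b.2)).ofLp i =
    ∑ i', M.cov ζ i i' * M.thetaBar P s b.1 i' b.2 := rfl
  rw [this, Finset.sum_mul]
  exact Finset.sum_congr rfl fun i' _ => by ring

theorem overlapOmega_eq_inner (P : Params dz J L n) (ζ : Fin dz) (a b : Fin L × Fin J)
    (s : Noise dz J L n m) :
    M.overlapOmega P ζ a b s = inner ℝ (M.vecOmega P ζ a s) (M.vecOmega P ζ b s) := by
  rw [Model.overlapOmega, EuclideanSpace.inner_eq_star_dotProduct, Finset.sum_filter,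
    Finset.mul_sum]
  simp only [dotProduct, Pi.star_apply, star_trivial, Model.vecOmega]
  refine Finset.sum_congr rfl fun k _ => ?_
  split_ifs
  · rw [div_mul_div_comm, Real.mul_self_sqrt (Nat.cast_nonneg m)]
    ring
  · simp

theorem crossTheta_eq_inner (P : Params dz J L n) (ζ : Fin dz) (a b : Fin L × Fin J)
    (s : Noise dz J L n m) :
    M.crossTheta P ζ a b s = inner ℝ (vecG ζ a s) (M.vecTheta P ζ b s) / Real.sqrt m := by
  rw [Model.crossTheta, EuclideanSpace.inner_eq_star_dotProduct]
  simp only [dotProduct, Pi.star_apply, star_trivial, vecG, vecTheta_apply, Finset.sum_mul]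
  congr 1
  exact Finset.sum_congr rfl fun i _ => Finset.sum_congr rfl fun i' _ => by ring

theorem crossOmega_eq_inner (P : Params dz J L n) (ζ : Fin dz) (a b : Fin L × Fin J)
    (s : Noise dz J L n m) :
    M.crossOmega P ζ a b s = inner ℝ (vecH a s) (M.vecOmega P ζ b s) / Real.sqrt m := by
  rw [Model.crossOmega, EuclideanSpace.inner_eq_star_dotProduct, Finset.sum_filter,
    Finset.mul_sum]
  simp only [dotProduct, Pi.star_apply, star_trivial, vecH, Model.vecOmega]
  rw [Finset.sum_div]
  refine Finset.sum_congr rfl fun k _ => ?_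
  split_ifs
  · rw [mul_comm (_ / _), ← mul_div_assoc, div_div, Real.mul_self_sqrt (Nat.cast_nonneg m)]
    ring
  · simp

theorem meanTheta_eq_inner (P : Params dz J L n) (ζ : Fin dz) (l : Fin L) (j : Fin J)
    (s : Noise dz J L n m) :
    M.meanTheta P ζ l j s = inner ℝ (M.mean ζ) (col (M.thetaBar P s l) j) := by
  rw [Model.meanTheta, EuclideanSpace.inner_eq_star_dotProduct]
  simp only [dotProduct, Pi.star_apply, star_trivial, col_apply]
  exact Finset.sum_congr rfl fun i _ => by ring

theorem norm_vecTheta_le (hK : M.BoundedBy K) (P : Params dz J L n) (ζ : Fin dz)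
    (a : Fin L × Fin J) (s : Noise dz J L n m) :
    ‖M.vecTheta P ζ a s‖ ≤ Real.sqrt K * l2norm (M.thetaBar P s a.1) :=
  (ContinuousLinearMap.le_opNorm _ _).trans (mul_le_mul (norm_covSqrt_le hK ζ) (norm_col_le _ _)
    (norm_nonneg _) (Real.sqrt_nonneg _))

theorem norm_vecOmega_le (P : Params dz J L n) (ζ : Fin dz)
    (a : Fin L × Fin J) (s : Noise dz J L n m) :
    ‖M.vecOmega P ζ a s‖ ≤ l2norm (M.omegaBar P s a.1) / Real.sqrt m := by
  have h : ‖M.vecOmega P ζ a s‖ ≤ ‖(Real.sqrt m)⁻¹ • col (M.omegaBar P s a.1) a.2‖ := by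
    rw [EuclideanSpace.norm_eq, EuclideanSpace.norm_eq]
    refine Real.sqrt_le_sqrt (Finset.sum_le_sum fun k _ => ?_)
    simp only [Model.vecOmega, PiLp.smul_apply, col_apply, smul_eq_mul, Real.norm_eq_abs, sq_abs]
    split_ifs
    · rw [div_eq_inv_mul]
    · simp [sq_nonneg]
  refine h.trans ?_
  rw [norm_smul, norm_inv, Real.norm_of_nonneg (Real.sqrt_nonneg _), div_eq_inv_mul]
  exact mul_le_mul_of_nonneg_left (norm_col_le _ _) (by positivity)

theorem abs_meanOmega_le (P : Params dz J L n) (ζ : Fin dz) (l : Fin L) (j : Fin J)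
    (s : Noise dz J L n m) :
    |M.meanOmega P ζ l j s| ≤ l2norm (M.omegaBar P s l) / Real.sqrt m := by
  rcases Nat.eq_zero_or_pos m with rfl | hm
  · simp [Model.meanOmega]
  have hm' : (0 : ℝ) < Real.sqrt m := Real.sqrt_pos.2 (by exact_mod_cast hm)
  have h1 : M.meanOmega P ζ l j s = (Real.sqrt m)⁻¹ *
      inner ℝ (WithLp.toLp 2 fun _ => 1 : EuclideanSpace ℝ (Fin m)) (M.vecOmega P ζ (l, j) s) := by
    rw [Model.meanOmega, EuclideanSpace.inner_eq_star_dotProduct, Finset.sum_filter,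
      Finset.mul_sum]
    simp only [dotProduct, Pi.star_apply, star_trivial, Model.vecOmega]
    rw [Finset.mul_sum]
    refine Finset.sum_congr rfl fun k _ => ?_
    split_ifs
    · rw [mul_one, ← mul_div_assoc, inv_mul_eq_div, inv_mul_eq_div, div_div,
        Real.mul_self_sqrt (Nat.cast_nonneg m)]
    · simp
  have h2 : ‖(WithLp.toLp 2 fun _ => 1 : EuclideanSpace ℝ (Fin m))‖ = Real.sqrt m := by
    simp [EuclideanSpace.norm_eq]
  rw [h1, abs_mul, abs_of_pos (inv_pos.2 hm'), inv_mul_le_iff₀ hm']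
  refine (abs_real_inner_le_norm _ _).trans ?_
  rw [h2]
  exact mul_le_mul_of_nonneg_left (norm_vecOmega_le P ζ (l, j) s) hm'.le

/-- A diagonal entry of `AᵀA` is the squared norm of a column of `A`. With the Cholesky relation,
second moments of the features control all entries of `A`. -/
theorem abs_le_of_cholesky {A V : Kernel J L} (h : IsBlockCholesky A V) (a c : Fin L × Fin J)
    {v : ℝ} (hv : 0 ≤ v) (hV : V c c ≤ v ^ 2) : |A a c| ≤ v := by
  refine abs_le_of_sq_le_sq (le_trans ?_ hV) hv
  rw [← h.2, Matrix.mul_apply]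
  simp only [Matrix.transpose_apply]
  have := Finset.single_le_sum (f := fun i => A i c * A i c) (fun i _ => mul_self_nonneg _)
    (Finset.mem_univ a)
  simpa [sq] using this

theorem abs_Atheta_le (hK : M.BoundedBy K) {P : Params dz J L n} (hP : M.IsDMF P)
    {l : Fin L} {c : ℝ} (hc : L2Bound M.noiseLaw (fun s => l2norm (M.thetaBar P s l)) c)
    (ζ : Fin dz) (a : Fin L × Fin J) (j : Fin J) :
    |P.Atheta ζ a (l, j)| ≤ Real.sqrt K * c := by
  have h1 := hc.const_mul (Real.sqrt_nonneg K)
  refine abs_le_of_cholesky (hP.Atheta_cholesky ζ) a (l, j) h1.nonneg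
    (le_trans ?_ h1.integral_sq_le)
  rw [Matrix.of_apply]
  refine integral_mono_of_nonneg (ae_of_all _ fun s => ?_) h1.memLp.integrable_sq
    (ae_of_all _ fun s => ?_)
  · simp only [Pi.zero_apply, overlapTheta_eq_inner, real_inner_self_eq_norm_sq]; positivity
  · simp only [overlapTheta_eq_inner, real_inner_self_eq_norm_sq]
    gcongr
    exact norm_vecTheta_le hK P ζ (l, j) s

theorem abs_Aomega_le {P : Params dz J L n} (hP : M.IsDMF P)
    {l : Fin L} {c : ℝ}
    (hc : L2Bound M.noiseLaw (fun s => l2norm (M.omegaBar P s l) / Real.sqrt m) c)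
    (ζ : Fin dz) (a : Fin L × Fin J) (j : Fin J) :
    |P.Aomega ζ a (l, j)| ≤ c := by
  refine abs_le_of_cholesky (hP.Aomega_cholesky ζ) a (l, j) hc.nonneg
    (le_trans ?_ hc.integral_sq_le)
  rw [Matrix.of_apply]
  refine integral_mono_of_nonneg (ae_of_all _ fun s => ?_) hc.memLp.integrable_sq
    (ae_of_all _ fun s => ?_)
  · simp only [Pi.zero_apply, overlapOmega_eq_inner, real_inner_self_eq_norm_sq]; positivity
  · simp only [overlapOmega_eq_inner, real_inner_self_eq_norm_sq]
    gcongr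
    exact norm_vecOmega_le P ζ (l, j) s

theorem abs_integral_le_of_l2Bound {Ω : Type*} [MeasurableSpace Ω] {μ : Measure Ω}
    [IsProbabilityMeasure μ] {f g : Ω → ℝ} {c : ℝ} (hg : L2Bound μ g c) (h : ∀ s, |f s| ≤ g s) :
    |∫ s, f s ∂μ| ≤ c := by
  have hg' : Integrable g μ := hg.memLp.integrable one_le_two
  calc |∫ s, f s ∂μ| ≤ ∫ s, |f s| ∂μ := abs_integral_le_integral_abs
    _ ≤ ∫ s, |g s| ∂μ := integral_mono_of_nonneg (ae_of_all _ fun s => abs_nonneg _)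
        hg'.abs (ae_of_all _ fun s => (h s).trans (le_abs_self _))
    _ ≤ c := hg.integral_abs_le

theorem abs_beta_le (hK : M.BoundedBy K) (hK0 : 0 ≤ K) {P : Params dz J L n} (hP : M.IsDMF P)
    {l : Fin L} {c : ℝ} (hc : L2Bound M.noiseLaw (fun s => l2norm (M.thetaBar P s l)) c)
    (ζ : Fin dz) (j : Fin J) : |P.beta l ζ j| ≤ K * c := by
  rw [hP.beta_eq]
  refine abs_integral_le_of_l2Bound (hc.const_mul hK0) fun s => ?_
  rw [meanTheta_eq_inner]
  exact (abs_real_inner_le_norm _ _).trans (mul_le_mul (hK.mean ζ) (norm_col_le _ _)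
    (norm_nonneg _) hK0)

theorem l2norm_e_le (hK : M.BoundedBy K) {P : Params dz J L n} (hP : M.IsDMF P)
    {l : Fin L} {c : ℝ}
    (hc : L2Bound M.noiseLaw (fun s => l2norm (M.omegaBar P s l) / Real.sqrt m) c) :
    l2norm (P.e l) ≤ J * (dz * (c * K)) := by
  refine (l2norm_le_sum_col _).trans ?_
  have h : ∀ j, ‖col (P.e l) j‖ ≤ dz * (c * K) := fun j => by
    have h1 : col (P.e l) j = ∑ ζ, (∫ s, M.meanOmega P ζ l j s ∂M.noiseLaw) • M.mean ζ := by
      ext i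
      simp only [col_apply, hP.e_eq, WithLp.ofLp_sum, Finset.sum_apply, PiLp.smul_apply,
        smul_eq_mul]
      exact Finset.sum_congr rfl fun ζ _ => mul_comm _ _
    rw [h1]
    refine (norm_sum_le _ _).trans ((Finset.sum_le_sum (g := fun _ => c * K) fun ζ _ => ?_).trans
      (le_of_eq (by simp)))
    rw [norm_smul]
    exact mul_le_mul (abs_integral_le_of_l2Bound hc fun s => abs_meanOmega_le P ζ l j s)
      (hK.mean ζ) (norm_nonneg _) hc.nonneg
  exact (Finset.sum_le_sum fun j _ => h j).trans (le_of_eq (by simp))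

end Vectors

/-! ### Uniform bounds on moments and parameters. -/

namespace Problem

variable {dz J L : ℕ} {γ C K : ℝ}

/-- Induction over time. The parameters that enter at a given time are bounded by second moments of
`θ̄(l)` or `ω̄(l)`, and these involve only earlier times of the trajectory. -/
theorem exists_l2Bound (dz J L : ℕ) (γ : ℝ) (hγ : 0 < γ) {C K : ℝ} (hC : 0 ≤ C) (hK : 0 ≤ K)
    (T : ℕ) :
    ∃ c, 0 ≤ c ∧ ∀ p : Problem dz J L γ C K, ∀ t < T,
      L2Bound p.M.noiseLaw (fun s => stepNorm (p.M.xiBar p.P s) t) c := by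
  -- Times up to `2L` cover every coefficient, so one bound `b` serves the whole induction.
  obtain ⟨b, hb, hB⟩ := exists_memoryBound dz J L γ hγ hC hK (2 * L + 1)
  induction T with
  | zero => exact ⟨0, le_rfl, fun p t ht => absurd ht (Nat.not_lt_zero t)⟩
  | succ T ih =>
    obtain ⟨c, hc0, hc⟩ := ih
    have h : ∃ c', ∀ p : Problem dz J L γ C K,
        L2Bound p.M.noiseLaw (fun s => stepNorm (p.M.xiBar p.P s) T) c' := by
      have main : ∀ t ≤ T, t = T → ∃ c', ∀ p : Problem dz J L γ C K,
          L2Bound p.M.noiseLaw (fun s => stepNorm (p.M.xiBar p.P s) t) c' := by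
        refine stepNorm_cases (L := L) (p := fun t => t = T → ∃ c',
          ∀ p : Problem dz J L γ C K,
          L2Bound p.M.noiseLaw (fun s => stepNorm (p.M.xiBar p.P s) t) c') T ?_ ?_ ?_
        · rintro l hl rfl
          have ht0 : 0 ≤ K + C * ((2 * l : ℕ) * c) := by positivity
          set t := K + C * ((2 * l : ℕ) * c) with ht
          refine ⟨J * (dz * (K * t)) + J * (L * J * (dz * (Real.sqrt K * t))) +
            memorySource dz J L K b + memoryConst dz J L C K b * ((2 * l : ℕ) * c), fun p => ?_⟩
          · have hth := l2Bound_thetaBar p.lip hC p.bdd hK (P := p.P) l (hc p)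
            exact l2Bound_xiBar_even p.m_pos p.lip hC p.bdd hK hb l
              (fun ζ a j => (hB p (2 * l) (by omega)).1 ζ a l j le_rfl)
              (fun ζ j => abs_beta_le p.bdd hK p.isDMF hth ζ j)
              (mul_nonneg (Real.sqrt_nonneg _) ht0) (mul_nonneg hK ht0)
              (fun ζ a j => abs_Atheta_le p.bdd p.isDMF hth ζ a j) (hc p)
        · rintro l hl rfl
          have ht0 : 0 ≤ K + C * ((2 * l + 1 : ℕ) * c) := by positivity
          set t := K + C * ((2 * l + 1 : ℕ) * c) with ht
          refine ⟨J * (dz * (t * K)) + J * (dz * (L * J * (Real.sqrt K * t))) * Real.sqrt γ +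
            memorySource dz J L K b + memoryConst dz J L C K b * ((2 * l + 1 : ℕ) * c),
            fun p => ?_⟩
          · have hth := l2Bound_omegaBar p.lip hC p.bdd hK (P := p.P) l (hc p)
            exact l2Bound_xiBar_odd p.m_pos p.n_eq p.lip hC p.bdd hK hb l
              (fun ζ a j => (hB p (2 * l + 1) (by omega)).2 ζ a l j le_rfl)
              (l2norm_e_le p.bdd p.isDMF hth) ht0
              (fun ζ a j => abs_Aomega_le p.isDMF hth ζ a j) (hc p)
        · rintro t ht -
          refine ⟨0, fun p => ?_⟩
          simp_rw [stepNorm_of_le _ ht]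
          exact .zero
      exact main T le_rfl rfl
    obtain ⟨c', hc'⟩ := h
    refine ⟨max c c', le_max_of_le_left hc0, fun p t ht => ?_⟩
    rcases Nat.lt_succ_iff_lt_or_eq.1 ht with h | rfl
    · exact (hc p t h).mono_const (le_max_left _ _)
    · exact (hc' p).mono_const (le_max_right _ _)

/-- A common bound on the parameters and the second moments of the mean-field limit. -/
structure UniformBound (p : Problem dz J L γ C K) (κ : ℝ) : Prop where
  memory : ∀ T, p.P.MemoryBound κ T
  Atheta : ∀ ζ a b, |p.P.Atheta ζ a b| ≤ κ
  Aomega : ∀ ζ a b, |p.P.Aomega ζ a b| ≤ κ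
  theta : ∀ l, L2Bound p.M.noiseLaw (fun s => l2norm (p.M.thetaBar p.P s l)) κ
  omega : ∀ l,
    L2Bound p.M.noiseLaw (fun s => l2norm (p.M.omegaBar p.P s l) / Real.sqrt p.m) κ

theorem exists_uniformBound (dz J L : ℕ) (γ : ℝ) (hγ : 0 < γ) {C K : ℝ} (hC : 0 ≤ C)
    (hK : 0 ≤ K) : ∃ κ, 0 ≤ κ ∧ ∀ p : Problem dz J L γ C K, p.UniformBound κ := by
  obtain ⟨b, hb, hB⟩ := exists_memoryBound dz J L γ hγ hC hK (2 * L + 1)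
  obtain ⟨c, hc, h⟩ := exists_l2Bound dz J L γ hγ hC hK (2 * L)
  set t := K + C * ((2 * L : ℕ) * c) with ht
  have ht0 : 0 ≤ t := by positivity
  have hth : ∀ (p : Problem dz J L γ C K) l,
      L2Bound p.M.noiseLaw (fun s => l2norm (p.M.thetaBar p.P s l)) t := fun p l =>
    (l2Bound_thetaBar p.lip hC p.bdd hK l fun r hr => h p r (by omega)).mono_const (by
      rw [ht]; gcongr; exact l.2.le)
  have hom : ∀ (p : Problem dz J L γ C K) l,
      L2Bound p.M.noiseLaw (fun s => l2norm (p.M.omegaBar p.P s l) / Real.sqrt p.m) t := fun p l =>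
    (l2Bound_omegaBar p.lip hC p.bdd hK l fun r hr => h p r (by omega)).mono_const (by
      rw [ht]; gcongr; omega)
  refine ⟨b + t + Real.sqrt K * t, by positivity, fun p => ⟨fun T => ⟨fun ζ a l j _ => ?_,
    fun ζ a l j _ => ?_⟩, fun ζ a b => ?_, fun ζ a b => ?_, fun l => ?_, fun l => ?_⟩⟩
  · refine ((hB p (2 * l) (by omega)).1 ζ a l j le_rfl).trans ?_
    have : 0 ≤ t + Real.sqrt K * t := by positivity
    linarith
  · refine ((hB p (2 * l + 1) (by omega)).2 ζ a l j le_rfl).trans ?_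
    have : 0 ≤ t + Real.sqrt K * t := by positivity
    linarith
  · exact (abs_Atheta_le p.bdd p.isDMF (hth p b.1) ζ a b.2).trans (by linarith)
  · refine (abs_Aomega_le p.isDMF (hom p b.1) ζ a b.2).trans ?_
    have : 0 ≤ Real.sqrt K * t := by positivity
    linarith
  · have : 0 ≤ Real.sqrt K * t := by positivity
    exact (hth p l).mono_const (by linarith)
  · have : 0 ≤ Real.sqrt K * t := by positivity
    exact (hom p l).mono_const (by linarith)

end Problem

end DMF

end

noncomputable section

namespace DMF

/-! ### Stability of Gram–Schmidt for almost orthonormal families. -/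

section GramSchmidt

variable {V : Type*} [NormedAddCommGroup V] [InnerProductSpace ℝ V]
variable {ι : Type*} [LinearOrder ι] [LocallyFiniteOrderBot ι] [WellFoundedLT ι]

theorem gramSchmidt_congr {f g : ι → V} {i : ι} (h : ∀ j ≤ i, f j = g j) :
    InnerProductSpace.gramSchmidt ℝ f i = InnerProductSpace.gramSchmidt ℝ g i := by
  induction i using WellFoundedLT.induction with
  | ind i ih =>
    rw [InnerProductSpace.gramSchmidt_def, InnerProductSpace.gramSchmidt_def, h i le_rfl]
    congr 1
    refine Finset.sum_congr rfl fun j hj => ?_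
    have hj := Finset.mem_Iio.1 hj
    rw [ih j hj fun k hk => h k (hk.trans hj.le)]

theorem measurable_gramSchmidt {X : Type*} [MeasurableSpace X] [MeasurableSpace V] [BorelSpace V]
    [SecondCountableTopology V] {f : X → ι → V} (hf : ∀ i, Measurable fun x => f x i) (i : ι) :
    Measurable fun x => InnerProductSpace.gramSchmidt ℝ (f x) i := by
  induction i using WellFoundedLT.induction with
  | ind i ih =>
    have h : ∀ x, InnerProductSpace.gramSchmidt ℝ (f x) i = f x i - ∑ j ∈ Finset.Iio i,
        (inner ℝ (InnerProductSpace.gramSchmidt ℝ (f x) j) (f x i) /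
          ‖InnerProductSpace.gramSchmidt ℝ (f x) j‖ ^ 2) •
          InnerProductSpace.gramSchmidt ℝ (f x) j := fun x =>
      eq_sub_of_add_eq (InnerProductSpace.gramSchmidt_def'' ℝ (f x) i).symm
    simp_rw [h]
    refine (hf i).sub (Finset.measurable_fun_sum _ fun j hj => ?_)
    have hj := ih j (Finset.mem_Iio.1 hj)
    exact ((hj.inner (hf i)).div (hj.norm.pow_const 2)).smul hj

/-- Removing the projections to earlier vectors moves `f i` by its inner products with them, up to
the errors already made. Normalizing then moves it by the defect of its norm. The bound is
recursive, and no linear independence is assumed. -/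
theorem norm_gramSchmidtNormed_sub_le {f : ι → V} {q : ι → V}
    (hq : q = InnerProductSpace.gramSchmidtNormed ℝ f) (i : ι) :
    ‖q i - f i‖ ≤ |1 - ‖f i‖| +
      2 * ∑ j ∈ Finset.Iio i, (|inner ℝ (f j) (f i)| + ‖q j - f j‖ * ‖f i‖) := by
  set v := InnerProductSpace.gramSchmidt ℝ f with hv
  have hqn : ∀ j, ‖q j‖ ≤ 1 := fun j => by
    by_cases h : q j = 0
    · simp [h]
    · rw [hq] at h ⊢; exact (InnerProductSpace.gramSchmidtNormed_unit_length' h).le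
  have hqv : ∀ j, q j = ‖v j‖⁻¹ • v j := fun j => by rw [hq]; rfl
  have hproj : ∀ j, (inner ℝ (v j) (f i) / ‖v j‖ ^ 2) • v j = inner ℝ (q j) (f i) • q j := fun j => by
    rw [hqv, real_inner_smul_left, smul_smul]
    congr 1
    ring
  have h1 : v i - f i = -∑ j ∈ Finset.Iio i, inner ℝ (q j) (f i) • q j := by
    have := InnerProductSpace.gramSchmidt_def'' ℝ f i
    rw [← hv] at this
    simp only [RCLike.ofReal_real_eq_id, id_eq, hproj] at this
    rw [eq_neg_iff_add_eq_zero, sub_add_eq_add_sub, sub_eq_zero]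
    exact this.symm
  have h2 : ‖v i - f i‖ ≤ ∑ j ∈ Finset.Iio i, (|inner ℝ (f j) (f i)| + ‖q j - f j‖ * ‖f i‖) := by
    rw [h1, norm_neg]
    refine (norm_sum_le _ _).trans (Finset.sum_le_sum fun j _ => ?_)
    have e : inner ℝ (q j) (f i) = inner ℝ (f j) (f i) + inner ℝ (q j - f j) (f i) := by
      rw [← inner_add_left]; congr 1; abel
    rw [norm_smul, Real.norm_eq_abs]
    calc |inner ℝ (q j) (f i)| * ‖q j‖ ≤ |inner ℝ (q j) (f i)| * 1 :=
          mul_le_mul_of_nonneg_left (hqn j) (abs_nonneg _)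
      _ ≤ |inner ℝ (f j) (f i)| + |inner ℝ (q j - f j) (f i)| := by
          rw [mul_one, e]; exact abs_add_le _ _
      _ ≤ _ := by gcongr; exact abs_real_inner_le_norm _ _
  -- A vanishing `v i` is normalized to zero, and then the bound is trivial.
  have h3 : ‖q i - v i‖ ≤ |1 - ‖v i‖| := by
    by_cases h : v i = 0
    · rw [hqv, h]; simp
    · have hn : ‖v i‖ ≠ 0 := norm_ne_zero_iff.2 h
      have : q i - v i = (‖v i‖⁻¹ - 1) • v i := by rw [hqv, sub_smul, one_smul]
      rw [this, norm_smul, Real.norm_eq_abs, ← abs_norm (v i), ← abs_mul, sub_mul, one_mul,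
        abs_norm, inv_mul_cancel₀ hn]
  have h4 : |1 - ‖v i‖| ≤ |1 - ‖f i‖| + ‖v i - f i‖ := by
    have e : (1 - ‖v i‖) = (1 - ‖f i‖) - (‖v i‖ - ‖f i‖) := by ring
    rw [e]
    exact (abs_sub _ _).trans (add_le_add le_rfl (abs_norm_sub_norm_le _ _))
  have h5 : ‖q i - f i‖ ≤ ‖q i - v i‖ + ‖v i - f i‖ := norm_sub_le_norm_sub_add_norm_sub _ _ _
  linarith

end GramSchmidt

/-! ### Orthonormalization in time order, and regularized Cholesky factors. -/

section Orthonormalize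

variable {V : Type*} [NormedAddCommGroup V] [InnerProductSpace ℝ V] {J L : ℕ}

/-- The linear order puts the time first, so Gram–Schmidt in this order is causal in time. -/
theorem fst_le_of_finProdFinEquiv_le {a b : Fin L × Fin J}
    (h : finProdFinEquiv a ≤ finProdFinEquiv b) : a.1 ≤ b.1 := by
  have h : (a.2 : ℕ) + J * a.1 ≤ b.2 + J * b.1 := h
  by_contra hcon
  have h1 : (b.1 : ℕ) + 1 ≤ a.1 := not_le.1 hcon
  have h2 := Nat.mul_le_mul_left J h1
  have := b.2.2
  rw [mul_add, mul_one] at h2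
  omega

/-- The Gram–Schmidt orthonormalization of a family indexed by `Fin L × Fin J`, in
lexicographic order. -/
def orthonormalize (f : Fin L × Fin J → V) (a : Fin L × Fin J) : V :=
  InnerProductSpace.gramSchmidtNormed ℝ (f ∘ finProdFinEquiv.symm) (finProdFinEquiv a)

theorem orthonormal_orthonormalize {f : Fin L × Fin J → V} (hf : LinearIndependent ℝ f) :
    Orthonormal ℝ (orthonormalize f) :=
  (InnerProductSpace.gramSchmidtNormed_orthonormal
    (hf.comp _ finProdFinEquiv.symm.injective)).comp _ finProdFinEquiv.injective

theorem orthonormalize_congr {f g : Fin L × Fin J → V} {a : Fin L × Fin J}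
    (h : ∀ b, b.1 ≤ a.1 → f b = g b) : orthonormalize f a = orthonormalize g a := by
  have := gramSchmidt_congr (f := f ∘ finProdFinEquiv.symm) (g := g ∘ finProdFinEquiv.symm)
    (i := finProdFinEquiv a) fun j hj => h _
      (fst_le_of_finProdFinEquiv_le (by rwa [Equiv.apply_symm_apply]))
  rw [orthonormalize, orthonormalize, InnerProductSpace.gramSchmidtNormed,
    InnerProductSpace.gramSchmidtNormed, this]

theorem measurable_orthonormalize {X : Type*} [MeasurableSpace X] [MeasurableSpace V]
    [BorelSpace V] [SecondCountableTopology V] {f : X → Fin L × Fin J → V}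
    (hf : ∀ a, Measurable fun x => f x a) (a : Fin L × Fin J) :
    Measurable fun x => orthonormalize (f x) a := by
  have := measurable_gramSchmidt (f := fun x => f x ∘ finProdFinEquiv.symm)
    (fun i => hf _) (finProdFinEquiv a)
  exact this.norm.inv.smul this

theorem norm_orthonormalize_sub_le (f : Fin L × Fin J → V) (a : Fin L × Fin J) :
    ‖orthonormalize f a - f a‖ ≤ |1 - ‖f a‖| +
      2 * ∑ b with finProdFinEquiv b < finProdFinEquiv a,
        (|inner ℝ (f b) (f a)| + ‖orthonormalize f b - f b‖ * ‖f a‖) := by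
  have h := norm_gramSchmidtNormed_sub_le (f := f ∘ finProdFinEquiv.symm) rfl (finProdFinEquiv a)
  simp only [Function.comp_apply, Equiv.symm_apply_apply] at h
  refine h.trans (le_of_eq ?_)
  congr 2
  symm
  refine Finset.sum_nbij' (fun b => finProdFinEquiv b) (fun i => finProdFinEquiv.symm i)
    ?_ ?_ ?_ ?_ ?_
  · simp
  · intro i hi
    simpa only [Finset.mem_filter, Finset.mem_univ, true_and, Equiv.apply_symm_apply,
      Finset.mem_Iio] using hi
  · simp
  · exact fun i _ => Equiv.apply_symm_apply _ i
  · intro b _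
    simp [orthonormalize]

theorem inner_orthonormalize_eq_zero (f : Fin L × Fin J → V) {a b : Fin L × Fin J}
    (h : finProdFinEquiv b < finProdFinEquiv a) : inner ℝ (orthonormalize f a) (f b) = 0 := by
  have := InnerProductSpace.gramSchmidt_inv_triangular ℝ (f ∘ finProdFinEquiv.symm) h
  rw [Function.comp_apply, Equiv.symm_apply_apply] at this
  rw [orthonormalize, InnerProductSpace.gramSchmidtNormed, real_inner_smul_left, this, mul_zero]

theorem exists_orthonormalize_eq_sum (f : Fin L × Fin J → V) :
    ∃ N : Kernel J L, (∀ a b, finProdFinEquiv b < finProdFinEquiv a → N a b = 0) ∧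
      ∀ b, orthonormalize f b = ∑ a, N a b • f a := by
  have h : ∀ b, ∃ c : Fin L × Fin J → ℝ, (∀ a, finProdFinEquiv b < finProdFinEquiv a → c a = 0) ∧
      orthonormalize f b = ∑ a, c a • f a := fun b => by
    have h1 : orthonormalize f b ∈
        Submodule.span ℝ (f '' {a | finProdFinEquiv a ≤ finProdFinEquiv b}) := by
      have : InnerProductSpace.gramSchmidt ℝ (f ∘ finProdFinEquiv.symm) (finProdFinEquiv b) ∈
          Submodule.span ℝ ((f ∘ finProdFinEquiv.symm) '' Set.Iic (finProdFinEquiv b)) :=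
        InnerProductSpace.gramSchmidt_mem_span ℝ _ le_rfl
      refine Submodule.smul_mem _ _ (Submodule.span_mono ?_ this)
      rintro _ ⟨i, hi, rfl⟩
      exact ⟨finProdFinEquiv.symm i, (Equiv.apply_symm_apply finProdFinEquiv i).trans_le hi, rfl⟩
    obtain ⟨c, hc, hcs⟩ := (Finsupp.mem_span_image_iff_linearCombination ℝ).1 h1
    refine ⟨c, fun a ha => ?_, ?_⟩
    · by_contra h
      exact absurd (hc (Finsupp.mem_support_iff.2 h)) (not_le.2 ha)
    · rw [← hcs, Finsupp.linearCombination_apply, Finsupp.sum_fintype _ _ (by simp)]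
  choose c hc hcs using h
  exact ⟨fun a b => c b a, fun a b hab => hc b a hab, hcs⟩

/-- An invertible block upper triangular square root of `Aᵀ A + D²`. -/
structure Regularization (A : Kernel J L) (D : Fin L × Fin J → ℝ) where
  R : Kernel J L
  N : Kernel J L
  R_upper : ∀ a b, b.1 < a.1 → R a b = 0
  N_upper : ∀ a b, b.1 < a.1 → N a b = 0
  R_mul_N : R * N = 1
  transpose_mul : R.transpose * R = A.transpose * A + Matrix.diagonal fun a => D a ^ 2
  abs_N_le : ∀ a b, |N a b| ≤ (D a)⁻¹

theorem Regularization.N_mul_R {A : Kernel J L} {D : Fin L × Fin J → ℝ}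
    (r : Regularization A D) : r.N * r.R = 1 := mul_eq_one_comm.1 r.R_mul_N

theorem Regularization.transpose_N_mul {A : Kernel J L} {D : Fin L × Fin J → ℝ}
    (r : Regularization A D) :
    r.N.transpose * (A.transpose * A + Matrix.diagonal fun a => D a ^ 2) * r.N = 1 := by
  rw [← r.transpose_mul, ← Matrix.mul_assoc, ← Matrix.transpose_mul, r.R_mul_N,
    Matrix.transpose_one, Matrix.one_mul, r.R_mul_N]

/-- The columns of `R` have the squared norms of those of `A` plus `D²`, so `R` stays bounded
however small `D` is. -/
theorem Regularization.abs_R_le {A : Kernel J L} {D : Fin L × Fin J → ℝ}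
    (r : Regularization A D) {κ : ℝ} (hA : ∀ a b, |A a b| ≤ κ) (hD : ∀ a, |D a| ≤ 1)
    (a b : Fin L × Fin J) : |r.R a b| ≤ L * J * κ + 1 := by
  have hκ : 0 ≤ κ := (abs_nonneg _).trans (hA a b)
  have h1 : ∑ c, r.R c b ^ 2 = ∑ c, A c b ^ 2 + D b ^ 2 := by
    have := congrFun (congrFun r.transpose_mul b) b
    simpa [Matrix.mul_apply, sq] using this
  have h2 : r.R a b ^ 2 ≤ ∑ c, A c b ^ 2 + D b ^ 2 := by
    rw [← h1]
    exact Finset.single_le_sum (f := fun c => r.R c b ^ 2) (fun _ _ => sq_nonneg _)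
      (Finset.mem_univ a)
  have h3 : ∑ c, A c b ^ 2 ≤ (L * J * κ) ^ 2 := by
    calc ∑ c, A c b ^ 2 = ∑ c, |A c b| ^ 2 := by simp
      _ ≤ (∑ c, |A c b|) ^ 2 := Finset.sum_sq_le_sq_sum_of_nonneg fun _ _ => abs_nonneg _
      _ ≤ (∑ _c : Fin L × Fin J, κ) ^ 2 := by gcongr; exact hA _ _
      _ = _ := by simp
  have h4 : D b ^ 2 ≤ 1 := by rw [← sq_abs]; exact pow_le_one₀ (abs_nonneg _) (hD b)
  refine abs_le_of_sq_le_sq ?_ (by positivity)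
  have : 0 ≤ L * J * κ := by positivity
  nlinarith

/-- Gram–Schmidt on the columns of `A` stacked on the diagonal matrix `D`. Their Gram matrix is `S =
AᵀA + D²`, the change of basis is `N` with `NᵀSN = 1`, and `R = NᵀS`. This also yields the bound on
`N`, which matters most: only the size of `D` enters, not the conditioning of `A`. -/
theorem nonempty_regularization (A : Kernel J L) {D : Fin L × Fin J → ℝ} (hD : ∀ a, 0 < D a) :
    Nonempty (Regularization A D) := by
  -- The lower half makes the columns linearly independent even when `A` is singular.
  let c : Fin L × Fin J → EuclideanSpace ℝ ((Fin L × Fin J) ⊕ (Fin L × Fin J)) := fun a =>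
    WithLp.toLp 2 (Sum.elim (fun i => A i a) (fun i => if i = a then D a else 0))
  have hc : LinearIndependent ℝ c := by
    rw [Fintype.linearIndependent_iff]
    intro g hg a
    have := congrArg (fun v : EuclideanSpace ℝ ((Fin L × Fin J) ⊕ (Fin L × Fin J)) => v (.inr a)) hg
    simp only [c, WithLp.ofLp_sum, Finset.sum_apply, PiLp.smul_apply, Sum.elim_inr, smul_eq_mul,
      mul_ite, mul_zero, Finset.sum_ite_eq, Finset.mem_univ, if_true, WithLp.ofLp_zero,
      Pi.zero_apply] at this
    exact (mul_eq_zero.1 this).resolve_right (hD a).ne'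
  have hin : ∀ a b, inner ℝ (c a) (c b) =
      (A.transpose * A + Matrix.diagonal fun a => D a ^ 2) a b := fun a b => by
    rw [EuclideanSpace.inner_eq_star_dotProduct]
    simp only [dotProduct, Pi.star_apply, star_trivial, c, Fintype.sum_sum_type, Sum.elim_inl,
      Sum.elim_inr, Matrix.add_apply, Matrix.mul_apply, Matrix.transpose_apply, Matrix.diagonal_apply]
    congr 1
    · exact Finset.sum_congr rfl fun i _ => mul_comm _ _
    · simp only [mul_ite, mul_zero, Finset.sum_ite_eq', Finset.mem_univ, if_true, ite_mul, zero_mul]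
      by_cases h : a = b
      · subst h; simp [sq]
      · simp [h]
  obtain ⟨N, hN, hNs⟩ := exists_orthonormalize_eq_sum c
  have ho := orthonormal_orthonormalize hc
  set S := A.transpose * A + Matrix.diagonal fun a => D a ^ 2 with hS
  have hR : ∀ a b, (N.transpose * S) a b = inner ℝ (orthonormalize c a) (c b) := fun a b => by
    rw [hNs, sum_inner, Matrix.mul_apply]
    simp [real_inner_smul_left, hin]
  have hRN : N.transpose * S * N = 1 := by
    ext a b
    rw [Matrix.mul_apply]
    simp_rw [hR, Matrix.one_apply, ← orthonormal_iff_ite.1 ho a b]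
    rw [hNs b, inner_sum]
    simp [real_inner_smul_right, mul_comm]
  have hNR : N * (N.transpose * S) = 1 := mul_eq_one_comm.1 hRN
  have hSt : S.transpose = S := by
    simp [hS, Matrix.transpose_add, Matrix.transpose_mul]
  refine ⟨⟨N.transpose * S, N, fun a b hab => ?_, fun a b hab => hN a b ?_, hRN, ?_, fun a b => ?_⟩⟩
  · rw [hR]
    refine inner_orthonormalize_eq_zero c ?_
    by_contra h
    exact absurd (fst_le_of_finProdFinEquiv_le (not_lt.1 h)) (not_le.2 hab)
  · by_contra h
    exact absurd (fst_le_of_finProdFinEquiv_le (not_lt.1 h)) (not_le.2 hab)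
  · rw [Matrix.transpose_mul, Matrix.transpose_transpose, hSt, Matrix.mul_assoc, hNR,
      Matrix.mul_one]
  -- The lower coordinates of an orthonormal vector are the entries of `N` times `D`, and they are
  -- at most 1.
  · have h1 : D a * N a b = orthonormalize c b (.inr a) := by
      rw [hNs b]
      simp [c, WithLp.ofLp_sum, mul_comm]
    have h2 : |orthonormalize c b (.inr a)| ≤ 1 := by
      rw [← ho.1 b]; exact PiLp.norm_apply_le (orthonormalize c b) (.inr a)
    rw [← h1, abs_mul, abs_of_pos (hD a)] at h2
    rwa [← one_div, le_div_iff₀' (hD a)]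

end Orthonormalize

end DMF

end

noncomputable section

namespace DMF

/-! ### Adaptive overwriting of a Gaussian vector. -/

section AdaptiveLaw

variable {κ ω ι : Type*} [Fintype κ] [Fintype ω] [Fintype ι]

/-- A step that overwrites the projection of a vector `W` to an `ι`-dimensional subspace by fresh
noise. The isometry `frame y` that spans the subspace may depend on the noise `y`. -/
structure AdaptiveStep (κ ω ι : Type*) [Fintype κ] [Fintype ω] [Fintype ι] [DecidableEq ι] where
  coord : ι → κ
  coord_injective : Function.Injective coord
  frame : (κ → ℝ) → Matrix ω ι ℝ
  isometry : ∀ y, (frame y).transpose * frame y = 1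
  measurable : ∀ i j, Measurable fun y => frame y i j

variable [DecidableEq ι]

namespace AdaptiveStep

/-- The action of a step. -/
def act (s : AdaptiveStep κ ω ι) (y : κ → ℝ) (W : ω → ℝ) : ω → ℝ :=
  W + (s.frame y).mulVec ((fun i => y (s.coord i)) - (s.frame y).transpose.mulVec W)

/-- The action of a list of steps, the last step acting first. -/
def run (ℓ : List (AdaptiveStep κ ω ι)) (y : κ → ℝ) (W : ω → ℝ) : ω → ℝ :=
  ℓ.foldr (fun s W => s.act y W) W

/-- The frame of `s` does not depend on the fresh noise of `s'`. -/
def IndepOf (s s' : AdaptiveStep κ ω ι) : Prop :=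
  ∀ y v, s.frame (Function.extend s'.coord v y) = s.frame y

theorem measurable_act (s : AdaptiveStep κ ω ι) {X : Type*} [MeasurableSpace X] {f : X → κ → ℝ}
    {g : X → ω → ℝ} (hf : Measurable f) (hg : Measurable g) :
    Measurable fun x => s.act (f x) (g x) := by
  have h : ∀ i j, Measurable fun x => s.frame (f x) i j := fun i j => (s.measurable i j).comp hf
  unfold act Matrix.mulVec dotProduct
  refine measurable_pi_iff.2 fun i => ?_
  simp only [Pi.add_apply, Pi.sub_apply, Matrix.transpose_apply]
  fun_prop

theorem measurable_run (ℓ : List (AdaptiveStep κ ω ι)) :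
    Measurable fun p : (κ → ℝ) × (ω → ℝ) => run ℓ p.1 p.2 := by
  induction ℓ with
  | nil => exact measurable_snd
  | cons s ℓ ih => exact s.measurable_act measurable_fst ih

/-- The map is `[a, 1 - a aᵀ]` applied to the pair, a coisometry because `a aᵀ` is the orthogonal
projection onto the range of `a`. -/
theorem measurePreserving_act_aux [DecidableEq ω] (a : Matrix ω ι ℝ) (ha : a.transpose * a = 1) :
    MeasurePreserving (fun p : (ι → ℝ) × (ω → ℝ) => p.2 + a.mulVec (p.1 - a.transpose.mulVec p.2))
      ((gaussPi ι).prod (gaussPi ω)) (gaussPi ω) := by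
  have h := (measurePreserving_mulVec (Matrix.fromCols a (1 - a * a.transpose)) (by
    have e1 : a * a.transpose * (a * a.transpose) = a * a.transpose := by
      rw [Matrix.mul_assoc, ← Matrix.mul_assoc a.transpose, ha, Matrix.one_mul]
    rw [Matrix.transpose_fromCols, Matrix.fromCols_mul_fromRows]
    simp only [Matrix.transpose_sub, Matrix.transpose_one, Matrix.transpose_mul,
      Matrix.transpose_transpose, Matrix.mul_sub, Matrix.sub_mul, Matrix.one_mul, Matrix.mul_one,
      e1]
    abel)).comp measurePreserving_sumElim
  convert h using 2 with p
  simp only [Function.comp_apply, Matrix.fromCols_mulVec_sumElim, Matrix.sub_mulVec,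
    Matrix.one_mulVec, Matrix.mulVec_sub, Matrix.mulVec_mulVec]
  abel

/-- Heads of the list are early steps, and they act last. The frame of a step must not see its own
noise nor that of later steps. Hence, after the head has been absorbed into the test function, the
latter is still insensitive to the noise of the tail, and the tail can be removed by induction. Then
the head is removed by integrating over its own noise. The test function may depend on `y`, which
the induction needs. -/
theorem lintegral_run (ℓ : List (AdaptiveStep κ ω ι))
    (hself : ∀ s ∈ ℓ, s.IndepOf s)
    (hpair : ℓ.Pairwise fun s s' => s.IndepOf s' ∧ ∀ i j, s.coord i ≠ s'.coord j)
    {Φ : (κ → ℝ) × (ω → ℝ) → ENNReal} (hΦ : Measurable Φ)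
    (hind : ∀ s ∈ ℓ, ∀ y v W, Φ (Function.extend s.coord v y, W) = Φ (y, W)) :
    ∫⁻ p, Φ (p.1, run ℓ p.1 p.2) ∂((gaussPi κ).prod (gaussPi ω)) =
      ∫⁻ p, Φ p ∂((gaussPi κ).prod (gaussPi ω)) := by
  classical
  induction ℓ generalizing Φ with
  | nil => rfl
  | cons s ℓ ih =>
    rw [List.pairwise_cons] at hpair
    have hΦ' : Measurable fun p : (κ → ℝ) × (ω → ℝ) => Φ (p.1, s.act p.1 p.2) :=
      hΦ.comp (measurable_fst.prodMk (s.measurable_act measurable_fst measurable_snd))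
    -- Apply the induction hypothesis to the test function composed with the action of the head.
    have h1 := ih (fun s' hs' => hself s' (by simp [hs'])) hpair.2 hΦ' (fun s' hs' y v W => by
      have h2 := hpair.1 s' hs'
      have e : s.act (Function.extend s'.coord v y) W = s.act y W := by
        unfold act
        rw [h2.1 y v]
        congr 3
        funext i
        exact Function.extend_apply' _ _ _ fun ⟨j, hj⟩ => h2.2 i j hj.symm
      simp only [e]
      exact hind s' (by simp [hs']) y v _)
    refine Eq.trans h1 ?_
    rw [lintegral_prod _ hΦ'.aemeasurable, lintegral_prod _ hΦ.aemeasurable]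
    have hΨ : Measurable fun y => ∫⁻ W, Φ (y, s.act y W) ∂(gaussPi ω) := hΦ'.lintegral_prod_right'
    have hΨ' : Measurable fun p : (κ → ℝ) × (ι → ℝ) =>
        ∫⁻ W, Φ (Function.extend s.coord p.2 p.1, s.act (Function.extend s.coord p.2 p.1) W)
          ∂(gaussPi ω) := hΨ.comp (measurePreserving_extend s.coord).measurable
    -- Resample the coordinates of the head. With everything else fixed, its frame is constant and
    -- the overwriting map preserves the Gaussian law.
    rw [← (measurePreserving_extend s.coord).lintegral_comp hΨ, lintegral_prod _ hΨ'.aemeasurable]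
    refine lintegral_congr fun y => ?_
    have h3 := measurePreserving_act_aux (s.frame y) (s.isometry y)
    have hΦy : Measurable fun W => Φ (y, W) := hΦ.comp measurable_prodMk_left
    have hm : Measurable fun p : (ι → ℝ) × (ω → ℝ) => Φ (y, p.2 + (s.frame y).mulVec
        (p.1 - (s.frame y).transpose.mulVec p.2)) := hΦy.comp h3.measurable
    rw [← h3.lintegral_comp hΦy, lintegral_prod _ hm.aemeasurable]
    refine lintegral_congr fun v => lintegral_congr fun W => ?_
    rw [hind s (by simp)]
    simp only [act, hself s (by simp) y v, s.coord_injective.extend_apply]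

theorem measurePreserving_run (ℓ : List (AdaptiveStep κ ω ι))
    (hself : ∀ s ∈ ℓ, s.IndepOf s)
    (hpair : ℓ.Pairwise fun s s' => s.IndepOf s' ∧ ∀ i j, s.coord i ≠ s'.coord j) :
    MeasurePreserving (fun p : (κ → ℝ) × (ω → ℝ) => run ℓ p.1 p.2)
      ((gaussPi κ).prod (gaussPi ω)) (gaussPi ω) := by
  refine ⟨measurable_run ℓ, Measure.ext fun S hS => ?_⟩
  have h := lintegral_run ℓ hself hpair
    (Φ := fun p => S.indicator 1 p.2) ((measurable_one.indicator hS).comp measurable_snd)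
    (fun _ _ _ _ _ => rfl)
  have h' : ∫⁻ p, S.indicator 1 p.2 ∂((gaussPi κ).prod (gaussPi ω)) = gaussPi ω S := by
    rw [← lintegral_indicator_one hS]
    exact measurePreserving_snd.lintegral_comp (measurable_one.indicator hS)
  rw [← h', ← h, Measure.map_apply (measurable_run ℓ) hS,
    ← lintegral_indicator_one (measurable_run ℓ hS)]
  rfl

end AdaptiveStep

end AdaptiveLaw

set_option linter.unusedSectionVars false

/-! ### Overwriting products of Gaussian matrices with orthonormal directions. -/

section RowColumnSteps

variable {Z A I : Type*} [Fintype Z] [DecidableEq Z] [Fintype A] [DecidableEq A] [Fintype I]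
  [DecidableEq I]

/-- The action of block `ζ` of `W` on a vector: `Wᵀ u` for `k = true`, and `W u` for
`k = false`. -/
def blockMul (W : Z × I × I → ℝ) (k : Bool) (ζ : Z) (u : EuclideanSpace ℝ I) :
    EuclideanSpace ℝ I :=
  WithLp.toLp 2 fun c => ∑ i, (if k then W (ζ, i, c) else W (ζ, c, i)) * u i

theorem inner_eq_sum (u v : EuclideanSpace ℝ I) : inner ℝ u v = ∑ i, u i * v i := by
  rw [EuclideanSpace.inner_eq_star_dotProduct]
  simp [dotProduct, mul_comm]

/-- The frame of a step that prescribes `Wᵀ q` or `W q` in block `ζ`. -/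
def stepFrame (k : Bool) (ζ : Z) (q : EuclideanSpace ℝ I) : Matrix (Z × I × I) I ℝ :=
  Matrix.of fun p c => if p.1 = ζ then
    (if k then (if p.2.2 = c then q p.2.1 else 0) else (if p.2.1 = c then q p.2.2 else 0)) else 0

theorem stepFrame_transpose_mulVec (k : Bool) (ζ : Z) (q : EuclideanSpace ℝ I)
    (W : Z × I × I → ℝ) :
    (stepFrame k ζ q).transpose.mulVec W = (blockMul W k ζ q).ofLp := by
  ext c
  simp only [Matrix.mulVec, dotProduct, Matrix.transpose_apply, stepFrame, Matrix.of_apply,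
    Fintype.sum_prod_type, blockMul, ite_mul, zero_mul]
  rw [Finset.sum_eq_single ζ (fun b _ hb => by simp [hb]) (by simp)]
  cases k
  · simp only [if_true, if_false, Bool.false_eq_true]
    rw [Finset.sum_eq_single c (fun b _ hb => by simp [hb]) (by simp)]
    simp [mul_comm]
  · simp [mul_comm]

theorem stepFrame_isometry (k : Bool) (ζ : Z) {q : EuclideanSpace ℝ I} (hq : ‖q‖ = 1) :
    (stepFrame k ζ q).transpose * stepFrame k ζ q = 1 := by
  have hq2 : ∑ i, q i * q i = 1 := by
    rw [← inner_eq_sum, real_inner_self_eq_norm_sq, hq, one_pow]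
  ext c c'
  have h := congrFun (stepFrame_transpose_mulVec k ζ q fun p => stepFrame k ζ q p c') c
  have e : ((stepFrame k ζ q).transpose * stepFrame k ζ q) c c' =
    (stepFrame k ζ q).transpose.mulVec (fun p => stepFrame k ζ q p c') c := rfl
  rw [e, h]
  cases k <;> by_cases hc : c = c' <;>
    simp [blockMul, stepFrame, hc, Matrix.one_apply, hq2]

/-- The update has rank one. Orthogonality to `q` means that the product with `u` is not disturbed.
-/
theorem blockMul_step_same (W : Z × I × I → ℝ) (k : Bool) (ζ : Z) (q u : EuclideanSpace ℝ I)
    (v : I → ℝ) :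
    blockMul (W + (stepFrame k ζ q).mulVec v) k ζ u =
      blockMul W k ζ u + inner ℝ q u • WithLp.toLp 2 v := by
  ext c
  cases k <;> simp [blockMul, stepFrame, Matrix.mulVec, dotProduct, add_mul,
    Finset.sum_add_distrib, inner_eq_sum, Finset.sum_mul] <;>
    exact Finset.sum_congr rfl fun _ _ => by ring

/-- Transposing the rank-one update exchanges the roles of `q` and `v`. This is the only way in
which rows and columns interact, and the origin of the memory terms. -/
theorem blockMul_step_other (W : Z × I × I → ℝ) (k : Bool) (ζ : Z) (q u : EuclideanSpace ℝ I)
    (v : I → ℝ) :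
    blockMul (W + (stepFrame k ζ q).mulVec v) (!k) ζ u =
      blockMul W (!k) ζ u + inner ℝ (WithLp.toLp 2 v) u • q := by
  ext c
  cases k <;> simp [blockMul, stepFrame, Matrix.mulVec, dotProduct, add_mul,
    Finset.sum_add_distrib, inner_eq_sum, Finset.sum_mul] <;>
    exact Finset.sum_congr rfl fun _ _ => by ring

theorem blockMul_step_ne (W : Z × I × I → ℝ) (k k' : Bool) {ζ ζ' : Z} (h : ζ' ≠ ζ)
    (q u : EuclideanSpace ℝ I) (v : I → ℝ) :
    blockMul (W + (stepFrame k ζ q).mulVec v) k' ζ' u = blockMul W k' ζ' u := by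
  ext c
  simp [blockMul, stepFrame, Matrix.mulVec, dotProduct, h]

theorem inner_blockMul (W : Z × I × I → ℝ) (k : Bool) (ζ : Z) (q u : EuclideanSpace ℝ I) :
    inner ℝ (blockMul W k ζ q) u = inner ℝ q (blockMul W (!k) ζ u) := by
  simp only [inner_eq_sum, blockMul, Finset.sum_mul, Finset.mul_sum]
  rw [Finset.sum_comm]
  refine Finset.sum_congr rfl fun i _ => Finset.sum_congr rfl fun j _ => ?_
  cases k <;> simp <;> ring

/-- The noise of a step as a vector. -/
def noiseVec {S : Type*} (y : S × I → ℝ) (σ : S) : EuclideanSpace ℝ I :=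
  WithLp.toLp 2 fun i => y (σ, i)

/-- The action of a list of row and column steps with directions `dir σ`. -/
def runSteps (dir : Bool × Z × A → EuclideanSpace ℝ I) (y : (Bool × Z × A) × I → ℝ)
    (ℓ : List (Bool × Z × A)) (W : Z × I × I → ℝ) : Z × I × I → ℝ :=
  ℓ.foldr (fun σ W => W + (stepFrame σ.1 σ.2.1 (dir σ)).mulVec
    ((noiseVec y σ).ofLp - (blockMul W σ.1 σ.2.1 (dir σ)).ofLp)) W

/-- The step that prescribes the product with a direction gives the noise vector. Earlier steps,
which act afterwards, change it only if they are of the opposite kind in the same block. Each adds a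
multiple of its own direction; by orthonormality these multiples do not influence one another. -/
theorem blockMul_runSteps (dir : Bool × Z × A → EuclideanSpace ℝ I)
    (hdir : ∀ k ζ, Orthonormal ℝ fun a => dir (k, ζ, a)) (y : (Bool × Z × A) × I → ℝ)
    {time : Bool × Z × A → ℕ} (htime : ∀ k ζ a b, time (k, ζ, a) ≠ time (!k, ζ, b))
    (W : Z × I × I → ℝ) (ℓ : List (Bool × Z × A)) (hnodup : ℓ.Nodup)
    (hsort : ℓ.Pairwise fun σ τ => time σ ≤ time τ) (k : Bool) (ζ : Z) (a : A)
    (hmem : (k, ζ, a) ∈ ℓ) :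
    blockMul (runSteps dir y ℓ W) k ζ (dir (k, ζ, a)) = noiseVec y (k, ζ, a) +
      ∑ b with (!k, ζ, b) ∈ ℓ ∧ time (!k, ζ, b) < time (k, ζ, a),
        (inner ℝ (noiseVec y (!k, ζ, b)) (dir (k, ζ, a)) -
          inner ℝ (dir (!k, ζ, b)) (noiseVec y (k, ζ, a))) • dir (!k, ζ, b) := by
  induction ℓ with
  | nil => simp at hmem
  | cons τ ℓ ih =>
    rw [List.nodup_cons] at hnodup
    rw [List.pairwise_cons] at hsort
    set W' := runSteps dir y ℓ W with hW'
    have hrun : runSteps dir y (τ :: ℓ) W = W' + (stepFrame τ.1 τ.2.1 (dir τ)).mulVec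
      ((noiseVec y τ).ofLp - (blockMul W' τ.1 τ.2.1 (dir τ)).ofLp) := rfl
    rw [hrun]
    rcases List.mem_cons.1 hmem with rfl | hmem'
    -- The step of the direction itself has just acted: the product equals its noise, and no
    -- strictly earlier direction is in the list.
    · rw [blockMul_step_same, real_inner_self_eq_norm_sq, (hdir k ζ).1 a, Finset.sum_eq_zero]
      · simp
      · intro b hb
        obtain ⟨h1, h2⟩ := (Finset.mem_filter.1 hb).2
        rcases List.mem_cons.1 h1 with h1 | h1
        · simp at h1
        · exact absurd (hsort.1 _ h1) (not_le.2 h2)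
    · have IH := ih hnodup.2 hsort.2 hmem'
      obtain ⟨k', ζ', b₀⟩ := τ
      by_cases hζ : ζ = ζ'
      swap
      · rw [blockMul_step_ne _ _ _ hζ, IH]
        congr 2
        ext b
        simp [hζ]
      subst hζ
      by_cases hk : k' = k
      · subst hk
        -- Same block and same kind: the two directions are orthogonal.
        have hab : b₀ ≠ a := by rintro rfl; exact hnodup.1 hmem'
        rw [blockMul_step_same, (hdir k' ζ).2 hab, zero_smul, add_zero, IH]
        congr 2
        ext b
        simp
      · have hk : k' = !k := by cases k <;> cases k' <;> simp_all
        subst hk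
        have hlt : time (!k, ζ, b₀) < time (k, ζ, a) :=
          lt_of_le_of_ne (hsort.1 _ hmem') (htime k ζ a b₀).symm
        have hstep := blockMul_step_other W' (!k) ζ (dir (!k, ζ, b₀)) (dir (k, ζ, a))
          ((noiseVec y (!k, ζ, b₀)).ofLp - (blockMul W' (!k) ζ (dir (!k, ζ, b₀))).ofLp)
        rw [Bool.not_not] at hstep
        rw [hstep, IH]
        have hset : (Finset.univ.filter fun b => (!k, ζ, b) ∈ (!k, ζ, b₀) :: ℓ ∧
            time (!k, ζ, b) < time (k, ζ, a)) = insert b₀ (Finset.univ.filter fun b =>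
            (!k, ζ, b) ∈ ℓ ∧ time (!k, ζ, b) < time (k, ζ, a)) := by
          ext b
          simp only [List.mem_cons, Prod.mk.injEq, true_and, Finset.mem_filter, Finset.mem_univ,
            Finset.mem_insert]
          constructor
          · rintro ⟨rfl | h, h'⟩
            · exact .inl rfl
            · exact .inr ⟨h, h'⟩
          · rintro (rfl | ⟨h, h'⟩)
            · exact ⟨.inl rfl, hlt⟩
            · exact ⟨.inr h, h'⟩
        rw [hset, Finset.sum_insert (by simp [hnodup.1]), add_assoc, add_comm (Finset.sum _ _)]
        congr 3
        have e : WithLp.toLp 2 ((noiseVec y (!k, ζ, b₀)).ofLp -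
            (blockMul W' (!k) ζ (dir (!k, ζ, b₀))).ofLp) =
            noiseVec y (!k, ζ, b₀) - blockMul W' (!k) ζ (dir (!k, ζ, b₀)) := rfl
        -- By duality the old product with `dir b₀`, tested against `dir a`, is `dir b₀` tested
        -- against the product with `dir a`, which the induction hypothesis knows. Its corrections
        -- are orthogonal to `dir b₀`.
        rw [e, inner_sub_left, inner_blockMul, Bool.not_not, IH, inner_add_right, inner_sum,
          Finset.sum_eq_zero, add_zero]
        intro b hb
        have hb' := (Finset.mem_filter.1 hb).2.1
        have : b₀ ≠ b := by rintro rfl; exact hnodup.1 hb'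
        rw [real_inner_smul_right, (hdir (!k) ζ).2 this, mul_zero]

end RowColumnSteps

end DMF

end

noncomputable section

namespace DMF

/-- The index set of the vectors of the construction: it contains the rows, the columns, and
auxiliary coordinates that make the families linearly independent. -/
abbrev Ambient (J L n m : ℕ) : Type := Fin n ⊕ Fin m ⊕ (Fin L × Fin J)

/-- The index set of the directions: `(true, ζ, a)` stands for the column `a` of `R(ζ)^{1/2} Θ̄`,
and `(false, ζ, a)` for the column `a` of `Ω̄_ζ`. -/
abbrev StepIdx (dz J L : ℕ) : Type := Bool × Fin dz × (Fin L × Fin J)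

/-- Gaussian entries for each direction. -/
abbrev StepNoise (dz J L n m : ℕ) : Type := StepIdx dz J L × Ambient J L n m → ℝ

/-- The time at which a direction is known. -/
def stepTime {dz J L : ℕ} (σ : StepIdx dz J L) : ℕ := 2 * σ.2.2.1 + if σ.1 then 0 else 1

variable {dz J L n m : ℕ}

/-- The parameters `A_θ` and `A_ω`. -/
def Params.A (P : Params dz J L n) (k : Bool) (ζ : Fin dz) : Kernel J L :=
  if k then P.Atheta ζ else P.Aomega ζ

/-- The parameters `B_ω` and `B_θ`. -/
def Params.B (P : Params dz J L n) (k : Bool) (ζ : Fin dz) : Kernel J L :=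
  if k then P.Bomega ζ else P.Btheta ζ

/-- The same parameters with other values of `A_θ` and `A_ω`. -/
def Params.withA (P : Params dz J L n) (A : Bool → Fin dz → Kernel J L) : Params dz J L n :=
  { P with Atheta := A true, Aomega := A false }

/-- The noise of the mean-field dynamics, taken from the entries for each direction. -/
def noiseOf (z : Fin m → Fin dz) (y : StepNoise dz J L n m) : Noise dz J L n m :=
  (z, fun ζ i a => y ((false, ζ, a), .inl i), fun k a => y ((true, z k, a), .inr (.inl k)))

/-- The columns of `R(ζ)^{1/2} Θ̄` and of `Ω̄_ζ / √m` as vectors of the ambient space. -/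
def Model.feature (M : Model dz J L n m) (P : Params dz J L n) (k : Bool) (ζ : Fin dz)
    (a : Fin L × Fin J) (s : Noise dz J L n m) : EuclideanSpace ℝ (Ambient J L n m) :=
  if k then WithLp.toLp 2 (Sum.elim (M.vecTheta P ζ a s).ofLp fun _ => 0)
  else WithLp.toLp 2 (Sum.elim (fun _ => 0) (Sum.elim (M.vecOmega P ζ a s).ofLp fun _ => 0))

/-- The two families of overlaps. -/
def Model.overlap (M : Model dz J L n m) (P : Params dz J L n) (k : Bool) (ζ : Fin dz)
    (a b : Fin L × Fin J) (s : Noise dz J L n m) : ℝ :=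
  if k then M.overlapTheta P ζ a b s else M.overlapOmega P ζ a b s

/-- The two families of correlations of the features with the noise. -/
def Model.cross (M : Model dz J L n m) (P : Params dz J L n) (k : Bool) (ζ : Fin dz)
    (a b : Fin L × Fin J) (s : Noise dz J L n m) : ℝ :=
  if k then M.crossTheta P ζ a b s else M.crossOmega P ζ a b s

/-! ### Features of the mean-field dynamics and their causality. -/

section Features

variable {M : Model dz J L n m} {C K : ℝ}

theorem feature_true (P : Params dz J L n) (ζ : Fin dz) (a : Fin L × Fin J)
    (s : Noise dz J L n m) :
    M.feature P true ζ a s = WithLp.toLp 2 (Sum.elim (M.vecTheta P ζ a s).ofLp fun _ => 0) := rfl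

theorem feature_false (P : Params dz J L n) (ζ : Fin dz) (a : Fin L × Fin J)
    (s : Noise dz J L n m) :
    M.feature P false ζ a s =
      WithLp.toLp 2 (Sum.elim (fun _ => 0) (Sum.elim (M.vecOmega P ζ a s).ofLp fun _ => 0)) := rfl

theorem inner_feature (P : Params dz J L n) (k : Bool) (ζ : Fin dz) (a b : Fin L × Fin J)
    (s : Noise dz J L n m) :
    inner ℝ (M.feature P k ζ a s) (M.feature P k ζ b s) = M.overlap P k ζ a b s := by
  cases k
  · simp [Model.overlap, overlapOmega_eq_inner, feature_false, inner_eq_sum]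
  · simp [Model.overlap, overlapTheta_eq_inner, feature_true, inner_eq_sum]

/-- The noise of kind `!k` drives the dynamics that produces the features of kind `k`. For `ω̄_ζ`
only the rows of latent value `ζ` contribute, and there the noise is the corresponding row of `H_ζ`.
-/
theorem inner_noiseVec_feature (P : Params dz J L n) (k : Bool) (ζ : Fin dz)
    (a c : Fin L × Fin J) (z : Fin m → Fin dz) (x : StepNoise dz J L n m) :
    inner ℝ (noiseVec x (!k, ζ, a)) (M.feature P k ζ c (noiseOf z x)) / Real.sqrt m =
      M.cross P k ζ a c (noiseOf z x) := by
  cases k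
  · simp only [Model.cross, crossOmega_eq_inner, feature_false, inner_eq_sum,
      Fintype.sum_sum_type, Bool.false_eq_true, if_false]
    congr 1
    simp only [Sum.elim_inl, Sum.elim_inr, mul_zero, Finset.sum_const_zero, zero_add,
      add_zero]
    refine Finset.sum_congr rfl fun i _ => ?_
    by_cases h : z i = ζ
    · subst h; rfl
    · simp [Model.vecOmega, noiseOf, h]
  · simp only [Model.cross, crossTheta_eq_inner, feature_true, inner_eq_sum,
      Fintype.sum_sum_type, if_true]
    congr 1
    simp [vecG, noiseVec, noiseOf]

theorem norm_feature_true (P : Params dz J L n) (ζ : Fin dz) (a : Fin L × Fin J)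
    (s : Noise dz J L n m) : ‖M.feature P true ζ a s‖ = ‖M.vecTheta P ζ a s‖ := by
  rw [feature_true, EuclideanSpace.norm_eq, EuclideanSpace.norm_eq]
  simp

theorem norm_feature_false (P : Params dz J L n) (ζ : Fin dz) (a : Fin L × Fin J)
    (s : Noise dz J L n m) : ‖M.feature P false ζ a s‖ = ‖M.vecOmega P ζ a s‖ := by
  rw [feature_false, EuclideanSpace.norm_eq, EuclideanSpace.norm_eq]
  simp

theorem norm_vecTheta_sub_le (hK : M.BoundedBy K) (P P' : Params dz J L n) (ζ : Fin dz)
    (a : Fin L × Fin J) (s s' : Noise dz J L n m) :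
    ‖M.vecTheta P' ζ a s' - M.vecTheta P ζ a s‖ ≤
      Real.sqrt K * l2norm (M.thetaBar P' s' a.1 - M.thetaBar P s a.1) := by
  rw [Model.vecTheta, Model.vecTheta, ← map_sub, ← col_sub]
  exact (ContinuousLinearMap.le_opNorm _ _).trans (mul_le_mul (norm_covSqrt_le hK ζ)
    (norm_col_le _ _) (norm_nonneg _) (Real.sqrt_nonneg _))

theorem norm_vecOmega_sub_le (P P' : Params dz J L n) (ζ : Fin dz)
    (a : Fin L × Fin J) (s s' : Noise dz J L n m) (hz : s'.1 = s.1) :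
    ‖M.vecOmega P' ζ a s' - M.vecOmega P ζ a s‖ ≤
      l2norm (M.omegaBar P' s' a.1 - M.omegaBar P s a.1) / Real.sqrt m := by
  have h : ‖M.vecOmega P' ζ a s' - M.vecOmega P ζ a s‖ ≤
      ‖(Real.sqrt m)⁻¹ • col (M.omegaBar P' s' a.1 - M.omegaBar P s a.1) a.2‖ := by
    rw [EuclideanSpace.norm_eq, EuclideanSpace.norm_eq]
    refine Real.sqrt_le_sqrt (Finset.sum_le_sum fun k _ => ?_)
    simp only [Model.vecOmega, PiLp.smul_apply, PiLp.sub_apply, col_apply, smul_eq_mul,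
      Real.norm_eq_abs, sq_abs, hz, Pi.sub_apply]
    split_ifs
    · rw [← sub_div, div_eq_inv_mul]
    · simp [sq_nonneg]
  refine h.trans ?_
  rw [norm_smul, norm_inv, Real.norm_of_nonneg (Real.sqrt_nonneg _), div_eq_inv_mul]
  exact mul_le_mul_of_nonneg_left (norm_col_le _ _) (by positivity)

theorem thetaBar_withA (P : Params dz J L n) (A : Bool → Fin dz → Kernel J L)
    (s : Noise dz J L n m) (l : Fin L) :
    M.thetaBar (P.withA A) s l = M.theta (M.labels s.1) l
      (M.dmfSolution P s.1 (M.gTilde (P.withA A) s) (hTilde (P.withA A) s)) := rfl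

theorem omegaBar_withA (P : Params dz J L n) (A : Bool → Fin dz → Kernel J L)
    (s : Noise dz J L n m) (l : Fin L) :
    M.omegaBar (P.withA A) s l = M.omega (M.labels s.1) l
      (M.dmfSolution P s.1 (M.gTilde (P.withA A) s) (hTilde (P.withA A) s)) := rfl

/-- The total difference of the inputs of two instances of the mean-field dynamics before
time `T`. -/
def Model.inputDist (M : Model dz J L n m) (P P' : Params dz J L n) (s s' : Noise dz J L n m)
    (T : ℕ) : ℝ :=
  ∑ r ∈ Finset.range T, stepNorm (inputBlocks (M.gTilde P' s' - M.gTilde P s)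
    (hTilde P' s' - hTilde P s)) r

/-- A feature of time `t` sees inputs of times strictly below `t` only. Both instances share `B`,
`e` and `β`, so they differ only through their inputs. -/
theorem norm_feature_sub_le (hM : M.LipschitzUpdates C) (hC : 0 ≤ C)
    (hK : M.BoundedBy K) (hK0 : 0 ≤ K) {P : Params dz J L n} {b : ℝ} (hb : 0 ≤ b)
    (hB : ∀ t, P.MemoryBound b t) (A A' : Bool → Fin dz → Kernel J L)
    (s s' : Noise dz J L n m) (hz : s'.1 = s.1) (σ : StepIdx dz J L) :
    ‖M.feature (P.withA A') σ.1 σ.2.1 σ.2.2 s' - M.feature (P.withA A) σ.1 σ.2.1 σ.2.2 s‖ ≤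
      (Real.sqrt K + 1) * (responseConst dz J L C K b (stepTime σ) *
        M.inputDist (P.withA A) (P.withA A') s s' (stepTime σ)) := by
  obtain ⟨k, ζ, a⟩ := σ
  obtain ⟨rhs, hrhs⟩ : ∃ rhs, rhs = responseConst dz J L C K b (stepTime (k, ζ, a)) *
    M.inputDist (P.withA A) (P.withA A') s s' (stepTime (k, ζ, a)) := ⟨_, rfl⟩
  have h := M.sum_stepNorm_dmfSolution_le hM hC hK hK0 hb (T := stepTime (k, ζ, a))
    (fun t _ => hB t) s.1 (M.gTilde (P.withA A') s') (M.gTilde (P.withA A) s)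
    (hTilde (P.withA A') s') (hTilde (P.withA A) s)
  change _ ≤ responseConst dz J L C K b (stepTime (k, ζ, a)) *
    M.inputDist (P.withA A) (P.withA A') s s' (stepTime (k, ζ, a)) at h
  rw [← hrhs] at h ⊢
  have h0 : 0 ≤ rhs := le_trans (mul_nonneg hC (sum_stepNorm_nonneg _ _)) h
  cases k
  · have e : M.feature (P.withA A') false ζ a s' - M.feature (P.withA A) false ζ a s =
        WithLp.toLp 2 (Sum.elim (fun _ => 0) (Sum.elim
          (M.vecOmega (P.withA A') ζ a s' - M.vecOmega (P.withA A) ζ a s).ofLp fun _ => 0)) := by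
      ext (i | i | i) <;> simp [feature_false]
    have e2 : ‖M.feature (P.withA A') false ζ a s' - M.feature (P.withA A) false ζ a s‖ =
        ‖M.vecOmega (P.withA A') ζ a s' - M.vecOmega (P.withA A) ζ a s‖ := by
      rw [e, EuclideanSpace.norm_eq, EuclideanSpace.norm_eq]
      simp
    rw [e2]
    refine (norm_vecOmega_sub_le _ _ ζ a s s' hz).trans ?_
    have h1 := (hM.omega_le hC (M.labels s.1) a.1 (M.dmfSolution P s.1
      (M.gTilde (P.withA A') s') (hTilde (P.withA A') s')) (M.dmfSolution P s.1
      (M.gTilde (P.withA A) s) (hTilde (P.withA A) s))).trans h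
    rw [omegaBar_withA, omegaBar_withA, hz]
    have := Real.sqrt_nonneg K
    nlinarith
  · have e : M.feature (P.withA A') true ζ a s' - M.feature (P.withA A) true ζ a s =
        WithLp.toLp 2 (Sum.elim
          (M.vecTheta (P.withA A') ζ a s' - M.vecTheta (P.withA A) ζ a s).ofLp fun _ => 0) := by
      ext (i | i | i) <;> simp [feature_true]
    have e2 : ‖M.feature (P.withA A') true ζ a s' - M.feature (P.withA A) true ζ a s‖ =
        ‖M.vecTheta (P.withA A') ζ a s' - M.vecTheta (P.withA A) ζ a s‖ := by
      rw [e, EuclideanSpace.norm_eq, EuclideanSpace.norm_eq]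
      simp
    rw [e2]
    refine (norm_vecTheta_sub_le hK _ _ ζ a s s').trans ?_
    have h1 := (hM.theta_le hC (M.labels s.1) a.1 (M.dmfSolution P s.1
      (M.gTilde (P.withA A') s') (hTilde (P.withA A') s')) (M.dmfSolution P s.1
      (M.gTilde (P.withA A) s) (hTilde (P.withA A) s))).trans h
    rw [thetaBar_withA, thetaBar_withA, hz]
    have := mul_le_mul_of_nonneg_left h1 (Real.sqrt_nonneg K)
    linarith

theorem stepNorm_eq_zero_of {ξ : Blocks J L n m} {T : ℕ}
    (h0 : ∀ l : Fin L, 2 * (l : ℕ) < T → ξ.2 l = 0)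
    (h1 : ∀ l : Fin L, 2 * (l : ℕ) + 1 < T → ξ.1 l = 0) (t : ℕ) (ht : t < T) :
    stepNorm ξ t = 0 := by
  have hz : ∀ {a b : ℕ}, l2norm (0 : Fin a → Fin b → ℝ) = 0 := l2norm_zero
  refine stepNorm_cases (L := L) (p := fun t => t < T → stepNorm ξ t = 0) t
    (fun l _ hl => ?_) (fun l _ hl => ?_) (fun t h _ => stepNorm_of_le _ h) t le_rfl ht
  · rw [stepNorm_even, h0 l hl, hz, zero_div]
  · rw [stepNorm_odd, h1 l hl, hz]

/-- The block triangular shape of `A` makes the inputs up to a given time depend on the noise up to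
that time. Noise that agrees at earlier times gives input distance zero. -/
theorem feature_congr (hM : M.LipschitzUpdates C) (hC : 0 ≤ C)
    (hK : M.BoundedBy K) (hK0 : 0 ≤ K) (P : Params dz J L n) (A : Bool → Fin dz → Kernel J L)
    (hA : ∀ k ζ a b, b.1 < a.1 → A k ζ a b = 0) (z : Fin m → Fin dz)
    {y y' : StepNoise dz J L n m} (σ : StepIdx dz J L)
    (h : ∀ τ i, stepTime τ < stepTime σ → y (τ, i) = y' (τ, i)) :
    M.feature (P.withA A) σ.1 σ.2.1 σ.2.2 (noiseOf z y) =
      M.feature (P.withA A) σ.1 σ.2.1 σ.2.2 (noiseOf z y') := by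
  obtain ⟨b, hb, hB⟩ := exists_memoryBound P
  have h1 := norm_feature_sub_le hM hC hK hK0 hb hB A A (noiseOf z y') (noiseOf z y) rfl σ
  have h2 : M.inputDist (P.withA A) (P.withA A) (noiseOf z y') (noiseOf z y) (stepTime σ) = 0 := by
    refine Finset.sum_eq_zero fun r hr => stepNorm_eq_zero_of (T := stepTime σ)
      (fun l hl => ?_) (fun l hl => ?_) r (Finset.mem_range.1 hr)
    · ext k j
      simp only [inputBlocks, Pi.sub_apply, hTilde, noiseOf, Params.withA, Pi.zero_apply,
        ← Finset.sum_sub_distrib, ← sub_mul]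
      refine Finset.sum_eq_zero fun a _ => ?_
      rcases lt_or_ge l a.1 with h3 | h3
      · rw [hA _ _ _ _ h3, mul_zero]
      · rw [h, sub_self, zero_mul]
        have : (a.1 : ℕ) ≤ l := h3
        simp only [stepTime, if_true] at hl ⊢
        omega
    · ext i j
      simp only [inputBlocks, Pi.sub_apply, Model.gTilde, noiseOf, Params.withA, Pi.zero_apply,
        ← Finset.sum_sub_distrib, ← sub_mul, ← mul_sub]
      rw [div_eq_zero_iff]
      left
      refine Finset.sum_eq_zero fun ζ _ => Finset.sum_eq_zero fun i' _ => ?_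
      refine mul_eq_zero_of_right _ (Finset.sum_eq_zero fun a _ => ?_)
      rcases lt_or_ge l a.1 with h3 | h3
      · rw [hA _ _ _ _ h3, mul_zero]
      · rw [h, sub_self, zero_mul]
        have : (a.1 : ℕ) ≤ l := h3
        simp only [stepTime, if_false, Bool.false_eq_true] at hl ⊢
        omega
  rw [h2, mul_zero, mul_zero] at h1
  exact sub_eq_zero.1 (norm_le_zero_iff.1 h1)

theorem continuous_feature (P : Params dz J L n) (k : Bool) (ζ : Fin dz) (a : Fin L × Fin J)
    (z : Fin m → Fin dz) :
    Continuous fun y : StepNoise dz J L n m => M.feature P k ζ a (noiseOf z y) := by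
  have hn : Continuous fun y : StepNoise dz J L n m => (noiseOf z y).2 := by
    unfold noiseOf; fun_prop
  cases k
  · simp only [feature_false]
    have h1 : ∀ k j, Continuous fun y : StepNoise dz J L n m =>
        M.omegaBar P (noiseOf z y) a.1 k j := fun k j =>
      (continuous_apply_apply k j).comp ((continuous_omegaBar (M := M) P z a.1).comp hn)
    refine (PiLp.continuous_toLp 2 _).comp (continuous_pi fun i => ?_)
    rcases i with i | i | i
    · exact continuous_const
    · simp only [Sum.elim_inr, Sum.elim_inl, Model.vecOmega]
      have : ∀ y : StepNoise dz J L n m, (noiseOf z y).1 = z := fun _ => rfl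
      simp only [this]
      split_ifs
      · exact (h1 i a.2).div_const _
      · exact continuous_const
    · exact continuous_const
  · simp only [feature_true]
    have h1 : ∀ k j, Continuous fun y : StepNoise dz J L n m =>
        M.thetaBar P (noiseOf z y) a.1 k j := fun k j =>
      (continuous_apply_apply k j).comp ((continuous_thetaBar (M := M) P z a.1).comp hn)
    refine (PiLp.continuous_toLp 2 _).comp (continuous_pi fun i => ?_)
    rcases i with i | i
    · simp only [Sum.elim_inl, vecTheta_apply]
      exact continuous_finsetSum _ fun i' _ => continuous_const.mul (h1 i' a.2)
    · exact continuous_const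

end Features

/-! ### Directions and the adaptive construction of the matrices. -/

section Directions

variable {D : Bool → Fin L × Fin J → ℝ}

/-- The regularized values of `A_θ` and `A_ω`. -/
def regA {P : Params dz J L n} (r : ∀ k ζ, Regularization (P.A k ζ) (D k)) (k : Bool)
    (ζ : Fin dz) : Kernel J L := (r k ζ).R

/-- The features of the regularized dynamics, with an additional independent component. -/
def Model.augFeature (M : Model dz J L n m) {P : Params dz J L n}
    (r : ∀ k ζ, Regularization (P.A k ζ) (D k)) (z : Fin m → Fin dz) (y : StepNoise dz J L n m)
    (σ : StepIdx dz J L) : EuclideanSpace ℝ (Ambient J L n m) :=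
  M.feature (P.withA (regA r)) σ.1 σ.2.1 σ.2.2 (noiseOf z y) +
    D σ.1 σ.2.2 • EuclideanSpace.single (Sum.inr (Sum.inr σ.2.2)) 1

/-- The augmented features in almost orthonormal coordinates. -/
def Model.normFeature (M : Model dz J L n m) {P : Params dz J L n}
    (r : ∀ k ζ, Regularization (P.A k ζ) (D k)) (z : Fin m → Fin dz) (y : StepNoise dz J L n m)
    (σ : StepIdx dz J L) : EuclideanSpace ℝ (Ambient J L n m) :=
  ∑ a, (r σ.1 σ.2.1).N a σ.2.2 • M.augFeature r z y (σ.1, σ.2.1, a)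

/-- The orthonormal directions in which the Gaussian matrices are revealed. -/
def Model.direction (M : Model dz J L n m) {P : Params dz J L n}
    (r : ∀ k ζ, Regularization (P.A k ζ) (D k)) (z : Fin m → Fin dz) (y : StepNoise dz J L n m)
    (σ : StepIdx dz J L) : EuclideanSpace ℝ (Ambient J L n m) :=
  orthonormalize (fun a => M.normFeature r z y (σ.1, σ.2.1, a)) σ.2.2

variable {M : Model dz J L n m} {C K : ℝ} {P : Params dz J L n}
  (r : ∀ k ζ, Regularization (P.A k ζ) (D k))

theorem augFeature_aux (z : Fin m → Fin dz) (y : StepNoise dz J L n m) (k : Bool) (ζ : Fin dz)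
    (a b : Fin L × Fin J) :
    M.augFeature r z y (k, ζ, a) (.inr (.inr b)) = if b = a then D k a else 0 := by
  cases k <;> simp [Model.augFeature, feature_true, feature_false]

/-- Independence is visible in the auxiliary coordinates alone: there the family is the invertible
matrix `N` up to the positive factors `D`. -/
theorem linearIndependent_normFeature (hD : ∀ k a, 0 < D k a) (z : Fin m → Fin dz)
    (y : StepNoise dz J L n m) (k : Bool) (ζ : Fin dz) :
    LinearIndependent ℝ fun a => M.normFeature r z y (k, ζ, a) := by
  rw [Fintype.linearIndependent_iff]
  intro g hg
  have h1 : ∀ b, ∑ a, (r k ζ).N b a * g a = 0 := fun b => by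
    have := congrArg (fun v : EuclideanSpace ℝ (Ambient J L n m) => v (.inr (.inr b))) hg
    simp only [Model.normFeature, WithLp.ofLp_sum, Finset.sum_apply, PiLp.smul_apply,
      augFeature_aux, smul_eq_mul, mul_ite, mul_zero, Finset.sum_ite_eq, Finset.mem_univ, if_true,
      WithLp.ofLp_zero, Pi.zero_apply] at this
    have e : ∑ a, g a * ((r k ζ).N b a * D k b) = (∑ a, (r k ζ).N b a * g a) * D k b := by
      rw [Finset.sum_mul]
      exact Finset.sum_congr rfl fun a _ => by ring
    rw [e] at this
    exact (mul_eq_zero.1 this).resolve_right (hD k b).ne'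
  have h2 : (r k ζ).N.mulVec g = 0 := by ext b; exact h1 b
  have h3 : (r k ζ).R.mulVec ((r k ζ).N.mulVec g) = g := by
    rw [Matrix.mulVec_mulVec, (r k ζ).R_mul_N, Matrix.one_mulVec]
  rw [h2, Matrix.mulVec_zero] at h3
  intro a
  rw [← h3]; rfl

theorem orthonormal_direction (hD : ∀ k a, 0 < D k a) (z : Fin m → Fin dz)
    (y : StepNoise dz J L n m) (k : Bool) (ζ : Fin dz) :
    Orthonormal ℝ fun a => M.direction r z y (k, ζ, a) := by
  have h := orthonormal_orthonormalize (linearIndependent_normFeature (M := M) r hD z y k ζ)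
  unfold Model.direction
  exact h

/-- Gram–Schmidt and `N` mix only features of times not later than that of the direction, so a
direction depends on strictly earlier noise. This is the independence on which the law of the
matrices rests. -/
theorem direction_congr (hM : M.LipschitzUpdates C) (hC : 0 ≤ C)
    (hK : M.BoundedBy K) (hK0 : 0 ≤ K) (z : Fin m → Fin dz)
    {y y' : StepNoise dz J L n m} (σ : StepIdx dz J L)
    (h : ∀ τ i, stepTime τ < stepTime σ → y (τ, i) = y' (τ, i)) :
    M.direction r z y σ = M.direction r z y' σ := by
  obtain ⟨k, ζ, a⟩ := σ
  refine orthonormalize_congr fun b hb => ?_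
  refine Finset.sum_congr rfl fun c _ => ?_
  rcases lt_or_ge b.1 c.1 with h3 | h3
  · simp only [(r k ζ).N_upper _ _ h3, zero_smul]
  · congr 1
    simp only [Model.augFeature]
    congr 1
    refine feature_congr hM hC hK hK0 P (regA r) (fun k ζ => (r k ζ).R_upper) z (k, ζ, c)
      fun τ i hτ => h τ i (hτ.trans_le ?_)
    have h4 : (c.1 : ℕ) ≤ a.1 := h3.trans hb
    simp only [stepTime]
    omega

theorem measurable_direction (z : Fin m → Fin dz) (σ : StepIdx dz J L) :
    Measurable fun y => M.direction r z y σ := by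
  refine measurable_orthonormalize (fun a => ?_) _
  refine Continuous.measurable ?_
  have h : ∀ τ : StepIdx dz J L, Continuous fun y => M.augFeature r z y τ := fun τ => by
    have h1 := continuous_feature (M := M) (P.withA (regA r)) τ.1 τ.2.1 τ.2.2 z
    unfold Model.augFeature
    fun_prop
  unfold Model.normFeature
  fun_prop

/-- The directions sorted by time. -/
def sortedSteps (dz J L : ℕ) : List (StepIdx dz J L) :=
  (Finset.univ : Finset (StepIdx dz J L)).toList.insertionSort fun σ τ => stepTime σ ≤ stepTime τ

theorem sortedSteps_nodup : (sortedSteps dz J L).Nodup :=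
  (List.perm_insertionSort _ _).nodup_iff.2 (Finset.nodup_toList _)

theorem mem_sortedSteps (σ : StepIdx dz J L) : σ ∈ sortedSteps dz J L :=
  (List.perm_insertionSort _ _).mem_iff.2 (by simp)

theorem sortedSteps_pairwise :
    (sortedSteps dz J L).Pairwise fun σ τ => stepTime σ ≤ stepTime τ := by
  have : Std.Total fun σ τ : StepIdx dz J L => stepTime σ ≤ stepTime τ :=
    ⟨fun _ _ => le_total _ _⟩
  have : IsTrans (StepIdx dz J L) fun σ τ => stepTime σ ≤ stepTime τ :=
    ⟨fun _ _ _ => le_trans⟩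
  exact List.pairwise_insertionSort _ _

/-- The Gaussian matrices, revealed in the order of the dynamics. -/
def Model.adaptive (M : Model dz J L n m) {P : Params dz J L n}
    (r : ∀ k ζ, Regularization (P.A k ζ) (D k)) (z : Fin m → Fin dz) (y : StepNoise dz J L n m)
    (W : Fin dz × Ambient J L n m × Ambient J L n m → ℝ) :
    Fin dz × Ambient J L n m × Ambient J L n m → ℝ :=
  runSteps (M.direction r z y) y (sortedSteps dz J L) W

theorem blockMul_adaptive (hD : ∀ k a, 0 < D k a) (z : Fin m → Fin dz) (y : StepNoise dz J L n m)
    (W : Fin dz × Ambient J L n m × Ambient J L n m → ℝ) (k : Bool) (ζ : Fin dz)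
    (a : Fin L × Fin J) :
    blockMul (M.adaptive r z y W) k ζ (M.direction r z y (k, ζ, a)) = noiseVec y (k, ζ, a) +
      ∑ b with stepTime (!k, ζ, b) < stepTime (k, ζ, a),
        (inner ℝ (noiseVec y (!k, ζ, b)) (M.direction r z y (k, ζ, a)) -
          inner ℝ (M.direction r z y (!k, ζ, b)) (noiseVec y (k, ζ, a))) •
            M.direction r z y (!k, ζ, b) := by
  have h := blockMul_runSteps (M.direction r z y) (orthonormal_direction r hD z y) y
    -- Directions of opposite kinds never share a time, because of parity.
    (time := stepTime) (fun k ζ a b => by cases k <;> simp [stepTime] <;> omega) W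
    (sortedSteps dz J L) sortedSteps_nodup sortedSteps_pairwise k ζ a (mem_sortedSteps _)
  simp only [mem_sortedSteps, true_and] at h
  unfold Model.adaptive
  exact h

/-- A step of the construction, with its frame as a function of the noise. -/
def Model.adaptiveStep (M : Model dz J L n m) {P : Params dz J L n}
    (r : ∀ k ζ, Regularization (P.A k ζ) (D k)) (hD : ∀ k a, 0 < D k a) (z : Fin m → Fin dz)
    (σ : StepIdx dz J L) : AdaptiveStep (StepIdx dz J L × Ambient J L n m)
      (Fin dz × Ambient J L n m × Ambient J L n m) (Ambient J L n m) where
  coord i := (σ, i)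
  coord_injective i j h := (Prod.mk.injEq _ _ _ _ ▸ h).2
  frame y := stepFrame σ.1 σ.2.1 (M.direction r z y σ)
  isometry y := stepFrame_isometry _ _ ((orthonormal_direction r hD z y σ.1 σ.2.1).1 σ.2.2)
  measurable i j := by
    have h : ∀ c, Measurable fun y => M.direction r z y σ c := fun c =>
      (EuclideanSpace.proj (𝕜 := ℝ) c).continuous.measurable.comp (measurable_direction r z σ)
    unfold stepFrame
    simp only [Matrix.of_apply]
    split_ifs <;> first | exact h _ | exact measurable_const

theorem adaptive_eq_run (hD : ∀ k a, 0 < D k a) (z : Fin m → Fin dz) (y : StepNoise dz J L n m)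
    (W : Fin dz × Ambient J L n m × Ambient J L n m → ℝ) :
    M.adaptive r z y W =
      AdaptiveStep.run ((sortedSteps dz J L).map (M.adaptiveStep r hD z)) y W := by
  unfold Model.adaptive runSteps AdaptiveStep.run
  induction sortedSteps dz J L with
  | nil => rfl
  | cons σ ℓ ih =>
    simp only [List.map_cons, List.foldr_cons, ih]
    rw [AdaptiveStep.act]
    congr 2
    show _ = _ - (stepFrame σ.1 σ.2.1 (M.direction r z y σ)).transpose.mulVec _
    rw [stepFrame_transpose_mulVec]
    rfl

/-- In the sorted list, the frame of a step depends only on noise of times strictly before it, hence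
neither on its own noise nor on that of later steps. -/
theorem measurePreserving_adaptive (hM : M.LipschitzUpdates C) (hC : 0 ≤ C)
    (hK : M.BoundedBy K) (hK0 : 0 ≤ K) (hD : ∀ k a, 0 < D k a) (z : Fin m → Fin dz) :
    MeasurePreserving (fun p : StepNoise dz J L n m × _ => M.adaptive r z p.1 p.2)
      ((gaussPi _).prod (gaussPi _)) (gaussPi _) := by
  simp_rw [adaptive_eq_run r hD z]
  have hind : ∀ σ τ : StepIdx dz J L, stepTime σ ≤ stepTime τ →
      (M.adaptiveStep r hD z σ).IndepOf (M.adaptiveStep r hD z τ) := fun σ τ h y v => by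
    have h1 : M.direction r z (Function.extend (M.adaptiveStep r hD z τ).coord v y) σ =
        M.direction r z y σ := by
      refine direction_congr r hM hC hK hK0 z σ fun τ' i hτ' => ?_
      refine Function.extend_apply' _ _ _ ?_
      rintro ⟨j, hj⟩
      have : τ = τ' := congrArg Prod.fst hj
      subst this
      exact absurd hτ' (not_lt.2 h)
    show stepFrame σ.1 σ.2.1 _ = stepFrame σ.1 σ.2.1 _
    rw [h1]
  refine AdaptiveStep.measurePreserving_run _ (fun s hs => ?_) ?_
  · obtain ⟨σ, -, rfl⟩ := List.mem_map.1 hs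
    exact hind σ σ le_rfl
  · rw [List.pairwise_map]
    refine (sortedSteps_pairwise.and sortedSteps_nodup).imp fun {σ τ} h => ⟨hind σ τ h.1, ?_⟩
    intro i j hij
    exact h.2 (congrArg Prod.fst hij)

end Directions

end DMF

end

noncomputable section

namespace DMF

open Asymptotics

/-! ### The filter of likely events. -/

section Whp

variable {ι : Type*} {Ω : ι → Type*} [∀ i, MeasurableSpace (Ω i)]

/-- The filter of the events whose probability tends to one along `F`. -/
def whp (μ : ∀ i, Measure (Ω i)) (F : Filter ι) : Filter (Σ i, Ω i) where
  sets := {S | Tendsto (fun i => μ i {w | (⟨i, w⟩ : Σ i, Ω i) ∉ S}) F (𝓝 0)}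
  univ_sets := by simpa using tendsto_const_nhds
  sets_of_superset {S T} hS hST := by
    refine tendsto_of_tendsto_of_tendsto_of_le_of_le tendsto_const_nhds hS (fun _ => zero_le)
      fun i => measure_mono fun w hw hS' => hw (hST hS')
  inter_sets {S T} hS hT := by
    have h : Tendsto (fun i => μ i {w | (⟨i, w⟩ : Σ i, Ω i) ∉ S} +
        μ i {w | (⟨i, w⟩ : Σ i, Ω i) ∉ T}) F (𝓝 0) := by
      simpa using Tendsto.add hS hT
    refine tendsto_of_tendsto_of_tendsto_of_le_of_le tendsto_const_nhds h (fun _ => zero_le)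
      fun i => (measure_mono fun w hw => ?_).trans (measure_union_le _ _)
    by_cases hw' : (⟨i, w⟩ : Σ i, Ω i) ∈ S
    · exact Or.inr fun h => hw ⟨hw', h⟩
    · exact Or.inl hw'

variable {μ : ∀ i, Measure (Ω i)} {F : Filter ι}

theorem eventually_whp {p : (Σ i, Ω i) → Prop} :
    (∀ᶠ ω in whp μ F, p ω) ↔ Tendsto (fun i => μ i {w | ¬ p ⟨i, w⟩}) F (𝓝 0) := Iff.rfl

theorem tendsto_fst_whp : Tendsto Sigma.fst (whp μ F) F := fun S hS => by
  refine eventually_whp.2 (tendsto_const_nhds.congr' ?_)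
  filter_upwards [hS] with i hi
  simp [hi]

end Whp

/-! ### Random variables that vanish for every fixed regularization. -/

section Negligible

variable {β : Type*} {Ω : ℕ × β → Type*} [∀ i, MeasurableSpace (Ω i)]

/-- A family of random variables that tends to zero in probability, uniformly in the problem,
after multiplication by an arbitrary function of the first index. -/
def Negligible (μ : ∀ i, Measure (Ω i)) (G : Filter β) (X : (Σ i, Ω i) → ℝ) : Prop :=
  ∀ g : ℕ → ℝ, (fun ω => g ω.1.1 * X ω) =o[whp μ (atTop.curry G)] fun _ => (1 : ℝ)

variable {μ : ∀ i, Measure (Ω i)} {G : Filter β} {X Y : (Σ i, Ω i) → ℝ}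

/-- In the iterated limit it suffices to argue separately for each value of the first index, without
uniformity. -/
theorem eventually_whp_curry {p : (Σ i, Ω i) → Prop}
    (h : ∀ j, Tendsto (fun b => μ (j, b) {w | ¬ p ⟨(j, b), w⟩}) G (𝓝 0)) :
    ∀ᶠ ω in whp μ (atTop.curry G), p ω :=
  eventually_whp.2 (Tendsto.curry (f := fun j b => μ (j, b) {w | ¬ p ⟨(j, b), w⟩})
    (Eventually.of_forall h))

theorem isBigO_one_of_tail {c : ℝ}
    (h : ∀ j, Tendsto (fun b => μ (j, b) {w | c < |X ⟨(j, b), w⟩|}) G (𝓝 0)) :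
    X =O[whp μ (atTop.curry G)] fun _ => (1 : ℝ) := by
  refine IsBigO.of_bound c ?_
  refine eventually_whp_curry fun j => ?_
  simpa using h j

namespace Negligible

theorem isLittleO (h : Negligible μ G X) : X =o[whp μ (atTop.curry G)] fun _ => (1 : ℝ) := by
  simpa using h fun _ => 1

/-- The multiplier is a constant for each fixed first index, so it only rescales `ε`. This is what
later permits factors that blow up as the regularization tends to zero. -/
theorem of_tail (h : ∀ ε > 0, ∀ j, Tendsto (fun b => μ (j, b) {w | ε < |X ⟨(j, b), w⟩|}) G (𝓝 0)) :
    Negligible μ G X := fun g => by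
  refine IsLittleO.of_bound fun ε hε => eventually_whp_curry fun j => ?_
  have hpos : 0 < ε / (|g j| + 1) := by positivity
  refine tendsto_of_tendsto_of_tendsto_of_le_of_le tendsto_const_nhds (h _ hpos j)
    (fun _ => zero_le) fun b => measure_mono fun w hw => ?_
  simp only [Set.mem_ofPred_eq, norm_mul, Real.norm_eq_abs, norm_one, mul_one, not_le] at hw ⊢
  rw [div_lt_iff₀ (by positivity)]
  have := abs_nonneg (X ⟨(j, b), w⟩)
  nlinarith

/-- Chebyshev's inequality. -/
theorem of_lintegral_sq (hX : ∀ i, AEMeasurable (fun w => X ⟨i, w⟩) (μ i)) {b : β → ℝ}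
    (h : ∀ i, ∫⁻ w, ENNReal.ofReal (X ⟨i, w⟩ ^ 2) ∂(μ i) ≤ ENNReal.ofReal (b i.2))
    (hb : Tendsto b G (𝓝 0)) : Negligible μ G X := by
  refine of_tail fun ε hε j => ?_
  have hlim : Tendsto (fun p => ENNReal.ofReal (b p) / ENNReal.ofReal (ε ^ 2)) G (𝓝 0) := by
    have h1 : Tendsto (fun p => ENNReal.ofReal (b p)) G (𝓝 0) := by
      simpa using ENNReal.tendsto_ofReal hb
    have h2 := ENNReal.Tendsto.div_const h1 (b := ENNReal.ofReal (ε ^ 2))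
      (Or.inr (ENNReal.ofReal_pos.2 (by positivity)).ne')
    simpa using h2
  refine tendsto_of_tendsto_of_tendsto_of_le_of_le tendsto_const_nhds hlim
    (fun _ => zero_le) fun p => ?_
  have hm : AEMeasurable (fun w => ENNReal.ofReal (X ⟨(j, p), w⟩ ^ 2)) (μ (j, p)) :=
    ((hX (j, p)).pow_const 2).ennreal_ofReal
  refine (measure_mono fun w hw => ?_).trans ((meas_ge_le_lintegral_div hm
    (ENNReal.ofReal_pos.2 (by positivity : 0 < ε ^ 2)).ne' ENNReal.ofReal_ne_top).trans
    (ENNReal.div_le_div_right (h (j, p)) _))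
  have hw' : ε < |X ⟨(j, p), w⟩| := hw
  refine ENNReal.ofReal_le_ofReal ?_
  rw [← sq_abs (X _)]
  exact pow_le_pow_left₀ hε.le hw'.le 2

theorem of_lintegral_sq' {X : ∀ i, Ω i → ℝ} (hX : ∀ i, Measurable (X i)) {b : β → ℝ}
    (h : ∀ i, ∫⁻ w, ENNReal.ofReal (X i w ^ 2) ∂(μ i) ≤ ENNReal.ofReal (b i.2))
    (hb : Tendsto b G (𝓝 0)) : Negligible μ G fun ω => X ω.1 ω.2 :=
  of_lintegral_sq (fun i => (hX i).aemeasurable) h hb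

theorem of_deviation [∀ i, IsFiniteMeasure (μ i)] {c δ : β → ℝ} (hc : Tendsto c G (𝓝 0))
    (hδ : Tendsto δ G (𝓝 0))
    (h : ∀ᶠ b in G, ∀ j, (μ (j, b)).real {w | c b < |X ⟨(j, b), w⟩|} ≤ δ b) :
    Negligible μ G X := by
  refine of_tail fun ε hε j => ?_
  have hlim : Tendsto (fun p => ENNReal.ofReal (δ p)) G (𝓝 0) := by
    simpa using ENNReal.tendsto_ofReal hδ
  refine tendsto_of_tendsto_of_tendsto_of_le_of_le' tendsto_const_nhds hlim
    (Eventually.of_forall fun _ => zero_le) ?_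
  filter_upwards [h, hc.eventually (gt_mem_nhds hε)] with b hb hcb
  refine (measure_mono fun w (hw : ε < _) => ?_).trans
    ((ENNReal.le_ofReal_iff_toReal_le (measure_ne_top _ _)
      (measureReal_nonneg.trans (hb j))).2 (hb j))
  exact hcb.trans hw

theorem congr (h : Negligible μ G X) (hXY : ∀ ω, X ω = Y ω) : Negligible μ G Y := by
  rwa [← funext hXY]

theorem mul_le (h : Negligible μ G X) (g : ℕ → ℝ) (hXY : ∀ ω, |Y ω| ≤ g ω.1.1 * |X ω|) :
    Negligible μ G Y := fun g' => by
  refine IsBigO.trans_isLittleO (IsBigO.of_bound 1 (Eventually.of_forall fun ω => ?_))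
    (h fun j => g' j * g j)
  rw [one_mul, norm_mul, norm_mul, norm_mul, mul_assoc]
  refine mul_le_mul_of_nonneg_left ((hXY ω).trans ?_) (norm_nonneg _)
  exact mul_le_mul_of_nonneg_right (le_abs_self _) (abs_nonneg _)

end Negligible

end Negligible

/-! ### The randomness of the coupling. -/

section Sample

variable {dz J L n m : ℕ}

/-- The randomness of the coupling: the latent variables, two independent sets of Gaussian vectors
for the directions, and independent Gaussian matrices. -/
abbrev Sample (dz J L n m : ℕ) : Type :=
  (Fin m → Fin dz) × ((StepNoise dz J L n m × StepNoise dz J L n m) ×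
    (Fin dz × Ambient J L n m × Ambient J L n m → ℝ))

/-- The law of the randomness of the coupling. -/
def Model.couplingLaw (M : Model dz J L n m) : Measure (Sample dz J L n m) :=
  M.latentLaw.prod (((gaussPi _).prod (gaussPi _)).prod (gaussPi _))

instance (M : Model dz J L n m) : IsProbabilityMeasure M.couplingLaw := by
  unfold Model.couplingLaw; infer_instance

theorem measurePreserving_blockDiagonal {S B B' : Type*} [Fintype S] [Fintype B] [Fintype B']
    [DecidableEq S] [DecidableEq B] (Q : S → Matrix B B' ℝ)
    (hQ : ∀ s, Q s * (Q s).transpose = 1) :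
    MeasurePreserving (fun (x : B' × S → ℝ) (p : B × S) => ∑ b, Q p.2 p.1 b * x (b, p.2))
      (gaussPi (B' × S)) (gaussPi (B × S)) := by
  have h := measurePreserving_mulVec (Matrix.blockDiagonal Q) (by
    rw [Matrix.blockDiagonal_transpose, ← Matrix.blockDiagonal_mul]
    simp only [hQ]
    exact Matrix.blockDiagonal_one)
  convert h using 2 with x
  ext ⟨b, s⟩
  simp [Matrix.mulVec, dotProduct, Fintype.sum_prod_type, Matrix.blockDiagonal_apply]

variable {P : Params dz J L n} {D : Bool → Fin L × Fin J → ℝ}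
  (r : ∀ k ζ, Regularization (P.A k ζ) (D k))

/-- The Gaussian vectors `y` with `y R = x A + x' D`. -/
def rotate (x : StepNoise dz J L n m × StepNoise dz J L n m) : StepNoise dz J L n m := fun p =>
  ∑ c, (r p.1.1 p.1.2.1).N c p.1.2.2 * (∑ c', P.A p.1.1 p.1.2.1 c' c *
    x.1 ((p.1.1, p.1.2.1, c'), p.2) + D p.1.1 c * x.2 ((p.1.1, p.1.2.1, c), p.2))

/-- For each direction and coordinate, `y = (x A + x' D) N` applies a coisometry to the pair `(x,
x')`, because `Nᵀ (AᵀA + D²) N = 1`. -/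
theorem measurePreserving_rotate :
    MeasurePreserving (rotate (m := m) r) ((gaussPi _).prod (gaussPi _)) (gaussPi _) := by
  let Q : Bool × Fin dz × Ambient J L n m →
      Matrix (Fin L × Fin J) ((Fin L × Fin J) ⊕ (Fin L × Fin J)) ℝ := fun s =>
    Matrix.fromCols (P.A s.1 s.2.1 * (r s.1 s.2.1).N).transpose
      (Matrix.diagonal (D s.1) * (r s.1 s.2.1).N).transpose
  have hQ : ∀ s, Q s * (Q s).transpose = 1 := fun s => by
    simp only [Q]
    rw [Matrix.transpose_fromCols, Matrix.fromCols_mul_fromRows]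
    simp only [Matrix.transpose_mul, Matrix.transpose_transpose, Matrix.diagonal_transpose]
    rw [← (r s.1 s.2.1).transpose_N_mul, Matrix.mul_add, Matrix.add_mul]
    congr 1
    · simp only [Matrix.mul_assoc]
    · simp only [Matrix.mul_assoc]
      rw [← Matrix.mul_assoc (Matrix.diagonal _) (Matrix.diagonal _), Matrix.diagonal_mul_diagonal]
      simp only [sq]
  have h1 := measurePreserving_sumElim (α := StepIdx dz J L × Ambient J L n m)
    (β := StepIdx dz J L × Ambient J L n m)
  let e : ((Fin L × Fin J) ⊕ (Fin L × Fin J)) × (Bool × Fin dz × Ambient J L n m) →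
      (StepIdx dz J L × Ambient J L n m) ⊕ (StepIdx dz J L × Ambient J L n m) := fun p =>
    p.1.elim (fun c => .inl ((p.2.1, p.2.2.1, c), p.2.2.2))
      (fun c => .inr ((p.2.1, p.2.2.1, c), p.2.2.2))
  have he : Function.Injective e := by
    rintro ⟨c | c, k, ζ, i⟩ ⟨c' | c', k', ζ', i'⟩ h <;> simp [e] at h ⊢ <;> tauto
  let e' : StepIdx dz J L × Ambient J L n m →
      (Fin L × Fin J) × (Bool × Fin dz × Ambient J L n m) := fun p =>
    (p.1.2.2, p.1.1, p.1.2.1, p.2)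
  have he' : Function.Injective e' := by
    rintro ⟨⟨k, ζ, c⟩, i⟩ ⟨⟨k', ζ', c'⟩, i'⟩ h
    simp [e'] at h ⊢
    tauto
  have h2 := ((measurePreserving_comp_injective he').comp ((measurePreserving_blockDiagonal Q hQ).comp
    ((measurePreserving_comp_injective he).comp h1)))
  convert h2 using 1
  funext x ⟨⟨k, ζ, b⟩, i⟩
  simp only [rotate, Function.comp_apply, e, e', Fintype.sum_sum_type, Sum.elim_inl, Sum.elim_inr, Q,
    Matrix.fromCols_apply_inl, Matrix.fromCols_apply_inr, Matrix.transpose_apply,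
    Matrix.mul_apply, mul_add, Finset.sum_add_distrib]
  congr 1
  · simp only [Finset.mul_sum, Finset.sum_mul]
    rw [Finset.sum_comm]
    exact Finset.sum_congr rfl fun _ _ => Finset.sum_congr rfl fun _ _ => by ring
  · simp only [Matrix.diagonal_apply, ite_mul, zero_mul, Finset.sum_ite_eq, Finset.mem_univ, if_true]
    exact Finset.sum_congr rfl fun _ _ => by ring

/-- The point of the construction: the inputs of the regularized dynamics differ from the original
ones only by `x' D`. -/
theorem rotate_mul_R (x : StepNoise dz J L n m × StepNoise dz J L n m) (k : Bool) (ζ : Fin dz)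
    (c : Fin L × Fin J) (i : Ambient J L n m) :
    ∑ b, rotate r x ((k, ζ, b), i) * (r k ζ).R b c =
      ∑ c', P.A k ζ c' c * x.1 ((k, ζ, c'), i) + D k c * x.2 ((k, ζ, c), i) := by
  have h : ∀ c', ∑ b, (r k ζ).N c' b * (r k ζ).R b c = if c' = c then 1 else 0 := fun c' => by
    have := congrFun (congrFun (r k ζ).N_mul_R c') c
    rwa [Matrix.mul_apply, Matrix.one_apply] at this
  simp only [rotate, Finset.sum_mul]
  rw [Finset.sum_comm]
  have h2 : ∀ (c' : Fin L × Fin J) (t : ℝ), ∑ b, (r k ζ).N c' b * t * (r k ζ).R b c =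
      if c' = c then t else 0 := fun c' t => by
    have : ∀ b, (r k ζ).N c' b * t * (r k ζ).R b c = (r k ζ).N c' b * (r k ζ).R b c * t :=
      fun b => by ring
    simp only [this, ← Finset.sum_mul, h, ite_mul, one_mul, zero_mul]
  simp only [h2, Finset.sum_ite_eq', Finset.mem_univ, if_true]

/-- For given latent variables the noise consists of distinct entries of `y`. The selection depends
on `z`, hence the skew product. -/
theorem measurePreserving_noiseOf (M : Model dz J L n m) :
    MeasurePreserving (fun p : (Fin m → Fin dz) × StepNoise dz J L n m => noiseOf p.1 p.2)
      (M.latentLaw.prod (gaussPi _)) M.noiseLaw := by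
  let e : (Fin m → Fin dz) → NoiseIndex dz J L n m → StepIdx dz J L × Ambient J L n m := fun z =>
    Sum.elim (fun p => ((false, p.1, p.2.2), .inl p.2.1))
      (fun p => ((true, z p.1, p.2), .inr (.inl p.1)))
  have he : ∀ z, Function.Injective (e z) := by
    rintro z (⟨ζ, i, a⟩ | ⟨k, a⟩) (⟨ζ', i', a'⟩ | ⟨k', a'⟩) h <;> simp [e] at h ⊢ <;> tauto
  have h := (MeasurePreserving.id M.latentLaw).skew_product
    (g := fun z (x : StepNoise dz J L n m) c => x (e z c)) (μc := gaussPi _) (μd := gaussPi _)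
    (measurable_from_prod_countable_right fun z => by
      simp only [Function.uncurry]; fun_prop)
    (ae_of_all _ fun z => (measurePreserving_comp_injective (he z)).map_eq)
  exact (measurePreserving_mkNoise M).comp h

end Sample

end DMF

end

noncomputable section

namespace DMF

/-! ### Laws and second moments under the coupling. -/

section Laws

variable {dz J L n m : ℕ} {M : Model dz J L n m} {C K : ℝ} {P : Params dz J L n}
  {D : Bool → Fin L × Fin J → ℝ} (r : ∀ k ζ, Regularization (P.A k ζ) (D k))

variable (M) in
theorem measurePreserving_latent_fst_noise :
    MeasurePreserving (fun s : Sample dz J L n m => (s.1, s.2.1)) M.couplingLaw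
      (M.latentLaw.prod ((gaussPi _).prod (gaussPi _))) :=
  (MeasurePreserving.id _).prod measurePreserving_fst

variable (M) in
theorem measurePreserving_sample_noiseOf :
    MeasurePreserving (fun s : Sample dz J L n m => noiseOf s.1 s.2.1.1) M.couplingLaw
      M.noiseLaw :=
  (measurePreserving_noiseOf M).comp
    (((MeasurePreserving.id _).prod measurePreserving_fst).comp
      (measurePreserving_latent_fst_noise M))

variable (M) in
theorem measurePreserving_sample_rotate :
    MeasurePreserving (fun s : Sample dz J L n m => (s.1, rotate r s.2.1)) M.couplingLaw
      (M.latentLaw.prod (gaussPi _)) :=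
  ((MeasurePreserving.id _).prod (measurePreserving_rotate r)).comp
    (measurePreserving_latent_fst_noise M)

variable (M) in
theorem measurePreserving_sample_snd :
    MeasurePreserving (fun s : Sample dz J L n m => s.2.1.2) M.couplingLaw (gaussPi _) :=
  (measurePreserving_snd.comp measurePreserving_snd).comp (measurePreserving_latent_fst_noise M)

theorem measurePreserving_sample_adaptive (hM : M.LipschitzUpdates C) (hC : 0 ≤ C)
    (hK : M.BoundedBy K) (hK0 : 0 ≤ K) (hD : ∀ k a, 0 < D k a) :
    MeasurePreserving (fun s : Sample dz J L n m =>
      (s.1, M.adaptive r s.1 (rotate r s.2.1) s.2.2)) M.couplingLaw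
      (M.latentLaw.prod (gaussPi (Fin dz × Ambient J L n m × Ambient J L n m))) := by
  have h1 : MeasurePreserving (fun s : Sample dz J L n m => (s.1, (rotate r s.2.1, s.2.2)))
      M.couplingLaw (M.latentLaw.prod ((gaussPi _).prod (gaussPi _))) :=
    (MeasurePreserving.id _).prod ((measurePreserving_rotate r).prod (MeasurePreserving.id _))
  have h2 := (MeasurePreserving.id M.latentLaw).skew_product
    (g := fun z (q : StepNoise dz J L n m × (Fin dz × Ambient J L n m × Ambient J L n m → ℝ)) =>
      M.adaptive r z q.1 q.2)
    (μc := (gaussPi _).prod (gaussPi _)) (μd := gaussPi _)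
    (measurable_from_prod_countable_right fun z =>
      (measurePreserving_adaptive r hM hC hK hK0 hD z).measurable)
    (ae_of_all _ fun z => (measurePreserving_adaptive r hM hC hK hK0 hD z).map_eq)
  exact h2.comp h1

theorem measurable_noiseVec {S I : Type*} [Fintype S] [Fintype I] (σ : S) :
    Measurable fun y : S × I → ℝ => (noiseVec y σ : EuclideanSpace ℝ I) := by
  unfold noiseVec; fun_prop

/-- A direction not later than the noise vector does not depend on it. Given everything else, the
inner product is the linear form of a unit vector in fresh Gaussian noise. -/
theorem lintegral_sq_inner_direction (hM : M.LipschitzUpdates C) (hC : 0 ≤ C)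
    (hK : M.BoundedBy K) (hK0 : 0 ≤ K) (hD : ∀ k a, 0 < D k a) {σ τ : StepIdx dz J L}
    (h : stepTime σ ≤ stepTime τ) :
    ∫⁻ s, ENNReal.ofReal (inner ℝ (noiseVec (rotate r s.2.1) τ)
      (M.direction r s.1 (rotate r s.2.1) σ) ^ 2) ∂M.couplingLaw = 1 := by
  have hmz : ∀ z, Measurable fun y : StepNoise dz J L n m =>
      ENNReal.ofReal (inner ℝ (noiseVec y τ) (M.direction r z y σ) ^ 2) := fun z =>
    (((measurable_noiseVec τ).inner (measurable_direction r z σ)).pow_const 2).ennreal_ofReal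
  have hm : Measurable fun p : (Fin m → Fin dz) × StepNoise dz J L n m =>
      ENNReal.ofReal (inner ℝ (noiseVec p.2 τ) (M.direction r p.1 p.2 σ) ^ 2) :=
    measurable_from_prod_countable_right hmz
  have h1 := (measurePreserving_sample_rotate M r).lintegral_comp hm
  rw [h1, lintegral_prod _ hm.aemeasurable]
  have h2 : ∀ z, ∫⁻ y, ENNReal.ofReal (inner ℝ (noiseVec y τ) (M.direction r z y σ) ^ 2)
      ∂(gaussPi (StepIdx dz J L × Ambient J L n m)) = 1 := fun z => by
    have hinj : Function.Injective fun i : Ambient J L n m => (τ, i) := fun i j hij =>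
      (Prod.mk.injEq _ _ _ _ ▸ hij).2
    have hext := measurePreserving_extend fun i : Ambient J L n m => (τ, i)
    have hm2 : Measurable fun q : StepNoise dz J L n m × (Ambient J L n m → ℝ) =>
        ENNReal.ofReal (inner ℝ (noiseVec (Function.extend (fun i => (τ, i)) q.2 q.1) τ)
          (M.direction r z (Function.extend (fun i => (τ, i)) q.2 q.1) σ) ^ 2) :=
      (hmz z).comp hext.measurable
    rw [← hext.lintegral_comp (hmz z), lintegral_prod _ hm2.aemeasurable]
    have h3 : ∀ y : StepNoise dz J L n m, ∫⁻ v, ENNReal.ofReal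
        (inner ℝ (noiseVec (Function.extend (fun i => (τ, i)) v y) τ)
          (M.direction r z (Function.extend (fun i => (τ, i)) v y) σ) ^ 2)
        ∂(gaussPi (Ambient J L n m)) = 1 := fun y => by
      have e1 : ∀ v : Ambient J L n m → ℝ,
          M.direction r z (Function.extend (fun i => (τ, i)) v y) σ = M.direction r z y σ :=
        fun v => direction_congr r hM hC hK hK0 z σ fun τ' i hτ' => by
          refine Function.extend_apply' _ _ _ ?_
          rintro ⟨j, hj⟩
          have : τ = τ' := congrArg Prod.fst hj
          subst this
          exact absurd hτ' (not_lt.2 h)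
      have e2 : ∀ v : Ambient J L n m → ℝ,
          inner ℝ (noiseVec (Function.extend (fun i => (τ, i)) v y) τ) (M.direction r z y σ) =
            ∑ i, M.direction r z y σ i * v i := fun v => by
        rw [inner_eq_sum]
        refine Finset.sum_congr rfl fun i _ => ?_
        rw [mul_comm]
        congr 1
        exact hinj.extend_apply _ _ i
      have hn : ∑ i, M.direction r z y σ i ^ 2 = 1 := by
        rw [← EuclideanSpace.real_norm_sq_eq,
          (orthonormal_direction r hD z y σ.1 σ.2.1).1 σ.2.2, one_pow]
      simp only [e1, e2]
      rw [lintegral_sq_dotProduct, hn, ENNReal.ofReal_one]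
    simp only [h3, lintegral_one, measure_univ]
  simp only [h2, lintegral_one, measure_univ]

theorem measurable_feature (k : Bool) (ζ : Fin dz) (a : Fin L × Fin J) :
    Measurable fun p : (Fin m → Fin dz) × StepNoise dz J L n m =>
      M.feature P k ζ a (noiseOf p.1 p.2) :=
  measurable_from_prod_countable_right fun z => (continuous_feature P k ζ a z).measurable

theorem lintegral_sq_norm_feature_le (hK : M.BoundedBy K) {κ : ℝ}
    (hθ : ∀ l, L2Bound M.noiseLaw (fun s => l2norm (M.thetaBar P s l)) κ)
    (hω : ∀ l, L2Bound M.noiseLaw (fun s => l2norm (M.omegaBar P s l) / Real.sqrt m) κ)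
    (k : Bool) (ζ : Fin dz) (a : Fin L × Fin J) :
    ∫⁻ s, ENNReal.ofReal (‖M.feature P k ζ a s‖ ^ 2) ∂M.noiseLaw ≤
      ENNReal.ofReal (((Real.sqrt K + 1) * κ) ^ 2) := by
  have hs := Real.sqrt_nonneg K
  obtain ⟨X, hX, hle⟩ : ∃ X : Noise dz J L n m → ℝ, L2Bound M.noiseLaw X κ ∧
      ∀ s, ‖M.feature P k ζ a s‖ ≤ (Real.sqrt K + 1) * X s := by
    cases k
    · refine ⟨_, hω a.1, fun s => ?_⟩
      rw [norm_feature_false]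
      refine (norm_vecOmega_le P ζ a s).trans (le_mul_of_one_le_left ?_ (by linarith))
      exact div_nonneg (l2norm_nonneg _) (Real.sqrt_nonneg _)
    · refine ⟨_, hθ a.1, fun s => ?_⟩
      rw [norm_feature_true]
      refine (norm_vecTheta_le hK P ζ a s).trans ?_
      exact mul_le_mul_of_nonneg_right (by linarith) (l2norm_nonneg _)
  refine (lintegral_mono fun s => ENNReal.ofReal_le_ofReal ?_).trans
    (hX.const_mul (by positivity : 0 ≤ Real.sqrt K + 1)).lintegral_sq_le
  exact pow_le_pow_left₀ (norm_nonneg _) (hle s) 2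

/-- The auxiliary noise `x'` is independent of the mean-field dynamics, which is driven by `x`
alone. -/
theorem lintegral_sq_inner_feature (τ : StepIdx dz J L) (k : Bool) (ζ : Fin dz)
    (a : Fin L × Fin J) :
    ∫⁻ s, ENNReal.ofReal (inner ℝ (noiseVec s.2.1.2 τ)
      (M.feature P k ζ a (noiseOf s.1 s.2.1.1)) ^ 2) ∂M.couplingLaw =
    ∫⁻ s, ENNReal.ofReal (‖M.feature P k ζ a s‖ ^ 2) ∂M.noiseLaw := by
  have h0 : MeasurePreserving (fun s : Sample dz J L n m => ((s.1, s.2.1.1), s.2.1.2))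
      M.couplingLaw ((M.latentLaw.prod (gaussPi _)).prod (gaussPi _)) :=
    ((measurePreserving_prodAssoc _ _ _).symm).comp (measurePreserving_latent_fst_noise M)
  have hf := measurable_feature (M := M) (P := P) k ζ a
  have hm : Measurable fun q : ((Fin m → Fin dz) × StepNoise dz J L n m) × StepNoise dz J L n m =>
      ENNReal.ofReal (inner ℝ (noiseVec q.2 τ) (M.feature P k ζ a (noiseOf q.1.1 q.1.2)) ^ 2) := by
    refine (Measurable.pow_const ?_ 2).ennreal_ofReal
    exact ((measurable_noiseVec τ).comp measurable_snd).inner (hf.comp measurable_fst)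
  have h1 := h0.lintegral_comp hm
  rw [h1, lintegral_prod _ hm.aemeasurable]
  have h2 : ∀ p : (Fin m → Fin dz) × StepNoise dz J L n m,
      ∫⁻ x, ENNReal.ofReal (inner ℝ (noiseVec x τ) (M.feature P k ζ a (noiseOf p.1 p.2)) ^ 2)
        ∂(gaussPi (StepIdx dz J L × Ambient J L n m)) =
      ENNReal.ofReal (‖M.feature P k ζ a (noiseOf p.1 p.2)‖ ^ 2) := fun p => by
    set u := M.feature P k ζ a (noiseOf p.1 p.2)
    have hinj : Function.Injective fun i : Ambient J L n m => (τ, i) := fun i j hij =>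
      (Prod.mk.injEq _ _ _ _ ▸ hij).2
    have h3 := (measurePreserving_comp_injective hinj).lintegral_comp
      (f := fun v : Ambient J L n m → ℝ => ENNReal.ofReal ((∑ i, u i * v i) ^ 2)) (by fun_prop)
    rw [lintegral_sq_dotProduct, ← EuclideanSpace.real_norm_sq_eq] at h3
    rw [← h3]
    refine lintegral_congr fun x => ?_
    rw [inner_eq_sum]
    congr 2
    exact Finset.sum_congr rfl fun i _ => mul_comm _ _
  simp only [h2]
  have h4 : Measurable fun s : Noise dz J L n m => ENNReal.ofReal (‖M.feature P k ζ a s‖ ^ 2) := by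
    refine (Measurable.pow_const ?_ 2).ennreal_ofReal
    refine measurable_noise fun z => ?_
    cases k
    · simp only [norm_feature_false]
      simp only [EuclideanSpace.norm_eq, Model.vecOmega]
      refine Real.continuous_sqrt.comp (continuous_finsetSum _ fun i _ => ?_)
      have h5 : Continuous fun x => M.omegaBar P (z, x) a.1 i a.2 :=
        (continuous_apply_apply i a.2).comp (continuous_omegaBar P z a.1)
      refine (Continuous.norm ?_).pow 2
      split_ifs
      · exact h5.div_const _
      · exact continuous_const
    · simp only [norm_feature_true, Model.vecTheta]
      have h5 : Continuous fun x => col (M.thetaBar P (z, x) a.1) a.2 := by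
        have := continuous_thetaBar (M := M) P z a.1
        unfold col
        fun_prop
      exact (ContinuousLinearMap.continuous _).norm.comp h5
  exact (measurePreserving_noiseOf M).lintegral_comp h4

theorem measurable_direction_prod (σ : StepIdx dz J L) :
    Measurable fun q : (Fin m → Fin dz) × StepNoise dz J L n m => M.direction r q.1 q.2 σ :=
  measurable_from_prod_countable_right fun z => measurable_direction r z σ

theorem measurable_inner_direction (σ τ : StepIdx dz J L) :
    Measurable fun s : Sample dz J L n m =>
      (inner ℝ (noiseVec (rotate r s.2.1) τ) (M.direction r s.1 (rotate r s.2.1) σ) : ℝ) := by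
  have hr := (measurePreserving_sample_rotate M r).measurable
  have h1 : Measurable fun s : Sample dz J L n m => M.direction r s.1 (rotate r s.2.1) σ := by
    have h := Measurable.comp (measurable_direction_prod (M := M) r σ) hr
    simpa only [Function.comp_def] using h
  have h2 : Measurable fun s : Sample dz J L n m =>
      (noiseVec (rotate r s.2.1) τ : EuclideanSpace ℝ (Ambient J L n m)) :=
    (measurable_noiseVec τ).comp (measurable_snd.comp hr)
  exact h2.inner h1

theorem measurable_inner_feature (τ : StepIdx dz J L) (k : Bool) (ζ : Fin dz)
    (a : Fin L × Fin J) :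
    Measurable fun s : Sample dz J L n m =>
      (inner ℝ (noiseVec s.2.1.2 τ) (M.feature P k ζ a (noiseOf s.1 s.2.1.1)) : ℝ) := by
  have h0 : Measurable fun s : Sample dz J L n m => (s.1, s.2.1.1) :=
    measurable_fst.prodMk (measurable_fst.comp (measurable_fst.comp measurable_snd))
  have h1 : Measurable fun s : Sample dz J L n m =>
      M.feature P k ζ a (noiseOf s.1 s.2.1.1) := by
    have h := Measurable.comp (measurable_feature (M := M) (P := P) k ζ a) h0
    simpa only [Function.comp_def] using h
  have h2 : Measurable fun s : Sample dz J L n m =>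
      (noiseVec s.2.1.2 τ : EuclideanSpace ℝ (Ambient J L n m)) :=
    (measurable_noiseVec τ).comp (measurable_snd.comp (measurable_fst.comp measurable_snd))
  exact h2.inner h1

theorem lintegral_sq_div_sqrt_le {Ω : Type*} [MeasurableSpace Ω] {μ : Measure Ω} {f : Ω → ℝ}
    {b : ℝ} (h : ∫⁻ s, ENNReal.ofReal (f s ^ 2) ∂μ ≤ ENNReal.ofReal b) :
    ∫⁻ s, ENNReal.ofReal ((f s / Real.sqrt m) ^ 2) ∂μ ≤ ENNReal.ofReal (b / m) := by
  have e : ∀ s, ENNReal.ofReal ((f s / Real.sqrt m) ^ 2) =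
      ENNReal.ofReal (1 / m) * ENNReal.ofReal (f s ^ 2) := fun s => by
    rw [← ENNReal.ofReal_mul (by positivity), div_pow, Real.sq_sqrt (by positivity),
      div_mul_eq_mul_div, one_mul]
  simp only [e]
  rw [lintegral_const_mul' _ _ ENNReal.ofReal_ne_top]
  refine (mul_le_mul_right h _).trans (le_of_eq ?_)
  rw [← ENNReal.ofReal_mul (by positivity), one_div_mul_eq_div]

end Laws

/-! ### Norms of Gaussian vectors and matrices of the size of the problem. -/

section Tails

/-- The constant is chosen for the operator norm in the next lemma. Here there is room to spare, and
using it twice gives a common tail. -/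
theorem gauss_norm_tail {γ : ℝ} {n m N : ℕ} (hn : (n : ℝ) = γ * m) {κ : Type*}
    [Fintype κ] (hκ : Fintype.card κ = n + (m + N)) :
    gaussPi κ {x | Real.sqrt (128 * (γ + 1) + 32) * Real.sqrt m <
      ‖(WithLp.toLp 2 x : EuclideanSpace ℝ κ)‖} ≤
      ENNReal.ofReal (Real.exp (4 * N - m)) := by
  refine (gaussPi_norm_tail (by positivity)).trans (ENNReal.ofReal_le_ofReal ?_)
  have h5 : (5 : ℝ) ≤ Real.exp 2 := by
    have := Real.add_one_le_exp (1 : ℝ)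
    have h2 := Real.exp_one_gt_d9
    rw [show (2 : ℝ) = 1 + 1 by norm_num, Real.exp_add]
    nlinarith
  have hcard : (Fintype.card κ : ℝ) = γ * m + (m + N) := by rw [hκ]; push_cast; rw [hn]
  have hm : (0 : ℝ) ≤ m := by positivity
  have hγm : 0 ≤ γ * m := hn ▸ by positivity
  have ht : (Real.sqrt (128 * (γ + 1) + 32) * Real.sqrt m) ^ 2 = (128 * (γ + 1) + 32) * m := by
    rcases hm.eq_or_lt with h | h
    · rw [← h]; simp
    · have : 0 ≤ γ := le_of_mul_le_mul_right (by simpa using hγm) h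
      rw [mul_pow, Real.sq_sqrt (by positivity), Real.sq_sqrt hm]
  calc 5 ^ Fintype.card κ * Real.exp (-(Real.sqrt (128 * (γ + 1) + 32) * Real.sqrt m) ^ 2 / 8)
      ≤ Real.exp 2 ^ Fintype.card κ *
        Real.exp (-(Real.sqrt (128 * (γ + 1) + 32) * Real.sqrt m) ^ 2 / 8) := by gcongr
    _ = Real.exp (2 * (γ * m + (m + N)) - (128 * (γ + 1) + 32) * m / 8) := by
      rw [← Real.exp_nat_mul, ← Real.exp_add, hcard, ht]
      congr 1; ring
    _ ≤ _ := Real.exp_le_exp.2 (by have : (0 : ℝ) ≤ N := by positivity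
                                   nlinarith)

/-- With `25 ≤ e⁴` the entropy is at most `4 (γ m + m + N)`, and the constant divided by 32 is `4 (γ
+ 1) + 1`. The remaining exponent is exactly `4 N - m`. -/
theorem gauss_opNorm_tail {γ : ℝ} {n m N : ℕ} (hn : (n : ℝ) = γ * m) {κ : Type*}
    [Fintype κ] [DecidableEq κ] (hκ : Fintype.card κ = n + (m + N)) :
    gaussPi (κ × κ) {x | Real.sqrt (128 * (γ + 1) + 32) * Real.sqrt m <
      ‖Matrix.toEuclideanCLM (n := κ) (𝕜 := ℝ) (Matrix.of (Function.curry x))‖} ≤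
      ENNReal.ofReal (Real.exp (4 * N - m)) := by
  refine (gaussPi_opNorm_tail (by positivity)).trans (ENNReal.ofReal_le_ofReal ?_)
  have h5 : (25 : ℝ) ≤ Real.exp 4 := by
    have h2 := Real.exp_one_gt_d9
    have h3 : (5 : ℝ) ≤ Real.exp 2 := by
      rw [show (2 : ℝ) = 1 + 1 by norm_num, Real.exp_add]
      nlinarith
    rw [show (4 : ℝ) = 2 + 2 by norm_num, Real.exp_add]
    nlinarith
  have hcard : (Fintype.card κ : ℝ) = γ * m + (m + N) := by rw [hκ]; push_cast; rw [hn]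
  have hm : (0 : ℝ) ≤ m := by positivity
  have hγm : 0 ≤ γ * m := hn ▸ by positivity
  have ht : (Real.sqrt (128 * (γ + 1) + 32) * Real.sqrt m) ^ 2 = (128 * (γ + 1) + 32) * m := by
    rcases hm.eq_or_lt with h | h
    · rw [← h]; simp
    · have : 0 ≤ γ := le_of_mul_le_mul_right (by simpa using hγm) h
      rw [mul_pow, Real.sq_sqrt (by positivity), Real.sq_sqrt hm]
  calc 25 ^ Fintype.card κ * Real.exp (-(Real.sqrt (128 * (γ + 1) + 32) * Real.sqrt m) ^ 2 / 32)
      ≤ Real.exp 4 ^ Fintype.card κ *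
        Real.exp (-(Real.sqrt (128 * (γ + 1) + 32) * Real.sqrt m) ^ 2 / 32) := by gcongr
    _ = Real.exp (4 * (γ * m + (m + N)) - (128 * (γ + 1) + 32) * m / 32) := by
      rw [← Real.exp_nat_mul, ← Real.exp_add, hcard, ht]
      congr 1; ring
    _ ≤ _ := Real.exp_le_exp.2 (by nlinarith)

variable {Z I : Type*} [Fintype I]

/-- The operator norm of a block of `W`. -/
def blockOpNorm [DecidableEq I] (W : Z × I × I → ℝ) (ζ : Z) : ℝ :=
  ‖Matrix.toEuclideanCLM (n := I) (𝕜 := ℝ) (Matrix.of fun i j => W (ζ, i, j))‖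

theorem norm_blockMul_le [Fintype Z] [DecidableEq Z] [DecidableEq I] (W : Z × I × I → ℝ) (k : Bool) (ζ : Z) (u : EuclideanSpace ℝ I) :
    ‖blockMul W k ζ u‖ ≤ blockOpNorm W ζ * ‖u‖ := by
  have h1 : ∀ u, ‖blockMul W false ζ u‖ ≤ blockOpNorm W ζ * ‖u‖ := fun u => by
    have e : blockMul W false ζ u =
        Matrix.toEuclideanCLM (n := I) (𝕜 := ℝ) (Matrix.of fun i j => W (ζ, i, j)) u := by
      ext c
      simp [blockMul, Matrix.mulVec, dotProduct]
    rw [e]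
    exact ContinuousLinearMap.le_opNorm _ _
  cases k
  · exact h1 u
  -- The transpose obeys the same bound, by duality.
  · have h2 : ‖blockMul W true ζ u‖ ^ 2 ≤ ‖u‖ * (blockOpNorm W ζ * ‖blockMul W true ζ u‖) := by
      rw [← real_inner_self_eq_norm_sq, inner_blockMul]
      exact (real_inner_le_norm _ _).trans (mul_le_mul_of_nonneg_left (h1 _) (norm_nonneg _))
    rcases (norm_nonneg (blockMul W true ζ u)).eq_or_lt with h | h
    · rw [← h]
      exact mul_nonneg (norm_nonneg _) (norm_nonneg _)
    · nlinarith

theorem blockMul_add (W : Z × I × I → ℝ) (k : Bool) (ζ : Z) (u v : EuclideanSpace ℝ I) :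
    blockMul W k ζ (u + v) = blockMul W k ζ u + blockMul W k ζ v := by
  ext c
  simp [blockMul, mul_add, Finset.sum_add_distrib]

theorem blockMul_smul (W : Z × I × I → ℝ) (k : Bool) (ζ : Z) (a : ℝ) (u : EuclideanSpace ℝ I) :
    blockMul W k ζ (a • u) = a • blockMul W k ζ u := by
  ext c
  simp only [blockMul, PiLp.smul_apply, smul_eq_mul, Finset.mul_sum]
  exact Finset.sum_congr rfl fun _ _ => by ring

/-- The action of a block as a linear map. -/
def blockMulLinear (W : Z × I × I → ℝ) (k : Bool) (ζ : Z) :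
    EuclideanSpace ℝ I →ₗ[ℝ] EuclideanSpace ℝ I where
  toFun := blockMul W k ζ
  map_add' := blockMul_add W k ζ
  map_smul' := blockMul_smul W k ζ

theorem blockMul_sum {κ : Type*} (s : Finset κ) (W : Z × I × I → ℝ) (k : Bool) (ζ : Z)
    (u : κ → EuclideanSpace ℝ I) :
    blockMul W k ζ (∑ a ∈ s, u a) = ∑ a ∈ s, blockMul W k ζ (u a) :=
  map_sum (blockMulLinear W k ζ) u s

end Tails

end DMF

end

noncomputable section

namespace DMF

/-! ### The effect of the regularization on the dynamics. -/

section InputDifference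

variable {dz J L n m : ℕ} {M : Model dz J L n m} {C K : ℝ} {P : Params dz J L n}

/-- The size of the regularization: a step later in time is regularized by a larger amount. -/
def stepScale (η : ℝ) (k : Bool) (a : Fin L × Fin J) : ℝ :=
  η ^ (2 * L - (2 * (a.1 : ℕ) + if k then 0 else 1))

theorem stepScale_pos {η : ℝ} (hη : 0 < η) (k : Bool) (a : Fin L × Fin J) :
    0 < stepScale η k a := pow_pos hη _

theorem stepScale_eq (η : ℝ) (σ : StepIdx dz J L) :
    stepScale η σ.1 σ.2.2 = η ^ (2 * L - stepTime σ) := rfl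

theorem stepScale_le {η : ℝ} (hη : 0 ≤ η) (hη1 : η ≤ 1) (k : Bool) (a : Fin L × Fin J) :
    stepScale η k a ≤ η := by
  refine pow_le_of_le_one hη hη1 ?_
  have := a.1.2
  split_ifs <;> omega

variable {η : ℝ} (r : ∀ k ζ, Regularization (P.A k ζ) (stepScale η k))

theorem hTilde_sub (z : Fin m → Fin dz) (x : StepNoise dz J L n m × StepNoise dz J L n m)
    (l : Fin L) (k : Fin m) (j : Fin J) :
    (hTilde (P.withA (regA r)) (noiseOf z (rotate r x)) - hTilde P (noiseOf z x.1)) l k j =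
      stepScale η true (l, j) * x.2 ((true, z k, (l, j)), .inr (.inl k)) := by
  have h := rotate_mul_R r x true (z k) (l, j) (.inr (.inl k))
  simp only [Pi.sub_apply, hTilde, noiseOf, Params.withA, regA]
  rw [h, sub_eq_iff_eq_add, add_comm]
  congr 1
  exact Finset.sum_congr rfl fun a _ => mul_comm _ _

theorem gTilde_sub (z : Fin m → Fin dz) (x : StepNoise dz J L n m × StepNoise dz J L n m)
    (l : Fin L) (i : Fin n) (j : Fin J) :
    (M.gTilde (P.withA (regA r)) (noiseOf z (rotate r x)) - M.gTilde P (noiseOf z x.1)) l i j =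
      ∑ ζ, ∑ i', M.covSqrt ζ i i' *
        (stepScale η false (l, j) * x.2 ((false, ζ, (l, j)), .inl i')) := by
  simp only [Pi.sub_apply, Model.gTilde, noiseOf, Params.withA, regA, ← Finset.sum_sub_distrib,
    ← mul_sub]
  refine Finset.sum_congr rfl fun ζ _ => Finset.sum_congr rfl fun i' _ => ?_
  congr 1
  rw [Finset.sum_sub_distrib, rotate_mul_R r x false ζ (l, j) (.inl i'), sub_eq_iff_eq_add,
    add_comm]
  congr 1
  exact Finset.sum_congr rfl fun a _ => mul_comm _ _

/-- At time `t` the inputs differ by `η^(2L - t)` times auxiliary noise. For `h̃` the rows belong to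
different latent values, so the noise vectors of all values are summed. -/
theorem stepNorm_input_sub_le (hK : M.BoundedBy K) (hη : 0 ≤ η) (z : Fin m → Fin dz)
    (x : StepNoise dz J L n m × StepNoise dz J L n m) {N : ℝ}
    (hN : ∀ σ, ‖(noiseVec x.2 σ : EuclideanSpace ℝ (Ambient J L n m))‖ ≤ N) (hN0 : 0 ≤ N)
    (t : ℕ) :
    stepNorm (inputBlocks
      (M.gTilde (P.withA (regA r)) (noiseOf z (rotate r x)) - M.gTilde P (noiseOf z x.1))
      (hTilde (P.withA (regA r)) (noiseOf z (rotate r x)) - hTilde P (noiseOf z x.1))) t ≤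
      η ^ (2 * L - t) * ((Real.sqrt K + 1) * (J * (dz * N))) / Real.sqrt m := by
  have hs := Real.sqrt_nonneg K
  refine stepNorm_cases (L := L) (p := fun t => stepNorm (inputBlocks
      (M.gTilde (P.withA (regA r)) (noiseOf z (rotate r x)) - M.gTilde P (noiseOf z x.1))
      (hTilde (P.withA (regA r)) (noiseOf z (rotate r x)) - hTilde P (noiseOf z x.1))) t ≤
      η ^ (2 * L - t) * ((Real.sqrt K + 1) * (J * (dz * N))) / Real.sqrt m) t
    (fun l _ => ?_) (fun l _ => ?_) (fun t ht => ?_) t le_rfl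
  · rw [stepNorm_even]
    refine div_le_div_of_nonneg_right ?_ (Real.sqrt_nonneg _)
    refine (l2norm_le_sum_col _).trans ?_
    have h : ∀ j, ‖col ((inputBlocks (M.gTilde (P.withA (regA r)) (noiseOf z (rotate r x)) -
        M.gTilde P (noiseOf z x.1)) (hTilde (P.withA (regA r)) (noiseOf z (rotate r x)) -
          hTilde P (noiseOf z x.1))).2 l) j‖ ≤ η ^ (2 * L - 2 * (l : ℕ)) * (dz * N) := fun j => by
      refine le_of_sq_le_sq ?_ (by positivity)
      have e : ∀ k, col ((inputBlocks (M.gTilde (P.withA (regA r)) (noiseOf z (rotate r x)) -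
        M.gTilde P (noiseOf z x.1)) (hTilde (P.withA (regA r)) (noiseOf z (rotate r x)) -
          hTilde P (noiseOf z x.1))).2 l) j k =
          η ^ (2 * L - 2 * (l : ℕ)) * x.2 ((true, z k, (l, j)), .inr (.inl k)) := fun k =>
        hTilde_sub r z x l k j
      rw [EuclideanSpace.real_norm_sq_eq]
      simp only [e, mul_pow, ← Finset.mul_sum]
      refine mul_le_mul_of_nonneg_left ?_ (by positivity)
      calc ∑ k, x.2 ((true, z k, (l, j)), .inr (.inl k)) ^ 2
          ≤ ∑ k, ∑ ζ, x.2 ((true, ζ, (l, j)), .inr (.inl k)) ^ 2 :=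
            Finset.sum_le_sum fun k _ => Finset.single_le_sum
              (f := fun ζ => x.2 ((true, ζ, (l, j)), .inr (.inl k)) ^ 2)
              (fun _ _ => sq_nonneg _) (Finset.mem_univ (z k))
        _ = ∑ ζ, ∑ k, x.2 ((true, ζ, (l, j)), .inr (.inl k)) ^ 2 := Finset.sum_comm
        _ ≤ ∑ ζ, ‖(noiseVec x.2 (true, ζ, (l, j)) : EuclideanSpace ℝ (Ambient J L n m))‖ ^ 2 := by
            refine Finset.sum_le_sum fun ζ _ => ?_
            rw [EuclideanSpace.real_norm_sq_eq, Fintype.sum_sum_type, Fintype.sum_sum_type]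
            have h1 : 0 ≤ ∑ i : Fin n, (noiseVec x.2 (true, ζ, (l, j)) :
              EuclideanSpace ℝ (Ambient J L n m)) (.inl i) ^ 2 := by positivity
            have h2 : 0 ≤ ∑ i, (noiseVec x.2 (true, ζ, (l, j)) :
              EuclideanSpace ℝ (Ambient J L n m)) (.inr (.inr i)) ^ 2 := by positivity
            simp only [noiseVec] at h1 h2 ⊢
            linarith
        _ ≤ (∑ ζ, ‖(noiseVec x.2 (true, ζ, (l, j)) : EuclideanSpace ℝ (Ambient J L n m))‖) ^ 2 :=
            Finset.sum_sq_le_sq_sum_of_nonneg fun _ _ => norm_nonneg _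
        _ ≤ (∑ _ζ : Fin dz, N) ^ 2 := pow_le_pow_left₀ (Finset.sum_nonneg fun _ _ => norm_nonneg _)
            (Finset.sum_le_sum fun _ _ => hN _) 2
        _ = dz ^ 2 * N ^ 2 := by simp [mul_pow]
    refine (Finset.sum_le_sum fun j _ => h j).trans ?_
    simp only [Finset.sum_const, Finset.card_univ, Fintype.card_fin, nsmul_eq_mul]
    have : 0 ≤ η ^ (2 * L - 2 * (l : ℕ)) * (J * (dz * N)) := by positivity
    nlinarith
  · rw [stepNorm_odd]
    have e0 : (inputBlocks (M.gTilde (P.withA (regA r)) (noiseOf z (rotate r x)) -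
        M.gTilde P (noiseOf z x.1)) (hTilde (P.withA (regA r)) (noiseOf z (rotate r x)) -
          hTilde P (noiseOf z x.1))).1 l = (Real.sqrt m)⁻¹ •
        ((M.gTilde (P.withA (regA r)) (noiseOf z (rotate r x)) - M.gTilde P (noiseOf z x.1)) l) := by
      ext i j
      simp only [inputBlocks, Pi.smul_apply, smul_eq_mul]
      rw [div_eq_inv_mul]
    rw [e0, l2norm_smul, abs_of_nonneg (by positivity), ← div_eq_inv_mul]
    refine div_le_div_of_nonneg_right ?_ (Real.sqrt_nonneg _)
    refine (l2norm_le_sum_col _).trans ?_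
    have h : ∀ j, ‖col ((M.gTilde (P.withA (regA r)) (noiseOf z (rotate r x)) -
        M.gTilde P (noiseOf z x.1)) l) j‖ ≤
          η ^ (2 * L - (2 * (l : ℕ) + 1)) * (Real.sqrt K * (dz * N)) := fun j => by
      have e : col ((M.gTilde (P.withA (regA r)) (noiseOf z (rotate r x)) -
        M.gTilde P (noiseOf z x.1)) l) j = ∑ ζ, Matrix.toEuclideanCLM (𝕜 := ℝ) (M.covSqrt ζ)
          (WithLp.toLp 2 fun i' => η ^ (2 * L - (2 * (l : ℕ) + 1)) *
            x.2 ((false, ζ, (l, j)), .inl i')) := by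
        ext i
        rw [col_apply, gTilde_sub]
        simp only [WithLp.ofLp_sum, Finset.sum_apply]
        rfl
      rw [e]
      refine (norm_sum_le _ _).trans ((Finset.sum_le_sum (g := fun _ : Fin dz =>
        Real.sqrt K * (η ^ (2 * L - (2 * (l : ℕ) + 1)) * N)) fun ζ _ => ?_).trans
          (le_of_eq (by simp; ring)))
      refine (ContinuousLinearMap.le_opNorm _ _).trans (mul_le_mul (norm_covSqrt_le hK ζ) ?_
        (norm_nonneg _) hs)
      refine le_trans ?_ (mul_le_mul_of_nonneg_left (hN (false, ζ, (l, j))) (by positivity))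
      refine le_of_sq_le_sq ?_ (by positivity)
      rw [mul_pow, EuclideanSpace.real_norm_sq_eq, EuclideanSpace.real_norm_sq_eq,
        Fintype.sum_sum_type]
      simp only [mul_pow, ← Finset.mul_sum]
      refine mul_le_mul_of_nonneg_left ?_ (by positivity)
      have h2 : 0 ≤ ∑ i, (noiseVec x.2 (false, ζ, (l, j)) :
              EuclideanSpace ℝ (Ambient J L n m)) (.inr i) ^ 2 := by positivity
      simp only [noiseVec] at h2 ⊢
      linarith
    refine (Finset.sum_le_sum fun j _ => h j).trans ?_
    simp only [Finset.sum_const, Finset.card_univ, Fintype.card_fin, nsmul_eq_mul]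
    have : 0 ≤ η ^ (2 * L - (2 * (l : ℕ) + 1)) * (J * (dz * N)) := by positivity
    nlinarith
  · rw [stepNorm_of_le _ ht]
    positivity

/-- Only times strictly below `T` enter, and the scale grows by a factor `1 / η` per time step.
Hence the gain of a factor `η` over the scale `η^(2L - T)` of time `T` itself. -/
theorem inputDist_le (hK : M.BoundedBy K) (hη : 0 ≤ η) (hη1 : η ≤ 1) (z : Fin m → Fin dz)
    (x : StepNoise dz J L n m × StepNoise dz J L n m) {N : ℝ}
    (hN : ∀ σ, ‖(noiseVec x.2 σ : EuclideanSpace ℝ (Ambient J L n m))‖ ≤ N) (hN0 : 0 ≤ N)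
    {T : ℕ} (hT : T ≤ 2 * L) :
    M.inputDist P (P.withA (regA r)) (noiseOf z x.1) (noiseOf z (rotate r x)) T ≤
      2 * L * (η * η ^ (2 * L - T) * ((Real.sqrt K + 1) * (J * (dz * N))) / Real.sqrt m) := by
  have hs := Real.sqrt_nonneg K
  have h : ∀ t ∈ Finset.range T, stepNorm (inputBlocks
      (M.gTilde (P.withA (regA r)) (noiseOf z (rotate r x)) - M.gTilde P (noiseOf z x.1))
      (hTilde (P.withA (regA r)) (noiseOf z (rotate r x)) - hTilde P (noiseOf z x.1))) t ≤
      η * η ^ (2 * L - T) * ((Real.sqrt K + 1) * (J * (dz * N))) / Real.sqrt m := fun t ht => by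
    refine (stepNorm_input_sub_le r hK hη z x hN hN0 t).trans ?_
    have : t < T := Finset.mem_range.1 ht
    rw [← pow_succ']
    gcongr ?_ * _ / _
    exact pow_le_pow_of_le_one hη hη1 (by omega)
  refine (Finset.sum_le_sum h).trans ?_
  rw [Finset.sum_const, Finset.card_range, nsmul_eq_mul]
  have : (T : ℝ) ≤ 2 * L := by exact_mod_cast hT
  gcongr

theorem stepTime_lt (σ : StepIdx dz J L) : stepTime σ < 2 * L := by
  have := σ.2.2.1.2
  unfold stepTime
  split_ifs <;> omega

/-- The constant in the estimate of the effect of the regularization on the features. -/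
def featureConst (dz J L : ℕ) (C K b : ℝ) : ℝ :=
  (Real.sqrt K + 1) * ((∑ T ∈ Finset.range (2 * L), responseConst dz J L C K b T) *
    (2 * L * ((Real.sqrt K + 1) * (J * dz))))

theorem featureConst_nonneg (hC : 0 ≤ C) (hK0 : 0 ≤ K) {b : ℝ} (hb : 0 ≤ b) :
    0 ≤ featureConst dz J L C K b := by
  have := Finset.sum_nonneg fun T (_ : T ∈ Finset.range (2 * L)) =>
    responseConst_nonneg (dz := dz) (J := J) (L := L) hC hK0 hb T
  have := Real.sqrt_nonneg K
  unfold featureConst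
  positivity

/-- The reason for scales that increase in time: the change of a feature is smaller by a factor `η`
than its own scale, so it survives the multiplication by `N`, whose row of that feature is bounded
by the inverse of this scale. -/
theorem norm_feature_regularized_sub_le (hM : M.LipschitzUpdates C) (hC : 0 ≤ C)
    (hK : M.BoundedBy K) (hK0 : 0 ≤ K) {b : ℝ} (hb : 0 ≤ b) (hB : ∀ t, P.MemoryBound b t)
    (hη : 0 ≤ η) (hη1 : η ≤ 1) (z : Fin m → Fin dz)
    (x : StepNoise dz J L n m × StepNoise dz J L n m) {N : ℝ}
    (hN : ∀ σ, ‖(noiseVec x.2 σ : EuclideanSpace ℝ (Ambient J L n m))‖ ≤ N) (hN0 : 0 ≤ N)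
    (k : Bool) (ζ : Fin dz) (a : Fin L × Fin J) :
    ‖M.feature (P.withA (regA r)) k ζ a (noiseOf z (rotate r x)) -
      M.feature P k ζ a (noiseOf z x.1)‖ ≤
      featureConst dz J L C K b * (N / Real.sqrt m) * (η * stepScale η k a) := by
  have hs := Real.sqrt_nonneg K
  have h1 := norm_feature_sub_le hM hC hK hK0 hb hB P.A (regA r) (noiseOf z x.1)
    (noiseOf z (rotate r x)) rfl (k, ζ, a)
  have h2 := inputDist_le r hK hη hη1 z x hN hN0 (stepTime_lt (k, ζ, a)).le
  have h3 : responseConst dz J L C K b (stepTime (k, ζ, a)) ≤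
      ∑ T ∈ Finset.range (2 * L), responseConst dz J L C K b T :=
    Finset.single_le_sum (f := fun T => responseConst dz J L C K b T)
      (fun T _ => responseConst_nonneg hC hK0 hb T)
      (Finset.mem_range.2 (stepTime_lt (k, ζ, a)))
  have h4 := (responseConst_nonneg (dz := dz) (J := J) (L := L) hC hK0 hb
    (stepTime (k, ζ, a))).trans h3
  have h5 : 0 ≤ M.inputDist P (P.withA (regA r)) (noiseOf z x.1) (noiseOf z (rotate r x))
      (stepTime (k, ζ, a)) := Finset.sum_nonneg fun _ _ => stepNorm_nonneg _ _
  refine h1.trans ((mul_le_mul_of_nonneg_left (mul_le_mul h3 h2 h5 h4) (by positivity)).trans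
    (le_of_eq ?_))
  rw [featureConst, stepScale_eq η (k, ζ, a)]
  ring

end InputDifference

end DMF

end

/-! ### Families of couplings along growing problems. -/

noncomputable section

namespace DMF

open Asymptotics

variable {dz J L : ℕ} {γ C K : ℝ}

/-- The size of the regularization of the `j`-th coupling. -/
def regSize (j : ℕ) : ℝ := 1 / ((j : ℝ) + 1)

theorem regSize_pos (j : ℕ) : 0 < regSize j := by unfold regSize; positivity

theorem regSize_le_one (j : ℕ) : regSize j ≤ 1 := by
  unfold regSize
  rw [div_le_one (by positivity)]
  have : (0 : ℝ) ≤ j := by positivity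
  linarith

theorem tendsto_regSize : Tendsto regSize atTop (𝓝 0) := tendsto_one_div_add_atTop_nhds_zero_nat

/-- The regularization of a problem. -/
def Problem.reg (p : Problem dz J L γ C K) (j : ℕ) (k : Bool) (ζ : Fin dz) :
    Regularization (p.P.A k ζ) (stepScale (regSize j) k) :=
  Classical.choice (nonempty_regularization _ fun a => stepScale_pos (regSize_pos j) k a)

/-- A problem, the index of a coupling, and an outcome of the randomness of the coupling. -/
abbrev Outcome (dz J L : ℕ) (γ C K : ℝ) : Type :=
  Σ i : ℕ × Problem dz J L γ C K, Sample dz J L i.2.n i.2.m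

/-- The law of the randomness of a coupling. -/
def couplingLaw (i : ℕ × Problem dz J L γ C K) : Measure (Sample dz J L i.2.n i.2.m) :=
  i.2.M.couplingLaw

instance (i : ℕ × Problem dz J L γ C K) : IsProbabilityMeasure (couplingLaw i) := by
  unfold couplingLaw; infer_instance

/-- The filter of likely events: first the problem tends to infinity along `G`, and then the
regularization to zero. -/
def likely (G : Filter (Problem dz J L γ C K)) : Filter (Outcome dz J L γ C K) :=
  whp couplingLaw (atTop.curry G)

/-- The problems grow along `G`, and the mean-field parameters concentrate. -/
structure GrowingProblems (G : Filter (Problem dz J L γ C K)) : Prop where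
  C_nonneg : 0 ≤ C
  K_nonneg : 0 ≤ K
  γ_pos : 0 < γ
  tendsto_m : Tendsto (fun p : Problem dz J L γ C K => p.m) G atTop
  concentrates : ∃ c δ : Problem dz J L γ C K → ℝ, Tendsto c G (𝓝 0) ∧ Tendsto δ G (𝓝 0) ∧
    ∀ᶠ p in G, p.M.Concentrates p.P (c p) (δ p)

namespace Outcome

variable (ω : Outcome dz J L γ C K)

/-- The problem. -/
abbrev p : Problem dz J L γ C K := ω.1.2

/-- The size of the regularization. -/
abbrev η : ℝ := regSize ω.1.1

/-- The regularization. -/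
abbrev reg (k : Bool) (ζ : Fin dz) : Regularization (ω.p.P.A k ζ) (stepScale ω.η k) :=
  ω.p.reg ω.1.1 k ζ

/-- The vectors that drive the mean-field dynamics. -/
def vecX (σ : StepIdx dz J L) : EuclideanSpace ℝ (Ambient J L ω.p.n ω.p.m) :=
  noiseVec ω.2.2.1.1 σ

/-- The auxiliary vectors. -/
def vecX' (σ : StepIdx dz J L) : EuclideanSpace ℝ (Ambient J L ω.p.n ω.p.m) :=
  noiseVec ω.2.2.1.2 σ

/-- The noise that drives the regularized dynamics. -/
def noise : StepNoise dz J L ω.p.n ω.p.m := rotate ω.reg ω.2.2.1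

/-- The vectors that drive the regularized dynamics. -/
def vecY (σ : StepIdx dz J L) : EuclideanSpace ℝ (Ambient J L ω.p.n ω.p.m) :=
  noiseVec ω.noise σ

/-- The features of the mean-field dynamics. -/
def feat (k : Bool) (ζ : Fin dz) (a : Fin L × Fin J) :
    EuclideanSpace ℝ (Ambient J L ω.p.n ω.p.m) :=
  ω.p.M.feature ω.p.P k ζ a (noiseOf ω.2.1 ω.2.2.1.1)

/-- The features of the regularized dynamics. -/
def regFeat (k : Bool) (ζ : Fin dz) (a : Fin L × Fin J) :
    EuclideanSpace ℝ (Ambient J L ω.p.n ω.p.m) :=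
  ω.p.M.feature (ω.p.P.withA (regA ω.reg)) k ζ a (noiseOf ω.2.1 ω.noise)

/-- An auxiliary coordinate vector. -/
def aux (a : Fin L × Fin J) : EuclideanSpace ℝ (Ambient J L ω.p.n ω.p.m) :=
  EuclideanSpace.single (Sum.inr (Sum.inr a)) 1

/-- The normalized features. -/
def norFeat (k : Bool) (ζ : Fin dz) (a : Fin L × Fin J) :
    EuclideanSpace ℝ (Ambient J L ω.p.n ω.p.m) :=
  ω.p.M.normFeature ω.reg ω.2.1 ω.noise (k, ζ, a)

/-- The directions. -/
def dir (k : Bool) (ζ : Fin dz) (a : Fin L × Fin J) :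
    EuclideanSpace ℝ (Ambient J L ω.p.n ω.p.m) :=
  ω.p.M.direction ω.reg ω.2.1 ω.noise (k, ζ, a)

/-- The Gaussian matrices. -/
def W : Fin dz × Ambient J L ω.p.n ω.p.m × Ambient J L ω.p.n ω.p.m → ℝ :=
  ω.p.M.adaptive ω.reg ω.2.1 ω.noise ω.2.2.2

end Outcome

variable {G : Filter (Problem dz J L γ C K)}

namespace GrowingProblems

variable (hG : GrowingProblems G)

include hG

theorem tendsto_tail :
    Tendsto (fun p : Problem dz J L γ C K => ENNReal.ofReal (Real.exp (4 * (L * J : ℕ) - p.m))) G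
      (𝓝 0) := by
  have h1 : Tendsto (fun p : Problem dz J L γ C K => (4 * (L * J : ℕ) - (p.m : ℝ))) G atBot :=
    tendsto_const_nhds.add_atBot
      (tendsto_neg_atTop_atBot.comp (tendsto_natCast_atTop_atTop.comp hG.tendsto_m))
  simpa using ENNReal.tendsto_ofReal (Real.tendsto_exp_atBot.comp h1)

/-- The Gaussian norm tail decays exponentially in `m`, for every value of the regularization. -/
theorem isBigO_norm_noiseVec
    {f : ∀ i : ℕ × Problem dz J L γ C K, Sample dz J L i.2.n i.2.m → StepNoise dz J L i.2.n i.2.m}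
    (hf : ∀ i, MeasurePreserving (f i) (couplingLaw i) (gaussPi _)) (τ : StepIdx dz J L) :
    (fun ω : Outcome dz J L γ C K =>
      ‖(noiseVec (f ω.1 ω.2) τ : EuclideanSpace ℝ (Ambient J L ω.p.n ω.p.m))‖ / Real.sqrt ω.p.m)
      =O[likely G] fun _ => (1 : ℝ) := by
  refine isBigO_one_of_tail (c := Real.sqrt (128 * (γ + 1) + 32)) fun j => ?_
  refine tendsto_of_tendsto_of_tendsto_of_le_of_le tendsto_const_nhds hG.tendsto_tail
    (fun _ => zero_le) fun p => ?_
  have hinj : Function.Injective fun i : Ambient J L p.n p.m => (τ, i) := fun i j hij =>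
    (Prod.mk.injEq _ _ _ _ ▸ hij).2
  have h1 := (measurePreserving_comp_injective hinj).comp (hf (j, p))
  have hS : MeasurableSet {x : Ambient J L p.n p.m → ℝ | Real.sqrt (128 * (γ + 1) + 32) *
      Real.sqrt p.m < ‖(WithLp.toLp 2 x : EuclideanSpace ℝ (Ambient J L p.n p.m))‖} :=
    measurableSet_lt measurable_const (by fun_prop)
  refine (measure_mono fun s hs => ?_).trans ((h1.measure_preimage hS.nullMeasurableSet).le.trans
    (gauss_norm_tail p.n_eq (N := L * J) (by simp)))
  have hs' : Real.sqrt (128 * (γ + 1) + 32) <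
    |‖(noiseVec (f (j, p) s) τ : EuclideanSpace ℝ (Ambient J L p.n p.m))‖ / Real.sqrt p.m| := hs
  rwa [abs_of_nonneg (div_nonneg (norm_nonneg _) (Real.sqrt_nonneg _)),
    lt_div_iff₀ p.sqrt_m_pos] at hs'

theorem isBigO_norm_vecY (τ : StepIdx dz J L) :
    (fun ω : Outcome dz J L γ C K => ‖ω.vecY τ‖ / Real.sqrt ω.p.m) =O[likely G]
      fun _ => (1 : ℝ) :=
  hG.isBigO_norm_noiseVec (f := fun i s => rotate (i.2.reg i.1) s.2.1)
    (fun i => measurePreserving_snd.comp (measurePreserving_sample_rotate i.2.M _)) τ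

theorem isBigO_norm_vecX' (τ : StepIdx dz J L) :
    (fun ω : Outcome dz J L γ C K => ‖ω.vecX' τ‖ / Real.sqrt ω.p.m) =O[likely G]
      fun _ => (1 : ℝ) :=
  hG.isBigO_norm_noiseVec (f := fun _ s => s.2.1.2)
    (fun i => measurePreserving_sample_snd i.2.M) τ

theorem isBigO_blockOpNorm (ζ : Fin dz) :
    (fun ω : Outcome dz J L γ C K => blockOpNorm ω.W ζ / Real.sqrt ω.p.m) =O[likely G]
      fun _ => (1 : ℝ) := by
  refine isBigO_one_of_tail (c := Real.sqrt (128 * (γ + 1) + 32)) fun j => ?_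
  refine tendsto_of_tendsto_of_tendsto_of_le_of_le tendsto_const_nhds hG.tendsto_tail
    (fun _ => zero_le) fun p => ?_
  have hinj : Function.Injective fun q : Ambient J L p.n p.m × Ambient J L p.n p.m => (ζ, q) :=
    fun i j hij => (Prod.mk.injEq _ _ _ _ ▸ hij).2
  have h0 := measurePreserving_sample_adaptive (p.reg j) p.lip hG.C_nonneg p.bdd hG.K_nonneg
    fun k a => stepScale_pos (regSize_pos j) k a
  have h1 := (measurePreserving_comp_injective hinj).comp (measurePreserving_snd.comp h0)
  have hS : MeasurableSet {x : Ambient J L p.n p.m × Ambient J L p.n p.m → ℝ |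
      Real.sqrt (128 * (γ + 1) + 32) * Real.sqrt p.m < ‖Matrix.toEuclideanCLM
        (n := Ambient J L p.n p.m) (𝕜 := ℝ) (Matrix.of (Function.curry x))‖} := by
    refine measurableSet_lt measurable_const (Continuous.measurable ?_)
    let T : (Ambient J L p.n p.m × Ambient J L p.n p.m → ℝ) →ₗ[ℝ] _ :=
      { toFun := fun x => Matrix.toEuclideanCLM
          (n := Ambient J L p.n p.m) (𝕜 := ℝ) (Matrix.of (Function.curry x))
        map_add' := fun x y => map_add (Matrix.toEuclideanCLM (n := Ambient J L p.n p.m) (𝕜 := ℝ))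
          (Matrix.of (Function.curry x)) (Matrix.of (Function.curry y))
        map_smul' := fun c x => map_smul
          (Matrix.toEuclideanCLM (n := Ambient J L p.n p.m) (𝕜 := ℝ)) c
            (Matrix.of (Function.curry x)) }
    exact (LinearMap.continuous_of_finiteDimensional T).norm
  refine (measure_mono fun s hs => ?_).trans ((h1.measure_preimage hS.nullMeasurableSet).le.trans
    (gauss_opNorm_tail p.n_eq (N := L * J) (by simp)))
  have hs' : Real.sqrt (128 * (γ + 1) + 32) <
    |blockOpNorm (Outcome.W ⟨(j, p), s⟩) ζ / Real.sqrt p.m| := hs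
  have h0 : 0 ≤ blockOpNorm (Outcome.W ⟨(j, p), s⟩) ζ := norm_nonneg _
  rwa [abs_of_nonneg (div_nonneg h0 (Real.sqrt_nonneg _)), lt_div_iff₀ p.sqrt_m_pos] at hs'

theorem tendsto_inv_m (c : ℝ) :
    Tendsto (fun p : Problem dz J L γ C K => c / p.m) G (𝓝 0) :=
  tendsto_const_nhds.div_atTop (tendsto_natCast_atTop_atTop.comp hG.tendsto_m)

/-- The second moment equals `1 / m` after the scaling. -/
theorem negligible_inner_dir (k : Bool) (ζ : Fin dz) (a : Fin L × Fin J) {τ : StepIdx dz J L}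
    (h : stepTime (k, ζ, a) ≤ stepTime τ) :
    Negligible couplingLaw G fun ω : Outcome dz J L γ C K =>
      inner ℝ (ω.vecY τ) (ω.dir k ζ a) / Real.sqrt ω.p.m := by
  have h1 : ∀ i : ℕ × Problem dz J L γ C K, _ := fun i =>
    lintegral_sq_inner_direction (i.2.reg i.1) i.2.lip hG.C_nonneg i.2.bdd hG.K_nonneg
      (fun k a => stepScale_pos (regSize_pos i.1) k a) h
  have h2 := Negligible.of_lintegral_sq' (μ := couplingLaw) (G := G)
    (X := fun i s => inner ℝ (noiseVec (rotate (i.2.reg i.1) s.2.1) τ) (i.2.M.direction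
      (i.2.reg i.1) s.1 (rotate (i.2.reg i.1) s.2.1) (k, ζ, a)) / Real.sqrt i.2.m)
    (b := fun p => 1 / p.m)
    (fun i => (measurable_inner_direction (i.2.reg i.1) _ τ).div_const _)
    (fun i => lintegral_sq_div_sqrt_le ((h1 i).le.trans_eq ENNReal.ofReal_one.symm))
    (hG.tendsto_inv_m 1)
  exact h2

theorem negligible_inner_feat (τ : StepIdx dz J L) (k : Bool) (ζ : Fin dz) (a : Fin L × Fin J) :
    Negligible couplingLaw G fun ω : Outcome dz J L γ C K =>
      inner ℝ (ω.vecX' τ) (ω.feat k ζ a) / Real.sqrt ω.p.m := by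
  obtain ⟨κ, hκ, hb⟩ := Problem.exists_uniformBound dz J L γ hG.γ_pos hG.C_nonneg hG.K_nonneg
  have h2 := Negligible.of_lintegral_sq' (μ := couplingLaw) (G := G)
    (X := fun i s => inner ℝ (noiseVec s.2.1.2 τ) (i.2.M.feature i.2.P k ζ a
      (noiseOf s.1 s.2.1.1)) / Real.sqrt i.2.m)
    (b := fun p => ((Real.sqrt K + 1) * κ) ^ 2 / p.m)
    (fun i => (measurable_inner_feature τ k ζ a).div_const _)
    (fun i => lintegral_sq_div_sqrt_le
      ((lintegral_sq_inner_feature (M := i.2.M) (P := i.2.P) τ k ζ a).le.trans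
        (lintegral_sq_norm_feature_le i.2.bdd (hb i.2).theta (hb i.2).omega k ζ a)))
    (hG.tendsto_inv_m _)
  exact h2

/-- The concentration hypothesis concerns the law of the mean-field noise. It transfers to the
coupling because the noise built from `x` has that law, for every value of the regularization. -/
theorem negligible_of_concentrates
    {X : ∀ p : Problem dz J L γ C K, Noise dz J L p.n p.m → ℝ}
    (hX : ∀ (p : Problem dz J L γ C K) c δ, p.M.Concentrates p.P c δ → p.M.ConcentratesVar c δ (X p))
    (hXm : ∀ p, Measurable (X p)) :
    Negligible couplingLaw G fun ω : Outcome dz J L γ C K =>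
      X ω.p (noiseOf ω.2.1 ω.2.2.1.1) - ∫ s, X ω.p s ∂ω.p.M.noiseLaw := by
  obtain ⟨c, δ, hc, hδ, h⟩ := hG.concentrates
  refine .of_deviation hc hδ (h.mono fun p hp j => ?_)
  have h1 := hX p _ _ hp
  have hS : MeasurableSet {s | c p < |X p s - ∫ s', X p s' ∂p.M.noiseLaw|} :=
    measurableSet_lt measurable_const ((hXm p).sub_const _).abs
  have h2 := (measurePreserving_sample_noiseOf p.M).measure_preimage hS.nullMeasurableSet
  have h3 : (couplingLaw (j, p)).real {s | c p < |X p (noiseOf s.1 s.2.1.1) -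
      ∫ s', X p s' ∂p.M.noiseLaw|} ≤ δ p :=
    (congrArg ENNReal.toReal h2).le.trans h1
  exact h3

end GrowingProblems

end DMF

end

/-! ### Bounded and vanishing quantities; the Gram matrix of the normalized features. -/

noncomputable section

namespace DMF

open Asymptotics

variable {dz J L : ℕ} {γ C K : ℝ} {G : Filter (Problem dz J L γ C K)}

/-- Convergence to zero along the likely events. -/
def Vanishing (G : Filter (Problem dz J L γ C K)) (f : Outcome dz J L γ C K → ℝ) : Prop :=
  f =o[likely G] fun _ => (1 : ℝ)

/-- Boundedness along the likely events. -/
def Bounded (G : Filter (Problem dz J L γ C K)) (f : Outcome dz J L γ C K → ℝ) : Prop :=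
  f =O[likely G] fun _ => (1 : ℝ)

variable {f g : Outcome dz J L γ C K → ℝ}

theorem Vanishing.of_le (hg : Vanishing G g) (h : ∀ ω, |f ω| ≤ |g ω|) : Vanishing G f :=
  (IsBigO.of_bound 1 (Eventually.of_forall fun ω => by simpa using h ω)).trans_isLittleO hg

theorem Vanishing.add (hf : Vanishing G f) (hg : Vanishing G g) :
    Vanishing G fun ω => f ω + g ω := IsLittleO.add hf hg

theorem Vanishing.sum {κ : Type*} {s : Finset κ} {f : κ → Outcome dz J L γ C K → ℝ}
    (h : ∀ k ∈ s, Vanishing G (f k)) : Vanishing G fun ω => ∑ k ∈ s, f k ω :=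
  (IsLittleO.sum h).congr_left fun ω => by simp only [Finset.sum_apply]

theorem Bounded.of_le (hg : Bounded G g) (h : ∀ ω, |f ω| ≤ |g ω|) : Bounded G f :=
  (IsBigO.of_bound 1 (Eventually.of_forall fun ω => by simpa using h ω)).trans hg

theorem Bounded.const (c : ℝ) : Bounded G fun _ => c :=
  isBigO_const_const _ one_ne_zero _

theorem Bounded.of_abs_le {c : ℝ} (h : ∀ ω, |f ω| ≤ c) : Bounded G f :=
  (Bounded.const c).of_le fun ω => (h ω).trans (le_abs_self _)

theorem Bounded.add (hf : Bounded G f) (hg : Bounded G g) :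
    Bounded G fun ω => f ω + g ω := IsBigO.add hf hg

theorem Bounded.sum {κ : Type*} {s : Finset κ} {f : κ → Outcome dz J L γ C K → ℝ}
    (h : ∀ k ∈ s, Bounded G (f k)) : Bounded G fun ω => ∑ k ∈ s, f k ω :=
  (IsBigO.sum h).congr_left fun ω => by simp only [Finset.sum_apply]

theorem Bounded.mul (hf : Bounded G f) (hg : Bounded G g) :
    Bounded G fun ω => f ω * g ω := by
  simpa [Bounded] using IsBigO.mul hf hg

theorem Bounded.mul_vanishing (hf : Bounded G f) (hg : Vanishing G g) :
    Vanishing G fun ω => f ω * g ω := by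
  simpa [Vanishing] using IsBigO.mul_isLittleO hf hg

theorem Vanishing.abs (hf : Vanishing G f) : Vanishing G fun ω => |f ω| :=
  hf.of_le fun _ => (abs_abs _).le

theorem Bounded.abs (hf : Bounded G f) : Bounded G fun ω => |f ω| :=
  hf.of_le fun _ => (abs_abs _).le

theorem Vanishing.bounded (hf : Vanishing G f) : Bounded G f := hf.isBigO

theorem Vanishing.const_mul (hf : Vanishing G f) (c : ℝ) : Vanishing G fun ω => c * f ω :=
  (Bounded.const c).mul_vanishing hf

theorem Negligible.vanishing (hf : Negligible couplingLaw G f) : Vanishing G f := hf.isLittleO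

/-- The size of the regularization is a function of the outer index alone. -/
theorem vanishing_η : Vanishing G fun ω : Outcome dz J L γ C K => ω.η := by
  refine (isLittleO_one_iff ℝ).2 ?_
  have h1 : Tendsto (fun i : ℕ × Problem dz J L γ C K => regSize i.1) (atTop.curry G) (𝓝 0) :=
    tendsto_regSize.comp (tendsto_fst.mono_left curry_le_prod)
  exact h1.comp tendsto_fst_whp

namespace Outcome

variable (ω : Outcome dz J L γ C K)

/-- The normalized features of the mean-field dynamics. -/
def norBar (k : Bool) (ζ : Fin dz) (a : Fin L × Fin J) :
    EuclideanSpace ℝ (Ambient J L ω.p.n ω.p.m) :=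
  ∑ b, (ω.reg k ζ).N b a • (ω.feat k ζ b + stepScale ω.η k b • ω.aux b)

theorem norFeat_eq (k : Bool) (ζ : Fin dz) (a : Fin L × Fin J) :
    ω.norFeat k ζ a =
      ∑ b, (ω.reg k ζ).N b a • (ω.regFeat k ζ b + stepScale ω.η k b • ω.aux b) := rfl

theorem η_pos : 0 < ω.η := regSize_pos _

theorem η_le_one : ω.η ≤ 1 := regSize_le_one _

theorem stepScale_pos (k : Bool) (a : Fin L × Fin J) : 0 < stepScale ω.η k a :=
  DMF.stepScale_pos ω.η_pos k a

theorem stepScale_le (k : Bool) (a : Fin L × Fin J) : stepScale ω.η k a ≤ ω.η :=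
  DMF.stepScale_le ω.η_pos.le ω.η_le_one k a

/-- Errors proportional to the scale of a feature survive normalization without loss. -/
theorem abs_N_mul_le (k : Bool) (ζ : Fin dz) (a b : Fin L × Fin J) :
    |(ω.reg k ζ).N b a| * stepScale ω.η k b ≤ 1 := by
  have := (ω.reg k ζ).abs_N_le b a
  have h := ω.stepScale_pos k b
  calc _ ≤ (stepScale ω.η k b)⁻¹ * stepScale ω.η k b := by gcongr
    _ = 1 := inv_mul_cancel₀ h.ne'

/-- A bound by a function of the coupling index alone, as needed for multiplying negligible
quantities. -/
theorem abs_N_le (k : Bool) (ζ : Fin dz) (a b : Fin L × Fin J) :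
    |(ω.reg k ζ).N b a| ≤ ((regSize ω.1.1) ^ (2 * L))⁻¹ := by
  refine ((ω.reg k ζ).abs_N_le b a).trans (inv_anti₀ (pow_pos ω.η_pos _) ?_)
  exact pow_le_pow_of_le_one ω.η_pos.le ω.η_le_one (by omega)

theorem inner_aux_aux (a b : Fin L × Fin J) :
    inner ℝ (ω.aux a) (ω.aux b) = if a = b then (1 : ℝ) else 0 := by
  simp [aux, EuclideanSpace.inner_single_left]

theorem norm_aux (a : Fin L × Fin J) : ‖ω.aux a‖ = 1 := by simp [aux]

theorem inner_feat_aux (k : Bool) (ζ : Fin dz) (a b : Fin L × Fin J) :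
    inner ℝ (ω.feat k ζ a) (ω.aux b) = (0 : ℝ) := by
  cases k <;> simp [aux, feat, feature_true, feature_false, EuclideanSpace.inner_single_right]

/-- The overlap of the features. -/
def overlap (k : Bool) (ζ : Fin dz) (a b : Fin L × Fin J) : ℝ :=
  ω.p.M.overlap ω.p.P k ζ a b (noiseOf ω.2.1 ω.2.2.1.1)

theorem inner_feat_feat (k : Bool) (ζ : Fin dz) (a b : Fin L × Fin J) :
    inner ℝ (ω.feat k ζ a) (ω.feat k ζ b) = ω.overlap k ζ a b := inner_feature _ _ _ _ _ _

/-- The auxiliary coordinates add exactly `D²` to the Gram matrix, and `Nᵀ (AᵀA + D²) N = 1`. What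
remains is the fluctuation of the overlaps, conjugated by `N`. -/
theorem inner_norBar (k : Bool) (ζ : Fin dz) (a b : Fin L × Fin J) :
    inner ℝ (ω.norBar k ζ a) (ω.norBar k ζ b) - (if a = b then (1 : ℝ) else 0) =
      ∑ c, ∑ d, (ω.reg k ζ).N c a * (ω.reg k ζ).N d b * (ω.overlap k ζ c d -
        ((ω.p.P.A k ζ).transpose * ω.p.P.A k ζ) c d) := by
  have e1 : inner ℝ (ω.norBar k ζ a) (ω.norBar k ζ b) = ∑ c, ∑ d, (ω.reg k ζ).N c a *
      (ω.reg k ζ).N d b * (ω.overlap k ζ c d + if c = d then stepScale ω.η k c ^ 2 else 0) := by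
    rw [Outcome.norBar, Outcome.norBar, sum_inner]
    refine Finset.sum_congr rfl fun c _ => ?_
    rw [inner_sum]
    refine Finset.sum_congr rfl fun d _ => ?_
    rw [real_inner_smul_left, real_inner_smul_right, inner_add_left, inner_add_right,
      inner_add_right, real_inner_smul_left, real_inner_smul_left, real_inner_smul_right,
      real_inner_smul_right, inner_feat_feat, inner_feat_aux, inner_aux_aux,
      real_inner_comm, inner_feat_aux]
    split_ifs with h
    · subst h; ring
    · ring
  have e2 : (if a = b then (1 : ℝ) else 0) = ∑ c, ∑ d, (ω.reg k ζ).N c a *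
      (ω.reg k ζ).N d b * (((ω.p.P.A k ζ).transpose * ω.p.P.A k ζ) c d +
        if c = d then stepScale ω.η k c ^ 2 else 0) := by
    have h1 := congrFun (congrFun (ω.reg k ζ).transpose_N_mul a) b
    rw [Matrix.one_apply] at h1
    rw [← h1, Matrix.mul_apply, Finset.sum_comm]
    refine Finset.sum_congr rfl fun d _ => ?_
    rw [Matrix.mul_apply, Finset.sum_mul]
    refine Finset.sum_congr rfl fun c _ => ?_
    rw [Matrix.transpose_apply, Matrix.add_apply, Matrix.diagonal_apply]
    ring
  rw [e1, e2, ← Finset.sum_sub_distrib]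
  refine Finset.sum_congr rfl fun c _ => ?_
  rw [← Finset.sum_sub_distrib]
  exact Finset.sum_congr rfl fun d _ => by ring

/-- The correlation of the features with the noise. -/
def cross (k : Bool) (ζ : Fin dz) (a b : Fin L × Fin J) : ℝ :=
  ω.p.M.cross ω.p.P k ζ a b (noiseOf ω.2.1 ω.2.2.1.1)

theorem inner_vecX_feat (k : Bool) (ζ : Fin dz) (a b : Fin L × Fin J) :
    inner ℝ (ω.vecX (!k, ζ, a)) (ω.feat k ζ b) / Real.sqrt ω.p.m = ω.cross k ζ a b :=
  inner_noiseVec_feature _ _ _ _ _ _ _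

theorem vecY_eq (k : Bool) (ζ : Fin dz) (b : Fin L × Fin J) :
    ω.vecY (k, ζ, b) = ∑ c, (ω.reg k ζ).N c b • (∑ c', ω.p.P.A k ζ c' c • ω.vecX (k, ζ, c') +
      stepScale ω.η k c • ω.vecX' (k, ζ, c)) := by
  ext i
  simp only [WithLp.ofLp_sum, Finset.sum_apply, PiLp.smul_apply, PiLp.add_apply, smul_eq_mul]
  rfl

/-- The regularized `A` times `B`. -/
theorem sum_N_mul_eq (k : Bool) (ζ : Fin dz) (b c : Fin L × Fin J) (B : Kernel J L) :
    ∑ d, (ω.reg k ζ).N d b * ((ω.p.P.A k ζ).transpose * (ω.p.P.A k ζ * B)) d c =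
      ((ω.reg k ζ).R * B) b c - ∑ d, (ω.reg k ζ).N d b * stepScale ω.η k d ^ 2 * B d c := by
  have h : (ω.reg k ζ).N.transpose * ((ω.p.P.A k ζ).transpose * (ω.p.P.A k ζ * B)) =
      (ω.reg k ζ).R * B -
        (ω.reg k ζ).N.transpose * (Matrix.diagonal (fun d => stepScale ω.η k d ^ 2) * B) := by
    have h1 := (ω.reg k ζ).transpose_mul
    have h2 : (ω.p.P.A k ζ).transpose * ω.p.P.A k ζ = (ω.reg k ζ).R.transpose * (ω.reg k ζ).R -
        Matrix.diagonal fun d => stepScale ω.η k d ^ 2 := by rw [h1]; abel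
    have h3 : (ω.reg k ζ).N.transpose * (ω.reg k ζ).R.transpose = 1 := by
      rw [← Matrix.transpose_mul, (ω.reg k ζ).R_mul_N, Matrix.transpose_one]
    rw [← Matrix.mul_assoc (ω.p.P.A k ζ).transpose, h2, Matrix.sub_mul, Matrix.mul_sub,
      ← Matrix.mul_assoc _ _ B, ← Matrix.mul_assoc _ _ B, ← Matrix.mul_assoc, h3, Matrix.one_mul]
  have h4 := congrFun (congrFun h b) c
  rw [Matrix.mul_apply] at h4
  simp only [Matrix.transpose_apply, Matrix.sub_apply] at h4
  rw [h4]
  congr 1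
  rw [Matrix.mul_apply]
  simp only [Matrix.transpose_apply, Matrix.diagonal_mul, mul_assoc]

end Outcome

theorem Problem.UniformBound.A {p : Problem dz J L γ C K} {κ : ℝ} (h : p.UniformBound κ) (k : Bool)
    (ζ : Fin dz) (a b : Fin L × Fin J) : |p.P.A k ζ a b| ≤ κ := by
  cases k
  · exact h.Aomega ζ a b
  · exact h.Atheta ζ a b

theorem Problem.UniformBound.B {p : Problem dz J L γ C K} {κ : ℝ} (h : p.UniformBound κ) (k : Bool)
    (ζ : Fin dz) (a b : Fin L × Fin J) : |p.P.B k ζ a b| ≤ κ := by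
  cases k
  · exact (h.memory (2 * b.1 + 1)).2 ζ a b.1 b.2 le_rfl
  · exact (h.memory (2 * b.1)).1 ζ a b.1 b.2 le_rfl

theorem Problem.integral_overlap (p : Problem dz J L γ C K) (k : Bool) (ζ : Fin dz)
    (a b : Fin L × Fin J) :
    ∫ s, p.M.overlap p.P k ζ a b s ∂p.M.noiseLaw = ((p.P.A k ζ).transpose * p.P.A k ζ) a b := by
  cases k
  · exact (congrFun (congrFun (p.isDMF.Aomega_cholesky ζ).2 a) b).symm
  · exact (congrFun (congrFun (p.isDMF.Atheta_cholesky ζ).2 a) b).symm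

namespace GrowingProblems

variable (hG : GrowingProblems G)

include hG

theorem exists_uniformBound :
    ∃ κ, 0 ≤ κ ∧ ∀ p : Problem dz J L γ C K, p.UniformBound κ :=
  Problem.exists_uniformBound dz J L γ hG.γ_pos hG.C_nonneg hG.K_nonneg

theorem bounded_R (k : Bool) (ζ : Fin dz) (a b : Fin L × Fin J) :
    Bounded G fun ω => (ω.reg k ζ).R a b := by
  obtain ⟨κ, -, h⟩ := hG.exists_uniformBound
  exact .of_abs_le fun ω => (ω.reg k ζ).abs_R_le (fun a b => (h ω.p).A k ζ a b)
    (fun a => by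
      rw [abs_of_pos (ω.stepScale_pos k a)]
      exact (ω.stepScale_le k a).trans ω.η_le_one) a b

theorem bounded_B (k : Bool) (ζ : Fin dz) (a b : Fin L × Fin J) :
    Bounded G fun ω => ω.p.P.B k ζ a b := by
  obtain ⟨κ, -, h⟩ := hG.exists_uniformBound
  exact .of_abs_le fun ω => (h ω.p).B k ζ a b

/-- The sum of the norms of the auxiliary vectors is of order `√m`. -/
theorem bounded_sum_vecX' : Bounded G fun ω => (∑ σ, ‖ω.vecX' σ‖) / Real.sqrt ω.p.m := by
  have : Bounded G fun ω => ∑ σ, ‖ω.vecX' σ‖ / Real.sqrt ω.p.m :=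
    Bounded.sum fun σ _ => hG.isBigO_norm_vecX' σ
  simpa only [← Finset.sum_div] using this

/-- The bound on the auxiliary noise is random but of order `√m`. A single factor serves all
features. -/
theorem exists_regFeat_bound : ∃ B : Outcome dz J L γ C K → ℝ, Bounded G B ∧ (∀ ω, 0 ≤ B ω) ∧
    ∀ ω k ζ a, ‖ω.regFeat k ζ a - ω.feat k ζ a‖ ≤ B ω * (ω.η * stepScale ω.η k a) := by
  obtain ⟨κ, hκ, h⟩ := hG.exists_uniformBound
  refine ⟨_, (Bounded.const (featureConst dz J L C K κ)).mul hG.bounded_sum_vecX',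
    fun ω => ?_, fun ω k ζ a => ?_⟩
  · exact mul_nonneg (featureConst_nonneg hG.C_nonneg hG.K_nonneg hκ) (by positivity)
  · exact norm_feature_regularized_sub_le (ω.p.reg ω.1.1) ω.p.lip hG.C_nonneg ω.p.bdd hG.K_nonneg
      hκ (h ω.p).memory ω.η_pos.le ω.η_le_one ω.2.1 ω.2.2.1
      (fun σ => Finset.single_le_sum (f := fun σ => ‖ω.vecX' σ‖) (fun _ _ => norm_nonneg _)
        (Finset.mem_univ σ)) (Finset.sum_nonneg fun _ _ => norm_nonneg _) k ζ a

/-- Each feature has moved by `O(η D)`, and the matching row of `N` is at most `1 / D`. -/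
theorem vanishing_norFeat_sub (k : Bool) (ζ : Fin dz) (a : Fin L × Fin J) :
    Vanishing G fun ω => ‖ω.norFeat k ζ a - ω.norBar k ζ a‖ := by
  obtain ⟨B, hB, hB0, h⟩ := hG.exists_regFeat_bound
  refine ((hB.mul_vanishing vanishing_η).const_mul (L * J : ℕ)).of_le fun ω => ?_
  rw [abs_of_nonneg (norm_nonneg _), abs_of_nonneg (by
    have := ω.η_pos
    have := hB0 ω
    positivity), ω.norFeat_eq, Outcome.norBar, ← Finset.sum_sub_distrib]
  refine (norm_sum_le _ _).trans ((Finset.sum_le_sum (g := fun _ => B ω * ω.η) fun b _ => ?_).trans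
    (le_of_eq (by simp)))
  rw [← smul_sub, add_sub_add_right_eq_sub, norm_smul, Real.norm_eq_abs]
  have h1 := h ω k ζ b
  have h2 := ω.abs_N_mul_le k ζ a b
  have h3 : 0 ≤ B ω * ω.η := mul_nonneg (hB0 ω) ω.η_pos.le
  calc |(ω.reg k ζ).N b a| * ‖ω.regFeat k ζ b - ω.feat k ζ b‖
      ≤ |(ω.reg k ζ).N b a| * (B ω * (ω.η * stepScale ω.η k b)) := by gcongr
    _ = B ω * ω.η * (|(ω.reg k ζ).N b a| * stepScale ω.η k b) := by ring
    _ ≤ B ω * ω.η * 1 := by gcongr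
    _ = _ := mul_one _

end GrowingProblems

end DMF

end

/-! ### The directions are close to the normalized features. -/

noncomputable section

namespace DMF

open Asymptotics

section MeasurableObservables

variable {dz J L n m : ℕ} {M : Model dz J L n m} (P : Params dz J L n)

theorem measurable_overlap (k : Bool) (ζ : Fin dz) (a b : Fin L × Fin J) :
    Measurable (M.overlap P k ζ a b) := by
  refine measurable_noise fun z => ?_
  have h1 : ∀ l i j, Continuous fun x => M.thetaBar P (z, x) l i j := fun l i j =>
    (continuous_apply_apply i j).comp (continuous_thetaBar P z l)
  have h2 : ∀ l k j, Continuous fun x => M.omegaBar P (z, x) l k j := fun l i j =>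
    (continuous_apply_apply i j).comp (continuous_omegaBar P z l)
  cases k
  · simp only [Model.overlap, Model.overlapOmega, Bool.false_eq_true, if_false]
    fun_prop
  · simp only [Model.overlap, Model.overlapTheta, if_true]
    fun_prop

theorem measurable_cross (k : Bool) (ζ : Fin dz) (a b : Fin L × Fin J) :
    Measurable (M.cross P k ζ a b) := by
  refine measurable_noise fun z => ?_
  have h1 : ∀ l i j, Continuous fun x => M.thetaBar P (z, x) l i j := fun l i j =>
    (continuous_apply_apply i j).comp (continuous_thetaBar P z l)
  have h2 : ∀ l k j, Continuous fun x => M.omegaBar P (z, x) l k j := fun l i j =>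
    (continuous_apply_apply i j).comp (continuous_omegaBar P z l)
  cases k
  · simp only [Model.cross, Model.crossOmega, Bool.false_eq_true, if_false]
    fun_prop
  · simp only [Model.cross, Model.crossTheta, if_true]
    fun_prop

theorem measurable_meanTheta (ζ : Fin dz) (l : Fin L) (j : Fin J) :
    Measurable (M.meanTheta P ζ l j) := by
  refine measurable_noise fun z => ?_
  have h1 : ∀ l i j, Continuous fun x => M.thetaBar P (z, x) l i j := fun l i j =>
    (continuous_apply_apply i j).comp (continuous_thetaBar P z l)
  unfold Model.meanTheta
  fun_prop

theorem measurable_meanOmega (ζ : Fin dz) (l : Fin L) (j : Fin J) :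
    Measurable (M.meanOmega P ζ l j) := by
  refine measurable_noise fun z => ?_
  have h2 : ∀ l k j, Continuous fun x => M.omegaBar P (z, x) l k j := fun l i j =>
    (continuous_apply_apply i j).comp (continuous_omegaBar P z l)
  change Continuous fun x => (m : ℝ)⁻¹ * ∑ k with z k = ζ, M.omegaBar P (z, x) l k j
  exact continuous_const.mul (continuous_finsetSum _ fun k _ => h2 l k j)

end MeasurableObservables

variable {dz J L : ℕ} {γ C K : ℝ} {G : Filter (Problem dz J L γ C K)}

namespace GrowingProblems

variable (hG : GrowingProblems G)

include hG

/-- Integration by parts, with the responses replaced by the parameters `B`. -/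
theorem integral_cross (p : Problem dz J L γ C K) (k : Bool) (ζ : Fin dz)
    (a b : Fin L × Fin J) :
    ∫ s, p.M.cross p.P k ζ a b s ∂p.M.noiseLaw = (p.P.A (!k) ζ * p.P.B k ζ) a b := by
  have hB := p.isDMF.B_eq_resp p.m_pos p.lip hG.C_nonneg p.bdd hG.K_nonneg ζ
  cases k
  · have h := integral_crossOmega p.m_pos p.lip hG.C_nonneg p.bdd hG.K_nonneg p.P ζ
    rw [← hB.1] at h
    exact congrFun (congrFun h a) b
  · have h := integral_crossTheta p.m_pos p.lip hG.C_nonneg p.bdd hG.K_nonneg p.P ζ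
    rw [← hB.2] at h
    exact congrFun (congrFun h a) b

theorem negligible_overlap (k : Bool) (ζ : Fin dz) (a b : Fin L × Fin J) :
    Negligible couplingLaw G fun ω : Outcome dz J L γ C K =>
      ω.overlap k ζ a b - ((ω.p.P.A k ζ).transpose * ω.p.P.A k ζ) a b := by
  refine (hG.negligible_of_concentrates (X := fun p => p.M.overlap p.P k ζ a b)
    (fun p c δ h => ?_) fun _ => measurable_overlap _ _ _ _ _).congr fun ω => ?_
  · cases k
    · exact h.overlapOmega ζ a b
    · exact h.overlapTheta ζ a b
  · rw [Problem.integral_overlap]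
    rfl

theorem negligible_cross (k : Bool) (ζ : Fin dz) (a b : Fin L × Fin J) :
    Negligible couplingLaw G fun ω : Outcome dz J L γ C K =>
      ω.cross k ζ a b - (ω.p.P.A (!k) ζ * ω.p.P.B k ζ) a b := by
  refine (hG.negligible_of_concentrates (X := fun p => p.M.cross p.P k ζ a b)
    (fun p c δ h => ?_) fun _ => measurable_cross _ _ _ _ _).congr fun ω => ?_
  · cases k
    · exact h.crossOmega ζ a b
    · exact h.crossTheta ζ a b
  · rw [hG.integral_cross]
    rfl

theorem vanishing_meanTheta (ζ : Fin dz) (l : Fin L) (j : Fin J) :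
    Vanishing G fun ω => ω.p.M.meanTheta ω.p.P ζ l j (noiseOf ω.2.1 ω.2.2.1.1) -
      ω.p.P.beta l ζ j := by
  refine ((hG.negligible_of_concentrates (X := fun p => p.M.meanTheta p.P ζ l j)
    (fun _ _ _ h => h.meanTheta ζ l j) fun _ => measurable_meanTheta _ _ _ _).congr
      fun ω : Outcome dz J L γ C K => ?_).vanishing
  rw [ω.p.isDMF.beta_eq]

theorem vanishing_meanOmega (ζ : Fin dz) (l : Fin L) (j : Fin J) :
    Vanishing G fun ω => ω.p.M.meanOmega ω.p.P ζ l j (noiseOf ω.2.1 ω.2.2.1.1) -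
      ∫ s, ω.p.M.meanOmega ω.p.P ζ l j s ∂ω.p.M.noiseLaw :=
  (hG.negligible_of_concentrates (X := fun p => p.M.meanOmega p.P ζ l j)
    (fun _ _ _ h => h.meanOmega ζ l j) fun _ => measurable_meanOmega _ _ _ _).vanishing

/-- The overlaps concentrate at fixed `η`, so the factors `N`, bounded in terms of `η` alone, do no
harm. -/
theorem vanishing_inner_norBar (k : Bool) (ζ : Fin dz) (a b : Fin L × Fin J) :
    Vanishing G fun ω => inner ℝ (ω.norBar k ζ a) (ω.norBar k ζ b) -
      (if a = b then (1 : ℝ) else 0) := by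
  simp only [Outcome.inner_norBar]
  refine .sum fun c _ => .sum fun d _ => Negligible.vanishing ?_
  refine (hG.negligible_overlap k ζ c d).mul_le
    (fun j => ((regSize j) ^ (2 * L))⁻¹ * ((regSize j) ^ (2 * L))⁻¹)
    fun ω : Outcome dz J L γ C K => ?_
  rw [abs_mul, abs_mul]
  gcongr
  · exact (abs_nonneg _).trans (ω.abs_N_le k ζ a c)
  · exact ω.abs_N_le k ζ a c
  · exact ω.abs_N_le k ζ b d

theorem bounded_norm_norBar (k : Bool) (ζ : Fin dz) (a : Fin L × Fin J) :
    Bounded G fun ω => ‖ω.norBar k ζ a‖ := by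
  refine ((Bounded.const 2).add (hG.vanishing_inner_norBar k ζ a a).bounded.abs).of_le
    fun ω => ?_
  simp only [if_true, real_inner_self_eq_norm_sq, abs_norm]
  refine le_trans ?_ (le_abs_self _)
  have h := le_abs_self (‖ω.norBar k ζ a‖ ^ 2 - 1)
  nlinarith [sq_nonneg (‖ω.norBar k ζ a‖ - 1)]

theorem bounded_norm_norFeat (k : Bool) (ζ : Fin dz) (a : Fin L × Fin J) :
    Bounded G fun ω => ‖ω.norFeat k ζ a‖ := by
  refine ((hG.bounded_norm_norBar k ζ a).add (hG.vanishing_norFeat_sub k ζ a).bounded).of_le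
    fun ω => ?_
  rw [abs_norm, abs_of_nonneg (by positivity), add_comm]
  have := norm_add_le (ω.norFeat k ζ a - ω.norBar k ζ a) (ω.norBar k ζ a)
  rwa [sub_add_cancel] at this

theorem vanishing_inner_norFeat (k : Bool) (ζ : Fin dz) (a b : Fin L × Fin J) :
    Vanishing G fun ω => inner ℝ (ω.norFeat k ζ a) (ω.norFeat k ζ b) -
      (if a = b then (1 : ℝ) else 0) := by
  refine (((hG.vanishing_inner_norBar k ζ a b).abs.add
    ((hG.bounded_norm_norFeat k ζ b).mul_vanishing (hG.vanishing_norFeat_sub k ζ a))).add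
    ((hG.bounded_norm_norBar k ζ a).mul_vanishing (hG.vanishing_norFeat_sub k ζ b))).of_le
    fun ω => ?_
  refine le_trans ?_ (le_abs_self _)
  have e : inner ℝ (ω.norFeat k ζ a) (ω.norFeat k ζ b) - (if a = b then (1 : ℝ) else 0) =
      (inner ℝ (ω.norBar k ζ a) (ω.norBar k ζ b) - (if a = b then (1 : ℝ) else 0)) +
      inner ℝ (ω.norFeat k ζ a - ω.norBar k ζ a) (ω.norFeat k ζ b) +
      inner ℝ (ω.norBar k ζ a) (ω.norFeat k ζ b - ω.norBar k ζ b) := by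
    rw [inner_sub_left, inner_sub_right]
    ring
  rw [e]
  refine (abs_add_le _ _).trans (add_le_add ((abs_add_le _ _).trans (add_le_add le_rfl ?_)) ?_)
  · rw [mul_comm]; exact abs_real_inner_le_norm _ _
  · exact abs_real_inner_le_norm _ _

/-- The normalized features are almost orthonormal, so Gram–Schmidt hardly moves them. Induction
along its order, using the recursive stability estimate. -/
theorem vanishing_dir_sub (k : Bool) (ζ : Fin dz) (a : Fin L × Fin J) :
    Vanishing G fun ω => ‖ω.dir k ζ a - ω.norFeat k ζ a‖ := by
  have main : ∀ (t : ℕ) (a : Fin L × Fin J), (finProdFinEquiv a : ℕ) = t →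
      Vanishing G fun ω => ‖ω.dir k ζ a - ω.norFeat k ζ a‖ := by
    intro t
    induction t using Nat.strong_induction_on with
    | _ t ih =>
      rintro a rfl
      have h1 : Vanishing G fun ω => |1 - ‖ω.norFeat k ζ a‖| := by
        refine (hG.vanishing_inner_norFeat k ζ a a).of_le fun ω => ?_
        simp only [if_true, real_inner_self_eq_norm_sq, abs_abs]
        have h2 : ‖ω.norFeat k ζ a‖ ^ 2 - 1 = (‖ω.norFeat k ζ a‖ - 1) * (‖ω.norFeat k ζ a‖ + 1) := by
          ring
        rw [h2, abs_mul, abs_sub_comm]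
        refine le_mul_of_one_le_right (abs_nonneg _) ?_
        rw [abs_of_nonneg (by positivity)]
        linarith [norm_nonneg (ω.norFeat k ζ a)]
      have h2 : Vanishing G fun ω => ∑ b with finProdFinEquiv b < finProdFinEquiv a,
          (|inner ℝ (ω.norFeat k ζ b) (ω.norFeat k ζ a)| +
            ‖ω.dir k ζ b - ω.norFeat k ζ b‖ * ‖ω.norFeat k ζ a‖) := by
        refine .sum fun b hb => ?_
        have hb' : finProdFinEquiv b < finProdFinEquiv a := (Finset.mem_filter.1 hb).2
        have hne : b ≠ a := fun h => by simp [h] at hb'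
        have h3 := hG.vanishing_inner_norFeat k ζ b a
        simp only [if_neg hne, sub_zero] at h3
        refine h3.abs.add ?_
        have h4 := (hG.bounded_norm_norFeat k ζ a).mul_vanishing (ih _ hb' b rfl)
        simpa only [mul_comm] using h4
      refine (h1.add (h2.const_mul 2)).of_le fun ω => ?_
      rw [abs_norm]
      exact (norm_orthonormalize_sub_le _ a).trans (le_abs_self _)
  exact main _ a rfl

end GrowingProblems

end DMF

end

/-! ### Exact decomposition of the residual. -/

noncomputable section

namespace DMF

open Asymptotics

variable {dz J L : ℕ} {γ C K : ℝ} {G : Filter (Problem dz J L γ C K)}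

namespace Outcome

variable (ω : Outcome dz J L γ C K)

/-- Expand `y = (x A + x' D) N`. The correlation with `x` is `A B` up to fluctuations, and `Nᵀ Aᵀ A
B = R B - Nᵀ D² B`. The two leftover terms carry `x' D` and `D²`. -/
theorem inner_vecY_feat (k : Bool) (ζ : Fin dz) (b c : Fin L × Fin J) :
    inner ℝ (ω.vecY (!k, ζ, b)) (ω.feat k ζ c) / Real.sqrt ω.p.m -
        ((ω.reg (!k) ζ).R * ω.p.P.B k ζ) b c =
      ∑ d, (∑ c', (ω.reg (!k) ζ).N d b * ω.p.P.A (!k) ζ c' d *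
          (ω.cross k ζ c' c - (ω.p.P.A (!k) ζ * ω.p.P.B k ζ) c' c) +
        (ω.reg (!k) ζ).N d b * stepScale ω.η (!k) d *
          (inner ℝ (ω.vecX' (!k, ζ, d)) (ω.feat k ζ c) / Real.sqrt ω.p.m)) -
      ∑ d, (ω.reg (!k) ζ).N d b * stepScale ω.η (!k) d ^ 2 * ω.p.P.B k ζ d c := by
  have h1 := ω.sum_N_mul_eq (!k) ζ b c (ω.p.P.B k ζ)
  simp only [Matrix.mul_apply (M := (ω.p.P.A (!k) ζ).transpose), Matrix.transpose_apply] at h1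
  have h2 : inner ℝ (ω.vecY (!k, ζ, b)) (ω.feat k ζ c) / Real.sqrt ω.p.m =
      ∑ d, (ω.reg (!k) ζ).N d b * (∑ c', ω.p.P.A (!k) ζ c' d * ω.cross k ζ c' c +
        stepScale ω.η (!k) d *
          (inner ℝ (ω.vecX' (!k, ζ, d)) (ω.feat k ζ c) / Real.sqrt ω.p.m)) := by
    rw [vecY_eq, sum_inner, Finset.sum_div]
    refine Finset.sum_congr rfl fun d _ => ?_
    rw [real_inner_smul_left, inner_add_left, sum_inner, real_inner_smul_left, mul_div_assoc,
      add_div, Finset.sum_div, mul_div_assoc]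
    simp only [real_inner_smul_left, mul_div_assoc, inner_vecX_feat]
  have h3 : ((ω.reg (!k) ζ).R * ω.p.P.B k ζ) b c = ∑ d, (ω.reg (!k) ζ).N d b *
        ∑ c', ω.p.P.A (!k) ζ c' d * (ω.p.P.A (!k) ζ * ω.p.P.B k ζ) c' c +
      ∑ d, (ω.reg (!k) ζ).N d b * stepScale ω.η (!k) d ^ 2 * ω.p.P.B k ζ d c := by
    rw [h1, sub_add_cancel]
  rw [h2, h3, ← sub_sub, ← Finset.sum_sub_distrib]
  congr 1
  refine Finset.sum_congr rfl fun d _ => ?_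
  simp only [mul_sub, Finset.sum_sub_distrib, mul_add, Finset.mul_sum, mul_assoc]
  ring

/-- The deviation of the action of the Gaussian matrix on a feature from its prediction. -/
def residual (k : Bool) (ζ : Fin dz) (c : Fin L × Fin J) :
    EuclideanSpace ℝ (Ambient J L ω.p.n ω.p.m) :=
  (Real.sqrt ω.p.m)⁻¹ • blockMul ω.W k ζ (ω.regFeat k ζ c) -
    ∑ a, (ω.reg k ζ).R a c • (Real.sqrt ω.p.m)⁻¹ • ω.vecY (k, ζ, a) -
    ∑ b, ω.p.P.B k ζ b c • ω.regFeat (!k) ζ b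

/-- `N R = 1` undoes the normalization and returns the augmented feature. -/
theorem sum_R_smul_norFeat (k : Bool) (ζ : Fin dz) (c : Fin L × Fin J) :
    ∑ a, (ω.reg k ζ).R a c • ω.norFeat k ζ a =
      ω.regFeat k ζ c + stepScale ω.η k c • ω.aux c := by
  simp only [norFeat_eq, Finset.smul_sum, smul_smul]
  rw [Finset.sum_comm]
  have h : ∀ b, ∑ a, (ω.reg k ζ).R a c * (ω.reg k ζ).N b a = if b = c then 1 else 0 := fun b => by
    have := congrFun (congrFun (ω.reg k ζ).N_mul_R b) c
    rw [Matrix.mul_apply, Matrix.one_apply] at this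
    rw [← this]
    exact Finset.sum_congr rfl fun a _ => mul_comm _ _
  simp only [← Finset.sum_smul, h, ite_smul, one_smul, zero_smul, Finset.sum_ite_eq',
    Finset.mem_univ, if_true]

theorem norm_dir (k : Bool) (ζ : Fin dz) (a : Fin L × Fin J) : ‖ω.dir k ζ a‖ = 1 :=
  (orthonormal_direction ω.reg (fun k a => ω.stepScale_pos k a) ω.2.1 ω.noise k ζ).1 a

/-- The correlation of the noise with the directions. -/
def corr (k : Bool) (ζ : Fin dz) (b a : Fin L × Fin J) : ℝ :=
  inner ℝ (ω.vecY (!k, ζ, b)) (ω.dir k ζ a) / Real.sqrt ω.p.m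

/-- The part of the correlations that does not contribute to the limit. -/
def corrError (k : Bool) (ζ : Fin dz) (b a : Fin L × Fin J) : ℝ :=
  if stepTime (!k, ζ, b) < stepTime (k, ζ, a) then
    -(inner ℝ (ω.vecY (k, ζ, a)) (ω.dir (!k) ζ b) / Real.sqrt ω.p.m) else -ω.corr k ζ b a

/-- All correlations with the opposite noise are written down, not just those of earlier times;
`corrError` removes the others and includes the correction from overwriting. Both are negligible,
and the full sum is what combines to a correlation with a feature. -/
theorem blockMul_dir (k : Bool) (ζ : Fin dz) (a : Fin L × Fin J) :
    (Real.sqrt ω.p.m)⁻¹ • blockMul ω.W k ζ (ω.dir k ζ a) =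
      (Real.sqrt ω.p.m)⁻¹ • ω.vecY (k, ζ, a) +
        ∑ b, (ω.corr k ζ b a + ω.corrError k ζ b a) • ω.dir (!k) ζ b := by
  have h := blockMul_adaptive (M := ω.p.M) ω.reg (fun k a => ω.stepScale_pos k a) ω.2.1 ω.noise
    ω.2.2.2 k ζ a
  have h' : blockMul ω.W k ζ (ω.dir k ζ a) = ω.vecY (k, ζ, a) +
      ∑ b with stepTime (!k, ζ, b) < stepTime (k, ζ, a),
        (inner ℝ (ω.vecY (!k, ζ, b)) (ω.dir k ζ a) -
          inner ℝ (ω.dir (!k) ζ b) (ω.vecY (k, ζ, a))) • ω.dir (!k) ζ b := h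
  rw [h', smul_add, Finset.smul_sum, Finset.sum_filter]
  congr 1
  refine Finset.sum_congr rfl fun b _ => ?_
  unfold corrError
  split_ifs with hb
  · rw [smul_smul, corr, real_inner_comm (ω.vecY (k, ζ, a))]
    congr 1
    ring
  · rw [add_neg_cancel, zero_smul]

/-- The deviation of the correlation with a feature from its prediction. -/
def corrDev (k : Bool) (ζ : Fin dz) (b c : Fin L × Fin J) : ℝ :=
  ∑ a, (ω.reg k ζ).R a c * ω.corr k ζ b a - ((ω.reg (!k) ζ).R * ω.p.P.B k ζ) b c

/-- The errors, in this order: directions in place of normalized features, the auxiliary coordinate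
of the feature, correlations with independent noise, fluctuation of the remaining correlations about
`R B`, directions in place of normalized features on the output side, and the auxiliary coordinates
there. -/
theorem residual_eq (k : Bool) (ζ : Fin dz) (c : Fin L × Fin J) :
    ω.residual k ζ c =
      ∑ a, (ω.reg k ζ).R a c •
          (Real.sqrt ω.p.m)⁻¹ • blockMul ω.W k ζ (ω.norFeat k ζ a - ω.dir k ζ a) -
        (Real.sqrt ω.p.m)⁻¹ • blockMul ω.W k ζ (stepScale ω.η k c • ω.aux c) +
      ∑ a, ∑ b, ((ω.reg k ζ).R a c * ω.corrError k ζ b a) • ω.dir (!k) ζ b +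
      ∑ b, ω.corrDev k ζ b c • ω.dir (!k) ζ b +
      ∑ b, ((ω.reg (!k) ζ).R * ω.p.P.B k ζ) b c • (ω.dir (!k) ζ b - ω.norFeat (!k) ζ b) +
      ∑ b, ω.p.P.B k ζ b c • stepScale ω.η (!k) b • ω.aux b := by
  set i := (Real.sqrt ω.p.m)⁻¹ with hi
  have h1 : i • blockMul ω.W k ζ (ω.regFeat k ζ c) =
      ∑ a, (ω.reg k ζ).R a c • i • blockMul ω.W k ζ (ω.norFeat k ζ a) -
        i • blockMul ω.W k ζ (stepScale ω.η k c • ω.aux c) := by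
    have e := congrArg (blockMul ω.W k ζ) (ω.sum_R_smul_norFeat k ζ c)
    rw [blockMul_add, blockMul_sum] at e
    rw [eq_sub_iff_add_eq, ← smul_add, ← e, Finset.smul_sum]
    exact Finset.sum_congr rfl fun a _ => by rw [blockMul_smul, smul_comm]
  have h2 : ∀ a, i • blockMul ω.W k ζ (ω.norFeat k ζ a) =
      i • blockMul ω.W k ζ (ω.norFeat k ζ a - ω.dir k ζ a) + (i • ω.vecY (k, ζ, a) +
        ∑ b, (ω.corr k ζ b a + ω.corrError k ζ b a) • ω.dir (!k) ζ b) := fun a => by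
    rw [← ω.blockMul_dir k ζ a, ← smul_add, ← blockMul_add, sub_add_cancel]
  have h3 : ∑ a, (ω.reg k ζ).R a c • ∑ b, (ω.corr k ζ b a + ω.corrError k ζ b a) •
      ω.dir (!k) ζ b = ∑ b, (∑ a, (ω.reg k ζ).R a c * ω.corr k ζ b a) • ω.dir (!k) ζ b +
      ∑ a, ∑ b, ((ω.reg k ζ).R a c * ω.corrError k ζ b a) • ω.dir (!k) ζ b := by
    have e : ∀ a, (ω.reg k ζ).R a c • ∑ b, (ω.corr k ζ b a + ω.corrError k ζ b a) •
        ω.dir (!k) ζ b = ∑ b, ((ω.reg k ζ).R a c * ω.corr k ζ b a) • ω.dir (!k) ζ b +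
        ∑ b, ((ω.reg k ζ).R a c * ω.corrError k ζ b a) • ω.dir (!k) ζ b := fun a => by
      rw [Finset.smul_sum, ← Finset.sum_add_distrib]
      exact Finset.sum_congr rfl fun b _ => by rw [smul_smul, mul_add, add_smul]
    rw [Finset.sum_congr rfl fun a _ => e a, Finset.sum_add_distrib, Finset.sum_comm]
    simp only [Finset.sum_smul]
  -- The factor `R` in `R B` undoes the normalization of the opposite features, so the memory term
  -- appears with the coefficients `B` themselves.
  have h4 : ∑ b, ((ω.reg (!k) ζ).R * ω.p.P.B k ζ) b c • ω.norFeat (!k) ζ b =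
      ∑ b, ω.p.P.B k ζ b c • ω.regFeat (!k) ζ b +
        ∑ b, ω.p.P.B k ζ b c • stepScale ω.η (!k) b • ω.aux b := by
    rw [← Finset.sum_add_distrib]
    have e : ∀ b, ω.p.P.B k ζ b c • ω.regFeat (!k) ζ b +
        ω.p.P.B k ζ b c • stepScale ω.η (!k) b • ω.aux b =
        ∑ a, ((ω.reg (!k) ζ).R a b * ω.p.P.B k ζ b c) • ω.norFeat (!k) ζ a := fun b => by
      rw [← smul_add, ← sum_R_smul_norFeat, Finset.smul_sum]
      exact Finset.sum_congr rfl fun a _ => by rw [smul_smul, mul_comm]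
    rw [Finset.sum_congr rfl fun b _ => e b, Finset.sum_comm]
    simp only [Matrix.mul_apply, Finset.sum_smul]
  have h5 : ∑ b, (∑ a, (ω.reg k ζ).R a c * ω.corr k ζ b a) • ω.dir (!k) ζ b =
      ∑ b, ω.corrDev k ζ b c • ω.dir (!k) ζ b +
        ∑ b, ((ω.reg (!k) ζ).R * ω.p.P.B k ζ) b c • ω.dir (!k) ζ b := by
    simp only [← Finset.sum_add_distrib, ← add_smul, corrDev, sub_add_cancel]
  rw [residual, h1]
  simp only [h2, smul_add, smul_sub, Finset.sum_add_distrib, Finset.sum_sub_distrib, h3, h4, h5]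
  abel

end Outcome

end DMF

end

/-! ### The residual vanishes. -/

noncomputable section

namespace DMF

open Asymptotics

variable {dz J L : ℕ} {γ C K : ℝ} {G : Filter (Problem dz J L γ C K)}

theorem Vanishing.sub {f g : Outcome dz J L γ C K → ℝ} (hf : Vanishing G f) (hg : Vanishing G g) :
    Vanishing G fun ω => f ω - g ω := IsLittleO.sub hf hg

theorem vanishing_stepScale (k : Bool) (a : Fin L × Fin J) :
    Vanishing G fun ω : Outcome dz J L γ C K => stepScale ω.η k a :=
  vanishing_η.of_le fun ω => by
    rw [abs_of_pos (ω.stepScale_pos k a), abs_of_pos ω.η_pos]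
    exact ω.stepScale_le k a

namespace Outcome

variable (ω : Outcome dz J L γ C K)

/-- Summing against `R` turns correlations with normalized features into correlations with features,
up to the auxiliary coordinate. -/
theorem corrDev_eq (k : Bool) (ζ : Fin dz) (b c : Fin L × Fin J) :
    ω.corrDev k ζ b c =
      ∑ a, (ω.reg k ζ).R a c *
        (inner ℝ (ω.vecY (!k, ζ, b)) (ω.dir k ζ a - ω.norFeat k ζ a) / Real.sqrt ω.p.m) +
      stepScale ω.η k c * (inner ℝ (ω.vecY (!k, ζ, b)) (ω.aux c) / Real.sqrt ω.p.m) +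
      (inner ℝ (ω.vecY (!k, ζ, b)) (ω.regFeat k ζ c) / Real.sqrt ω.p.m -
        ((ω.reg (!k) ζ).R * ω.p.P.B k ζ) b c) := by
  have h := congrArg (fun v => inner ℝ (ω.vecY (!k, ζ, b)) v / Real.sqrt ω.p.m)
    (ω.sum_R_smul_norFeat k ζ c)
  simp only [inner_sum, inner_add_right, real_inner_smul_right, Finset.sum_div, add_div,
    mul_div_assoc] at h
  simp only [corrDev, corr, inner_sub_right, sub_div, mul_sub, Finset.sum_sub_distrib]
  linarith

theorem norm_blockMul_div_le (k : Bool) (ζ : Fin dz)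
    (v : EuclideanSpace ℝ (Ambient J L ω.p.n ω.p.m)) :
    ‖(Real.sqrt ω.p.m)⁻¹ • blockMul ω.W k ζ v‖ ≤ blockOpNorm ω.W ζ / Real.sqrt ω.p.m * ‖v‖ := by
  rw [norm_smul, Real.norm_eq_abs, abs_of_nonneg (inv_nonneg.2 (Real.sqrt_nonneg _)),
    div_mul_eq_mul_div, div_eq_inv_mul]
  gcongr
  exact norm_blockMul_le _ _ _ _

theorem norm_residual_le (k : Bool) (ζ : Fin dz) (c : Fin L × Fin J) :
    ‖ω.residual k ζ c‖ ≤
      ∑ a, |(ω.reg k ζ).R a c| *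
          (|blockOpNorm ω.W ζ / Real.sqrt ω.p.m| * ‖ω.dir k ζ a - ω.norFeat k ζ a‖) +
        |blockOpNorm ω.W ζ / Real.sqrt ω.p.m| * stepScale ω.η k c +
      ∑ a, ∑ b, |(ω.reg k ζ).R a c| * |ω.corrError k ζ b a| +
      ∑ b, |ω.corrDev k ζ b c| +
      ∑ b, |((ω.reg (!k) ζ).R * ω.p.P.B k ζ) b c| * ‖ω.dir (!k) ζ b - ω.norFeat (!k) ζ b‖ +
      ∑ b, |ω.p.P.B k ζ b c| * stepScale ω.η (!k) b := by
  have hs : ∀ k a, ‖stepScale ω.η k a • ω.aux a‖ = stepScale ω.η k a := fun k a => by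
    rw [norm_smul, norm_aux, mul_one, Real.norm_eq_abs, abs_of_pos (ω.stepScale_pos k a)]
  have hW : ∀ v, ‖(Real.sqrt ω.p.m)⁻¹ • blockMul ω.W k ζ v‖ ≤
      |blockOpNorm ω.W ζ / Real.sqrt ω.p.m| * ‖v‖ := fun v =>
    (ω.norm_blockMul_div_le k ζ v).trans (by gcongr; exact le_abs_self _)
  rw [residual_eq]
  refine (norm_add_le _ _).trans (add_le_add ((norm_add_le _ _).trans (add_le_add
    ((norm_add_le _ _).trans (add_le_add ((norm_add_le _ _).trans (add_le_add
      ((norm_sub_le _ _).trans (add_le_add ?_ ?_)) ?_)) ?_)) ?_)) ?_)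
  · refine norm_sum_le_of_le _ fun a _ => ?_
    rw [norm_smul, Real.norm_eq_abs, norm_sub_rev (ω.dir k ζ a)]
    gcongr
    exact hW _
  · exact (hW _).trans_eq (by rw [hs])
  · refine norm_sum_le_of_le _ fun a _ => norm_sum_le_of_le _ fun b _ => ?_
    rw [norm_smul, norm_dir, mul_one, Real.norm_eq_abs, abs_mul]
  · refine norm_sum_le_of_le _ fun b _ => ?_
    rw [norm_smul, norm_dir, mul_one, Real.norm_eq_abs]
  · refine norm_sum_le_of_le _ fun b _ => ?_
    rw [norm_smul, Real.norm_eq_abs]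
  · refine norm_sum_le_of_le _ fun b _ => ?_
    rw [norm_smul, hs, Real.norm_eq_abs]

end Outcome

namespace GrowingProblems

variable (hG : GrowingProblems G)

include hG

/-- The fluctuations of the correlations are negligible at fixed `η`, and so is the correlation with
the independent noise `x'`. The deterministic error contains `|N| D² ≤ D ≤ η`. -/
theorem vanishing_inner_vecY_feat (k : Bool) (ζ : Fin dz) (b c : Fin L × Fin J) :
    Vanishing G fun ω => inner ℝ (ω.vecY (!k, ζ, b)) (ω.feat k ζ c) / Real.sqrt ω.p.m -
      ((ω.reg (!k) ζ).R * ω.p.P.B k ζ) b c := by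
  obtain ⟨κ, hκ, h⟩ := hG.exists_uniformBound
  simp only [Outcome.inner_vecY_feat]
  refine .sub (.sum fun d _ => .add (.sum fun c' _ => Negligible.vanishing ?_)
    (Negligible.vanishing ?_)) (.sum fun d _ => ?_)
  · refine (hG.negligible_cross k ζ c' c).mul_le (fun j => ((regSize j) ^ (2 * L))⁻¹ * κ)
      fun ω : Outcome dz J L γ C K => ?_
    rw [abs_mul, abs_mul]
    gcongr
    · exact (abs_nonneg _).trans (ω.abs_N_le k ζ b d)
    · exact ω.abs_N_le (!k) ζ b d
    · exact (h ω.p).A (!k) ζ c' d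
  · refine (hG.negligible_inner_feat (!k, ζ, d) k ζ c).mul_le (fun _ => 1)
      fun ω : Outcome dz J L γ C K => ?_
    rw [abs_mul, abs_mul, abs_of_pos (ω.stepScale_pos (!k) d)]
    gcongr
    exact ω.abs_N_mul_le (!k) ζ b d
  · refine ((hG.bounded_B k ζ d c).mul_vanishing vanishing_η).of_le fun ω => ?_
    rw [abs_mul, abs_mul, abs_mul, mul_comm, abs_pow, abs_of_pos (ω.stepScale_pos (!k) d),
      abs_of_pos ω.η_pos, sq, ← mul_assoc |(ω.reg (!k) ζ).N d b|]
    gcongr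
    calc _ ≤ 1 * ω.η := mul_le_mul (ω.abs_N_mul_le (!k) ζ b d) (ω.stepScale_le _ _)
          (ω.stepScale_pos _ _).le zero_le_one
      _ = _ := one_mul _

theorem vanishing_inner_vecY_regFeat (k : Bool) (ζ : Fin dz) (b c : Fin L × Fin J) :
    Vanishing G fun ω => inner ℝ (ω.vecY (!k, ζ, b)) (ω.regFeat k ζ c) / Real.sqrt ω.p.m -
      ((ω.reg (!k) ζ).R * ω.p.P.B k ζ) b c := by
  obtain ⟨B, hB, hB0, h⟩ := hG.exists_regFeat_bound
  refine ((hG.vanishing_inner_vecY_feat k ζ b c).abs.add ((Bounded.mul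
    (hG.isBigO_norm_vecY (!k, ζ, b)) hB).mul_vanishing vanishing_η)).of_le fun ω => ?_
  have h1 : |inner ℝ (ω.vecY (!k, ζ, b)) (ω.regFeat k ζ c - ω.feat k ζ c) / Real.sqrt ω.p.m| ≤
      ‖ω.vecY (!k, ζ, b)‖ / Real.sqrt ω.p.m * B ω * ω.η := by
    rw [abs_div, abs_of_nonneg (Real.sqrt_nonneg _), div_mul_eq_mul_div, div_mul_eq_mul_div]
    gcongr
    refine (abs_real_inner_le_norm _ _).trans ?_
    rw [mul_assoc]
    gcongr
    refine (h ω k ζ c).trans (mul_le_mul_of_nonneg_left ?_ (hB0 ω))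
    exact mul_le_of_le_one_right ω.η_pos.le ((ω.stepScale_le k c).trans ω.η_le_one)
  refine le_trans ?_ (le_abs_self _)
  refine le_trans (le_of_eq ?_) ((abs_add_le _ _).trans (add_le_add le_rfl h1))
  congr 1
  rw [inner_sub_right]
  ring

theorem vanishing_corrDev (k : Bool) (ζ : Fin dz) (b c : Fin L × Fin J) :
    Vanishing G fun ω => ω.corrDev k ζ b c := by
  have hY := hG.isBigO_norm_vecY (!k, ζ, b)
  simp only [Outcome.corrDev_eq]
  refine .add (.add (.sum fun a _ => (hG.bounded_R k ζ a c).mul_vanishing ?_) ?_)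
    (hG.vanishing_inner_vecY_regFeat k ζ b c)
  · refine (Bounded.mul_vanishing hY (hG.vanishing_dir_sub k ζ a)).of_le fun ω => ?_
    refine le_trans ?_ (le_abs_self _)
    rw [abs_div, abs_of_nonneg (Real.sqrt_nonneg _), div_mul_eq_mul_div]
    gcongr
    exact abs_real_inner_le_norm _ _
  · refine (Bounded.mul_vanishing hY (vanishing_stepScale k c)).of_le fun ω => ?_
    refine le_trans ?_ (le_abs_self _)
    rw [abs_mul, abs_of_pos (ω.stepScale_pos k c), mul_comm]
    have := (ω.stepScale_pos k c).le
    gcongr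
    rw [abs_div, abs_of_nonneg (Real.sqrt_nonneg _)]
    gcongr
    exact (abs_real_inner_le_norm _ _).trans_eq (by rw [ω.norm_aux, mul_one])

/-- In either case the noise vector is not earlier than the direction, hence independent of it. -/
theorem vanishing_corrError (k : Bool) (ζ : Fin dz) (b a : Fin L × Fin J) :
    Vanishing G fun ω => ω.corrError k ζ b a := by
  unfold Outcome.corrError Outcome.corr
  split_ifs with h
  · exact (hG.negligible_inner_dir (!k) ζ b h.le).vanishing.of_le fun ω => (abs_neg _).le
  · exact (hG.negligible_inner_dir k ζ a (not_lt.1 h)).vanishing.of_le fun ω => (abs_neg _).le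

theorem vanishing_residual (k : Bool) (ζ : Fin dz) (c : Fin L × Fin J) :
    Vanishing G fun ω => ‖ω.residual k ζ c‖ := by
  have hW : Bounded G fun ω => |blockOpNorm ω.W ζ / Real.sqrt ω.p.m| :=
    Bounded.abs (hG.isBigO_blockOpNorm ζ)
  have hRB : ∀ b, Bounded G fun ω => ((ω.reg (!k) ζ).R * ω.p.P.B k ζ) b c := fun b => by
    simp only [Matrix.mul_apply]
    exact .sum fun d _ => (hG.bounded_R (!k) ζ b d).mul (hG.bounded_B k ζ d c)
  refine Vanishing.of_le (.add (.add (.add (.add (.add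
    (.sum (s := Finset.univ) fun a _ => (hG.bounded_R k ζ a c).abs.mul_vanishing
      (hW.mul_vanishing (hG.vanishing_dir_sub k ζ a)))
    (hW.mul_vanishing (vanishing_stepScale k c)))
    (.sum (s := Finset.univ) fun a _ => .sum (s := Finset.univ) fun b _ =>
      (hG.bounded_R k ζ a c).abs.mul_vanishing (hG.vanishing_corrError k ζ b a).abs))
    (.sum (s := Finset.univ) fun b _ => (hG.vanishing_corrDev k ζ b c).abs))
    (.sum (s := Finset.univ) fun b _ => (hRB b).abs.mul_vanishing
      (hG.vanishing_dir_sub (!k) ζ b)))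
    (.sum (s := Finset.univ) fun b _ => (hG.bounded_B k ζ b c).abs.mul_vanishing
      (vanishing_stepScale (!k) b))) fun ω => ?_
  rw [abs_norm]
  exact (ω.norm_residual_le k ζ c).trans (le_abs_self _)

end GrowingProblems

end DMF

end

/-! ### Stability of the training response, and samples built from Gaussian matrices. -/

noncomputable section

namespace DMF

section Vectors

theorem norm_comp_injective_le {ι κ : Type*} [Fintype ι] [Fintype κ] {e : ι → κ}
    (he : Function.Injective e) (v : EuclideanSpace ℝ κ) :
    ‖(WithLp.toLp 2 fun i => v (e i) : EuclideanSpace ℝ ι)‖ ≤ ‖v‖ := by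
  refine le_of_sq_le_sq ?_ (norm_nonneg _)
  rw [EuclideanSpace.real_norm_sq_eq, EuclideanSpace.real_norm_sq_eq]
  have h := Finset.sum_map Finset.univ ⟨e, he⟩ fun k => v k ^ 2
  simp only [Function.Embedding.coeFn_mk] at h
  rw [← h]
  exact Finset.sum_le_univ_sum_of_nonneg fun _ => sq_nonneg _

/-- Quantities whose row `k` depends on the latent value of `k` are bounded by treating each value
on all rows. -/
theorem norm_le_sum_of_labels {dz m : ℕ} (z : Fin m → Fin dz)
    (u : Fin dz → EuclideanSpace ℝ (Fin m)) :
    ‖(WithLp.toLp 2 fun k => u (z k) k : EuclideanSpace ℝ (Fin m))‖ ≤ ∑ ζ, ‖u ζ‖ := by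
  refine le_of_sq_le_sq ?_ (Finset.sum_nonneg fun _ _ => norm_nonneg _)
  refine le_trans ?_ (Finset.sum_sq_le_sq_sum_of_nonneg fun _ _ => norm_nonneg _)
  simp only [EuclideanSpace.real_norm_sq_eq]
  rw [Finset.sum_comm]
  exact Finset.sum_le_sum fun k _ => Finset.single_le_sum (f := fun ζ => u ζ k ^ 2)
    (fun _ _ => sq_nonneg _) (Finset.mem_univ (z k))

theorem norm_const_vector (m : ℕ) (c : ℝ) :
    ‖(WithLp.toLp 2 fun _ => c : EuclideanSpace ℝ (Fin m))‖ = Real.sqrt m * |c| := by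
  rw [EuclideanSpace.norm_eq]
  simp [Real.sqrt_sq_eq_abs]

theorem l2norm_le_of_col_le {a b c : ℕ} {x : Fin a → Fin c → ℝ} {y : Fin b → Fin c → ℝ} {κ : ℝ}
    (hκ : 0 ≤ κ) (h : ∀ j, ‖col x j‖ ≤ κ * ‖col y j‖) : l2norm x ≤ κ * l2norm y := by
  refine le_of_sq_le_sq ?_ (mul_nonneg hκ (l2norm_nonneg _))
  rw [mul_pow, l2norm_sq, l2norm_sq, Finset.mul_sum]
  refine Finset.sum_le_sum fun j _ => ?_
  rw [← mul_pow]
  exact pow_le_pow_left₀ (norm_nonneg _) (h j) 2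

/-- A bound for a matrix is also a bound for its transpose. -/
theorem norm_sum_smul_le {n m : ℕ} {x : Fin m → EuclideanSpace ℝ (Fin n)} {κ : ℝ} (hκ : 0 ≤ κ)
    (h : ∀ u, ‖(WithLp.toLp 2 fun k => inner ℝ (x k) u : EuclideanSpace ℝ (Fin m))‖ ≤ κ * ‖u‖)
    (v : EuclideanSpace ℝ (Fin m)) : ‖∑ k, v k • x k‖ ≤ κ * ‖v‖ := by
  set w := ∑ k, v k • x k with hw
  rcases eq_or_lt_of_le (norm_nonneg w) with h0 | h0
  · rw [← h0]
    positivity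
  · have h1 : ‖w‖ ^ 2 = inner ℝ (WithLp.toLp 2 fun k => inner ℝ (x k) w :
        EuclideanSpace ℝ (Fin m)) v := by
      rw [← real_inner_self_eq_norm_sq]
      conv_lhs => rw [hw, sum_inner]
      rw [inner_eq_sum]
      exact Finset.sum_congr rfl fun k _ => by rw [real_inner_smul_left, mul_comm]
    have h2 := (real_inner_le_norm _ _).trans
      (mul_le_mul_of_nonneg_right (h w) (norm_nonneg v))
    rw [← h1] at h2
    refine le_of_mul_le_mul_left ?_ h0
    linarith

end Vectors

section Response

variable {dz J L n m : ℕ} {M : Model dz J L n m} {C : ℝ}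

/-- The response depends on the training map in a stable way. -/
theorem blockNorm_response_sub_le (hm : 0 < m) (hM : M.LipschitzUpdates C) (hC : 0 ≤ C)
    (z : Fin m → Fin dz) {x : Fin m → EuclideanSpace ℝ (Fin n)} {κ : ℝ} (hκ : 0 ≤ κ)
    (h : ∀ u, ‖(WithLp.toLp 2 fun k => inner ℝ (x k) u : EuclideanSpace ℝ (Fin m))‖ ≤
      κ * Real.sqrt m * ‖u‖) (ξ : Blocks J L n m) :
    blockNorm (M.response z x - ξ) ≤ 2 * L * ((1 + κ * C) ^ (2 * L) *
      ∑ t ∈ Finset.range (2 * L), stepNorm (M.trainMap z x ξ - ξ) t) := by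
  have hm' : 0 < Real.sqrt m := Real.sqrt_pos.2 (by exact_mod_cast hm)
  set φ := M.response z x with hφ
  have e : M.trainMap z x φ = φ := ((M.trainMap_sequential z x).eq_iff _).2 rfl
  -- Defect of `ξ` as a solution, plus a difference of the training map that is causal and
  -- Lipschitz.
  have e' : φ - ξ = (M.trainMap z x ξ - ξ) + (M.trainMap z x φ - M.trainMap z x ξ) := by
    rw [e]; abel
  have hstep : ∀ t ≤ 2 * L, stepNorm (φ - ξ) t ≤ stepNorm (M.trainMap z x ξ - ξ) t +
      κ * C * ∑ r ∈ Finset.range t, stepNorm (φ - ξ) r := by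
    intro t _
    conv_lhs => rw [e']
    refine (stepNorm_add_le _ _ _).trans (add_le_add le_rfl ?_)
    refine stepNorm_cases (L := L) (p := fun t => stepNorm (M.trainMap z x φ - M.trainMap z x ξ) t ≤
      κ * C * ∑ r ∈ Finset.range t, stepNorm (φ - ξ) r) t (fun l _ => ?_) (fun l _ => ?_)
      (fun t ht => ?_) t le_rfl
    · rw [stepNorm_even, div_le_iff₀ hm']
      have h1 : l2norm ((M.trainMap z x φ - M.trainMap z x ξ).2 l) ≤ κ * Real.sqrt m *
          l2norm (M.theta (M.labels z) l φ - M.theta (M.labels z) l ξ) := by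
        refine l2norm_le_of_col_le (by positivity) fun j => ?_
        have := h (col (M.theta (M.labels z) l φ - M.theta (M.labels z) l ξ) j)
        refine le_of_eq_of_le ?_ this
        congr 1
        ext k
        simp only [col_apply, Prod.snd_sub, Pi.sub_apply, Model.trainMap, inner_eq_sum,
          ← Finset.sum_sub_distrib, ← mul_sub]
      refine h1.trans ?_
      have h2 := hM.theta_le hC (M.labels z) l φ ξ
      have : 0 ≤ κ * Real.sqrt m := by positivity
      nlinarith [mul_le_mul_of_nonneg_left h2 this]
    · rw [stepNorm_odd]
      have h1 : l2norm ((M.trainMap z x φ - M.trainMap z x ξ).1 l) ≤ (m : ℝ)⁻¹ *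
          (κ * Real.sqrt m) * l2norm (M.omega (M.labels z) l φ - M.omega (M.labels z) l ξ) := by
        refine l2norm_le_of_col_le (by positivity) fun j => ?_
        -- The update of `q` uses `X` where that of `p` uses `Xᵀ`. The same operator bound serves
        -- both.
        have h3 := norm_sum_smul_le (by positivity) h
          (col (M.omega (M.labels z) l φ - M.omega (M.labels z) l ξ) j)
        rw [mul_assoc]
        refine le_of_eq_of_le ?_ (mul_le_mul_of_nonneg_left h3 (by positivity))
        have h5 : ∀ v : EuclideanSpace ℝ (Fin n), (m : ℝ)⁻¹ * ‖v‖ = ‖(m : ℝ)⁻¹ • v‖ := fun v => by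
          rw [norm_smul, Real.norm_of_nonneg (by positivity : 0 ≤ (m : ℝ)⁻¹)]
        rw [h5]
        congr 1
        ext i
        simp only [col_apply, Prod.fst_sub, Pi.sub_apply, Model.trainMap, ← mul_sub,
          ← Finset.sum_sub_distrib, PiLp.smul_apply, WithLp.ofLp_sum, Finset.sum_apply, smul_eq_mul]
        congr 1
        exact Finset.sum_congr rfl fun k _ => mul_comm _ _
      refine h1.trans ?_
      have h2 := hM.omega_le hC (M.labels z) l φ ξ
      have e2 : (m : ℝ)⁻¹ * (κ * Real.sqrt m) *
          l2norm (M.omega (M.labels z) l φ - M.omega (M.labels z) l ξ) = κ *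
          (l2norm (M.omega (M.labels z) l φ - M.omega (M.labels z) l ξ) / Real.sqrt m) := by
        have h4 : (m : ℝ)⁻¹ = (Real.sqrt m)⁻¹ * (Real.sqrt m)⁻¹ := by
          rw [← mul_inv, Real.mul_self_sqrt (by positivity)]
        rw [h4]
        field_simp
      rw [e2, mul_assoc]
      exact mul_le_mul_of_nonneg_left h2 hκ
    · rw [stepNorm_of_le _ ht]
      have := sum_stepNorm_nonneg (φ - ξ) t
      positivity
  have hg := discrete_gronwall (by positivity : 0 ≤ κ * C)
    (fun t => stepNorm_nonneg (M.trainMap z x ξ - ξ) t) hstep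
  have hS : 0 ≤ (1 + κ * C) ^ (2 * L) *
      ∑ t ∈ Finset.range (2 * L), stepNorm (M.trainMap z x ξ - ξ) t :=
    mul_nonneg (by positivity) (sum_stepNorm_nonneg _ _)
  refine (blockNorm_le_sum_stepNorm _).trans ((Finset.sum_le_sum (g := fun _ =>
    (1 + κ * C) ^ (2 * L) * ∑ t ∈ Finset.range (2 * L), stepNorm (M.trainMap z x ξ - ξ) t)
    fun t ht => ?_).trans (le_of_eq (by simp)))
  have ht' : t < 2 * L := Finset.mem_range.1 ht
  refine (hg t ht'.le).trans (mul_le_mul ?_ (sum_stepNorm_mono _ (by omega))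
    (sum_stepNorm_nonneg _ _) (by positivity))
  exact pow_le_pow_right₀ (by linarith [mul_nonneg hκ hC]) ht'.le

end Response

section Data

variable {dz J L n m : ℕ} (M : Model dz J L n m)

/-- The samples that are built from Gaussian matrices. -/
def Model.data (z : Fin m → Fin dz) (W : Fin dz × Ambient J L n m × Ambient J L n m → ℝ)
    (k : Fin m) : EuclideanSpace ℝ (Fin n) :=
  M.mean (z k) + Matrix.toEuclideanCLM (𝕜 := ℝ) (M.covSqrt (z k))
    (WithLp.toLp 2 fun i => W (z k, .inl i, .inr (.inl k)))

variable {M}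

/-- A vector on the rows, as a vector of the ambient space. -/
def rowVec (u : EuclideanSpace ℝ (Fin n)) : EuclideanSpace ℝ (Ambient J L n m) :=
  WithLp.toLp 2 (Sum.elim u.ofLp fun _ => 0)

theorem norm_rowVec (u : EuclideanSpace ℝ (Fin n)) :
    ‖(rowVec u : EuclideanSpace ℝ (Ambient J L n m))‖ = ‖u‖ := by
  rw [rowVec, EuclideanSpace.norm_eq, EuclideanSpace.norm_eq]
  simp

theorem inner_covSqrt (ζ : Fin dz) (u v : EuclideanSpace ℝ (Fin n)) :
    inner ℝ (Matrix.toEuclideanCLM (𝕜 := ℝ) (M.covSqrt ζ) u) v =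
      inner ℝ u (Matrix.toEuclideanCLM (𝕜 := ℝ) (M.covSqrt ζ) v) := by
  simp only [inner_eq_sum]
  have h : ∀ i i', M.covSqrt ζ i i' = M.covSqrt ζ i' i := fun i i' =>
    congrFun (congrFun (covSqrt_transpose (M := M) ζ) i') i
  change ∑ i, (∑ i', M.covSqrt ζ i i' * u i') * v i = ∑ i, u i * ∑ i', M.covSqrt ζ i i' * v i'
  simp only [Finset.sum_mul, Finset.mul_sum]
  rw [Finset.sum_comm]
  exact Finset.sum_congr rfl fun i _ => Finset.sum_congr rfl fun i' _ => by
    rw [h i' i]; ring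

/-- Sample `k` uses column `k` of the block of its latent value. Moving the symmetric root `R^{1/2}`
to the other factor shows a product of `Wᵀ` with a vector of the form of a feature. -/
theorem inner_data (z : Fin m → Fin dz) (W : Fin dz × Ambient J L n m × Ambient J L n m → ℝ)
    (k : Fin m) (u : EuclideanSpace ℝ (Fin n)) :
    inner ℝ (M.data z W k) u = inner ℝ (M.mean (z k)) u +
      blockMul W true (z k) (rowVec (Matrix.toEuclideanCLM (𝕜 := ℝ) (M.covSqrt (z k)) u))
        (.inr (.inl k)) := by
  rw [Model.data, inner_add_left, inner_covSqrt]
  congr 1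
  simp [blockMul, rowVec, Fintype.sum_sum_type, inner_eq_sum]

/-- `Xᵀ` has operator norm of order `√m`: the means contribute through constant vectors of norm
`√m`, and the Gaussian part through the blocks. -/
theorem norm_inner_data_le {K : ℝ} (hm : 0 < m) (hK : M.BoundedBy K) (z : Fin m → Fin dz)
    (W : Fin dz × Ambient J L n m × Ambient J L n m → ℝ) (u : EuclideanSpace ℝ (Fin n)) :
    ‖(WithLp.toLp 2 fun k => inner ℝ (M.data z W k) u : EuclideanSpace ℝ (Fin m))‖ ≤
      (dz * K + Real.sqrt K * ∑ ζ, blockOpNorm W ζ / Real.sqrt m) * Real.sqrt m * ‖u‖ := by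
  have hm' : 0 < Real.sqrt m := Real.sqrt_pos.2 (by exact_mod_cast hm)
  have e : (WithLp.toLp 2 fun k => inner ℝ (M.data z W k) u : EuclideanSpace ℝ (Fin m)) =
      WithLp.toLp 2 fun k => ((WithLp.toLp 2 fun _ => inner ℝ (M.mean (z k)) u) +
        WithLp.toLp 2 fun k' => blockMul W true (z k) (rowVec (Matrix.toEuclideanCLM (𝕜 := ℝ)
          (M.covSqrt (z k)) u)) (.inr (.inl k')) : EuclideanSpace ℝ (Fin m)) k := by
    ext k
    simp only [inner_data, PiLp.add_apply]
  rw [e]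
  refine (norm_le_sum_of_labels z fun ζ => ((WithLp.toLp 2 fun _ => inner ℝ (M.mean ζ) u) +
        WithLp.toLp 2 fun k' => blockMul W true ζ (rowVec (Matrix.toEuclideanCLM (𝕜 := ℝ)
          (M.covSqrt ζ) u)) (.inr (.inl k')) : EuclideanSpace ℝ (Fin m))).trans ?_
  refine (Finset.sum_le_sum (g := fun ζ => Real.sqrt m * (K * ‖u‖) +
    blockOpNorm W ζ * (Real.sqrt K * ‖u‖)) fun ζ _ => (norm_add_le _ _).trans
      (add_le_add ?_ ?_)).trans (le_of_eq ?_)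
  · rw [norm_const_vector]
    gcongr
    exact (abs_real_inner_le_norm _ _).trans
      (mul_le_mul_of_nonneg_right (hK.mean ζ) (norm_nonneg _))
  · refine (norm_comp_injective_le (Sum.inr_injective.comp Sum.inl_injective) _).trans
      ((norm_blockMul_le _ _ _ _).trans ?_)
    have : 0 ≤ blockOpNorm W ζ := norm_nonneg _
    gcongr
    rw [norm_rowVec]
    refine (ContinuousLinearMap.le_opNorm _ _).trans ?_
    gcongr
    exact norm_covSqrt_le hK ζ
  · rw [Finset.sum_add_distrib, ← Finset.sum_mul (f := fun ζ => blockOpNorm W ζ),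
      ← Finset.sum_div, add_mul, ← mul_div_assoc,
      div_mul_cancel₀ _ hm'.ne', add_mul]
    simp only [Finset.sum_const, Finset.card_univ, Fintype.card_fin, nsmul_eq_mul]
    ring

end Data

end DMF

end

/-! ### The defect of the regularized trajectory in the training equations. -/

noncomputable section

namespace DMF

open Asymptotics

variable {dz J L : ℕ} {γ C K : ℝ}

/-- The memory coefficients vanish outside the causal range, so the sum may run over all indices, as
it does in the residual. -/
theorem sum_filter_memory {p : Fin L → Prop} [DecidablePred p] {B : Kernel J L}
    {c : Fin L × Fin J} (hB : ∀ b, ¬ p b.1 → B b c = 0) (f : Fin L → Fin J → ℝ) :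
    ∑ μ with p μ, ∑ j', f μ j' * B (μ, j') c = ∑ b, B b c * f b.1 b.2 := by
  rw [Fintype.sum_prod_type, Finset.sum_filter]
  refine Finset.sum_congr rfl fun μ _ => ?_
  split_ifs with h
  · exact Finset.sum_congr rfl fun _ _ => mul_comm _ _
  · exact (Finset.sum_eq_zero fun j' _ => by rw [hB (μ, j') h, zero_mul]).symm

theorem sum_labels {m : ℕ} (z : Fin m → Fin dz) (f : Fin dz → Fin m → ℝ) :
    ∑ k, f (z k) k = ∑ ζ, ∑ k with z k = ζ, f ζ k := by
  simp only [Finset.sum_filter]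
  rw [Finset.sum_comm]
  exact Finset.sum_congr rfl fun k _ => by simp

theorem sum_covSqrt_vecTheta {n m : ℕ} {M : Model dz J L n m} (P : Params dz J L n)
    (ζ : Fin dz) (b : Fin L × Fin J) (s : Noise dz J L n m) (i : Fin n) :
    ∑ i', M.covSqrt ζ i i' * M.vecTheta P ζ b s i' =
      ∑ i', M.cov ζ i i' * M.thetaBar P s b.1 i' b.2 := by
  simp only [vecTheta_apply, ← covSqrt_mul_self (M := M) ζ, Matrix.mul_apply, Finset.mul_sum,
    Finset.sum_mul]
  rw [Finset.sum_comm]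
  exact Finset.sum_congr rfl fun _ _ => Finset.sum_congr rfl fun _ _ => (mul_assoc _ _ _).symm

namespace Outcome

variable (ω : Outcome dz J L γ C K)

/-- The mean-field limit. -/
def xi : Blocks J L ω.p.n ω.p.m := ω.p.M.xiBar ω.p.P (noiseOf ω.2.1 ω.2.2.1.1)

/-- The regularized parameters. -/
abbrev regP : Params dz J L ω.p.n := ω.p.P.withA (regA ω.reg)

/-- The noise of the regularized dynamics. -/
abbrev regNoise : Noise dz J L ω.p.n ω.p.m := noiseOf ω.2.1 ω.noise

/-- The solution of the regularized dynamics. -/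
def regXi : Blocks J L ω.p.n ω.p.m := ω.p.M.xiBar ω.regP ω.regNoise

/-- The samples. -/
def data : Fin ω.p.m → EuclideanSpace ℝ (Fin ω.p.n) := ω.p.M.data ω.2.1 ω.W

theorem residual_apply (k : Bool) (ζ : Fin dz) (c : Fin L × Fin J)
    (i : Ambient J L ω.p.n ω.p.m) :
    ω.residual k ζ c i =
      (Real.sqrt ω.p.m)⁻¹ * blockMul ω.W k ζ (ω.regFeat k ζ c) i -
        (Real.sqrt ω.p.m)⁻¹ * ∑ a, ω.noise ((k, ζ, a), i) * (ω.reg k ζ).R a c -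
        ∑ b, ω.p.P.B k ζ b c * ω.regFeat (!k) ζ b i := by
  simp only [residual, PiLp.sub_apply, PiLp.smul_apply, WithLp.ofLp_sum, Finset.sum_apply,
    smul_eq_mul, Finset.mul_sum]
  congr 2
  exact Finset.sum_congr rfl fun a _ => by
    change _ * (_ * ω.noise _) = _
    ring

theorem regFeat_false_apply (ζ : Fin dz) (b : Fin L × Fin J) (k : Fin ω.p.m) :
    ω.regFeat false ζ b (.inr (.inl k)) = if ω.2.1 k = ζ then
      ω.p.M.omegaBar ω.regP ω.regNoise b.1 k b.2 / Real.sqrt ω.p.m else 0 := rfl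

/-- Row `k` of `Xᵀ θ` is a mean part plus `Wᵀ` applied to a feature. Subtracting the mean-field
equation leaves the fluctuation about `β` and the residual, because `y R` is exactly the Gaussian
input of the regularized dynamics. -/
theorem trainMap_sub_snd (hC : 0 ≤ C) (hK : 0 ≤ K) (l : Fin L) (k : Fin ω.p.m) (j : Fin J) :
    (ω.p.M.trainMap ω.2.1 ω.data ω.regXi - ω.regXi).2 l k j =
      (ω.p.M.meanTheta ω.regP (ω.2.1 k) l j ω.regNoise - ω.p.P.beta l (ω.2.1 k) j) +
        Real.sqrt ω.p.m * ω.residual true (ω.2.1 k) (l, j) (.inr (.inl k)) := by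
  have hm := ω.p.sqrt_m_pos.ne'
  set ζ := ω.2.1 k with hζ
  have e1 : (ω.p.M.trainMap ω.2.1 ω.data ω.regXi).2 l k j =
      ω.p.M.meanTheta ω.regP ζ l j ω.regNoise +
        blockMul ω.W true ζ (ω.regFeat true ζ (l, j)) (.inr (.inl k)) := by
    rw [meanTheta_eq_inner]
    refine Eq.trans ?_ (inner_data ω.2.1 ω.W k (col (ω.p.M.thetaBar ω.regP ω.regNoise l) j))
    rw [inner_eq_sum]
    rfl
  have e2 : ω.regXi.2 l k j = ω.p.P.beta l ζ j +
      ∑ a, ω.noise ((true, ζ, a), .inr (.inl k)) * (ω.reg true ζ).R a (l, j) +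
      ∑ b, ω.p.P.B true ζ b (l, j) * ω.p.M.omegaBar ω.regP ω.regNoise b.1 k b.2 := by
    have h := congrFun (congrFun (congrFun (congrArg Prod.snd
      (ω.p.M.xiBar_eq ω.regP ω.regNoise)) l) k) j
    refine h.symm.trans ?_
    have hB := ω.p.isDMF.B_eq_resp ω.p.m_pos ω.p.lip hC ω.p.bdd hK ζ
    have h2 := sum_filter_memory (p := fun μ => μ < l) (B := ω.p.P.B true ζ) (c := (l, j))
      (fun b hb => by
        change ω.p.P.Bomega ζ b (l, j) = 0
        rw [hB.2]
        exact respOmega_eq_zero ω.p.m_pos ω.p.lip hC ω.p.bdd hK _ _ _ _ (not_lt.1 hb))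
      fun μ j' => ω.p.M.omegaBar ω.regP ω.regNoise μ k j'
    rw [← h2]
    rfl
  have e3 : ∀ b : Fin L × Fin J, ω.regFeat false ζ b (.inr (.inl k)) =
      ω.p.M.omegaBar ω.regP ω.regNoise b.1 k b.2 / Real.sqrt ω.p.m := fun b => by
    rw [regFeat_false_apply, if_pos hζ.symm]
  have e4 : ∑ b, ω.p.P.B true ζ b (l, j) * ω.regFeat (!true) ζ b (.inr (.inl k)) =
      (Real.sqrt ω.p.m)⁻¹ * ∑ b, ω.p.P.B true ζ b (l, j) *
        ω.p.M.omegaBar ω.regP ω.regNoise b.1 k b.2 := by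
    rw [Finset.mul_sum]
    refine Finset.sum_congr rfl fun b _ => ?_
    rw [Bool.not_true, e3]
    ring
  change (ω.p.M.trainMap ω.2.1 ω.data ω.regXi).2 l k j - ω.regXi.2 l k j = _
  rw [residual_apply, e1, e2, e4]
  field_simp
  ring

/-- The same for `X ω / m`. The mean part is compared with `e` through its defining equation, and `R
= R^{1/2} R^{1/2}` extracts one root from the memory term to match the feature. -/
theorem trainMap_sub_fst (hC : 0 ≤ C) (hK : 0 ≤ K) (l : Fin L) (i : Fin ω.p.n) (j : Fin J) :
    (ω.p.M.trainMap ω.2.1 ω.data ω.regXi - ω.regXi).1 l i j =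
      ∑ ζ, ω.p.M.mean ζ i * (ω.p.M.meanOmega ω.regP ζ l j ω.regNoise -
        ∫ s, ω.p.M.meanOmega ω.p.P ζ l j s ∂ω.p.M.noiseLaw) +
      ∑ ζ, ∑ i', ω.p.M.covSqrt ζ i i' * ω.residual false ζ (l, j) (.inl i') := by
  have hm := ω.p.sqrt_m_pos.ne'
  have e1 : (ω.p.M.trainMap ω.2.1 ω.data ω.regXi).1 l i j =
      ∑ ζ, ω.p.M.mean ζ i * ω.p.M.meanOmega ω.regP ζ l j ω.regNoise +
        ∑ ζ, ∑ i', ω.p.M.covSqrt ζ i i' * ((Real.sqrt ω.p.m)⁻¹ *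
          blockMul ω.W false ζ (ω.regFeat false ζ (l, j)) (.inl i')) := by
    have h0 : (ω.p.M.trainMap ω.2.1 ω.data ω.regXi).1 l i j = (ω.p.m : ℝ)⁻¹ *
        ∑ k, (ω.p.M.mean (ω.2.1 k) i + ∑ i', ω.p.M.covSqrt (ω.2.1 k) i i' *
          ω.W (ω.2.1 k, .inl i', .inr (.inl k))) *
            ω.p.M.omegaBar ω.regP ω.regNoise l k j := rfl
    rw [h0, sum_labels ω.2.1 fun ζ k => (ω.p.M.mean ζ i + ∑ i', ω.p.M.covSqrt ζ i i' *
          ω.W (ζ, .inl i', .inr (.inl k))) * ω.p.M.omegaBar ω.regP ω.regNoise l k j,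
      ← Finset.sum_add_distrib, Finset.mul_sum]
    refine Finset.sum_congr rfl fun ζ _ => ?_
    simp only [add_mul, Finset.sum_add_distrib, mul_add]
    congr 1
    · rw [← Finset.mul_sum, Model.meanOmega]
      change _ = _ * (_ * ∑ k with ω.2.1 k = ζ, _)
      ring
    · have h1 : ∀ i' : Fin ω.p.n, (Real.sqrt ω.p.m)⁻¹ *
          blockMul ω.W false ζ (ω.regFeat false ζ (l, j)) (.inl i') =
          (ω.p.m : ℝ)⁻¹ * ∑ k with ω.2.1 k = ζ, ω.W (ζ, .inl i', .inr (.inl k)) *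
            ω.p.M.omegaBar ω.regP ω.regNoise l k j := fun i' => by
        have h2 : blockMul ω.W false ζ (ω.regFeat false ζ (l, j)) (.inl i') =
            ∑ k, ω.W (ζ, .inl i', .inr (.inl k)) * ω.regFeat false ζ (l, j) (.inr (.inl k)) := by
          simp [blockMul, regFeat, feature_false, Fintype.sum_sum_type]
        have h4 : (ω.p.m : ℝ)⁻¹ = (Real.sqrt ω.p.m)⁻¹ * (Real.sqrt ω.p.m)⁻¹ := by
          rw [← mul_inv, Real.mul_self_sqrt (by positivity)]
        rw [h2, h4, mul_assoc, Finset.sum_filter]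
        congr 1
        rw [Finset.mul_sum]
        refine Finset.sum_congr rfl fun k _ => ?_
        rw [regFeat_false_apply]
        split_ifs
        · ring
        · simp
      simp only [h1, Finset.mul_sum, Finset.sum_mul]
      rw [Finset.sum_comm]
      exact Finset.sum_congr rfl fun _ _ => Finset.sum_congr rfl fun _ _ => by ring
  have e2 : ω.regXi.1 l i j = ∑ ζ, ω.p.M.mean ζ i *
        (∫ s, ω.p.M.meanOmega ω.p.P ζ l j s ∂ω.p.M.noiseLaw) +
      (Real.sqrt ω.p.m)⁻¹ * ∑ ζ, ∑ i', ω.p.M.covSqrt ζ i i' *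
        ∑ a, ω.noise ((false, ζ, a), .inl i') * (ω.reg false ζ).R a (l, j) +
      ∑ ζ, ∑ i', ω.p.M.covSqrt ζ i i' *
        ∑ b, ω.p.P.B false ζ b (l, j) * ω.regFeat true ζ b (.inl i') := by
    have h := congrFun (congrFun (congrFun (congrArg Prod.fst
      (ω.p.M.xiBar_eq ω.regP ω.regNoise)) l) i) j
    refine h.symm.trans ?_
    have h3 : ω.p.M.feedbackQ ω.p.P (ω.p.M.thetaBar ω.regP ω.regNoise) l i j =
        ∑ ζ, ∑ i', ω.p.M.covSqrt ζ i i' *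
          ∑ b, ω.p.P.B false ζ b (l, j) * ω.regFeat true ζ b (.inl i') := by
      refine Finset.sum_congr rfl fun ζ _ => ?_
      have hB := ω.p.isDMF.B_eq_resp ω.p.m_pos ω.p.lip hC ω.p.bdd hK ζ
      have h2 := fun i' : Fin ω.p.n => sum_filter_memory (p := fun μ => μ ≤ l)
        (B := ω.p.P.B false ζ) (c := (l, j)) (fun b hb => by
          change ω.p.P.Btheta ζ b (l, j) = 0
          rw [hB.1]
          exact respTheta_eq_zero ω.p.m_pos ω.p.lip hC ω.p.bdd hK _ _ _ _ (not_le.1 hb))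
        fun μ j' => ω.p.M.thetaBar ω.regP ω.regNoise μ i' j'
      calc _ = ∑ i', ω.p.M.cov ζ i i' * ∑ μ with μ ≤ l, ∑ j',
            ω.p.M.thetaBar ω.regP ω.regNoise μ i' j' * ω.p.P.B false ζ (μ, j') (l, j) := by
            simp only [Finset.mul_sum]
            rw [Finset.sum_comm]
            rfl
        _ = ∑ b, ω.p.P.B false ζ b (l, j) * ∑ i', ω.p.M.covSqrt ζ i i' *
            ω.p.M.vecTheta ω.regP ζ b ω.regNoise i' := by
            simp only [h2, sum_covSqrt_vecTheta, Finset.mul_sum]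
            rw [Finset.sum_comm]
            exact Finset.sum_congr rfl fun _ _ => Finset.sum_congr rfl fun _ _ => by ring
        _ = _ := by
            simp only [Finset.mul_sum]
            rw [Finset.sum_comm]
            refine Finset.sum_congr rfl fun _ _ => Finset.sum_congr rfl fun _ _ => ?_
            change _ = _ * (_ * ω.p.M.vecTheta ω.regP ζ _ ω.regNoise _)
            ring
    rw [← h3]
    change ω.p.P.e l i j + ω.p.M.gTilde ω.regP ω.regNoise l i j / Real.sqrt ω.p.m + _ = _
    rw [ω.p.isDMF.e_eq, div_eq_inv_mul]
    rfl
  have e3 : ∑ ζ, ∑ i', ω.p.M.covSqrt ζ i i' * ω.residual false ζ (l, j) (.inl i') =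
      ∑ ζ, ∑ i', ω.p.M.covSqrt ζ i i' * ((Real.sqrt ω.p.m)⁻¹ *
          blockMul ω.W false ζ (ω.regFeat false ζ (l, j)) (.inl i')) -
      (Real.sqrt ω.p.m)⁻¹ * ∑ ζ, ∑ i', ω.p.M.covSqrt ζ i i' *
        ∑ a, ω.noise ((false, ζ, a), .inl i') * (ω.reg false ζ).R a (l, j) -
      ∑ ζ, ∑ i', ω.p.M.covSqrt ζ i i' *
        ∑ b, ω.p.P.B false ζ b (l, j) * ω.regFeat true ζ b (.inl i') := by
    rw [Finset.mul_sum, ← Finset.sum_sub_distrib, ← Finset.sum_sub_distrib]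
    refine Finset.sum_congr rfl fun ζ _ => ?_
    rw [Finset.mul_sum, ← Finset.sum_sub_distrib, ← Finset.sum_sub_distrib]
    refine Finset.sum_congr rfl fun i' _ => ?_
    rw [residual_apply, Bool.not_false]
    ring
  change (ω.p.M.trainMap ω.2.1 ω.data ω.regXi).1 l i j - ω.regXi.1 l i j = _
  rw [e1, e2, e3]
  simp only [mul_sub, Finset.sum_sub_distrib]
  ring

end Outcome

end DMF

end

/-! ### The training response is close to the mean-field limit. -/

noncomputable section

namespace DMF

open Asymptotics

variable {dz J L : ℕ} {γ C K : ℝ} {G : Filter (Problem dz J L γ C K)}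

theorem blockNorm_sub_le {n m : ℕ} (ξ₁ ξ₂ ξ₃ : Blocks J L n m) :
    blockNorm (ξ₁ - ξ₃) ≤ blockNorm (ξ₁ - ξ₂) + blockNorm (ξ₂ - ξ₃) := by
  refine blockNorm_le_of_stepNorm_le _ (add_nonneg (blockNorm_nonneg _) (blockNorm_nonneg _))
    fun t _ => ?_
  rw [← sub_add_sub_cancel ξ₁ ξ₂ ξ₃]
  exact (stepNorm_add_le _ _ _).trans
    (add_le_add (stepNorm_le_blockNorm _ _) (stepNorm_le_blockNorm _ _))

theorem Bounded.pow {f : Outcome dz J L γ C K → ℝ} (hf : Bounded G f) (N : ℕ) :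
    Bounded G fun ω => f ω ^ N := by
  induction N with
  | zero => simpa using Bounded.const 1
  | succ N ih => simpa only [pow_succ] using ih.mul hf

namespace Outcome

variable (ω : Outcome dz J L γ C K)

theorem abs_meanTheta_sub_le (hK : 0 ≤ K) (ζ : Fin dz) (l : Fin L) (j : Fin J) :
    |ω.p.M.meanTheta ω.regP ζ l j ω.regNoise -
        ω.p.M.meanTheta ω.p.P ζ l j (noiseOf ω.2.1 ω.2.2.1.1)| ≤
      K * (C * blockNorm (ω.regXi - ω.xi)) := by
  rw [meanTheta_eq_inner, meanTheta_eq_inner, ← inner_sub_right, ← col_sub]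
  refine (abs_real_inner_le_norm _ _).trans (mul_le_mul (ω.p.bdd.mean ζ) ?_ (norm_nonneg _) hK)
  exact (norm_col_le _ _).trans (ω.p.lip.theta _ _ _ _)

theorem abs_meanOmega_sub_le (ζ : Fin dz) (l : Fin L) (j : Fin J) :
    |ω.p.M.meanOmega ω.regP ζ l j ω.regNoise -
        ω.p.M.meanOmega ω.p.P ζ l j (noiseOf ω.2.1 ω.2.2.1.1)| ≤
      C * blockNorm (ω.regXi - ω.xi) := by
  set Δ := ω.p.M.omegaBar ω.regP ω.regNoise l -
    ω.p.M.omegaBar ω.p.P (noiseOf ω.2.1 ω.2.2.1.1) l with hΔ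
  have e : ω.p.M.meanOmega ω.regP ζ l j ω.regNoise -
      ω.p.M.meanOmega ω.p.P ζ l j (noiseOf ω.2.1 ω.2.2.1.1) =
        (ω.p.m : ℝ)⁻¹ * ∑ k with ω.2.1 k = ζ, Δ k j := by
    simp only [hΔ, Pi.sub_apply, Finset.sum_sub_distrib, mul_sub]
    rfl
  have h1 : |∑ k with ω.2.1 k = ζ, Δ k j| ≤ Real.sqrt ω.p.m * l2norm Δ := by
    refine abs_le_of_sq_le_sq ?_ (mul_nonneg (Real.sqrt_nonneg _) (l2norm_nonneg _))
    rw [mul_pow, Real.sq_sqrt (Nat.cast_nonneg _)]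
    refine sq_sum_le_card_mul_sum_sq.trans ?_
    gcongr
    · exact (Finset.card_le_univ _).trans (by simp)
    · refine (Finset.sum_le_univ_sum_of_nonneg fun _ => sq_nonneg _).trans ?_
      have := pow_le_pow_left₀ (norm_nonneg _) (norm_col_le Δ j) 2
      rwa [EuclideanSpace.real_norm_sq_eq] at this
  have h2 : l2norm Δ / Real.sqrt ω.p.m ≤ C * blockNorm (ω.regXi - ω.xi) := ω.p.lip.omega _ _ _ _
  rw [e, abs_mul, abs_of_nonneg (by positivity)]
  refine (mul_le_mul_of_nonneg_left h1 (by positivity)).trans (le_trans (le_of_eq ?_) h2)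
  have h4 : (ω.p.m : ℝ)⁻¹ = (Real.sqrt ω.p.m)⁻¹ * (Real.sqrt ω.p.m)⁻¹ := by
    rw [← mul_inv, Real.mul_self_sqrt (by positivity)]
  have hm := ω.p.sqrt_m_pos.ne'
  rw [h4]
  field_simp

theorem stepNorm_trainMap_even_le (hC : 0 ≤ C) (hK : 0 ≤ K) (l : Fin L) :
    stepNorm (ω.p.M.trainMap ω.2.1 ω.data ω.regXi - ω.regXi) (2 * l) ≤
      ∑ j, ∑ ζ, (|ω.p.M.meanTheta ω.regP ζ l j ω.regNoise - ω.p.P.beta l ζ j| +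
        ‖ω.residual true ζ (l, j)‖) := by
  have hm := ω.p.sqrt_m_pos
  rw [stepNorm_even, div_le_iff₀ hm]
  refine (l2norm_le_sum_col _).trans ?_
  rw [Finset.sum_mul]
  refine Finset.sum_le_sum fun j _ => ?_
  have e : col ((ω.p.M.trainMap ω.2.1 ω.data ω.regXi - ω.regXi).2 l) j =
      WithLp.toLp 2 fun k => ((WithLp.toLp 2 fun _ =>
        ω.p.M.meanTheta ω.regP (ω.2.1 k) l j ω.regNoise - ω.p.P.beta l (ω.2.1 k) j) +
        Real.sqrt ω.p.m • WithLp.toLp 2 fun k' => ω.residual true (ω.2.1 k) (l, j) (.inr (.inl k')) :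
          EuclideanSpace ℝ (Fin ω.p.m)) k := by
    ext k
    rw [col_apply, ω.trainMap_sub_snd hC hK]
    rfl
  rw [e]
  refine (norm_le_sum_of_labels ω.2.1 fun ζ => ((WithLp.toLp 2 fun _ =>
        ω.p.M.meanTheta ω.regP ζ l j ω.regNoise - ω.p.P.beta l ζ j) +
        Real.sqrt ω.p.m • WithLp.toLp 2 fun k' => ω.residual true ζ (l, j) (.inr (.inl k')) :
          EuclideanSpace ℝ (Fin ω.p.m))).trans ?_
  rw [Finset.sum_mul]
  refine Finset.sum_le_sum fun ζ _ => (norm_add_le _ _).trans ?_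
  rw [norm_const_vector, norm_smul, Real.norm_of_nonneg hm.le, ← mul_add, mul_comm]
  gcongr
  exact norm_comp_injective_le (Sum.inr_injective.comp Sum.inl_injective) _

theorem stepNorm_trainMap_odd_le (hC : 0 ≤ C) (hK : 0 ≤ K) (l : Fin L) :
    stepNorm (ω.p.M.trainMap ω.2.1 ω.data ω.regXi - ω.regXi) (2 * l + 1) ≤
      ∑ j, (∑ ζ, |ω.p.M.meanOmega ω.regP ζ l j ω.regNoise -
        ∫ s, ω.p.M.meanOmega ω.p.P ζ l j s ∂ω.p.M.noiseLaw| * K +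
        ∑ ζ, Real.sqrt K * ‖ω.residual false ζ (l, j)‖) := by
  rw [stepNorm_odd]
  refine (l2norm_le_sum_col _).trans (Finset.sum_le_sum fun j _ => ?_)
  have e : col ((ω.p.M.trainMap ω.2.1 ω.data ω.regXi - ω.regXi).1 l) j =
      ∑ ζ, (ω.p.M.meanOmega ω.regP ζ l j ω.regNoise -
        ∫ s, ω.p.M.meanOmega ω.p.P ζ l j s ∂ω.p.M.noiseLaw) • ω.p.M.mean ζ +
      ∑ ζ, Matrix.toEuclideanCLM (𝕜 := ℝ) (ω.p.M.covSqrt ζ)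
        (WithLp.toLp 2 fun i => ω.residual false ζ (l, j) (.inl i)) := by
    ext i
    rw [col_apply, ω.trainMap_sub_fst hC hK]
    simp only [PiLp.add_apply, WithLp.ofLp_sum, Finset.sum_apply, PiLp.smul_apply, smul_eq_mul]
    congr 1
    exact Finset.sum_congr rfl fun _ _ => mul_comm _ _
  rw [e]
  refine (norm_add_le _ _).trans (add_le_add (norm_sum_le_of_le _ fun ζ _ => ?_)
    (norm_sum_le_of_le _ fun ζ _ => ?_))
  · rw [norm_smul, Real.norm_eq_abs]
    gcongr
    exact ω.p.bdd.mean ζ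
  · refine (ContinuousLinearMap.le_opNorm _ _).trans (mul_le_mul (norm_covSqrt_le ω.p.bdd ζ)
      (norm_comp_injective_le Sum.inl_injective _) (norm_nonneg _) (Real.sqrt_nonneg _))

end Outcome

namespace GrowingProblems

variable (hG : GrowingProblems G)

include hG

/-- Lipschitz dependence of the mean-field dynamics on its inputs, which differ by `O(η)`. -/
theorem vanishing_regXi_sub : Vanishing G fun ω => blockNorm (ω.regXi - ω.xi) := by
  obtain ⟨κ, hκ, h⟩ := hG.exists_uniformBound
  have hv := (hG.bounded_sum_vecX'.mul_vanishing vanishing_η).const_mul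
    (∑ t ∈ Finset.range (2 * L), (1 + memoryConst dz J L C K κ) ^ t *
      ((t + 1 : ℕ) * ((Real.sqrt K + 1) * (J * dz))))
  have hmc := memoryConst_nonneg (dz := dz) (J := J) (L := L) hG.C_nonneg hG.K_nonneg hκ
  refine hv.of_le fun ω => ?_
  rw [abs_of_nonneg (blockNorm_nonneg _)]
  refine ((blockNorm_le_sum_stepNorm _).trans ?_).trans (le_abs_self _)
  rw [Finset.sum_mul]
  refine Finset.sum_le_sum fun t ht => ?_
  have ht' : t < 2 * L := Finset.mem_range.1 ht
  have h1 := ω.p.M.dmfSolution_lipschitz ω.p.lip hG.C_nonneg ω.p.bdd hG.K_nonneg hκ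
    ((h ω.p).memory t) ω.2.1 (ω.p.M.gTilde ω.regP ω.regNoise)
    (ω.p.M.gTilde ω.p.P (noiseOf ω.2.1 ω.2.2.1.1)) (hTilde ω.regP ω.regNoise)
    (hTilde ω.p.P (noiseOf ω.2.1 ω.2.2.1.1)) t le_rfl
  refine le_trans h1 ?_
  rw [mul_assoc]
  refine mul_le_mul_of_nonneg_left ?_ (by positivity)
  refine (Finset.sum_le_sum (g := fun _ => (Real.sqrt K + 1) * (J * dz) *
    ((∑ σ, ‖ω.vecX' σ‖) / Real.sqrt ω.p.m * ω.η)) fun r hr => ?_).trans (le_of_eq (by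
      rw [Finset.sum_const, Finset.card_range, nsmul_eq_mul]; ring))
  have hr' : r < t + 1 := Finset.mem_range.1 hr
  have h2 := stepNorm_input_sub_le (ω.p.reg ω.1.1) ω.p.bdd ω.η_pos.le ω.2.1 ω.2.2.1
    (N := ∑ σ, ‖ω.vecX' σ‖) (fun σ => Finset.single_le_sum (f := fun σ => ‖ω.vecX' σ‖)
      (fun _ _ => norm_nonneg _) (Finset.mem_univ σ)) (Finset.sum_nonneg fun _ _ => norm_nonneg _) r
  refine le_trans h2 ?_
  have h3 : ω.η ^ (2 * L - r) ≤ ω.η := by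
    have := pow_le_pow_of_le_one ω.η_pos.le ω.η_le_one (show 1 ≤ 2 * L - r by omega)
    rwa [pow_one] at this
  have hN : 0 ≤ ∑ σ, ‖ω.vecX' σ‖ := Finset.sum_nonneg fun _ _ => norm_nonneg _
  calc _ ≤ ω.η * ((Real.sqrt K + 1) * (J * (dz * ∑ σ, ‖ω.vecX' σ‖))) / Real.sqrt ω.p.m := by gcongr
    _ = _ := by ring

/-- Concentration holds for the original trajectory and is transferred to the regularized one by the
Lipschitz property. -/
theorem vanishing_regMeanTheta (ζ : Fin dz) (l : Fin L) (j : Fin J) :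
    Vanishing G fun ω => ω.p.M.meanTheta ω.regP ζ l j ω.regNoise - ω.p.P.beta l ζ j := by
  have h1 := ((hG.vanishing_regXi_sub.const_mul C).const_mul K).abs.add
    (hG.vanishing_meanTheta ζ l j).abs
  refine h1.of_le fun ω => ?_
  refine le_trans ?_ (le_abs_self _)
  have h2 := (ω.abs_meanTheta_sub_le hG.K_nonneg ζ l j).trans (le_abs_self _)
  exact (abs_sub_le _ _ _).trans (add_le_add h2 le_rfl)

theorem vanishing_regMeanOmega (ζ : Fin dz) (l : Fin L) (j : Fin J) :
    Vanishing G fun ω => ω.p.M.meanOmega ω.regP ζ l j ω.regNoise -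
      ∫ s, ω.p.M.meanOmega ω.p.P ζ l j s ∂ω.p.M.noiseLaw := by
  have h1 := (hG.vanishing_regXi_sub.const_mul C).abs.add (hG.vanishing_meanOmega ζ l j).abs
  refine h1.of_le fun ω => ?_
  refine le_trans ?_ (le_abs_self _)
  have h2 := (ω.abs_meanOmega_sub_le ζ l j).trans (le_abs_self _)
  exact (abs_sub_le _ _ _).trans (add_le_add h2 le_rfl)

theorem vanishing_stepNorm_trainMap (t : ℕ) : Vanishing G fun ω =>
    stepNorm (ω.p.M.trainMap ω.2.1 ω.data ω.regXi - ω.regXi) t := by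
  refine stepNorm_cases (L := L) (p := fun t => Vanishing G fun ω =>
    stepNorm (ω.p.M.trainMap ω.2.1 ω.data ω.regXi - ω.regXi) t) t (fun l _ => ?_) (fun l _ => ?_)
    (fun t ht => ?_) t le_rfl
  · refine Vanishing.of_le (.sum (s := Finset.univ) fun j _ => .sum (s := Finset.univ) fun ζ _ =>
      (hG.vanishing_regMeanTheta ζ l j).abs.add (hG.vanishing_residual true ζ (l, j))) fun ω => ?_
    rw [abs_of_nonneg (stepNorm_nonneg _ _)]
    exact (ω.stepNorm_trainMap_even_le hG.C_nonneg hG.K_nonneg l).trans (le_abs_self _)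
  · refine Vanishing.of_le (.sum (s := Finset.univ) fun j _ => .add
      (.sum (s := Finset.univ) fun ζ _ => ((hG.vanishing_regMeanOmega ζ l j).abs.const_mul K))
      (.sum (s := Finset.univ) fun ζ _ =>
        (hG.vanishing_residual false ζ (l, j)).const_mul (Real.sqrt K))) fun ω => ?_
    rw [abs_of_nonneg (stepNorm_nonneg _ _)]
    refine (ω.stepNorm_trainMap_odd_le hG.C_nonneg hG.K_nonneg l).trans (le_trans ?_ (le_abs_self _))
    simp only [mul_comm _ K]
    exact le_rfl
  · simp only [stepNorm_of_le _ ht]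
    exact (vanishing_η.const_mul 0).of_le fun ω => by simp

/-- On likely events, the response to the samples is close to the mean-field limit. -/
theorem vanishing_response_sub :
    Vanishing G fun ω => blockNorm (ω.p.M.response ω.2.1 ω.data - ω.xi) := by
  have hκ : Bounded G fun ω => dz * K + Real.sqrt K * ∑ ζ, blockOpNorm ω.W ζ / Real.sqrt ω.p.m :=
    (Bounded.const _).add ((Bounded.const _).mul (Bounded.sum fun ζ _ => hG.isBigO_blockOpNorm ζ))
  -- The Gronwall factor of the stability estimate is random, but bounded on likely events.
  have h1 := ((Bounded.pow ((Bounded.const 1).add (hκ.mul (Bounded.const C)))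
    (2 * L)).mul_vanishing (.sum (s := Finset.range (2 * L)) fun t _ =>
      hG.vanishing_stepNorm_trainMap t)).const_mul (2 * L)
  refine (h1.abs.add hG.vanishing_regXi_sub).of_le fun ω => ?_
  rw [abs_of_nonneg (blockNorm_nonneg _)]
  refine ((blockNorm_sub_le _ ω.regXi _).trans (add_le_add ?_ le_rfl)).trans (le_abs_self _)
  have hW : ∀ ζ, 0 ≤ blockOpNorm ω.W ζ := fun ζ => norm_nonneg _
  have h0 : 0 ≤ dz * K + Real.sqrt K * ∑ ζ, blockOpNorm ω.W ζ / Real.sqrt ω.p.m := by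
    have := hG.K_nonneg
    have := Finset.sum_nonneg fun ζ (_ : ζ ∈ Finset.univ) =>
      div_nonneg (hW ζ) (Real.sqrt_nonneg ω.p.m)
    positivity
  exact (blockNorm_response_sub_le ω.p.m_pos ω.p.lip hG.C_nonneg ω.2.1 h0
    (norm_inner_data_le ω.p.m_pos ω.p.bdd ω.2.1 ω.W) ω.regXi).trans (le_abs_self _)

end GrowingProblems

end DMF

end

/-! ### From the coupling to expectations, and the uniform conclusion. -/

noncomputable section

namespace DMF

open Asymptotics

/-- The test functions: maps to the unit interval with Lipschitz constant one. -/
structure IsTest {J L n m : ℕ} (h : Blocks J L n m → ℝ) : Prop where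
  mem_Icc : ∀ ξ, h ξ ∈ Set.Icc (0 : ℝ) 1
  lipschitz : ∀ ξ ξ', |h ξ - h ξ'| ≤ blockNorm (ξ - ξ')

section Law

variable {dz J L n m : ℕ} {M : Model dz J L n m} {h : Blocks J L n m → ℝ}

theorem IsTest.continuous (hh : IsTest h) : Continuous h := by
  refine continuous_iff_continuousAt.2 fun ξ => tendsto_iff_dist_tendsto_zero.2 ?_
  have hc : Continuous fun ξ' : Blocks J L n m =>
      ∑ t ∈ Finset.range (2 * L), stepNorm (ξ' - ξ) t :=
    continuous_finsetSum _ fun t _ => (continuous_stepNorm t).comp (continuous_id.sub continuous_const)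
  have h0 : ∀ t, stepNorm (0 : Blocks J L n m) t = 0 := fun t => by
    simpa using stepNorm_smul 0 (0 : Blocks J L n m) t
  have h1 := hc.tendsto ξ
  simp only [sub_self, h0, Finset.sum_const_zero] at h1
  exact squeeze_zero (fun _ => dist_nonneg)
    (fun ξ' => (hh.lipschitz ξ' ξ).trans (blockNorm_le_sum_stepNorm _)) h1

theorem IsTest.abs_le_one (hh : IsTest h) (ξ : Blocks J L n m) : |h ξ| ≤ 1 :=
  abs_le.2 ⟨by linarith [(hh.mem_Icc ξ).1], (hh.mem_Icc ξ).2⟩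

theorem IsTest.abs_sub_le_one (hh : IsTest h) (ξ ξ' : Blocks J L n m) : |h ξ - h ξ'| ≤ 1 :=
  abs_le.2 ⟨by linarith [(hh.mem_Icc ξ).1, (hh.mem_Icc ξ').2],
    by linarith [(hh.mem_Icc ξ).2, (hh.mem_Icc ξ').1]⟩

theorem continuous_response (z : Fin m → Fin dz) : Continuous (M.response z) := by
  unfold Model.response solve
  generalize 2 * L = t
  induction t with
  | zero => exact continuous_const
  | succ t ih =>
    simp only [Function.iterate_succ_apply']
    have h1 : ∀ l k j, Continuous fun x => M.omega (M.labels z) l ((M.trainMap z x)^[t] 0) k j :=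
      fun l k j => (continuous_apply_apply k j).comp
        ((M.omega_differentiable (M.labels z) l).continuous.comp ih)
    have h2 : ∀ l i j, Continuous fun x => M.theta (M.labels z) l ((M.trainMap z x)^[t] 0) i j :=
      fun l i j => (continuous_apply_apply i j).comp
        ((M.theta_differentiable (M.labels z) l).continuous.comp ih)
    have h3 : ∀ k i, Continuous fun x : Fin m → EuclideanSpace ℝ (Fin n) => x k i := fun k i => by
      fun_prop
    refine Continuous.prodMk ?_ ?_
    · refine continuous_pi fun l => continuous_pi fun i => continuous_pi fun j => ?_
      exact continuous_const.mul (continuous_finsetSum _ fun k _ => (h3 k i).mul (h1 l k j))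
    · refine continuous_pi fun l => continuous_pi fun k => continuous_pi fun j => ?_
      exact continuous_finsetSum _ fun i _ => (h3 k i).mul (h2 l i j)

/-- Different samples use different columns, hence distinct entries of `W`, and the Gaussian law
with covariance `R` is the image of the standard one under `R^{1/2}`. -/
theorem measurePreserving_data (z : Fin m → Fin dz) :
    MeasurePreserving (M.data z) (gaussPi _) (M.sampleLaw z) := by
  have hinj : Function.Injective fun p : Fin m × Fin n =>
      ((z p.1, .inl p.2, .inr (.inl p.1)) : Fin dz × Ambient J L n m × Ambient J L n m) := by
    rintro ⟨k, i⟩ ⟨k', i'⟩ h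
    simp only [Prod.mk.injEq, Sum.inl.injEq, Sum.inr.injEq] at h
    exact Prod.ext h.2.2 h.2.1
  have h1 := measurePreserving_curry.comp (measurePreserving_comp_injective hinj)
  have h2 : ∀ k : Fin m, MeasurePreserving (fun w : Fin n → ℝ => M.mean (z k) +
      Matrix.toEuclideanCLM (𝕜 := ℝ) (M.covSqrt (z k)) (WithLp.toLp 2 w)) (gaussPi (Fin n))
      (multivariateGaussian (M.mean (z k)) (M.cov (z k))) := fun k => by
    refine ⟨by fun_prop, ?_⟩
    rw [multivariateGaussian, ← map_pi_eq_stdGaussian, Measure.map_map (by fun_prop) (by fun_prop)]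
    rfl
  exact (measurePreserving_pi _ _ h2).comp h1

theorem continuous_data (z : Fin m → Fin dz) : Continuous (M.data z) := by
  unfold Model.data
  fun_prop

theorem integral_comp_measurePreserving {α β : Type*} [MeasurableSpace α] [MeasurableSpace β]
    {μ : Measure α} {ν : Measure β} {f : α → β} (hf : MeasurePreserving f μ ν) {g : β → ℝ}
    (hg : Measurable g) : ∫ x, g (f x) ∂μ = ∫ y, g y ∂ν := by
  rw [← hf.map_eq, integral_map hf.measurable.aemeasurable hg.aestronglyMeasurable]

theorem integrable_of_abs_le_one {α : Type*} [MeasurableSpace α] {μ : Measure α}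
    [IsProbabilityMeasure μ] {f : α → ℝ} (hf : Measurable f) (h : ∀ x, |f x| ≤ 1) :
    Integrable f μ :=
  .of_bound hf.aestronglyMeasurable 1 (ae_of_all _ h)

theorem measurable_test_response (hh : IsTest h) :
    Measurable fun p : (Fin m → Fin dz) × (Fin dz × Ambient J L n m × Ambient J L n m → ℝ) =>
      h (M.response p.1 (M.data p.1 p.2)) :=
  measurable_from_prod_countable_right fun z =>
    (hh.continuous.comp ((continuous_response z).comp (continuous_data z))).measurable

theorem measurable_test_xiBar (hh : IsTest h) (P : Params dz J L n) :
    Measurable fun s => h (M.xiBar P s) :=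
  measurable_noise fun z => hh.continuous.comp (continuous_xiBar P z)

theorem trainExpectation_eq (hh : IsTest h) :
    M.trainExpectation h = ∫ p, h (M.response p.1 (M.data p.1 p.2))
      ∂(M.latentLaw.prod (gaussPi (Fin dz × Ambient J L n m × Ambient J L n m))) := by
  rw [integral_prod _ (integrable_of_abs_le_one (measurable_test_response hh)
    fun _ => hh.abs_le_one _), Model.trainExpectation]
  congr 1
  ext z
  exact (integral_comp_measurePreserving (measurePreserving_data z)
    (hh.continuous.comp (continuous_response z)).measurable).symm

end Law

variable {dz J L : ℕ} {γ C K : ℝ}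

/-- The difference of the two expectations. -/
def Problem.error (p : Problem dz J L γ C K) (h : Blocks J L p.n p.m → ℝ) : ℝ :=
  |p.M.trainExpectation h - ∫ s, h (p.M.xiBar p.P s) ∂p.M.noiseLaw|

theorem integral_coupling {α β β' : Type*} [MeasurableSpace α] [MeasurableSpace β]
    [MeasurableSpace β'] {μ : Measure α} [IsProbabilityMeasure μ] {ν : Measure β} {ν' : Measure β'}
    {φ : α → β} {ψ : α → β'} (hφ : MeasurePreserving φ μ ν) (hψ : MeasurePreserving ψ μ ν')
    {f : β → ℝ} {g : β' → ℝ} (hf : Measurable f) (hg : Measurable g) (hf1 : ∀ x, |f x| ≤ 1)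
    (hg1 : ∀ x, |g x| ≤ 1) : Integrable (fun s => f (φ s) - g (ψ s)) μ ∧
      |∫ x, f x ∂ν - ∫ x, g x ∂ν'| = |∫ s, (f (φ s) - g (ψ s)) ∂μ| := by
  have i1 : Integrable (fun s => f (φ s)) μ :=
    integrable_of_abs_le_one (hf.comp hφ.measurable) fun _ => hf1 _
  have i2 : Integrable (fun s => g (ψ s)) μ :=
    integrable_of_abs_le_one (hg.comp hψ.measurable) fun _ => hg1 _
  refine ⟨i1.sub i2, ?_⟩
  rw [integral_sub i1 i2, integral_comp_measurePreserving hφ hf,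
    integral_comp_measurePreserving hψ hg]

/-- Under one and the same law, the constructed samples have the law of the data and the driving
noise has the law of the mean-field noise. The difference of expectations is therefore one integral,
with an integrand controlled by the distance of the two trajectories. -/
theorem exists_error_eq (hC : 0 ≤ C) (hK : 0 ≤ K) (i : ℕ × Problem dz J L γ C K)
    {h : Blocks J L i.2.n i.2.m → ℝ} (hh : IsTest h) :
    ∃ f : Sample dz J L i.2.n i.2.m → ℝ, Integrable f (couplingLaw i) ∧
      i.2.error h = |∫ s, f s ∂couplingLaw i| ∧ (∀ s, |f s| ≤ 1) ∧
      ∀ s, |f s| ≤ blockNorm (i.2.M.response s.1 (Outcome.data ⟨i, s⟩) - Outcome.xi ⟨i, s⟩) := by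
  have hW := measurePreserving_sample_adaptive (i.2.reg i.1) i.2.lip hC i.2.bdd hK
    fun k a => stepScale_pos (regSize_pos i.1) k a
  have h12 := integral_coupling (μ := i.2.M.couplingLaw) hW
    (measurePreserving_sample_noiseOf i.2.M) (measurable_test_response (M := i.2.M) hh)
    (measurable_test_xiBar (M := i.2.M) hh i.2.P) (fun _ => hh.abs_le_one _) (fun _ => hh.abs_le_one _)
  rw [← trainExpectation_eq hh] at h12
  refine ⟨_, h12.1, h12.2, fun s => hh.abs_sub_le_one _ _, fun s => ?_⟩
  exact hh.lipschitz _ _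

theorem error_le_one (hC : 0 ≤ C) (hK : 0 ≤ K) (i : ℕ × Problem dz J L γ C K)
    {h : Blocks J L i.2.n i.2.m → ℝ} (hh : IsTest h) : i.2.error h ≤ 1 := by
  obtain ⟨f, hf, he, h1, -⟩ := exists_error_eq hC hK i hh
  have h2 := norm_integral_le_of_norm_le_const (μ := couplingLaw i) (f := f) (ae_of_all _ h1)
  simp only [probReal_univ, mul_one] at h2
  exact he.trans_le h2

theorem abs_integral_le_of_tail {α : Type*} [MeasurableSpace α] {μ : Measure α}
    [IsProbabilityMeasure μ] {f g : α → ℝ} (hf : Integrable f μ) (hf1 : ∀ s, |f s| ≤ 1)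
    (hfg : ∀ s, |f s| ≤ g s) {ε : ℝ} (hε : 0 ≤ ε) (hg : μ {s | ¬ ‖g s‖ ≤ ε} ≤ ENNReal.ofReal ε) :
    |∫ s, f s ∂μ| ≤ ε + ε := by
  -- The measurable hull avoids showing that the distance `g` is measurable.
  set T := toMeasurable μ {s | ¬ ‖g s‖ ≤ ε} with hTdef
  have hT : μ.real T ≤ ε := by
    rw [measureReal_def, measure_toMeasurable]
    exact ENNReal.toReal_le_of_le_ofReal hε hg
  have hTi : Integrable (T.indicator fun _ => (1 : ℝ)) μ :=
    (integrable_const 1).indicator (measurableSet_toMeasurable _ _)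
  refine (norm_integral_le_integral_norm f).trans ((integral_mono hf.norm
    ((integrable_const ε).add hTi) fun s => ?_).trans ?_)
  · change |f s| ≤ ε + T.indicator (fun _ => (1 : ℝ)) s
    by_cases hs : s ∈ T
    · rw [Set.indicator_of_mem hs]
      exact (hf1 s).trans (by linarith)
    · have hs' : ¬ ¬ ‖g s‖ ≤ ε := fun h => hs (subset_toMeasurable _ _ h)
      rw [Set.indicator_of_notMem hs, add_zero]
      exact (hfg s).trans ((le_abs_self _).trans (not_not.1 hs'))
  · change ∫ s, (ε + T.indicator (fun _ => (1 : ℝ)) s) ∂μ ≤ ε + ε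
    rw [integral_add (integrable_const _) hTi,
      integral_indicator_const _ (measurableSet_toMeasurable _ _)]
    simp only [integral_const, probReal_univ, smul_eq_mul, mul_one, one_mul]
    linarith

theorem error_le_of_tail (hC : 0 ≤ C) (hK : 0 ≤ K) (i : ℕ × Problem dz J L γ C K) {ε : ℝ}
    (hε : 0 ≤ ε) (hi : couplingLaw i {s | ¬ ‖blockNorm (i.2.M.response s.1 (Outcome.data ⟨i, s⟩) -
      Outcome.xi ⟨i, s⟩)‖ ≤ ε} ≤ ENNReal.ofReal ε)
    {h : Blocks J L i.2.n i.2.m → ℝ} (hh : IsTest h) : i.2.error h ≤ ε + ε := by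
  obtain ⟨f, hf, he, h1, h2⟩ := exists_error_eq hC hK i hh
  exact he.trans_le (abs_integral_le_of_tail hf h1 h2 hε hi)

/-- The error does not involve the regularization. Closeness in the iterated limit therefore permits
fixing one sufficiently small `η` and using only that coupling. -/
theorem GrowingProblems.eventually_error_le {G : Filter (Problem dz J L γ C K)}
    (hG : GrowingProblems G) {ε : ℝ} (hε : 0 < ε) :
    ∀ᶠ p in G, ∀ h : Blocks J L p.n p.m → ℝ, IsTest h → p.error h ≤ ε := by
  have h1 : ∀ᶠ ω in likely G, ‖blockNorm (ω.p.M.response ω.2.1 ω.data - ω.xi)‖ ≤ ε / 2 := by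
    simpa only [norm_one, mul_one] using hG.vanishing_response_sub.bound (half_pos hε)
  have h2 := (eventually_whp.1 h1).eventually
    (gt_mem_nhds (ENNReal.ofReal_pos.2 (half_pos hε)))
  obtain ⟨j, hj⟩ := (eventually_curry_iff.1 h2).exists
  filter_upwards [hj] with p hp h hh
  exact (error_le_of_tail hG.C_nonneg hG.K_nonneg (j, p) (half_pos hε).le hp.le hh).trans_eq
    (add_halves ε)

theorem Model.LipschitzUpdates.mono {n m : ℕ} {M : Model dz J L n m} {C C' : ℝ}
    (hM : M.LipschitzUpdates C) (hC : C ≤ C') : M.LipschitzUpdates C' where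
  theta y l ξ ξ' := (hM.theta y l ξ ξ').trans
    (mul_le_mul_of_nonneg_right hC (blockNorm_nonneg _))
  omega y l ξ ξ' := (hM.omega y l ξ ξ').trans
    (mul_le_mul_of_nonneg_right hC (blockNorm_nonneg _))

theorem Model.BoundedBy.mono {n m : ℕ} {M : Model dz J L n m} {K K' : ℝ}
    (hM : M.BoundedBy K) (hK : K ≤ K') : M.BoundedBy K' where
  mean ζ := (hM.mean ζ).trans hK
  cov ζ := (hM.cov ζ).trans hK
  theta y l := (hM.theta y l).trans hK
  omega y l := (hM.omega y l).trans hK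

/-- The errors that occur among the problems of size `m`. -/
def errorSet (dz J L : ℕ) (γ C K : ℝ) (c δ : ℕ → ℝ) (m : ℕ) : Set ℝ :=
  {e | ∃ p : Problem dz J L γ C K, p.m = m ∧ p.M.Concentrates p.P (c m) (δ m) ∧
    ∃ h : Blocks J L p.n p.m → ℝ, IsTest h ∧ e = p.error h}

theorem bddAbove_errorSet (hC : 0 ≤ C) (hK : 0 ≤ K) (c δ : ℕ → ℝ) (m : ℕ) :
    BddAbove (errorSet dz J L γ C K c δ m) := by
  refine ⟨1, ?_⟩
  rintro e ⟨p, -, -, h, hh, rfl⟩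
  -- Any coupling gives the trivial bound by 1.
  exact error_le_one hC hK (0, p) hh

/-- Uniformity over problems comes from the filter: it contains all problems of large size that
concentrate, so an eventual bound along it is a bound for all of them at once. -/
theorem tendsto_sSup_errorSet (hC : 0 ≤ C) (hK : 0 ≤ K) (hγ : 0 < γ) {c δ : ℕ → ℝ}
    (hc : Tendsto c atTop (𝓝 0)) (hδ : Tendsto δ atTop (𝓝 0)) :
    Tendsto (fun m => sSup (errorSet dz J L γ C K c δ m)) atTop (𝓝 0) := by
  set G : Filter (Problem dz J L γ C K) := comap (fun p => p.m) atTop ⊓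
    𝓟 {p | p.M.Concentrates p.P (c p.m) (δ p.m)} with hGdef
  have hm : Tendsto (fun p : Problem dz J L γ C K => p.m) G atTop :=
    tendsto_comap.mono_left inf_le_left
  have hG : GrowingProblems G := ⟨hC, hK, hγ, hm, fun p => c p.m, fun p => δ p.m, hc.comp hm,
    hδ.comp hm, (mem_inf_of_right (mem_principal_self _))⟩
  have h0 : ∀ m, 0 ≤ sSup (errorSet dz J L γ C K c δ m) := fun m =>
    Real.sSup_nonneg (by rintro e ⟨p, -, -, h, hh, rfl⟩; exact abs_nonneg _)
  refine (nhds_basis_abs_sub_lt (0 : ℝ)).tendsto_right_iff.2 fun ε hε => ?_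
  have h1 := hG.eventually_error_le (half_pos hε)
  rw [hGdef, eventually_inf_principal, eventually_comap] at h1
  filter_upwards [h1] with m hm'
  rw [sub_zero, abs_of_nonneg (h0 m)]
  refine lt_of_le_of_lt (Real.sSup_le ?_ (half_pos hε).le) (half_lt_self hε)
  rintro e ⟨p, hp, hpc, h, hh, rfl⟩
  subst hp
  exact hm' p rfl hpc h hh

end DMF

end

theorem theorem2 (dz J L : ℕ) (γ : ℝ) (hγ : 0 < γ) (C K : ℝ) (c δ : ℕ → ℝ)
    (hc : Tendsto c atTop (𝓝 0)) (hδ : Tendsto δ atTop (𝓝 0)) :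
    ∃ Cm : ℕ → ℝ, Tendsto Cm atTop (𝓝 0) ∧
      ∀ (m n : ℕ), 0 < m → (n : ℝ) = γ * m →
      ∀ (M : DMF.Model dz J L n m), M.LipschitzUpdates C → M.BoundedBy K →
      ∀ (P : DMF.Params dz J L n), M.IsDMF P → M.Concentrates P (c m) (δ m) →
      ∀ h : DMF.Blocks J L n m → ℝ, (∀ ξ, h ξ ∈ Set.Icc (0 : ℝ) 1) →
        (∀ ξ ξ', |h ξ - h ξ'| ≤ DMF.blockNorm (ξ - ξ')) →
        |M.trainExpectation h - ∫ s, h (M.xiBar P s) ∂M.noiseLaw| < Cm m := by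
  -- Nothing in the statement makes `C` or `K` nonnegative, so they are enlarged.
  have hC := le_max_right C 0
  have hK := le_max_right K 0
  -- The first summand only makes the inequality strict.
  refine ⟨fun m => 1 / ((m : ℝ) + 1) + sSup (DMF.errorSet dz J L γ (max C 0) (max K 0) c δ m), ?_,
    fun m n hm hn M hM hMK P hP hPc h h01 hh => ?_⟩
  · simpa using tendsto_one_div_add_atTop_nhds_zero_nat.add
      (DMF.tendsto_sSup_errorSet (dz := dz) (J := J) (L := L) hC hK hγ hc hδ)
  · have hmem : |M.trainExpectation h - ∫ s, h (M.xiBar P s) ∂M.noiseLaw| ∈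
        DMF.errorSet dz J L γ (max C 0) (max K 0) c δ m :=
      ⟨⟨m, n, hm, hn, M, hM.mono (le_max_left _ _), hMK.mono (le_max_left _ _), P, hP⟩, rfl, hPc,
        h, ⟨h01, hh⟩, rfl⟩
    have h1 := le_csSup (DMF.bddAbove_errorSet hC hK c δ m) hmem
    have h2 : 0 < 1 / ((m : ℝ) + 1) := by positivity
    linarith
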